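/- **Model.** Let $G$ be the infinite regular triangular grid graph. A particle system is a finite set $A$ of $n=|A|$ nodes of $G$ inducing a connected subgraph; each node of $A$ is occupied by one contracted, anonymous particle, which never moves. Each particle numbers its six ports in clockwise order from an arbitrary offset; particles share chirality but no orientation. Memories are initially empty. An execution is an infinite sequence of activations of particles in which every particle is activated infinitely often and which is otherwise arbitrary; an activated particle reads and writes its own memory and those of its neighbours. **Agents.** A particle without neighbours declares itself leader when activated; a particle with six neighbours does nothing. Otherwise the particle has one agent for each maximal run $v_1,\dots,v_k$ of unoccupied nodes in the clockwise ring of six nodes around it; with $v_0,v_{k+1}$ the occupied nodes before and after the run, the predecessor (successor) of the agent is the agent of the particle on $v_0$ (on $v_{k+1}$) whose own run ends (begins) next to the given particle, so that the agents form disjoint directed cycles, the boundaries. The agents of one particle carry distinct, otherwise arbitrary identifiers from $\{1,2,3\}$. An activated particle activates each of its agents once, in arbitrary order; the leader terminates. Tokens are constant-size pieces of information, which an agent passes to its predecessor or successor when it is activated. **Algorithm, with radix $r$.** 1. *Segments.* On its first activation each agent flips a fair coin; on heads it becomes a candidate. A segment is a candidate followed by all non-candidates up to the next candidate (in this initial partition).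 2. *Identifiers.* A token started by the candidate traverses the segment and gives each agent a uniformly random digit in $\{0,\dots,r-1\}$; the candidate holds the most significant digit. The token then stores a copy of the identifier in reversed digit order in the segment, carrying one digit at a time back and forth (last agent to first, first to last, second last to second, and so on), and returns to the candidate. All coin flips and digits are independent. 3. *Comparison.* Then, starting at the candidate, each agent of the segment creates one digit token with its digit of the reversed copy; the one of the last agent is a delimiter. Digit tokens move backward along the boundary without overtaking, at most one per agent and activation, at most two being held by an agent, and none being received by an agent before it has created its own. Agents are initially active, tokens inactive; a token becomes active when the first agent of a segment forwards it into the preceding segment. An active agent receiving an active token compares the two digits, and both become inactive. A delimiter token records the comparison result of the most significant differing digit seen in the current segment; each agent it reaches deletes its own result and becomes active. When the delimiter reaches the first agent $c$ of a segment, the token sequence is shorter than the segment if the delimiter is inactive on arrival, longer if the delimiter is active and $c$ is inactive, and of equal length if both are active. If the sequence is longer, or equally long with a greater number, then $c$ (if still a candidate) withdraws its candidacy, after completing any solitude verification in progress. If length and number are equal and $c$ is a candidate that is not busy with steps 4–5, it starts step 4. 4. *Solitude verification.* The candidate $c$ fixes a coordinate system for the grid by its port labels and sends an activation token forward to the next current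 candidate. For each boundary edge traversed, including the edge into that candidate, a positive or negative token is created at the tail of the edge for each axis in which the edge has coordinate $\pm1$. These tokens move backward toward $c$, not beyond it and without overtaking tokens of the same axis and sign, at most two of each axis and sign per agent. A token settles when it is at $c$, or when the predecessor of its agent holds two settled tokens of its kind. At the last agent before the next candidate, the activation token reads the identifier (in $\{1,2,3\}$) of that candidate and returns, separately for each axis, staying behind the tokens of the axis. At the first agent where it finds tokens and all of them are settled (or else at $c$), it checks whether there are equally many positive and negative ones there; it then deletes all tokens of the axis on its way to $c$ and reports. The verification succeeds if both checks are positive and the identifier read equals that of $c$; otherwise $c$ becomes idle again. 5. *Boundary identification.* If it succeeds (and $c$ need not withdraw), a token sent once around the boundary, to the next candidate, sums modulo $5$ the clockwise turns at the agents in units of $60^\circ$ (at an agent with a run of $k$ unoccupied nodes the turn is $k-2$). If the sum is $1$, the particle of $c$ declares itself leader; otherwise $c$ withdraws. **Theorem.** The algorithm solves the leader election problem with high probability. That is, for every real constant $c>1$ there are $r_0,N\in\mathbb N$ such that for every radix $r\ge r_0$, every connected particle system with $n\ge N$ particles, and every choice of port offsets and agent identifiers, the following holds with probability at least $1-n^{-c}$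 over the random coin flips and digits: in every execution (fair as above) there is a particle $p$ that at some time declares itself leader and remains leader forever, while no other particle ever declares itself leader. -/

import Mathlib

namespace Amoebot

/-! ### The triangular grid, in axial coordinates -/

/-- A node of the infinite regular triangular grid. The pair `(x, y)` stands for the point
`x • (1, 0) + y • (1/2, √3/2)` of the plane. -/
abbrev Node : Type := ℤ × ℤ

/-- The six unit vectors of the grid, listed in clockwise order. -/
def dir (i : ZMod 6) : Node :=
  (![(1, 0), (1, -1), (0, -1), (-1, 0), (-1, 1), (0, 1)] : Fin 6 → Node) i

theorem dir_ne_zero (i : ZMod 6) : dir i ≠ 0 := by revert i; decide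

theorem dir_add_three (i : ZMod 6) : dir (i + 3) = -dir i := by revert i; decide

theorem dir_add_two (i : ZMod 6) : dir (i + 2) = dir (i + 1) - dir i := by revert i; decide

/-- The triangular grid graph. -/
def triGrid : SimpleGraph Node where
  Adj u v := ∃ i, v = u + dir i
  symm := ⟨by
    rintro u v ⟨i, rfl⟩
    exact ⟨i + 3, by rw [dir_add_three, add_neg_cancel_right]⟩⟩
  loopless := ⟨by
    rintro u ⟨i, h⟩
    exact dir_ne_zero i (by simpa using h.symm)⟩

/-! ### Agents

A particle system of contracted particles is a finite set `A` of occupied nodes. -/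

/-- An agent is a particle together with one of the maximal runs of unoccupied nodes in the
clockwise ring around it. The run is recorded by the direction of the occupied node right before
it, which is the node of the predecessor. A particle all or none of whose neighbouring nodes are
occupied has no agents. -/
abbrev Agent (A : Finset Node) : Type :=
  {x : A × ZMod 6 // (x.1 : Node) + dir x.2 ∈ A ∧ (x.1 : Node) + dir (x.2 + 1) ∉ A}

namespace Agent

variable {A : Finset Node}

/-- The particle that an agent belongs to. -/
def particle (a : Agent A) : A := a.1.1

/-- The direction of the predecessor. -/
def predDir (a : Agent A) : ZMod 6 := a.1.2

theorem exists_succ (a : Agent A) :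
    ∃ m : ℕ, 2 ≤ m ∧ (a.particle : Node) + dir (a.predDir + m) ∈ A :=
  ⟨6, by norm_num, by
    have h : a.predDir + ((6 : ℕ) : ZMod 6) = a.predDir := by
      rw [ZMod.natCast_self, add_zero]
    rw [h]; exact a.2.1⟩

/-- The number of clockwise steps of 60 degrees from the predecessor to the first occupied node
after the empty run. -/
def span (a : Agent A) : ℕ := Nat.find a.exists_succ

/-- The direction of the successor. -/
def succDir (a : Agent A) : ZMod 6 := a.predDir + a.span

/-- The (clockwise) angle, in multiples of 60 degrees, by which the boundary turns at the agent:
it enters in direction `predDir + 3` and leaves in direction `predDir + span`. -/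
def turn (a : Agent A) : ℤ := (a.span : ℤ) - 3

/-- The next agent on the boundary: it belongs to the particle at the end of the empty run and has
the given particle as its predecessor. -/
def succ (a : Agent A) : Agent A :=
  ⟨(⟨(a.particle : Node) + dir a.succDir, (Nat.find_spec a.exists_succ).2⟩, a.succDir + 3), by
    have h0 := a.2
    have hs := Nat.find_spec a.exists_succ
    constructor
    · simp only [dir_add_three, add_neg_cancel_right]
      exact a.particle.2
    · have e : (a.particle : Node) + dir a.succDir + dir (a.succDir + 3 + 1)
          = (a.particle : Node) + dir (a.succDir - 1) := by
        have h1 := dir_add_two (a.succDir - 1)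
        have h2 := dir_add_three (a.succDir + 1)
        rw [show a.succDir - 1 + 2 = a.succDir + 1 by ring,
          show a.succDir - 1 + 1 = a.succDir by ring] at h1
        rw [show a.succDir + 3 + 1 = a.succDir + 1 + 3 by ring, h2, h1]
        abel
      simp only [e]
      rcases Nat.lt_or_ge 2 a.span with h | h
      · intro hm
        refine Nat.find_min a.exists_succ (m := a.span - 1)
          (show a.span - 1 < a.span by omega) ⟨by omega, ?_⟩
        rw [Nat.cast_sub (by omega), Nat.cast_one, ← add_sub_assoc]
        exact hm
      · have h2 : a.span = 2 := le_antisymm h hs.1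
        have : a.succDir - 1 = a.predDir + 1 := by
          rw [succDir, h2]; push_cast; ring
        rw [this]
        exact h0.2⟩

/-- The node of the predecessor. -/
def predNode (a : Agent A) : Node := (a.particle : Node) + dir a.predDir

theorem exists_pred (a : Agent A) :
    ∃ m : ℕ, 2 ≤ m ∧ a.predNode + dir (a.predDir + 3 - m) ∈ A :=
  ⟨6, by norm_num, by
    have h : a.predDir + 3 - ((6 : ℕ) : ZMod 6) = a.predDir + 3 := by
      rw [ZMod.natCast_self, sub_zero]
    rw [h, predNode, dir_add_three, add_neg_cancel_right]; exact a.particle.2⟩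

/-- The previous agent on the boundary: it belongs to the particle on the node of the predecessor,
and its empty run is the one that ends right before the given particle. -/
def pred (a : Agent A) : Agent A :=
  ⟨(⟨a.predNode, a.2.1⟩, a.predDir + 3 - (Nat.find a.exists_pred : ℕ)), by
    have hs := Nat.find_spec a.exists_pred
    refine ⟨hs.2, ?_⟩
    rcases Nat.lt_or_ge 2 (Nat.find a.exists_pred) with h | h
    · intro hm
      refine Nat.find_min a.exists_pred (m := Nat.find a.exists_pred - 1) (by omega)
        ⟨by omega, ?_⟩
      rw [Nat.cast_sub (by omega), Nat.cast_one, ← sub_add]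
      exact hm
    · have h2 : Nat.find a.exists_pred = 2 := le_antisymm h hs.1
      have e : a.predNode + dir (a.predDir + 2) = (a.particle : Node) + dir (a.predDir + 1) := by
        rw [predNode, dir_add_two]; abel
      have e2 : a.predDir + 3 - ((2 : ℕ) : ZMod 6) + 1 = a.predDir + 2 := by
        push_cast; ring
      simp only [h2, e2, e]
      exact a.2.2⟩

end Agent

/-! ### The memory of an agent (a finite type, of a size that depends on the radix only) -/

/-- A first-in first-out buffer for at most two tokens; in `two s t` the token `s` is older. -/
inductive Buf (α : Type) : Type
  | empty : Buf α
  | one : α → Buf α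
  | two : α → α → Buf α
  deriving DecidableEq

namespace Buf

variable {α : Type}

def push (t : α) : Buf α → Buf α
  | empty => one t
  | one s => two s t
  | two s u => two s u

/-- The oldest token and the remaining buffer. -/
def pop : Buf α → Option (α × Buf α)
  | empty => none
  | one s => some (s, empty)
  | two s t => some (s, one t)

def size : Buf α → ℕ
  | empty => 0
  | one _ => 1
  | two _ _ => 2

end Buf

/-- The token of the identifier setup. -/
inductive SetupToken (r : ℕ) : Type
  /-- moves forward and assigns random digits -/
  | gen : SetupToken r
  /-- carries a digit backward, to the first agent of the segment that holds no copy yet -/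
  | left : Option (Fin r) → SetupToken r
  /-- carries a digit forward, to the last agent of the segment that holds no copy yet -/
  | right : Option (Fin r) → SetupToken r
  /-- returns to the candidate, after all digits have been copied -/
  | home : SetupToken r
  deriving DecidableEq

/-- A digit token of the identifier comparison. The field `res` is used by delimiter tokens only:
it compares the token sequence with the segment being traversed, in the most significant digit
seen so far in which they differ. -/
structure DigitToken (r : ℕ) : Type where
  val : Fin r
  delim : Bool
  active : Bool
  res : Ordering
  deriving DecidableEq

/-- The two axes of the coordinate system that a candidate chooses. -/
inductive Axis : Type
  | x : Axis
  | y : Axis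
  deriving DecidableEq

/-- The activation token of the solitude verification on its way back, for one of the axes:
the agent identifier read at the end of the extended segment, and, once it is known, whether the
coordinate of the sum is zero. -/
structure ReturnToken : Type where
  aid : Fin 3
  zero : Option Bool
  deriving DecidableEq

/-- What a candidate is busy with, apart from the identifier comparison. -/
inductive Phase : Type
  | idle : Phase
  /-- solitude verification has been triggered -/
  | requested : Phase
  | solitude : Phase
  | boundary : Phase
  /-- the agent has determined that its particle is the leader -/
  | won : Phase
  deriving DecidableEq

/-- The memory of an agent. -/
structure AgentState (r : ℕ) : Type where
  /-- the agent has been activated before -/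
  awake : Bool
  /-- the coin flip came up heads: the agent is the first agent of a segment -/
  head : Bool
  /-- the agent is (still) a candidate -/
  cand : Bool
  /-- the locally unique agent identifier -/
  aid : Fin 3
  /-- the digit of the identifier -/
  digit : Option (Fin r)
  /-- the digit of the reversed copy of the identifier -/
  rdigit : Option (Fin r)
  setup : Option (SetupToken r)
  /-- (of a candidate) the identifier setup is complete -/
  setupDone : Bool
  /-- the agent has created its digit token -/
  created : Bool
  queue : Buf (DigitToken r)
  /-- the agent is active in the sense of the identifier comparison -/
  active : Bool
  /-- comparison of the digit of the matching token with the digit of the agent -/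
  cmp : Ordering
  /-- the agent has seen an identifier that is higher than its own -/
  beaten : Bool
  phase : Phase
  /-- the activation token; it stores the direction of its last move, in the coordinate system of
  the candidate that created it -/
  act : Option (ZMod 6)
  /-- the positive (`true`) and negative (`false`) tokens for each axis; a token is the bit that
  tells whether it has settled -/
  vec : Axis → Bool → Buf Bool
  ret : Axis → Option ReturnToken
  /-- (of a candidate) the results reported by the activation token -/
  report : Axis → Option Bool
  /-- the token of the boundary identification, with the sum of the turns modulo 5 -/
  angle : Option (ZMod 5)
  /-- (of a candidate) the total reported by the token of the boundary identification -/
  total : Option (ZMod 5)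

/-- Empty memory. -/
def AgentState.blank (r : ℕ) : AgentState r where
  awake := false
  head := false
  cand := false
  aid := 0
  digit := none
  rdigit := none
  setup := none
  setupDone := false
  created := false
  queue := .empty
  active := false
  cmp := .eq
  beaten := false
  phase := .idle
  act := none
  vec := fun _ _ => .empty
  ret := fun _ => none
  report := fun _ => none
  angle := none
  total := none

/-! ### The rules of the algorithm -/

/-- What an agent knows apart from its own memory and those of its predecessor and successor. -/
structure LocalView (r : ℕ) : Type where
  /-- the turn of the boundary at the agent, in multiples of 60 degrees -/
  turn : ℤ
  /-- the direction in which the boundary enters the agent, in the port labels of its particle -/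
  inDir : ZMod 6
  /-- the agent identifier chosen by the particle -/
  aid : Fin 3
  /-- the result of the coin flip of the agent -/
  coin : Bool
  /-- the random digit drawn for the agent -/
  digit : Fin r

/-- The effect of a rule on the memories of the agent, its predecessor and its successor. -/
structure Effect (r : ℕ) : Type where
  self : AgentState r
  pred : AgentState r → AgentState r := id
  succ : AgentState r → AgentState r := id

/-- A rule: `rule view p s q` is its effect if `p`, `s`, `q` are the memories of the predecessor,
the agent and the successor. -/
abbrev Rule (r : ℕ) : Type :=
  LocalView r → AgentState r → AgentState r → AgentState r → Effect r

variable {r : ℕ}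

/-- Segment setup, on the first activation. -/
def wake (view : LocalView r) (s : AgentState r) : AgentState r :=
  { s with
    awake := true
    head := view.coin
    cand := view.coin
    aid := view.aid
    active := true
    setup := if view.coin then some .gen else none }

/-- Identifier setup. An agent is the last agent of its segment if its successor flipped heads. -/
def setupRule : Rule r := fun view p s q =>
  match s.setup with
  | none => { self := s }
  | some .gen =>
    if q.awake = false then { self := s }
    else if q.head then
      { self := { s with digit := some view.digit, setup := some (.left (some view.digit)) } }
    else
      { self := { s with digit := some view.digit, setup := none }
        succ := fun q => { q with setup := some .gen } }
  | some (.left d) =>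
    if s.head || p.rdigit.isSome then
      if q.head || q.rdigit.isSome then
        { self := { s with rdigit := d, setup := some .home } }
      else
        { self := { s with rdigit := d, setup := none }
          succ := fun q => { q with setup := some (.right s.digit) } }
    else
      { self := { s with setup := none }
        pred := fun p => { p with setup := some (.left d) } }
  | some (.right d) =>
    if q.head || q.rdigit.isSome then
      if p.rdigit.isSome then
        { self := { s with rdigit := d, setup := some .home } }
      else
        { self := { s with rdigit := d, setup := none }
          pred := fun p => { p with setup := some (.left p.digit) } }
    else
      { self := { s with setup := none }
        succ := fun q => { q with setup := some (.right d) } }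
  | some .home =>
    if s.head then { self := { s with setup := none, setupDone := true } }
    else
      { self := { s with setup := none }
        pred := fun p => { p with setup := some .home } }

/-- Identifier comparison: creation of the digit tokens. It starts at the candidate, as soon as
the identifier setup is complete, and spreads along the segment. -/
def createRule : Rule r := fun _ p s q =>
  match s.rdigit with
  | none => { self := s }
  | some d =>
    if s.created = false ∧ (if s.head then s.setupDone else p.created) = true then
      { self := { s with
          created := true
          queue := s.queue.push { val := d, delim := q.head, active := false, res := .eq } } }
    else { self := s }

/-- The conclusion that the first agent `s` of a segment draws when it receives a delimiter token,
where `tokActive` and `s.active` are the states of the token and of the agent right before, and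
`res` is the comparison of the digits. An inactive delimiter token has matched another agent: the
token sequence is shorter than the segment. If the token is active and the agent is not, then the
agent has matched another token: the token sequence is longer. Otherwise they match: the lengths
are equal. -/
def judge (tokActive : Bool) (res : Ordering) (s : AgentState r) : AgentState r :=
  if tokActive = false then s
  else if s.active = false then { s with beaten := true }
  else
    match res with
    | .lt => s
    | .gt => { s with beaten := true }
    | .eq => if s.cand = true ∧ s.phase = .idle then { s with phase := .requested } else s

/-- The agent with memory `s` receives the digit token `t`. -/
def receive (t : DigitToken r) (s : AgentState r) : AgentState r :=
  let cmp : Ordering :=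
    if s.active && t.active then
      match s.digit with
      | some d => compare t.val d
      | none => .eq
    else s.cmp
  if t.delim then
    let res := cmp.then t.res
    let s₁ := if s.head then judge t.active res s else s
    { s₁ with
      active := true
      cmp := .eq
      queue := s.queue.push { t with active := t.active && !s.active, res := res } }
  else
    { s with
      active := s.active && !t.active
      cmp := cmp
      queue := s.queue.push { t with active := t.active && !s.active } }

/-- Identifier comparison: the digit tokens move backward, at most one per activation; they become
active when the first agent of a segment forwards them into the preceding segment. -/
def forwardRule : Rule r := fun _ p s _ =>
  match s.queue.pop with
  | none => { self := s }
  | some (t, rest) =>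
    if p.created = true ∧ p.queue.size < 2 then
      { self := { s with queue := rest }
        pred := receive (if s.head then { t with active := true, res := .eq } else t) }
    else { self := s }

/-- A coordinate of a unit vector. -/
def coord (ax : Axis) (i : ZMod 6) : ℤ :=
  match ax with
  | .x => (dir i).1
  | .y => (dir i).2

/-- Solitude verification: the activation token moves forward to the end of the extended segment.
For each edge, including the one to the next candidate, it leaves the corresponding positive and
negative tokens at the tail of the edge. -/
def activationRule : Rule r := fun view _ s q =>
  match s.act with
  | none => { self := s }
  | some i =>
    if q.awake = false then { self := s }
    else
      let out : ZMod 6 := i + (view.turn : ZMod 6)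
      let vec : Axis → Bool → Buf Bool := fun ax sg =>
        if coord ax out = (if sg then 1 else -1) then (s.vec ax sg).push false else s.vec ax sg
      if q.cand then
        { self := { s with act := none, vec := vec,
                           ret := fun _ => some { aid := q.aid, zero := none } } }
      else
        { self := { s with act := none, vec := vec }
          succ := fun q => { q with act := some out } }

def setVec (s : AgentState r) (ax : Axis) (sg : Bool) (b : Buf Bool) : AgentState r :=
  { s with vec := fun ax' sg' => if ax' = ax ∧ sg' = sg then b else s.vec ax' sg' }

def setRet (s : AgentState r) (ax : Axis) (t : Option ReturnToken) : AgentState r :=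
  { s with ret := fun ax' => if ax' = ax then t else s.ret ax' }

def settleAll : Buf Bool → Buf Bool
  | .empty => .empty
  | .one _ => .one true
  | .two _ _ => .two true true

/-- Solitude verification: the positive and negative tokens move backward until they settle. -/
def vectorRule (ax : Axis) (sg : Bool) : Rule r := fun _ p s _ =>
  if s.cand = true ∨ p.vec ax sg = .two true true then
    { self := setVec s ax sg (settleAll (s.vec ax sg)) }
  else
    match (s.vec ax sg).pop with
    | none => { self := s }
    | some (t, rest) =>
      if (p.vec ax sg).size < 2 then
        { self := setVec s ax sg rest
          pred := fun p => setVec p ax sg ((p.vec ax sg).push t) }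
      else { self := s }

/-- Solitude verification: the way back of the activation token. While undecided, it stays behind
the positive and negative tokens and stops at the first settled ones. There it waits for all
tokens to be forwarded or settled, decides, and from then on deletes all tokens on its way to the
candidate. -/
def returnRule (ax : Axis) : Rule r := fun _ _ s _ =>
  match s.ret ax with
  | none => { self := s }
  | some t =>
    let pos := s.vec ax true
    let neg := s.vec ax false
    let goOn (z : Bool) : Effect r :=
      let s₁ := setRet (setVec (setVec s ax true .empty) ax false .empty) ax none
      if s.cand then
        { self := { s₁ with report := fun ax' =>
            if ax' = ax then some (z && decide (t.aid = s.aid)) else s.report ax' } }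
      else
        { self := s₁
          pred := fun p => setRet p ax (some { t with zero := some z }) }
    match t.zero with
    | some z => goOn z
    | none =>
      if pos = settleAll pos ∧ neg = settleAll neg then
        if pos = .empty ∧ neg = .empty ∧ s.cand = false then
          { self := setRet s ax none
            pred := fun p => setRet p ax (some t) }
        else goOn (decide (pos.size = neg.size))
      else { self := s }

/-- Boundary identification: the token moves forward once around the boundary, up to the only
remaining candidate, and sums up the turns modulo 5. -/
def angleRule : Rule r := fun view _ s q =>
  match s.angle with
  | none => { self := s }
  | some k =>
    let k₁ : ZMod 5 := k + (view.turn : ZMod 5)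
    if q.cand then
      { self := { s with angle := none }
        succ := fun q => { q with total := some k₁ } }
    else
      { self := { s with angle := none }
        succ := fun q => { q with angle := some k₁ } }

def withdraw (s : AgentState r) : AgentState r :=
  { s with cand := false, phase := .idle }

/-- The decisions of a candidate. -/
def candidateRule : Rule r := fun view _ s _ =>
  if s.cand = false then { self := s }
  else
    match s.phase with
    | .idle => { self := if s.beaten then withdraw s else s }
    | .requested =>
      { self := if s.beaten then withdraw s
          else { s with phase := .solitude, act := some view.inDir } }
    | .solitude =>
      match s.report .x, s.report .y with
      | some b₁, some b₂ =>
        let s₁ : AgentState r := { s with report := fun _ => none }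
        { self := if s.beaten then withdraw s₁
            else if b₁ && b₂ then { s₁ with phase := .boundary, angle := some 0 }
            else { s₁ with phase := .idle } }
      | _, _ => { self := s }
    | .boundary =>
      match s.total with
      | none => { self := s }
      | some k =>
        { self := if k = 1 then { s with phase := .won, total := none }
            else withdraw { s with total := none } }
    | .won => { self := s }

/-- The rules that an agent executes on each activation after the first one, in this order. -/
def rules (r : ℕ) : List (Rule r) :=
  [setupRule, createRule, forwardRule, activationRule,
    vectorRule .x true, vectorRule .x false, vectorRule .y true, vectorRule .y false,
    returnRule .x, returnRule .y, angleRule, candidateRule]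

/-! ### Executions -/

variable {A : Finset Node}

/-- The random choices: the coin flip and the random digit of each agent. -/
abbrev Tape (A : Finset Node) (r : ℕ) : Type := Agent A → Bool × Fin r

/-- All coin flips and digits are independent and uniformly distributed. -/
noncomputable def tapeMeasure (A : Finset Node) (r : ℕ) : MeasureTheory.Measure (Tape A r) :=
  MeasureTheory.Measure.pi fun _ =>
    (ProbabilityTheory.uniformOn (Set.univ : Set Bool)).prod
      (ProbabilityTheory.uniformOn (Set.univ : Set (Fin r)))

/-- The choices that are not controlled by the algorithm: port `i` of particle `p` faces in
direction `offset p + i`, and each particle gives distinct identifiers to its agents. -/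
structure Labelling (A : Finset Node) : Type where
  offset : A → ZMod 6
  aid : Agent A → Fin 3
  aid_injective : ∀ a b : Agent A, a.particle = b.particle → aid a = aid b → a = b

/-- A fair asynchronous schedule: a sequence of activations of particles, each of which activates
all agents of the particle in an arbitrary order. Every particle is activated infinitely often. -/
structure Schedule (A : Finset Node) : Type where
  particle : ℕ → A
  order : ℕ → List (Agent A)
  nodup_order : ∀ t, (order t).Nodup
  mem_order : ∀ t a, a ∈ order t ↔ a.particle = particle t
  fair : ∀ p t, ∃ t', t ≤ t' ∧ particle t' = p

/-- The memories of all agents, and the leader bits of all particles. -/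
structure Config (A : Finset Node) (r : ℕ) : Type where
  mem : Agent A → AgentState r
  leader : A → Bool

def Config.blank (A : Finset Node) (r : ℕ) : Config A r where
  mem := fun _ => .blank r
  leader := fun _ => false

def view (lab : Labelling A) (tape : Tape A r) (a : Agent A) : LocalView r where
  turn := a.turn
  inDir := a.predDir + 3 - lab.offset a.particle
  aid := lab.aid a
  coin := (tape a).1
  digit := (tape a).2

/-- Agent `a` executes a rule. -/
def applyRule (lab : Labelling A) (tape : Tape A r) (a : Agent A)
    (mem : Agent A → AgentState r) (rule : Rule r) : Agent A → AgentState r :=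
  let e := rule (view lab tape a) (mem a.pred) (mem a) (mem a.succ)
  let mem₁ := Function.update mem a e.self
  let mem₂ := Function.update mem₁ a.pred (e.pred (mem₁ a.pred))
  Function.update mem₂ a.succ (e.succ (mem₂ a.succ))

/-- Activation of an agent. The leader terminates. -/
def activateAgent (lab : Labelling A) (tape : Tape A r) (C : Config A r) (a : Agent A) :
    Config A r :=
  if C.leader a.particle then C
  else if (C.mem a).awake then
    let mem := (rules r).foldl (applyRule lab tape a) C.mem
    { mem := mem
      leader := if (mem a).phase = .won then Function.update C.leader a.particle true
        else C.leader }
  else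
    { C with mem := Function.update C.mem a (wake (view lab tape a) (C.mem a)) }

/-- Activation of the particle `p`, whose agents are activated in the given order. A particle
without neighbours immediately declares itself the leader. -/
def activate (lab : Labelling A) (tape : Tape A r) (C : Config A r) (p : A)
    (order : List (Agent A)) : Config A r :=
  if ∀ i, (p : Node) + dir i ∉ A then { C with leader := Function.update C.leader p true }
  else order.foldl (activateAgent lab tape) C

/-- The configuration after the first `t` activations, starting with empty memories. -/
def run (lab : Labelling A) (tape : Tape A r) (sched : Schedule A) : ℕ → Config A r
  | 0 => .blank A r
  | t + 1 => activate lab tape (run lab tape sched t) (sched.particle t) (sched.order t)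

/-- The execution solves the leader election problem: some particle declares itself the leader at
some time and remains the leader forever, and no other particle ever declares itself the leader. -/
def ElectsLeader (lab : Labelling A) (tape : Tape A r) (sched : Schedule A) : Prop :=
  ∃ p : A,
    (∃ t₀, ∀ t, (run lab tape sched t).leader p = true ↔ t₀ ≤ t) ∧
    ∀ q, q ≠ p → ∀ t, (run lab tape sched t).leader q = false

end Amoebot

/-! The proof has a geometric, a deterministic and a probabilistic half-independent part, and
`mainTheorem2` joins them.

Geometry. Exactly one boundary, the outer one, has total turn 6, and every other boundary has total
turn -6 (`exists_outer_boundary`). Modulo 5 these are 1 and 4, so the test of step 5 accepts the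
outer boundary only. The reason is that a boundary consists of all edges between occupied nodes and
one component of the complement (`faces_iff_and_finite`, by a winding number). The total turn is
then a difference of numbers of triangle corners, which equals six times the Euler characteristic of
a finite set without holes (`card_corners`). That characteristic is 1 by homology modulo 2
(`euler_characteristic`).

Determinism. Let the coin flips and digits be such that some segment of the outer boundary, with
first agent `M`, has a strictly greater pair (length, number) than all others there. Then every
execution elects the particle of `M` (`electsLeader`). Safety: `M` never sees a higher identifier
and passes the test of step 5, so it remains a candidate (`IsGreatest.cand`). A verification
succeeds only if the activation token has come back to its origin, so a winner on this boundary is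
the only candidate and is therefore `M`; on other boundaries nobody wins. Liveness: the digit tokens
make every other candidate of the boundary withdraw, later `M` meets its own identifier again, and a
verification started then succeeds.

Asynchrony. An execution is a sequence of atomic steps, and all facts are invariants of these steps.
They are stated with ghost data that no agent stores: the phase of the setup of each segment, the
number `F x` of digit tokens that `x` has forwarded, and the stage of the verification of each
candidate. Since the queues are first-in first-out, the tokens that an agent sees do not depend on
the schedule (`trace`, `trace_spec`). Progress always follows one pattern: a measure in a
well-founded order never increases, and fairness executes some rule that decreases it
(`exists_goal`).

Probability. Let the outer boundary have `L` agents; then `n ≤ L ^ 2`. With `m` about half the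
binary logarithm of `L`, there are `L / m` disjoint windows of length `m`, and with high probability
one of them shows heads followed by `m - 1` tails, which gives a segment of length at least `m`. A
tie for the greatest identifier would then make two disjoint windows of `m` digits agree, and a
union bound gives probability at most `L ^ 2 * r ^ (-m)` for this. Both error terms are small
compared with `n ^ (-c)` if `r` and `n` are large (`error_le`). -/

namespace Amoebot

open Finset (range mem_image mem_range univ mem_image_of_mem sum_add_distrib card_filter card_bij
  mem_filter sum_congr filter_filter mem_Ico mem_product mem_univ sum_range_succ sum_lt_sum
  prod_congr prod_image)
open Function (update update_of_ne update_self update_eq_self iterate_succ_apply'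
  iterate_succ_apply iterate_add_apply iterate_succ iterate_zero)

variable {A : Finset Node}

/-! ### The successor map as a permutation, and its cycles -/

namespace Agent

/-- The node of the particle of an agent. -/
def node (a : Agent A) : Node := (a.particle : Node)

theorem node_mem (a : Agent A) : a.node ∈ A := a.particle.2

theorem ext_node {a b : Agent A} (h : a.node = b.node) (h' : a.predDir = b.predDir) : a = b :=
  Subtype.ext (Prod.ext (Subtype.ext h) h')

theorem particle_eq_iff {a b : Agent A} : a.particle = b.particle ↔ a.node = b.node :=
  Subtype.ext_iff

theorem pred_mem (a : Agent A) : a.node + dir a.predDir ∈ A := a.2.1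

theorem first_not_mem (a : Agent A) : a.node + dir (a.predDir + 1) ∉ A := a.2.2

theorem two_le_span (a : Agent A) : 2 ≤ a.span := (Nat.find_spec a.exists_succ).1

theorem succ_mem (a : Agent A) : a.node + dir a.succDir ∈ A := (Nat.find_spec a.exists_succ).2

theorem run_not_mem (a : Agent A) {m : ℕ} (h1 : 1 ≤ m) (h2 : m < a.span) :
    a.node + dir (a.predDir + m) ∉ A := by
  rcases h1.eq_or_lt with rfl | h
  · simpa using a.first_not_mem
  · intro hm
    exact Nat.find_min a.exists_succ h2 ⟨h, hm⟩

theorem span_eq (a : Agent A) {m : ℕ} (h2 : 2 ≤ m) (hm : a.node + dir (a.predDir + m) ∈ A)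
    (hlt : ∀ k : ℕ, 2 ≤ k → k < m → a.node + dir (a.predDir + k) ∉ A) : a.span = m := by
  refine le_antisymm (Nat.find_min' a.exists_succ ⟨h2, hm⟩) ?_
  by_contra hc
  exact hlt _ a.two_le_span (by omega) a.succ_mem

theorem node_succ (a : Agent A) : a.succ.node = a.node + dir a.succDir := rfl

theorem predDir_succ (a : Agent A) : a.succ.predDir = a.succDir + 3 := rfl

theorem succDir_eq (a : Agent A) : a.succDir = a.predDir + a.span := rfl

theorem node_pred (a : Agent A) : a.pred.node = a.node + dir a.predDir := rfl

/-- The successor records the direction back to the agent, hence `succDir` and then the node. If two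
agents of a node had the same `succDir` but different spans, the occupied predecessor direction of
the shorter run would lie strictly inside the longer run. -/
theorem succ_injective : Function.Injective (succ : Agent A → Agent A) := by
  intro a b h
  have hd : a.succDir = b.succDir := by
    have := congrArg predDir h
    rw [predDir_succ, predDir_succ] at this
    exact add_right_cancel this
  have hn : a.node = b.node := by
    have := congrArg node h
    rw [node_succ, node_succ, hd] at this
    exact add_right_cancel this
  have key : ∀ a b : Agent A, a.node = b.node → a.succDir = b.succDir → a.span ≤ b.span := by
    intro a b hn hd
    by_contra hc
    push Not at hc
    have e : a.predDir + ((a.span - b.span : ℕ) : ZMod 6) = b.predDir := by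
      rw [Nat.cast_sub hc.le]
      have : a.predDir = b.predDir + b.span - a.span := by
        rw [← succDir_eq, ← hd, succDir_eq]; ring
      rw [this]; ring
    have := a.run_not_mem (m := a.span - b.span) (by omega) (by have := b.two_le_span; omega)
    rw [e, hn] at this
    exact this b.pred_mem
  have hs := le_antisymm (key a b hn hd) (key b a hn.symm hd.symm)
  refine ext_node hn ?_
  rw [succDir_eq, succDir_eq, hs] at hd
  exact add_right_cancel hd

/-- The counterclockwise search that defines `pred` finds the start of the run whose end is found by
the clockwise search in `span`, so both searches have the same length `k`. -/
theorem succ_pred (a : Agent A) : a.pred.succ = a := by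
  obtain ⟨h2, hmem⟩ := Nat.find_spec a.exists_pred
  set k := Nat.find a.exists_pred with hk
  have hpd : a.pred.predDir = a.predDir + 3 - (k : ZMod 6) := rfl
  have hspan : a.pred.span = k := by
    refine span_eq _ h2 ?_ ?_
    · rw [hpd, sub_add_cancel, node_pred, dir_add_three, add_neg_cancel_right]
      exact a.node_mem
    · intro j hj2 hjk hmem'
      -- The minimality of `k` concerns distances of at least 2 only. The node at distance 1 is the
      -- first empty node of the run of `a` itself.
      rcases Nat.lt_or_ge (k - j) 2 with h | h
      · have hj : j = k - 1 := by omega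
        rw [hpd, node_pred, hj, Nat.cast_sub (by omega)] at hmem'
        have e : a.predDir + 3 - (k : ZMod 6) + (k - (1 : ℕ)) = a.predDir + 2 := by
          push_cast; ring
        rw [e, dir_add_two] at hmem'
        apply a.first_not_mem
        convert hmem' using 1
        abel
      · refine Nat.find_min a.exists_pred (m := k - j) (by omega) ⟨h, ?_⟩
        rw [hpd, node_pred] at hmem'
        have e : a.predDir + 3 - ((k - j : ℕ) : ZMod 6) = a.predDir + 3 - k + j := by
          rw [Nat.cast_sub (by omega)]; ring
        rw [e]
        exact hmem'
  have hsd : a.pred.succDir = a.predDir + 3 := by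
    rw [succDir_eq, hspan, hpd]; ring
  refine ext_node ?_ ?_
  · rw [node_succ, hsd, node_pred, dir_add_three, add_neg_cancel_right]
  · rw [predDir_succ, hsd]
    have : (3 : ZMod 6) + 3 = 0 := by decide
    rw [add_assoc, this, add_zero]

theorem pred_succ (a : Agent A) : a.succ.pred = a := succ_injective (succ_pred _)

theorem succ_ne (a : Agent A) : a.succ ≠ a := by
  intro h
  have := congrArg node h
  rw [node_succ] at this
  exact dir_ne_zero a.succDir (by simpa using this)

theorem pred_ne (a : Agent A) : a.pred ≠ a := by
  intro h
  have := a.pred.succ_ne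
  rw [succ_pred] at this
  exact this h.symm

/-- The number of agents on the boundary of an agent. -/
noncomputable def period (a : Agent A) : ℕ := Function.minimalPeriod succ a

theorem period_pos (a : Agent A) : 0 < a.period :=
  Function.minimalPeriod_pos_of_mem_periodicPts
    (succ_injective.mem_periodicPts a)

theorem iterate_period (a : Agent A) : succ^[a.period] a = a :=
  Function.iterate_minimalPeriod

theorem iterate_mod (a : Agent A) (k : ℕ) : succ^[k % a.period] a = succ^[k] a :=
  Function.iterate_mod_minimalPeriod_eq

theorem period_le_of_iterate_eq {a : Agent A} {k : ℕ} (hk : 0 < k) (h : succ^[k] a = a) :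
    a.period ≤ k :=
  Function.IsPeriodicPt.minimalPeriod_le hk h

theorem iterate_inj {a : Agent A} {j k : ℕ} (hj : j < a.period) (hk : k < a.period)
    (h : succ^[j] a = succ^[k] a) : j = k :=
  Function.iterate_injOn_Iio_minimalPeriod hj hk h

theorem two_le_period (a : Agent A) : 2 ≤ a.period := by
  have h0 := a.period_pos
  by_contra hc
  have h1 : a.period = 1 := by omega
  have := a.iterate_period
  rw [h1] at this
  exact a.succ_ne this

theorem period_iterate (a : Agent A) (k : ℕ) : (succ^[k] a).period = a.period :=
  Function.minimalPeriod_apply_iterate (succ_injective.mem_periodicPts a) k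

/-- Two agents lie on the same boundary. -/
def SameBoundary (a b : Agent A) : Prop := ∃ k : ℕ, succ^[k] a = b

theorem SameBoundary.refl (a : Agent A) : SameBoundary a a := ⟨0, rfl⟩

theorem SameBoundary.exists_lt {a b : Agent A} (h : SameBoundary a b) :
    ∃ k < a.period, succ^[k] a = b := by
  obtain ⟨k, rfl⟩ := h
  exact ⟨k % a.period, Nat.mod_lt _ a.period_pos, a.iterate_mod k⟩

theorem SameBoundary.symm {a b : Agent A} (h : SameBoundary a b) : SameBoundary b a := by
  obtain ⟨k, hk, rfl⟩ := h.exists_lt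
  refine ⟨a.period - k, ?_⟩
  rw [← iterate_add_apply, Nat.sub_add_cancel hk.le, iterate_period]

theorem SameBoundary.trans {a b c : Agent A} (h : SameBoundary a b) (h' : SameBoundary b c) :
    SameBoundary a c := by
  obtain ⟨k, rfl⟩ := h
  obtain ⟨j, rfl⟩ := h'
  exact ⟨j + k, iterate_add_apply _ _ _ _⟩

theorem SameBoundary.succ_right {a b : Agent A} (h : SameBoundary a b) : SameBoundary a b.succ :=
  h.trans ⟨1, rfl⟩

theorem SameBoundary.of_succ_right {a b : Agent A} (h : SameBoundary a b.succ) :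
    SameBoundary a b :=
  h.trans (SameBoundary.symm ⟨1, rfl⟩)

theorem SameBoundary.pred_right {a b : Agent A} (h : SameBoundary a b) : SameBoundary a b.pred :=
  SameBoundary.of_succ_right (by rwa [succ_pred])

theorem SameBoundary.period_eq {a b : Agent A} (h : SameBoundary a b) : b.period = a.period := by
  obtain ⟨k, rfl⟩ := h
  exact a.period_iterate k

/-- The total turn of the boundary of an agent. -/
noncomputable def totalTurn (a : Agent A) : ℤ :=
  ∑ k ∈ range a.period, (succ^[k] a).turn

/-- The agents on the boundary of an agent. -/
noncomputable def boundary (a : Agent A) : Finset (Agent A) :=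
  (range a.period).image fun k => succ^[k] a

theorem mem_boundary {a b : Agent A} : b ∈ a.boundary ↔ SameBoundary a b := by
  simp only [boundary, mem_image, mem_range]
  exact ⟨fun ⟨k, _, h⟩ => ⟨k, h⟩, fun h => h.exists_lt⟩

theorem sum_boundary {β : Type*} [AddCommMonoid β] (a : Agent A) (f : Agent A → β) :
    ∑ b ∈ a.boundary, f b = ∑ k ∈ range a.period, f (succ^[k] a) :=
  Finset.sum_image fun _ hj _ hk h =>
    iterate_inj (Finset.mem_range.1 hj) (Finset.mem_range.1 hk) h

theorem boundary_eq {a b : Agent A} (h : SameBoundary a b) : b.boundary = a.boundary := by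
  ext c
  rw [mem_boundary, mem_boundary]
  exact ⟨h.trans, h.symm.trans⟩

theorem totalTurn_eq_sum (a : Agent A) : a.totalTurn = ∑ b ∈ a.boundary, b.turn :=
  (a.sum_boundary _).symm

theorem totalTurn_eq {a b : Agent A} (h : SameBoundary a b) : b.totalTurn = a.totalTurn := by
  rw [totalTurn_eq_sum, totalTurn_eq_sum, boundary_eq h]

theorem card_boundary (a : Agent A) : a.boundary.card = a.period := by
  rw [Finset.card_eq_sum_ones, sum_boundary]; simp

end Agent

/-! ### The Euler characteristic of a set of nodes without holes -/

/-- A connected set of nodes. -/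
def Linked (S : Set Node) : Prop :=
  ∀ P : Node → Prop, (∀ u i, u ∈ S → u + dir i ∈ S → P u → P (u + dir i)) →
    ∀ u ∈ S, ∀ v ∈ S, P u → P v

/-- The functions that vanish outside a finite set. -/
def supportedIn {α : Type*} (S : Finset α) : Submodule (ZMod 2) (α → ZMod 2) where
  carrier := {f | ∀ a, a ∉ S → f a = 0}
  add_mem' hf hg a ha := by simp [hf a ha, hg a ha]
  zero_mem' _ _ := rfl
  smul_mem' c f hf a ha := by simp [hf a ha]

noncomputable def supportedInEquiv {α : Type*} [DecidableEq α] (S : Finset α) :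
    supportedIn S ≃ₗ[ZMod 2] (S → ZMod 2) where
  toFun f a := f.1 a
  map_add' _ _ := rfl
  map_smul' _ _ := rfl
  invFun g := ⟨fun a => if h : a ∈ S then g ⟨a, h⟩ else 0, fun a ha => by simp [ha]⟩
  left_inv f := by
    ext a
    by_cases h : a ∈ S
    · simp [h]
    · simp [h, f.2 a h]
  right_inv g := by
    ext a
    simp

theorem finrank_supportedIn {α : Type*} [DecidableEq α] (S : Finset α) :
    Module.finrank (ZMod 2) (supportedIn S) = S.card := by
  rw [(supportedInEquiv S).finrank_eq, Module.finrank_pi, Fintype.card_coe]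

instance {α : Type*} [DecidableEq α] (S : Finset α) :
    Module.Finite (ZMod 2) (supportedIn S) :=
  Module.Finite.equiv (supportedInEquiv S).symm

/-- The boundary of a chain of edges; the edges with the indices `0`, `1` and `2` at a node lead to
its neighbours in the directions `(1, 0)`, `(0, 1)` and `(1, -1)`. -/
def edgeBoundary : (Node × Fin 3 → ZMod 2) →ₗ[ZMod 2] (Node → ZMod 2) where
  toFun g u := g (u, 0) + g ((u.1 - 1, u.2), 0) + g (u, 1) + g ((u.1, u.2 - 1), 1) +
    g (u, 2) + g ((u.1 - 1, u.2 + 1), 2)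
  map_add' f g := by ext u; simp only [Pi.add_apply]; ring
  map_smul' c f := by ext u; simp only [Pi.smul_apply, smul_eq_mul, RingHom.id_apply]; ring

/-- The boundary of a chain of triangles; the triangles `true` and `false` at a node are the ones
above and below its edge in direction `(1, 0)`. -/
def triangleBoundary : (Node × Bool → ZMod 2) →ₗ[ZMod 2] (Node × Fin 3 → ZMod 2) where
  toFun t e := match e.2 with
    | 0 => t (e.1, true) + t (e.1, false)
    | 1 => t (e.1, true) + t ((e.1.1 - 1, e.1.2 + 1), false)
    | 2 => t (e.1, false) + t ((e.1.1, e.1.2 - 1), true)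
  map_add' f g := by
    ext ⟨u, j⟩
    fin_cases j <;> simp only [Pi.add_apply] <;> ring
  map_smul' c f := by
    ext ⟨u, j⟩
    fin_cases j <;> simp only [Pi.smul_apply, smul_eq_mul, RingHom.id_apply] <;> ring

/-- Each of the six triangles around a node has exactly two edges at that node. -/
theorem edgeBoundary_triangleBoundary (t : Node × Bool → ZMod 2) :
    edgeBoundary (triangleBoundary t) = 0 := by
  ext ⟨x, y⟩
  simp only [edgeBoundary, triangleBoundary, LinearMap.coe_mk, AddHom.coe_mk, Pi.zero_apply]
  have h : ∀ a b c d e f : ZMod 2,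
      a + b + (c + d) + (a + e) + (f + d) + (b + f) + (e + c) = 0 := by decide
  rw [← h (t ((x, y), true)) (t ((x, y), false)) (t ((x - 1, y), true))
    (t ((x - 1, y), false)) (t ((x - 1, y + 1), false)) (t ((x, y - 1), true))]
  simp only [sub_add_cancel, add_sub_cancel_right]

variable (D : Finset Node)

/-- The edges within a set of nodes. -/
def edgesIn : Finset (Node × Fin 3) :=
  (D ×ˢ univ).filter fun e => e.1 + dir (![0, 5, 1] e.2) ∈ D

/-- The triangles within a set of nodes. -/
def trianglesIn : Finset (Node × Bool) :=
  (D ×ˢ univ).filter fun e =>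
    e.1 + dir 0 ∈ D ∧ e.1 + dir (if e.2 then 5 else 1) ∈ D

variable {D}

theorem dir_zero : dir 0 = (1, 0) := rfl
theorem dir_one : dir 1 = (1, -1) := rfl
theorem dir_two : dir 2 = (0, -1) := rfl
theorem dir_three : dir 3 = (-1, 0) := rfl
theorem dir_five : dir 5 = (0, 1) := rfl

theorem mem_edgesIn_zero {u : Node} : (u, (0 : Fin 3)) ∈ edgesIn D ↔ u ∈ D ∧ u + dir 0 ∈ D := by
  simp [edgesIn]

theorem mem_edgesIn_one {u : Node} : (u, (1 : Fin 3)) ∈ edgesIn D ↔ u ∈ D ∧ u + dir 5 ∈ D := by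
  simp [edgesIn]

theorem mem_edgesIn_two {u : Node} : (u, (2 : Fin 3)) ∈ edgesIn D ↔ u ∈ D ∧ u + dir 1 ∈ D := by
  simp [edgesIn]

theorem mem_trianglesIn_true {u : Node} :
    (u, true) ∈ trianglesIn D ↔ u ∈ D ∧ u + dir 0 ∈ D ∧ u + dir 5 ∈ D := by
  simp [trianglesIn]

theorem mem_trianglesIn_false {u : Node} :
    (u, false) ∈ trianglesIn D ↔ u ∈ D ∧ u + dir 0 ∈ D ∧ u + dir 1 ∈ D := by
  simp [trianglesIn]

theorem exists_lower_bound (D : Finset Node) : ∃ b : ℤ, ∀ u ∈ D, b < u.2 := by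
  obtain ⟨b, hb⟩ := (D.image Prod.snd).bddBelow
  exact ⟨b - 1, fun u hu => by
    have := hb (Finset.mem_coe.2 (mem_image_of_mem Prod.snd hu)); omega⟩

/-- Across the edges in directions `(1, 0)` and `(1, -1)`, a chain without boundary has equal values
on both sides. So it is constant along every column of triangles, and below the finite set it
vanishes. -/
theorem triangleBoundary_injOn {t : Node × Bool → ZMod 2} (ht : t ∈ supportedIn (trianglesIn D))
    (h : triangleBoundary t = 0) : t = 0 := by
  obtain ⟨b, hb⟩ := exists_lower_bound D
  have h0 : ∀ u, t (u, false) = t (u, true) := fun u => by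
    have := congrFun h (u, 0)
    exact (CharTwo.add_eq_zero.1 this).symm
  have h2 : ∀ u : Node, t (u, false) = t ((u.1, u.2 - 1), true) := fun u =>
    CharTwo.add_eq_zero.1 (congrFun h (u, 2))
  have key : ∀ x y, t ((x, y), true) = 0 := by
    intro x y
    have hlow : ∀ y ≤ b, t ((x, y), true) = 0 := fun y hy => by
      refine ht _ fun hm => ?_
      have := hb _ (mem_trianglesIn_true.1 hm).1
      simp only at this
      omega
    rcases le_total y b with hy | hy
    · exact hlow y hy
    · induction y, hy using Int.leInduction with
      | base => exact hlow b le_rfl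
      | succ n hn ih =>
        rw [← h0, h2]
        simpa using ih
  ext ⟨⟨x, y⟩, c⟩
  cases c
  · rw [h0]; exact key x y
  · exact key x y

/-- Every cycle modulo 2 bounds, because the complement is connected. The chain of triangles counts,
for each triangle, the edges of the cycle crossed on the way up from far below. It solves the
equation in the whole grid. Its support lies within the set because its value is constant around
each node outside, and these nodes are linked to nodes far below. -/
theorem exists_triangleBoundary_eq (hD : Linked ((D : Set Node)ᶜ)) {g : Node × Fin 3 → ZMod 2}
    (hg : g ∈ supportedIn (edgesIn D)) (h : edgeBoundary g = 0) :
    ∃ t ∈ supportedIn (trianglesIn D), triangleBoundary t = g := by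
  obtain ⟨b, hb⟩ := exists_lower_bound D
  have two : ∀ a : ZMod 2, a + a = 0 := by decide
  have g0 : ∀ x y, (x, y) ∉ D ∨ (x + 1, y) ∉ D → g ((x, y), 0) = 0 := fun x y hy =>
    hg _ fun hm => by
      have := mem_edgesIn_zero.1 hm
      rw [dir_zero, Prod.mk_add_mk, add_zero] at this
      tauto
  have g1 : ∀ x y, (x, y) ∉ D ∨ (x, y + 1) ∉ D → g ((x, y), 1) = 0 := fun x y hy =>
    hg _ fun hm => by
      have := mem_edgesIn_one.1 hm
      rw [dir_five, Prod.mk_add_mk, add_zero] at this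
      tauto
  have g2 : ∀ x y, (x, y) ∉ D ∨ (x + 1, y - 1) ∉ D → g ((x, y), 2) = 0 := fun x y hy =>
    hg _ fun hm => by
      have := mem_edgesIn_two.1 hm
      rw [dir_one, Prod.mk_add_mk, ← sub_eq_add_neg] at this
      tauto
  have low : ∀ x y, y ≤ b → (x, y) ∉ D := fun x y hy hm => by
    have := hb _ hm; simp only at this; omega
  -- `up x y` and `dn x y` are the values on the triangles above and below the edge that leaves `(x,
  -- y)` in direction `(1, 0)`.
  set up : ℤ → ℤ → ZMod 2 := fun x y => ∑ s ∈ Finset.Ioc b y, (g ((x, s), 0) + g ((x, s), 2))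
    with hup
  set dn : ℤ → ℤ → ZMod 2 := fun x y => up x y + g ((x, y), 0) with hdn
  have uplow : ∀ x y, y ≤ b → up x y = 0 := fun x y hy => by
    simp only [hup]; rw [Finset.Ioc_eq_empty (by omega), Finset.sum_empty]
  have dnlow : ∀ x y, y ≤ b → dn x y = 0 := fun x y hy => by
    simp only [hdn]; rw [uplow x y hy, g0 x y (.inl (low x y hy)), add_zero]
  have upstep : ∀ x y, up x y = up x (y - 1) + (g ((x, y), 0) + g ((x, y), 2)) := by
    intro x y
    rcases le_or_gt y b with hy | hy
    · rw [uplow x y hy, uplow x _ (by omega), g0 x y (.inl (low x y hy)),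
        g2 x y (.inl (low x y hy))]
      simp
    · simp only [hup]
      have : Finset.Ioc b y = insert y (Finset.Ioc b (y - 1)) := by
        ext s; simp only [Finset.mem_Ioc, Finset.mem_insert]; omega
      rw [this, Finset.sum_insert (by simp), add_comm]
  have e0 : ∀ x y, up x y + dn x y = g ((x, y), 0) := fun x y => by
    simp only [hdn]; rw [← add_assoc, two, zero_add]
  have e2 : ∀ x y, dn x y + up x (y - 1) = g ((x, y), 2) := fun x y => by
    simp only [hdn]; rw [upstep x y]
    have : ∀ p q s : ZMod 2, p + (q + s) + q + p = s := by decide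
    exact this _ _ _
  -- The edges in direction `(0, 1)` are not crossed on the way up. The cycle condition at `(x, y)`
  -- shows that the error at such an edge equals the error one row below, and far below it is zero.
  have e1 : ∀ x y, up x y + dn (x - 1) (y + 1) = g ((x, y), 1) := by
    intro x y
    have step : ∀ y, up x y + dn (x - 1) (y + 1) + g ((x, y), 1) =
        up x (y - 1) + dn (x - 1) y + g ((x, y - 1), 1) := by
      intro y
      have hdeg := congrFun h (x, y)
      simp only [edgeBoundary, LinearMap.coe_mk, AddHom.coe_mk, Pi.zero_apply] at hdeg
      have hu := upstep x y
      have h1 := e2 (x - 1) (y + 1)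
      have h2 := e0 (x - 1) y
      rw [add_sub_cancel_right] at h1
      rw [← h2, ← h1] at hdeg
      rw [hu]
      have : ∀ p a c d1 d2 v1 v2 u1 : ZMod 2,
          a + (u1 + d1) + v1 + v2 + c + (d2 + u1) = 0 →
          p + (a + c) + d2 + v1 = p + d1 + v2 := by decide
      exact this _ _ _ _ _ _ _ _ hdeg
    suffices hs : up x y + dn (x - 1) (y + 1) + g ((x, y), 1) = 0 by
      have h' := two (g ((x, y), 1))
      exact CharTwo.add_eq_zero.1 hs
    rcases le_or_gt y (b - 1) with hy | hy
    · rw [uplow x y (by omega), dnlow _ _ (by omega), g1 x y (.inl (low x y (by omega)))]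
      simp
    · replace hy : b - 1 ≤ y := hy.le
      induction y, hy using Int.leInduction with
      | base =>
        rw [uplow x _ (by omega), dnlow _ _ (by omega), g1 x _ (.inl (low x _ (by omega)))]
        simp
      | succ n hn ih =>
        rw [step (n + 1)]
        simpa using ih
  set t : Node × Bool → ZMod 2 := fun p => if p.2 then up p.1.1 p.1.2 else dn p.1.1 p.1.2 with ht
  -- The cycle has no edge at a node outside `D`, so all six triangles around this node have the
  -- same value.
  have six : ∀ x y, (x, y) ∉ D → dn x y = up x y ∧ up x (y - 1) = up x y ∧
      dn (x - 1) y = up x y ∧ up (x - 1) y = up x y ∧ dn (x - 1) (y + 1) = up x y := by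
    intro x y hxy
    have a1 := e0 x y
    rw [g0 x y (.inl hxy)] at a1
    have a2 := e2 x y
    rw [g2 x y (.inl hxy)] at a2
    have a3 := e1 x (y - 1)
    rw [g1 x (y - 1) (.inr (by simpa using hxy)), sub_add_cancel] at a3
    have a4 := e0 (x - 1) y
    rw [g0 (x - 1) y (.inr (by simpa using hxy))] at a4
    have a5 := e2 (x - 1) (y + 1)
    rw [g2 (x - 1) (y + 1) (.inr (by simpa using hxy)), add_sub_cancel_right] at a5
    rw [CharTwo.add_eq_zero] at a1 a2 a3 a4 a5
    refine ⟨a1.symm, (a1.trans a2).symm, (a1.trans (a2.trans a3)).symm,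
      ((a1.trans (a2.trans a3)).trans a4.symm).symm, ?_⟩
    rw [a5, a4, ← a3, ← a2, ← a1]
  -- Two adjacent nodes outside `D` share a triangle, so their common values agree and spread
  -- through the connected complement.
  have zero : ∀ z : Node, z ∉ D → up z.1 z.2 = 0 := by
    intro z hz
    refine hD (fun z => up z.1 z.2 = 0) ?_ (0, b - 1) (low _ _ (by omega)) z hz
      (uplow _ _ (by simp))
    rintro ⟨x, y⟩ i hu hv hP
    simp only at hP ⊢
    obtain ⟨u1, u2, u3, u4, u5⟩ := six x y hu
    fin_cases i
    · obtain ⟨v1, v2, v3, v4, v5⟩ := six (x + 1) (y + 0) hv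
      rw [add_sub_cancel_right, add_zero] at v4
      show up (x + 1) (y + 0) = 0
      rw [add_zero, ← v4, hP]
    · obtain ⟨v1, v2, v3, v4, v5⟩ := six (x + 1) (y + -1) hv
      rw [add_sub_cancel_right, ← sub_eq_add_neg] at v4
      show up (x + 1) (y + -1) = 0
      rw [← sub_eq_add_neg, ← v4, u2, hP]
    · show up (x + 0) (y + -1) = 0
      rw [← sub_eq_add_neg, add_zero, u2, hP]
    · show up (x + -1) (y + 0) = 0
      rw [← sub_eq_add_neg, add_zero, u4, hP]
    · obtain ⟨v1, v2, v3, v4, v5⟩ := six (x + -1) (y + 1) hv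
      show up (x + -1) (y + 1) = 0
      rw [← v1, ← sub_eq_add_neg, u5, hP]
    · obtain ⟨v1, v2, v3, v4, v5⟩ := six (x + 0) (y + 1) hv
      show up (x + 0) (y + 1) = 0
      rw [← v2, add_sub_cancel_right, add_zero, hP]
  refine ⟨t, ?_, ?_⟩
  · rintro ⟨⟨x, y⟩, c⟩ hn
    cases c
    · rw [mem_trianglesIn_false] at hn
      simp only [dir_zero, dir_one, Prod.mk_add_mk] at hn
      show dn x y = 0
      by_cases h1 : (x, y) ∈ D
      · by_cases h2 : (x + 1, y + 0) ∈ D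
        · have h3 : (x + 1, y + -1) ∉ D := fun h3 => hn ⟨h1, h2, h3⟩
          obtain ⟨v1, v2, v3, v4, v5⟩ := six _ _ h3
          have hz := zero _ h3
          simp only at hz
          rw [hz, add_sub_cancel_right, ← sub_eq_add_neg, sub_add_cancel] at v5
          exact v5
        · obtain ⟨v1, v2, v3, v4, v5⟩ := six _ _ h2
          have hz := zero _ h2
          simp only at hz
          rw [hz, add_sub_cancel_right, add_zero] at v3
          exact v3
      · rw [(six x y h1).1]
        exact zero _ h1
    · rw [mem_trianglesIn_true] at hn
      simp only [dir_zero, dir_five, Prod.mk_add_mk] at hn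
      show up x y = 0
      by_cases h1 : (x, y) ∈ D
      · by_cases h2 : (x + 1, y + 0) ∈ D
        · have h3 : (x + 0, y + 1) ∉ D := fun h3 => hn ⟨h1, h2, h3⟩
          obtain ⟨v1, v2, v3, v4, v5⟩ := six _ _ h3
          have hz := zero _ h3
          simp only at hz
          rw [hz, add_sub_cancel_right, add_zero] at v2
          exact v2
        · obtain ⟨v1, v2, v3, v4, v5⟩ := six _ _ h2
          have hz := zero _ h2
          simp only at hz
          rw [hz, add_sub_cancel_right, add_zero] at v4
          exact v4
      · exact zero _ h1
  · ext ⟨⟨x, y⟩, j⟩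
    fin_cases j
    · exact e0 x y
    · exact e1 x y
    · exact e2 x y

theorem eq_sum_single {α : Type*} [DecidableEq α] {S : Finset α} {g : α → ZMod 2}
    (hg : g ∈ supportedIn S) : g = ∑ e ∈ S, g e • Pi.single e 1 := by
  ext e
  rw [Finset.sum_apply]
  simp only [Pi.smul_apply, Pi.single_apply, smul_eq_mul, mul_ite, mul_one, mul_zero]
  rw [Finset.sum_ite_eq]
  split_ifs with he
  · rfl
  · exact hg e he

/-- Over the field with two elements, the chains of triangles, edges and nodes and the augmentation
form an exact sequence. `triangleBoundary_injOn` and `exists_triangleBoundary_eq` give exactness at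
the triangles and edges, connectedness gives it at the nodes, and the alternating sum of the
dimensions vanishes. -/
theorem euler_characteristic (hne : D.Nonempty) (hD : Linked (D : Set Node))
    (hD' : Linked ((D : Set Node)ᶜ)) :
    D.card + (trianglesIn D).card = (edgesIn D).card + 1 := by
  classical
  set d1 := edgeBoundary.domRestrict (supportedIn (edgesIn D)) with hd1
  set d2 := triangleBoundary.domRestrict (supportedIn (trianglesIn D)) with hd2
  have r2 : Module.finrank (ZMod 2) (LinearMap.range d2) = (trianglesIn D).card := by
    rw [LinearMap.finrank_range_of_inj, finrank_supportedIn]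
    rw [← LinearMap.ker_eq_bot, LinearMap.ker_eq_bot']
    rintro ⟨t, ht⟩ h
    exact Subtype.ext (triangleBoundary_injOn ht h)
  have k1 : Module.finrank (ZMod 2) (LinearMap.ker d1) = (trianglesIn D).card := by
    rw [← r2, ← LinearMap.finrank_range_of_inj (f := (supportedIn (edgesIn D)).subtype ∘ₗ
      (LinearMap.ker d1).subtype) (by
        exact (Subtype.val_injective).comp Subtype.val_injective)]
    -- The kernel and the range live in different types, so both are embedded into the space of all
    -- chains of edges and compared there.
    suffices hs : LinearMap.range ((supportedIn (edgesIn D)).subtype ∘ₗ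
        (LinearMap.ker d1).subtype) = LinearMap.range d2 by rw [hs]
    ext g
    constructor
    · rintro ⟨⟨⟨g, hg⟩, h⟩, rfl⟩
      obtain ⟨t, ht, rfl⟩ := exists_triangleBoundary_eq hD' hg h
      exact ⟨⟨t, ht⟩, rfl⟩
    · rintro ⟨⟨t, ht⟩, rfl⟩
      have hs : triangleBoundary t ∈ supportedIn (edgesIn D) := by
        have h0 : ∀ x y, (x, y) ∉ D ∨ (x + 1, y) ∉ D →
            t ((x, y), true) = 0 ∧ t ((x, y), false) = 0 := fun x y h => by
          constructor <;> refine ht _ fun hm => ?_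
          · have := mem_trianglesIn_true.1 hm
            rw [dir_zero, Prod.mk_add_mk, add_zero] at this
            tauto
          · have := mem_trianglesIn_false.1 hm
            rw [dir_zero, Prod.mk_add_mk, add_zero] at this
            tauto
        have h1 : ∀ x y, (x, y + 1) ∉ D → t ((x, y), true) = 0 := fun x y h =>
          ht _ fun hm => by
            have := mem_trianglesIn_true.1 hm
            rw [dir_zero, dir_five, Prod.mk_add_mk, Prod.mk_add_mk, add_zero, add_zero] at this
            tauto
        have h2 : ∀ x y, (x + 1, y - 1) ∉ D → t ((x, y), false) = 0 := fun x y h =>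
          ht _ fun hm => by
            have := mem_trianglesIn_false.1 hm
            rw [dir_zero, dir_one, Prod.mk_add_mk, Prod.mk_add_mk, add_zero,
              ← sub_eq_add_neg] at this
            tauto
        rintro ⟨⟨x, y⟩, j⟩ hn
        fin_cases j
        · replace hn := mt mem_edgesIn_zero.2 hn
          rw [dir_zero, Prod.mk_add_mk, add_zero] at hn
          have := h0 x y (by tauto)
          show t ((x, y), true) + t ((x, y), false) = 0
          rw [this.1, this.2, add_zero]
        · replace hn := mt mem_edgesIn_one.2 hn
          rw [dir_five, Prod.mk_add_mk, add_zero] at hn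
          show t ((x, y), true) + t ((x - 1, y + 1), false) = 0
          by_cases hm : (x, y) ∈ D
          · have hm' : (x, y + 1) ∉ D := fun h => hn ⟨hm, h⟩
            rw [h1 x y hm', (h0 (x - 1) (y + 1) (.inr (by simpa using hm'))).2, add_zero]
          · rw [(h0 x y (.inl hm)).1, h2 (x - 1) (y + 1) (by simpa using hm), add_zero]
        · replace hn := mt mem_edgesIn_two.2 hn
          rw [dir_one, Prod.mk_add_mk, ← sub_eq_add_neg] at hn
          show t ((x, y), false) + t ((x, y - 1), true) = 0
          by_cases hm : (x, y) ∈ D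
          · have hm' : (x + 1, y - 1) ∉ D := fun h => hn ⟨hm, h⟩
            rw [h2 x y hm', (h0 x (y - 1) (.inr hm')).1, add_zero]
          · rw [(h0 x y (.inl hm)).2, h1 x (y - 1) (by simpa using hm), add_zero]
      refine ⟨⟨⟨triangleBoundary t, hs⟩, ?_⟩, rfl⟩
      exact edgeBoundary_triangleBoundary t
  -- The augmentation. It is onto because the set is nonempty.
  set σ : supportedIn D →ₗ[ZMod 2] ZMod 2 :=
    { toFun := fun f => ∑ u ∈ D, f.1 u
      map_add' := fun f g => by simp [sum_add_distrib]
      map_smul' := fun c f => by simp [Finset.mul_sum] } with hσ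
  have single_mem : ∀ u ∈ D, Pi.single u (1 : ZMod 2) ∈ supportedIn D := fun u hu v hv => by
    rw [Pi.single_eq_of_ne]; rintro rfl; exact hv hu
  have rσ : Module.finrank (ZMod 2) (LinearMap.range σ) = 1 := by
    obtain ⟨u, hu⟩ := hne
    have : LinearMap.range σ = ⊤ := by
      rw [LinearMap.range_eq_top]
      intro c
      refine ⟨c • ⟨Pi.single u 1, single_mem u hu⟩, ?_⟩
      rw [map_smul]
      simp [hσ, hu]
    rw [this, finrank_top, Module.finrank_self]
  have kσ := σ.finrank_range_add_finrank_ker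
  rw [rσ, finrank_supportedIn] at kσ
  have r1 : Module.finrank (ZMod 2) (LinearMap.range d1) =
      Module.finrank (ZMod 2) (LinearMap.ker σ) := by
    rw [← LinearMap.finrank_range_of_inj (f := (supportedIn D).subtype ∘ₗ
      (LinearMap.ker σ).subtype) ((Subtype.val_injective).comp Subtype.val_injective)]
    suffices hs : LinearMap.range d1 = LinearMap.range ((supportedIn D).subtype ∘ₗ
        (LinearMap.ker σ).subtype) by rw [hs]
    have edge_single : ∀ x y j,
        edgeBoundary (Pi.single ((x, y), j) 1) =
          Pi.single (x, y) 1 + Pi.single ((x, y) + dir (![0, 5, 1] j)) 1 := by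
      intro x y j
      ext ⟨x', y'⟩
      fin_cases j <;>
        simp only [edgeBoundary, LinearMap.coe_mk, AddHom.coe_mk, Pi.add_apply, Pi.single_apply,
          Prod.mk.injEq, Fin.zero_eta, Fin.mk_one, Fin.reduceFinMk, Matrix.cons_val, dir_zero,
          dir_five, dir_one, Prod.mk_add_mk, Fin.reduceEq, and_true, and_false, if_false, add_zero,
          zero_add, sub_eq_iff_eq_add, eq_add_neg_iff_add_eq]
    have edge_mem : ∀ (u : Node) j, u ∈ D → u + dir (![0, 5, 1] j) ∈ D →
        Pi.single u (1 : ZMod 2) + Pi.single (u + dir (![0, 5, 1] j)) 1 ∈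
          LinearMap.range d1 := by
      rintro ⟨x, y⟩ j hu hv
      rw [← edge_single]
      refine ⟨⟨Pi.single ((x, y), j) 1, ?_⟩, rfl⟩
      intro e he
      rw [Pi.single_eq_of_ne]
      rintro rfl
      apply he
      fin_cases j
      · exact mem_edgesIn_zero.2 ⟨hu, hv⟩
      · exact mem_edgesIn_one.2 ⟨hu, hv⟩
      · exact mem_edgesIn_two.2 ⟨hu, hv⟩
    have nbr_mem : ∀ (u : Node) i, u ∈ D → u + dir i ∈ D →
        Pi.single u (1 : ZMod 2) + Pi.single (u + dir i) 1 ∈ LinearMap.range d1 := by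
      have flip : ∀ (u : Node) (i : ZMod 6) (j : Fin 3), i + 3 = ![0, 5, 1] j → u ∈ D →
          u + dir i ∈ D →
          Pi.single u (1 : ZMod 2) + Pi.single (u + dir i) 1 ∈ LinearMap.range d1 := by
        intro u i j hj hu hv
        have hback : u + dir i + dir (![0, 5, 1] j) = u := by
          rw [← hj, dir_add_three, add_neg_cancel_right]
        have := edge_mem (u + dir i) j hv (by rwa [hback])
        rw [hback] at this
        rwa [add_comm]
      intro u i hu hv
      fin_cases i
      · exact edge_mem u 0 hu hv
      · exact edge_mem u 2 hu hv
      · exact flip u 2 1 (by decide) hu hv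
      · exact flip u 3 0 (by decide) hu hv
      · exact flip u 4 2 (by decide) hu hv
      · exact edge_mem u 1 hu hv
    -- The two ends of a path form the boundary of the path modulo 2.
    have pair_mem : ∀ u ∈ D, ∀ v ∈ D,
        Pi.single u (1 : ZMod 2) + Pi.single v 1 ∈ LinearMap.range d1 := by
      intro u hu v hv
      refine hD (fun v => Pi.single u (1 : ZMod 2) + Pi.single v 1 ∈ LinearMap.range d1) ?_
        u hu v hv ?_
      · intro v i hv hw hP
        have := (LinearMap.range d1).add_mem hP (nbr_mem v i hv hw)
        rwa [add_assoc, ← add_assoc (Pi.single v 1), CharTwo.add_self_eq_zero, zero_add] at this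
      · rw [CharTwo.add_self_eq_zero]
        exact zero_mem _
    obtain ⟨u, hu⟩ := hne
    apply le_antisymm
    · rintro _ ⟨⟨g, hg⟩, rfl⟩
      show edgeBoundary g ∈ _
      rw [eq_sum_single hg, map_sum]
      refine Submodule.sum_mem _ fun e he => ?_
      rw [map_smul]
      refine Submodule.smul_mem _ _ ?_
      obtain ⟨⟨x, y⟩, j⟩ := e
      rw [edge_single]
      have he' : (x, y) ∈ D ∧ (x, y) + dir (![0, 5, 1] j) ∈ D := by
        simpa [edgesIn] using he
      refine ⟨⟨⟨Pi.single (x, y) 1 + Pi.single ((x, y) + dir (![0, 5, 1] j)) 1,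
        (supportedIn D).add_mem (single_mem _ he'.1) (single_mem _ he'.2)⟩, ?_⟩, rfl⟩
      rw [LinearMap.mem_ker]
      simp only [hσ, LinearMap.coe_mk, AddHom.coe_mk, Pi.add_apply, sum_add_distrib,
        Pi.single_apply, Finset.sum_ite_eq', he'.1, he'.2, if_true]
      decide
    · rintro _ ⟨⟨⟨f, hf⟩, hk⟩, rfl⟩
      show f ∈ _
      have hk' : ∑ v ∈ D, f v = 0 := hk
      -- The coefficients sum to zero, so the fixed node `u` may be added to every term.
      have hdec : f = ∑ v ∈ D, f v • (Pi.single u (1 : ZMod 2) + Pi.single v 1) := by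
        simp only [smul_add, sum_add_distrib]
        rw [← Finset.sum_smul, hk', zero_smul, zero_add]
        exact eq_sum_single hf
      rw [hdec]
      exact Submodule.sum_mem _ fun v hv => Submodule.smul_mem _ _ (pair_mem u hu v hv)
  have k := d1.finrank_range_add_finrank_ker
  rw [finrank_supportedIn, k1, r1] at k
  omega

theorem dir_succ_eq (i : ZMod 6) : dir (i + 1) = dir i + dir (i + 2) := by
  rw [dir_add_two]; abel

theorem add_dir_add_dir (u : Node) (i : ZMod 6) : u + dir i + dir (i + 2) = u + dir (i + 1) := by
  rw [dir_succ_eq, add_assoc]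

theorem add_dir_back (u : Node) (i : ZMod 6) : u + dir i + dir (i + 3) = u := by
  rw [dir_add_three, add_neg_cancel_right]

theorem add_dir_four (u : Node) (i : ZMod 6) : u + dir (i + 1) + dir (i + 4) = u := by
  have := add_dir_back u (i + 1)
  rwa [add_assoc i, show (1 : ZMod 6) + 3 = 4 by decide] at this

theorem add_dir_five (u : Node) (i : ZMod 6) : u + dir (i + 1) + dir (i + 5) = u + dir i := by
  rw [← add_dir_add_dir u i]
  have := add_dir_back (u + dir i) (i + 2)
  rwa [add_assoc i, show (2 : ZMod 6) + 3 = 5 by decide] at this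

theorem sum_zmod_six {β : Type*} [AddCommMonoid β] (f : ZMod 6 → β) :
    ∑ i, f i = f 0 + f 1 + f 2 + f 3 + f 4 + f 5 :=
  Fin.sum_univ_six f

/-! ### Counting corners of triangles -/

section corners

variable (D)

/-- The corners of a set of nodes in triangles that contain no other node of the set. -/
def outerCorners : Finset (Node × ZMod 6) :=
  (D ×ˢ univ).filter fun p => p.1 + dir p.2 ∉ D ∧ p.1 + dir (p.2 + 1) ∉ D

/-- The first corners of a set of nodes in triangles that contain two of its nodes. -/
def innerCorners : Finset (Node × ZMod 6) :=
  (D ×ˢ univ).filter fun p => p.1 + dir p.2 ∈ D ∧ p.1 + dir (p.2 + 1) ∉ D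

theorem card_filter_prod_univ (Q : Node → ZMod 6 → Prop) [∀ u i, Decidable (Q u i)] :
    ((D ×ˢ (univ : Finset (ZMod 6))).filter fun p => Q p.1 p.2).card =
      ∑ i : ZMod 6, (D.filter fun u => Q u i).card := by
  simp only [card_filter, Finset.sum_product_right]

variable {D}

/-- Summed over the six directions, the nodes, the directed edges and the corners of occupied
triangles enter with coefficients 6, -3 and 2. Every edge is counted from both ends and every
triangle at its three corners, so the difference is six times nodes minus edges plus triangles. -/
theorem card_corners (hne : D.Nonempty) (hD : Linked (D : Set Node))
    (hD' : Linked ((D : Set Node)ᶜ)) :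
    ((outerCorners D).card : ℤ) - (innerCorners D).card = 6 := by
  have euler := euler_characteristic hne hD hD'
  set s : ZMod 6 → ℕ := fun i => (D.filter fun u => u + dir i ∈ D).card with hs
  set τ : ZMod 6 → ℕ := fun i => (D.filter fun u => u + dir i ∈ D ∧ u + dir (i + 1) ∈ D).card
    with hτ
  have s3 : ∀ i, s (i + 3) = s i := by
    intro i
    refine card_bij (fun u _ => u + dir (i + 3)) ?_ ?_ ?_
    · intro u hu
      rw [mem_filter] at hu ⊢
      refine ⟨hu.2, ?_⟩
      rw [dir_add_three, neg_add_cancel_right]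
      exact hu.1
    · intro u _ v _ h
      exact add_right_cancel h
    · intro u hu
      rw [mem_filter] at hu
      refine ⟨u + dir i, ?_, add_dir_back u i⟩
      rw [mem_filter, add_dir_back]
      exact ⟨hu.2, hu.1⟩
  have τ2 : ∀ i, τ (i + 2) = τ i := by
    intro i
    refine (card_bij (fun u _ => u + dir i) ?_ ?_ ?_).symm
    · intro u hu
      rw [mem_filter] at hu ⊢
      rw [add_dir_add_dir, add_assoc i 2 1, show (2 : ZMod 6) + 1 = 3 by decide, add_dir_back]
      exact ⟨hu.2.1, hu.2.2, hu.1⟩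
    · intro u _ v _ h
      exact add_right_cancel h
    · intro u hu
      rw [mem_filter, add_assoc i 2 1, show (2 : ZMod 6) + 1 = 3 by decide] at hu
      refine ⟨u + dir (i + 3), ?_, ?_⟩
      · have e : u + dir (i + 3) + dir i = u := by rw [dir_add_three, neg_add_cancel_right]
        rw [mem_filter, ← add_dir_add_dir, e]
        exact ⟨hu.2.2, hu.1, hu.2.1⟩
      · rw [dir_add_three, neg_add_cancel_right]
  have hE : (edgesIn D).card = s 0 + s 5 + s 1 := by
    have : edgesIn D = (D ×ˢ univ).filter fun e => e.1 + dir (![0, 5, 1] e.2) ∈ D := rfl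
    rw [this, card_filter, Finset.sum_product_right, Fin.sum_univ_three]
    simp only [hs, card_filter]
    rfl
  have hT : (trianglesIn D).card = τ 5 + τ 0 := by
    have : trianglesIn D = (D ×ˢ univ).filter fun e =>
      e.1 + dir 0 ∈ D ∧ e.1 + dir (if e.2 then 5 else 1) ∈ D := rfl
    rw [this, card_filter, Finset.sum_product_right, Fintype.sum_bool]
    simp only [hτ, card_filter]
    congr 1
    refine sum_congr rfl fun u _ => ?_
    simp only [show (5 : ZMod 6) + 1 = 0 by decide, if_true, and_comm]
  have hin : ∀ i, ((D.filter fun u => u + dir i ∈ D ∧ u + dir (i + 1) ∉ D).card : ℤ) =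
      s i - τ i := by
    intro i
    have := Finset.card_filter_add_card_filter_not (s := D.filter fun u => u + dir i ∈ D)
      (fun u => u + dir (i + 1) ∈ D)
    rw [filter_filter, filter_filter] at this
    simp only [hs, hτ]
    push_cast [← this]
    ring
  have hout : ∀ i, ((D.filter fun u => u + dir i ∉ D ∧ u + dir (i + 1) ∉ D).card : ℤ) =
      D.card - s i - s (i + 1) + τ i := by
    intro i
    have h1 := Finset.card_filter_add_card_filter_not (s := D) (fun u => u + dir (i + 1) ∈ D)
    have h2 := Finset.card_filter_add_card_filter_not
      (s := D.filter fun u => u + dir (i + 1) ∉ D) (fun u => u + dir i ∈ D)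
    rw [filter_filter, filter_filter] at h2
    have h3 := hin i
    have e1 : (D.filter fun u => u + dir (i + 1) ∉ D ∧ u + dir i ∈ D) =
        D.filter fun u => u + dir i ∈ D ∧ u + dir (i + 1) ∉ D :=
      Finset.filter_congr fun u _ => and_comm
    have e2 : (D.filter fun u => u + dir (i + 1) ∉ D ∧ u + dir i ∉ D) =
        D.filter fun u => u + dir i ∉ D ∧ u + dir (i + 1) ∉ D :=
      Finset.filter_congr fun u _ => and_comm
    rw [e1, e2] at h2
    have h4 : (s (i + 1) : ℤ) = (D.filter fun u => u + dir (i + 1) ∈ D).card := rfl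
    omega
  have ho : (outerCorners D).card =
      ∑ i, (D.filter fun u => u + dir i ∉ D ∧ u + dir (i + 1) ∉ D).card :=
    card_filter_prod_univ D fun u i => u + dir i ∉ D ∧ u + dir (i + 1) ∉ D
  have hi : (innerCorners D).card =
      ∑ i, (D.filter fun u => u + dir i ∈ D ∧ u + dir (i + 1) ∉ D).card :=
    card_filter_prod_univ D fun u i => u + dir i ∈ D ∧ u + dir (i + 1) ∉ D
  rw [ho, hi]
  push_cast
  simp only [hin, hout]
  rw [sum_zmod_six, sum_zmod_six]
  have a2 : s 2 = s 5 := s3 5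
  have a3 : s 3 = s 0 := s3 0
  have a4 : s 4 = s 1 := s3 1
  have b1 : τ 1 = τ 5 := τ2 5
  have b2 : τ 2 = τ 0 := τ2 0
  have b3 : τ 3 = τ 1 := τ2 1
  have b4 : τ 4 = τ 2 := τ2 2
  rw [show (0 : ZMod 6) + 1 = 1 by decide, show (1 : ZMod 6) + 1 = 2 by decide,
    show (2 : ZMod 6) + 1 = 3 by decide, show (3 : ZMod 6) + 1 = 4 by decide,
    show (4 : ZMod 6) + 1 = 5 by decide, show (5 : ZMod 6) + 1 = 0 by decide]
  omega

end corners

/-! ### Potentials -/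

/-- A discrete Poincaré lemma: `J` is closed on all triangles of the simply connected grid, and its
bounded support yields a potential with finite support. It is applied to the signed crossings of a
boundary, and the potential is then a winding number. -/
theorem exists_potential {J : Node → ZMod 6 → ℤ} (anti : ∀ u i, J (u + dir i) (i + 3) = -J u i)
    (curl : ∀ u i, J u (i + 1) = J u i + J (u + dir i) (i + 2)) {B : ℤ}
    (hB : ∀ u i, J u i ≠ 0 → -B < u.1 ∧ u.1 < B ∧ -B < u.2 ∧ u.2 < B) :
    ∃ w : Node → ℤ, (∀ u i, w u - w (u + dir i) = J u i) ∧ {u | w u ≠ 0}.Finite := by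
  have hz : ∀ x y i, (x ≤ -B ∨ B ≤ x ∨ y ≤ -B ∨ B ≤ y) → J (x, y) i = 0 := by
    intro x y i h
    by_contra hc
    have := hB _ _ hc
    simp only at this
    omega
  -- The sum of `J` along the horizontal ray up to the right side of the box that contains the
  -- support.
  set w : Node → ℤ := fun u => ∑ t ∈ Finset.Ico u.1 B, J (t, u.2) 0 with hw
  have wz : ∀ x y, B ≤ x → w (x, y) = 0 := fun x y hx => by
    simp only [hw]; rw [Finset.Ico_eq_empty (by omega), Finset.sum_empty]
  have P0 : ∀ u, w u - w (u + dir 0) = J u 0 := by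
    rintro ⟨x, y⟩
    rw [dir_zero, Prod.mk_add_mk, add_zero]
    rcases le_or_gt B x with h | h
    · rw [wz x y h, wz _ y (by omega), hz x y 0 (by omega), sub_zero]
    · simp only [hw]
      have : Finset.Ico x B = insert x (Finset.Ico (x + 1) B) := by
        ext s; simp only [mem_Ico, Finset.mem_insert]; omega
      rw [this, Finset.sum_insert (by simp)]
      ring
  have P5 : ∀ u, w u - w (u + dir 5) = J u 5 := by
    rintro ⟨x, y⟩
    -- Two triangles fill the parallelogram between neighbouring columns, so the defect in direction
    -- 5 is the same in both columns. To the right of the box it vanishes.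
    have step : ∀ x, w (x, y) - w (x, y + 1) - J (x, y) 5 =
        w (x + 1, y) - w (x + 1, y + 1) - J (x + 1, y) 5 := by
      intro x
      have h1 := P0 (x, y)
      have h2 := P0 (x, y + 1)
      have c1 := curl (x, y) 5
      have c2 := curl (x, y + 1) 0
      have c3 := anti (x + 1, y) 5
      simp only [dir_zero, dir_five, Prod.mk_add_mk, add_zero, zero_add,
        show (5 : ZMod 6) + 1 = 0 by decide, show (5 : ZMod 6) + 2 = 1 by decide,
        show (5 : ZMod 6) + 3 = 2 by decide] at h1 h2 c1 c2 c3
      omega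
    have main : ∀ n : ℕ, ∀ x, B - n ≤ x → w (x, y) - w (x, y + 1) - J (x, y) 5 = 0 := by
      intro n
      induction n with
      | zero =>
        intro x hx
        rw [wz x _ (by simpa using hx), wz x _ (by simpa using hx), hz x y 5 (by omega)]
        simp
      | succ n ih =>
        intro x hx
        rw [step]
        refine ih _ ?_
        push_cast at hx
        omega
    rw [dir_five, Prod.mk_add_mk, add_zero]
    have := main (B - x).toNat x (by omega)
    omega
  have flip : ∀ i, (∀ u, w u - w (u + dir i) = J u i) →
      ∀ u, w u - w (u + dir (i + 3)) = J u (i + 3) := by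
    intro i h u
    have h1 := h (u + dir (i + 3))
    have h2 := anti (u + dir (i + 3)) i
    have e : u + dir (i + 3) + dir i = u := by rw [dir_add_three, neg_add_cancel_right]
    rw [e] at h1 h2
    omega
  have P3 := flip 0 P0
  have P2 := flip 5 P5
  rw [zero_add] at P3
  rw [show (5 : ZMod 6) + 3 = 2 by decide] at P2
  have P1 : ∀ u, w u - w (u + dir 1) = J u 1 := by
    intro u
    have h1 := P0 u
    have h2 := P2 (u + dir 0)
    have h3 := curl u 0
    have h4 := add_dir_add_dir u 0
    simp only [zero_add] at h3 h4
    rw [h4] at h2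
    omega
  have P4 := flip 1 P1
  rw [show (1 : ZMod 6) + 3 = 4 by decide] at P4
  have P : ∀ u i, w u - w (u + dir i) = J u i := by
    intro u i
    fin_cases i
    exacts [P0 u, P1 u, P2 u, P3 u, P4 u, P5 u]
  refine ⟨w, P, ?_⟩
  refine Set.Finite.subset ((Set.finite_Ioo (-B) B).prod (Set.finite_Ioo (-B) B)) ?_
  rintro ⟨x, y⟩ hxy
  by_contra hc
  apply hxy
  simp only [Set.mem_prod, Set.mem_Ioo] at hc
  have row : ∀ x y, (y ≤ -B ∨ B ≤ y) → w (x, y) = 0 := by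
    intro x y h
    simp only [hw]
    exact Finset.sum_eq_zero fun t _ => hz t y 0 (by omega)
  by_cases hy : y ≤ -B ∨ B ≤ y
  · exact row x y hy
  · by_cases hx : B ≤ x
    · exact wz x y hx
    · have hx' : x ≤ -B := by omega
      -- To the left of the box the potential is constant along the column, and above the box it
      -- vanishes.
      have step : ∀ y, w (x, y) = w (x, y + 1) := by
        intro y
        have := P5 (x, y)
        rw [hz x y 5 (by omega), dir_five, Prod.mk_add_mk, add_zero] at this
        omega
      have main : ∀ n : ℕ, ∀ y, B - n ≤ y → w (x, y) = 0 := by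
        intro n
        induction n with
        | zero => intro y hy; exact row x y (by right; simpa using hy)
        | succ n ih =>
          intro y hy
          rw [step]
          refine ih _ ?_
          push_cast at hy
          omega
      exact main (B - y).toNat y (by omega)

/-! ### Connected sets of nodes and components of the complement -/

theorem linked_univ : Linked (Set.univ : Set Node) := by
  intro P hP u _ v _ hu
  have hP' : ∀ u i, P u → P (u + dir i) := fun u i => hP u i trivial trivial
  have hx : ∀ (n : ℕ) (x y : ℤ), P (x, y) → P (x + n, y) ∧ P (x - n, y) ∧ P (x, y + n) ∧
      P (x, y - n) := by
    intro n
    induction n with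
    | zero => intro x y hu; simpa using hu
    | succ n ih =>
      intro x y hu
      obtain ⟨h1, h2, h3, h4⟩ := ih x y hu
      push_cast
      simp only [← add_assoc, ← sub_sub]
      refine ⟨?_, ?_, ?_, ?_⟩
      · simpa [dir_zero] using hP' _ 0 h1
      · simpa [dir_three, ← sub_eq_add_neg] using hP' _ 3 h2
      · simpa [dir_five] using hP' _ 5 h3
      · simpa [dir_two, ← sub_eq_add_neg] using hP' _ 2 h4
  obtain ⟨x, y⟩ := u
  obtain ⟨x', y'⟩ := v
  have h1 : P (x', y) := by
    rcases le_total x x' with h | h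
    · have := (hx (x' - x).toNat x y hu).1
      rwa [Int.toNat_of_nonneg (by omega), add_sub_cancel] at this
    · have := (hx (x - x').toNat x y hu).2.1
      rwa [Int.toNat_of_nonneg (by omega), sub_sub_cancel] at this
  rcases le_total y y' with h | h
  · have := (hx (y' - y).toNat x' y h1).2.2.1
    rwa [Int.toNat_of_nonneg (by omega), add_sub_cancel] at this
  · have := (hx (y - y').toNat x' y h1).2.2.2
    rwa [Int.toNat_of_nonneg (by omega), sub_sub_cancel] at this

theorem linked_of_connected (hA : (triGrid.induce (A : Set Node)).Connected) :
    Linked (A : Set Node) := by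
  intro P hP u hu v hv hPu
  obtain ⟨p⟩ := hA.preconnected ⟨u, hu⟩ ⟨v, hv⟩
  suffices h : ∀ (x y : (A : Set Node)), (triGrid.induce (A : Set Node)).Walk x y → P x → P y from
    h _ _ p hPu
  intro x y p
  induction p with
  | nil => exact id
  | cons h p ih =>
    rename_i x z y
    intro hx
    refine ih ?_
    obtain ⟨i, hi⟩ : ∃ i, (z : Node) = x + dir i := h
    rw [hi]
    exact hP _ _ x.2 (by rw [← hi]; exact z.2) hx

/-- The connected component of a node in a set of nodes. -/
def component (S : Set Node) (z : Node) : Set Node :=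
  {v | ∀ P : Node → Prop, (∀ u i, u ∈ S → u + dir i ∈ S → P u → P (u + dir i)) → P z → P v}

theorem self_mem_component (S : Set Node) (z : Node) : z ∈ component S z := fun _ _ h => h

theorem component_subset {S : Set Node} {z : Node} (hz : z ∈ S) : component S z ⊆ S :=
  fun _ hv => hv (· ∈ S) (fun _ _ _ h _ => h) hz

theorem component_step {S : Set Node} {z u : Node} {i : ZMod 6} (hu : u ∈ component S z)
    (huS : u ∈ S) (h : u + dir i ∈ S) : u + dir i ∈ component S z :=
  fun P hP hz => hP u i huS h (hu P hP hz)

theorem component_step_iff {S : Set Node} {z u : Node} {i : ZMod 6}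
    (huS : u ∈ S) (h : u + dir i ∈ S) : u + dir i ∈ component S z ↔ u ∈ component S z := by
  refine ⟨fun hu => ?_, fun hu => component_step hu huS h⟩
  have := component_step (i := i + 3) hu h (by rwa [add_dir_back])
  rwa [add_dir_back] at this

theorem linked_component (S : Set Node) (z : Node) : Linked (component S z) := by
  have main : ∀ P : Node → Prop,
      (∀ u i, u ∈ component S z → u + dir i ∈ component S z → P u → P (u + dir i)) →
      ∀ v ∈ component S z, P v ↔ P z := by
    intro P hP v hv
    refine (hv (fun v => v ∈ component S z ∧ (P v ↔ P z)) ?_ ⟨self_mem_component S z, Iff.rfl⟩).2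
    rintro u i hu hv ⟨h1, h2⟩
    have h3 := component_step h1 hu hv
    refine ⟨h3, ?_⟩
    rw [← h2]
    refine ⟨fun h => ?_, hP u i h1 h3⟩
    have := hP (u + dir i) (i + 3) h3 (by rwa [add_dir_back]) h
    rwa [add_dir_back] at this
  intro P hP u hu v hv h
  exact (main P hP v hv).2 ((main P hP u hu).1 h)

/-- Otherwise the component would be closed under all six steps and thus be the whole grid. -/
theorem exists_adjacent_component (hA : A.Nonempty) {z : Node} (hz : z ∉ A) :
    ∃ u ∈ A, ∃ i, u + dir i ∈ component ((A : Set Node)ᶜ) z := by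
  by_contra hc
  push Not at hc
  obtain ⟨v, hv⟩ := hA
  have := linked_univ (· ∈ component ((A : Set Node)ᶜ) z) (fun u i _ _ hu => by
    have huA := component_subset (S := (A : Set Node)ᶜ) hz hu
    refine component_step hu huA fun h => ?_
    apply hc _ h (i + 3)
    rwa [add_dir_back]) z trivial v trivial (self_mem_component _ _)
  exact component_subset (S := (A : Set Node)ᶜ) hz this hv

/-- Any other component of the complement touches `A`, so every node outside the given component is
linked to `A` without entering it, and `A` is connected. -/
theorem linked_compl_component (hA : A.Nonempty) (hL : Linked (A : Set Node)) {z : Node}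
    (hz : z ∉ A) : Linked ((component ((A : Set Node)ᶜ) z)ᶜ) := by
  set C := component ((A : Set Node)ᶜ) z
  have hCA : C ⊆ (A : Set Node)ᶜ := component_subset hz
  have hAC : ∀ u ∈ A, u ∈ Cᶜ := fun u hu h => hCA h hu
  intro P hP
  have hsymm : ∀ u i, u ∈ Cᶜ → u + dir i ∈ Cᶜ → (P (u + dir i) ↔ P u) := by
    intro u i hu hv
    refine ⟨fun h => ?_, hP u i hu hv⟩
    have := hP (u + dir i) (i + 3) hv (by rwa [add_dir_back]) h
    rwa [add_dir_back] at this
  have main : ∀ v ∈ Cᶜ, ∃ u ∈ A, (P v ↔ P u) := by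
    intro v hv
    by_cases hvA : v ∈ A
    · exact ⟨v, hvA, Iff.rfl⟩
    · obtain ⟨u, hu, i, hi⟩ := exists_adjacent_component hA hvA
      obtain ⟨h1, h2⟩ := hi (fun y => y ∈ Cᶜ ∧ (P y ↔ P v)) (by
        rintro y j hy hyj ⟨h1, h2⟩
        have h3 : y + dir j ∈ Cᶜ := fun h => h1 ((component_step_iff hy hyj).1 h)
        exact ⟨h3, (hsymm y j h1 h3).trans h2⟩) ⟨hv, Iff.rfl⟩
      exact ⟨u, hu, h2.symm.trans (hsymm u i (hAC u hu) h1)⟩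
  intro u hu v hv h
  obtain ⟨u', hu', e⟩ := main u hu
  obtain ⟨v', hv', e'⟩ := main v hv
  rw [e']
  exact hL P (fun x i hx hxi => hP x i (hAC x hx) (hAC _ hxi)) u' hu' v' hv' (e.1 h)

/-! ### The winding number of a boundary -/

namespace Agent

/-- The direction `i` belongs to the empty run of an agent of the boundary of `a` at node `u`. -/
def Faces (a : Agent A) (u : Node) (i : ZMod 6) : Prop :=
  ∃ b, SameBoundary a b ∧ b.node = u ∧ ∃ m : ℕ, 1 ≤ m ∧ m < b.span ∧ i = b.predDir + m

variable {a : Agent A} {u : Node} {i : ZMod 6}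

theorem Faces.mem (h : a.Faces u i) : u ∈ A := by
  obtain ⟨b, _, rfl, _⟩ := h
  exact b.node_mem

theorem Faces.not_mem (h : a.Faces u i) : u + dir i ∉ A := by
  obtain ⟨b, _, rfl, m, h1, h2, rfl⟩ := h
  exact b.run_not_mem h1 h2

/-- Two consecutive empty directions at a node belong to the same run. -/
theorem faces_succ_iff (h1 : u + dir i ∉ A) (h2 : u + dir (i + 1) ∉ A) :
    a.Faces u (i + 1) ↔ a.Faces u i := by
  constructor
  · rintro ⟨b, hb, rfl, m, hm1, hm2, hm⟩
    have hi : i = b.predDir + ((m - 1 : ℕ) : ZMod 6) := by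
      rw [Nat.cast_sub hm1, Nat.cast_one, ← add_sub_assoc, ← hm, add_sub_cancel_right]
    refine ⟨b, hb, rfl, m - 1, ?_, by omega, hi⟩
    by_contra hc
    rw [show m - 1 = 0 by omega, Nat.cast_zero, add_zero] at hi
    rw [hi] at h1
    exact h1 b.pred_mem
  · rintro ⟨b, hb, rfl, m, hm1, hm2, rfl⟩
    refine ⟨b, hb, rfl, m + 1, by omega, ?_, by push_cast; ring⟩
    by_contra hc
    have : b.predDir + m + 1 = b.succDir := by
      rw [succDir_eq, show b.span = m + 1 by omega]; push_cast; ring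
    rw [this] at h2
    exact h2 b.succ_mem

/-- The empty third corner over an occupied edge is the first empty node for the agent at `u` and
the last one for its predecessor at `u + dir i`, and these two agents lie on the same boundary. -/
theorem faces_turn_iff (h0 : u ∈ A) (h1 : u + dir i ∈ A) (h2 : u + dir (i + 1) ∉ A) :
    a.Faces u (i + 1) ↔ a.Faces (u + dir i) (i + 2) := by
  constructor
  · rintro ⟨b, hb, rfl, m, hm1, hm2, hm⟩
    have hi : i = b.predDir + ((m - 1 : ℕ) : ZMod 6) := by
      rw [Nat.cast_sub hm1, Nat.cast_one, ← add_sub_assoc, ← hm, add_sub_cancel_right]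
    have hm' : m = 1 := by
      by_contra hc
      rw [hi] at h1
      exact b.run_not_mem (m := m - 1) (by omega) (by omega) h1
    rw [hm', Nat.sub_self, Nat.cast_zero, add_zero] at hi
    have hs := b.pred.succDir_eq
    have h3 : b.predDir = b.pred.succDir + 3 := by
      rw [← predDir_succ, succ_pred]
    refine ⟨b.pred, hb.pred_right, ?_, b.pred.span - 1, ?_, ?_, ?_⟩
    · rw [node_pred, hi]
    · have := b.pred.two_le_span; omega
    · have := b.pred.two_le_span; omega
    · rw [Nat.cast_sub (by have := b.pred.two_le_span; omega), ← add_sub_assoc, ← hs, hi, h3,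
        Nat.cast_one, add_assoc, show (3 : ZMod 6) + 2 = -1 by decide, sub_eq_add_neg]
  · rintro ⟨b, hb, hn, m, hm1, hm2, hm⟩
    have hs : m + 1 = b.span := by
      by_contra hc
      have := b.run_not_mem (m := m + 1) (by omega) (by omega)
      apply this
      rw [Nat.cast_add, Nat.cast_one, ← add_assoc, ← hm, hn, add_assoc i,
        show (2 : ZMod 6) + 1 = 3 by decide, add_dir_back]
      exact h0
    have hsd : b.succDir = i + 3 := by
      rw [succDir_eq, ← hs, Nat.cast_add, Nat.cast_one, ← add_assoc, ← hm, add_assoc,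
        show (2 : ZMod 6) + 1 = 3 by decide]
    refine ⟨b.succ, hb.succ_right, ?_, 1, le_rfl, by have := b.succ.two_le_span; omega, ?_⟩
    · rw [node_succ, hsd, hn, add_dir_back]
    · rw [predDir_succ, hsd, add_assoc i, show (3 : ZMod 6) + 3 = 0 by decide, add_zero,
        Nat.cast_one]

open Classical in
/-- The signed crossings of the boundary of `a`. -/
noncomputable def jump (a : Agent A) (u : Node) (i : ZMod 6) : ℤ :=
  (if a.Faces u i then 1 else 0) - (if a.Faces (u + dir i) (i + 3) then 1 else 0)

theorem jump_anti (a : Agent A) (u : Node) (i : ZMod 6) :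
    a.jump (u + dir i) (i + 3) = -a.jump u i := by
  rw [jump, jump, add_dir_back, add_assoc i, show (3 : ZMod 6) + 3 = 0 by decide, add_zero]
  ring

-- The crossings around a triangle cancel. If no corner or all corners are occupied, there are none.
-- With one occupied corner both crossed edges belong to one run, and with two they belong to
-- consecutive agents of a boundary.
open Classical in
theorem jump_curl (a : Agent A) (u : Node) (i : ZMod 6) :
    a.jump u (i + 1) = a.jump u i + a.jump (u + dir i) (i + 2) := by
  have nf : ∀ v j, v ∉ A → ¬ a.Faces v j := fun v j h h' => h h'.mem
  have nf' : ∀ v j, v + dir j ∈ A → ¬ a.Faces v j := fun v j h h' => h'.not_mem h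
  have ie : ∀ {v j v' j'}, (a.Faces v j ↔ a.Faces v' j') →
      (if a.Faces v j then (1 : ℤ) else 0) = if a.Faces v' j' then 1 else 0 :=
    fun h => if_congr h rfl rfl
  have z1 := add_dir_add_dir u i
  have z2 := add_dir_back u i
  have z3 := add_dir_four u i
  have z4 := add_dir_five u i
  have d1 : i + 1 + 3 = i + 4 := by rw [add_assoc]; rfl
  have d2 : i + 2 + 3 = i + 5 := by rw [add_assoc]; rfl
  have d3 : i + 2 + 1 = i + 3 := by rw [add_assoc]; rfl
  have d4 : i + 2 + 2 = i + 4 := by rw [add_assoc]; rfl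
  have d5 : i + 4 + 1 = i + 5 := by rw [add_assoc]; rfl
  have d6 : i + 4 + 2 = i := by rw [add_assoc, show (4 : ZMod 6) + 2 = 0 by decide, add_zero]
  rw [jump, jump, jump, d1, d2, z1]
  set p := u + dir i with hp
  set q := u + dir (i + 1) with hq
  by_cases hu : u ∈ A <;> by_cases hpA : p ∈ A <;> by_cases hqA : q ∈ A
  · simp [nf' u (i + 1) (by rwa [← hq]), nf' u i (by rwa [← hp]), nf' q (i + 4) (by rwa [z3]),
      nf' p (i + 3) (by rwa [z2]), nf' p (i + 2) (by rwa [z1]), nf' q (i + 5) (by rwa [z4])]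
  · have := faces_turn_iff (a := a) hu (i := i) (by rwa [← hp]) (by rwa [← hq])
    rw [← hp] at this
    simp [ie this, nf q _ hqA, nf' u i (by rwa [← hp]), nf' p (i + 3) (by rwa [z2])]
  · have := faces_turn_iff (a := a) hqA (i := i + 4) (by rwa [z3]) (by rwa [d5, z4])
    rw [d5, d6, z3] at this
    simp [ie this, nf p _ hpA, nf' u (i + 1) (by rwa [← hq]), nf' q (i + 4) (by rwa [z3])]
  · have := faces_succ_iff (a := a) (u := u) (i := i) (by rwa [← hp]) (by rwa [← hq])
    simp [ie this, nf p _ hpA, nf q _ hqA]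
  · have := faces_turn_iff (a := a) hpA (i := i + 2) (by rwa [z1]) (by rwa [d3, z2])
    rw [d3, d4, z1] at this
    simp [ie this, nf u _ hu, nf' p (i + 2) (by rwa [z1]), nf' q (i + 5) (by rwa [z4])]
  · have := faces_succ_iff (a := a) (u := p) (i := i + 2) (by rwa [z1]) (by rwa [d3, z2])
    rw [d3] at this
    simp [ie this, nf u _ hu, nf q _ hqA]
  · have := faces_succ_iff (a := a) (u := q) (i := i + 4) (by rwa [z3]) (by rwa [d5, z4])
    rw [d5] at this
    simp [ie this, nf u _ hu, nf p _ hpA]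
  · simp [nf u _ hu, nf p _ hpA, nf q _ hqA]

/-- The component of the complement that the boundary of an agent faces. -/
def face (a : Agent A) : Set Node :=
  component ((A : Set Node)ᶜ) (a.node + dir (a.predDir + 1))

theorem face_subset (a : Agent A) : a.face ⊆ (A : Set Node)ᶜ :=
  component_subset a.first_not_mem

/-- Consecutive nodes of a run are adjacent, and the last empty node of an agent is the first empty
node of its successor. So the boundary stays at one component. -/
theorem Faces.mem_face (h : a.Faces u i) : u + dir i ∈ a.face := by
  obtain ⟨b, ⟨k, rfl⟩, rfl, m, h1, h2, rfl⟩ := h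
  have run : ∀ b : Agent A, b.node + dir (b.predDir + 1) ∈ a.face →
      ∀ m : ℕ, 1 ≤ m → m < b.span → b.node + dir (b.predDir + m) ∈ a.face := by
    intro b hb m h1
    induction m, h1 using Nat.le_induction with
    | base => intro _; simpa using hb
    | succ m hm ih =>
      intro h
      have := component_step (i := b.predDir + m + 2) (ih (by omega))
        (b.run_not_mem hm (by omega)) (by
          rw [add_dir_add_dir]
          have := b.run_not_mem (m := m + 1) (by omega) h
          rwa [Nat.cast_add, Nat.cast_one, ← add_assoc] at this)
      rw [add_dir_add_dir] at this
      rw [Nat.cast_add, Nat.cast_one, ← add_assoc]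
      exact this
  refine run _ ?_ m h1 h2
  clear h1 h2 m
  induction k with
  | zero => exact self_mem_component _ _
  | succ k ih =>
    rw [iterate_succ_apply']
    set b := succ^[k] a
    have h2 := b.two_le_span
    have := run b ih (b.span - 1) (by omega) (by omega)
    convert this using 1
    rw [node_succ, predDir_succ, Nat.cast_sub (by omega), Nat.cast_one, ← add_sub_assoc,
      ← succDir_eq, add_assoc b.succDir, show (3 : ZMod 6) + 1 = 4 by decide]
    have h5 := add_dir_add_dir (b.node + dir b.succDir) (b.succDir + 3)
    rw [add_dir_back, add_assoc b.succDir, add_assoc b.succDir, show (3 : ZMod 6) + 1 = 4 by decide,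
      show (3 : ZMod 6) + 2 = -1 by decide, ← sub_eq_add_neg] at h5
    exact h5.symm

theorem faces_first (a : Agent A) : a.Faces a.node (a.predDir + 1) :=
  ⟨a, .refl a, rfl, 1, le_rfl, a.two_le_span, by simp⟩

/-- The boundary of an agent consists of all edges between the occupied nodes and the component of
the complement that it faces, and either this component or its complement is finite. -/
theorem faces_iff_and_finite (hL : Linked (A : Set Node)) (a : Agent A) :
    (∀ u i, a.Faces u i ↔ u ∈ A ∧ u + dir i ∈ a.face) ∧ (a.face.Finite ∨ a.faceᶜ.Finite) := by
  have hne : A.Nonempty := ⟨_, a.node_mem⟩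
  obtain ⟨B, hB⟩ : ∃ B : ℤ, ∀ u ∈ A, -B < u.1 ∧ u.1 < B ∧ -B < u.2 ∧ u.2 < B := by
    obtain ⟨B, hB⟩ := (A.image fun u => max |u.1| |u.2|).bddAbove
    refine ⟨B + 1, fun u hu => ?_⟩
    have := hB (Finset.mem_coe.2 (mem_image_of_mem (fun u : Node => max |u.1| |u.2|) hu))
    simp only [sup_le_iff, abs_le] at this
    omega
  have hdir : ∀ i, -1 ≤ (dir i).1 ∧ (dir i).1 ≤ 1 ∧ -1 ≤ (dir i).2 ∧ (dir i).2 ≤ 1 := by decide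
  have jz : ∀ u i, a.jump u i ≠ 0 → u ∈ A ∨ u + dir i ∈ A := by
    intro u i h
    by_contra hc
    push Not at hc
    apply h
    rw [jump, if_neg fun h => hc.1 h.mem, if_neg fun h => hc.2 h.mem, sub_zero]
  -- The winding number. It is constant on `A` and on each component of the complement, and it drops
  -- by one from `A` into the face of `a`.
  obtain ⟨w, hw, hfin⟩ := exists_potential a.jump_anti a.jump_curl (B := B + 1) (by
    intro u i h
    have hd := hdir i
    rcases jz u i h with h | h
    · have := hB _ h; omega
    · have := hB _ h
      simp only [Prod.fst_add, Prod.snd_add] at this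
      omega)
  set κ := w a.node with hκ
  have wA : ∀ u ∈ A, w u = κ := by
    intro u hu
    refine hL (fun u => w u = κ) ?_ a.node a.node_mem u hu rfl
    intro v i hv hvi hP
    have := hw v i
    rw [jump, if_neg fun h => h.not_mem hvi,
      if_neg fun h => h.not_mem (by rwa [add_dir_back])] at this
    rw [← hP]
    omega
  have wcomp : ∀ z, z ∉ A → ∀ v ∈ component ((A : Set Node)ᶜ) z, w v = w z := by
    intro z hz v hv
    refine hv (fun v => w v = w z) ?_ rfl
    intro v i hv hvi hP
    have := hw v i
    rw [jump, if_neg fun h => hv h.mem, if_neg fun h => hvi h.mem] at this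
    rw [← hP]
    omega
  have wC : ∀ z ∈ a.face, w z = κ - 1 := by
    intro z hz
    rw [wcomp _ a.first_not_mem z hz]
    have := hw a.node (a.predDir + 1)
    rw [jump, if_pos a.faces_first, if_neg fun h => a.first_not_mem h.mem] at this
    omega
  have hiff : ∀ u i, a.Faces u i ↔ u ∈ A ∧ u + dir i ∈ a.face := by
    intro u i
    refine ⟨fun h => ⟨h.mem, h.mem_face⟩, fun ⟨hu, hv⟩ => ?_⟩
    have := hw u i
    rw [wA u hu, wC _ hv, jump] at this
    by_contra hc
    rw [if_neg hc] at this
    split_ifs at this <;> omega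
  -- A component other than the face touches `A` along an edge that the boundary does not cross.
  have wO : ∀ z ∉ a.face, w z = κ := by
    intro z hz
    by_cases hzA : z ∈ A
    · exact wA z hzA
    · obtain ⟨u, hu, i, hi⟩ := exists_adjacent_component hne hzA
      have h1 := wcomp z hzA _ hi
      have h2 := hw u i
      have h3 : u + dir i ∉ a.face := by
        refine (hi (fun y => y ∉ a.face) ?_ hz)
        intro y j hy hyj h h'
        exact h ((component_step_iff hy hyj).1 h')
      rw [jump, if_neg fun h => h3 h.mem_face,
        if_neg fun h => component_subset (S := (A : Set Node)ᶜ) hzA hi h.mem, wA u hu] at h2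
      omega
  refine ⟨hiff, ?_⟩
  -- The potential is `κ - 1` on the face and `κ` elsewhere. One of these values is nonzero, and it
  -- is attained finitely often only.
  by_cases hκ0 : κ = 0
  · left
    refine hfin.subset fun z hz => ?_
    show w z ≠ 0
    rw [wC z hz]; omega
  · right
    refine hfin.subset fun z hz => ?_
    show w z ≠ 0
    rw [wO z hz]; exact hκ0

end Agent

/-! ### The total turn of a boundary -/

namespace Agent

/-- If the two agents differed, the occupied direction before one run would lie inside the other
run. -/
theorem run_unique {b b' : Agent A} {m m' : ℕ} (hn : b.node = b'.node) (hm : m < b.span)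
    (hm' : m' < b'.span) (h : b.predDir + m = b'.predDir + m') : b = b' ∧ m = m' := by
  have key : ∀ {b b' : Agent A} {m m' : ℕ}, b.node = b'.node → m' < b'.span →
      b.predDir + m = b'.predDir + m' → m ≤ m' → b = b' ∧ m = m' := by
    intro b b' m m' hn hm' h hle
    have e : b.predDir = b'.predDir + ((m' - m : ℕ) : ZMod 6) := by
      rw [Nat.cast_sub hle, ← add_sub_assoc, ← h, add_sub_cancel_right]
    have hmm : m = m' := by
      by_contra hc
      have := b'.run_not_mem (m := m' - m) (by omega) (by omega)
      rw [← e, ← hn] at this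
      exact this b.pred_mem
    refine ⟨ext_node hn ?_, hmm⟩
    rw [e, hmm, Nat.sub_self, Nat.cast_zero, add_zero]
  rcases le_total m m' with hle | hle
  · exact key hn hm' h hle
  · obtain ⟨h1, h2⟩ := key hn.symm hm h.symm hle
    exact ⟨h1.symm, h2.symm⟩

/-- The corners of triangles between a node and two nodes of an empty run of the boundary. -/
noncomputable def runCorners (a : Agent A) : Finset (Node × ZMod 6) :=
  (a.boundary.sigma fun b => Finset.Ico 1 (b.span - 1)).image fun p =>
    (p.1.node, p.1.predDir + p.2)

/-- The corners of triangles between the nodes of an agent and its predecessor, and the first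
node of the empty run. -/
noncomputable def agentCorners (a : Agent A) : Finset (Node × ZMod 6) :=
  a.boundary.image fun b => (b.node, b.predDir)

/-- A run of `span - 1` empty nodes has `span - 2` pairs of consecutive nodes. One corner per agent,
towards its predecessor, is subtracted, and `turn` is the difference. -/
theorem totalTurn_eq_corners (a : Agent A) :
    a.totalTurn = a.runCorners.card - a.agentCorners.card := by
  have h1 : a.runCorners.card = ∑ b ∈ a.boundary, (b.span - 2) := by
    rw [runCorners, Finset.card_image_of_injOn, Finset.card_sigma]
    · refine sum_congr rfl fun b _ => ?_
      rw [Nat.card_Ico]; omega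
    · rintro ⟨b, m⟩ hb ⟨b', m'⟩ hb' h
      simp only [Finset.coe_sigma, Set.mem_sigma_iff, Finset.mem_coe, mem_Ico] at hb hb'
      simp only [Prod.mk.injEq] at h
      obtain ⟨rfl, rfl⟩ := run_unique h.1 (by omega) (by omega) h.2
      rfl
  have h2 : a.agentCorners.card = ∑ b ∈ a.boundary, 1 := by
    rw [agentCorners, Finset.card_image_of_injOn, Finset.card_eq_sum_ones]
    intro b _ b' _ h
    simp only [Prod.mk.injEq] at h
    exact ext_node h.1 h.2
  rw [h1, h2, totalTurn_eq_sum]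
  push_cast
  rw [← Finset.sum_sub_distrib]
  refine sum_congr rfl fun b _ => ?_
  rw [turn, Nat.cast_sub b.two_le_span]
  push_cast
  ring

variable {a : Agent A}

theorem not_mem_of_mem_face {u : Node} (h : u ∈ a.face) : u ∉ A := a.face_subset h

/-- A neighbour of the face of an agent is occupied or belongs to the face. -/
theorem mem_of_adjacent_face {u : Node} {i : ZMod 6} (h : u + dir i ∈ a.face) (hu : u ∉ a.face) :
    u ∈ A := by
  by_contra hc
  exact hu ((component_step_iff hc (not_mem_of_mem_face h)).1 h)

/-- A description by the face alone, without `A`: this makes the corners comparable with those of a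
finite set in `card_corners`. -/
theorem mem_runCorners (hL : Linked (A : Set Node)) {u : Node} {i : ZMod 6} :
    (u, i) ∈ a.runCorners ↔ u ∉ a.face ∧ u + dir i ∈ a.face ∧ u + dir (i + 1) ∈ a.face := by
  obtain ⟨hf, -⟩ := faces_iff_and_finite hL a
  simp only [runCorners, mem_image, Finset.mem_sigma, mem_boundary, mem_Ico,
    Prod.mk.injEq, Sigma.exists]
  constructor
  · rintro ⟨b, m, ⟨hb, h1, h2⟩, rfl, rfl⟩
    refine ⟨fun h => not_mem_of_mem_face h b.node_mem, ?_, ?_⟩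
    · exact ((hf _ _).1 ⟨b, hb, rfl, m, h1, by omega, rfl⟩).2
    · exact ((hf _ _).1 ⟨b, hb, rfl, m + 1, by omega, by omega, by push_cast; ring⟩).2
  · rintro ⟨h0, h1, h2⟩
    obtain ⟨b, hb, rfl, m, hm1, hm2, rfl⟩ := (hf u i).2 ⟨mem_of_adjacent_face h1 h0, h1⟩
    refine ⟨b, m, ⟨hb, hm1, ?_⟩, rfl, rfl⟩
    by_contra hc
    apply not_mem_of_mem_face h2
    have : b.predDir + m + 1 = b.succDir := by
      rw [succDir_eq, show b.span = m + 1 by omega]; push_cast; ring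
    rw [this]
    exact b.succ_mem

theorem mem_agentCorners (hL : Linked (A : Set Node)) {u : Node} {i : ZMod 6} :
    (u, i) ∈ a.agentCorners ↔ u ∉ a.face ∧ u + dir i ∉ a.face ∧ u + dir (i + 1) ∈ a.face := by
  obtain ⟨hf, -⟩ := faces_iff_and_finite hL a
  simp only [agentCorners, mem_image, mem_boundary, Prod.mk.injEq]
  constructor
  · rintro ⟨b, hb, rfl, rfl⟩
    refine ⟨fun h => not_mem_of_mem_face h b.node_mem,
      fun h => not_mem_of_mem_face h b.pred_mem, ?_⟩
    exact ((hf _ _).1 ⟨b, hb, rfl, 1, le_rfl, b.two_le_span, by simp⟩).2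
  · rintro ⟨h0, h1, h2⟩
    obtain ⟨b, hb, rfl, m, hm1, hm2, hm⟩ := (hf u (i + 1)).2 ⟨mem_of_adjacent_face h2 h0, h2⟩
    have hi : i = b.predDir + ((m - 1 : ℕ) : ZMod 6) := by
      rw [Nat.cast_sub hm1, Nat.cast_one, ← add_sub_assoc, ← hm, add_sub_cancel_right]
    have hA : b.node + dir i ∈ A := by
      refine mem_of_adjacent_face (a := a) (i := i + 2) ?_ h1
      rwa [add_dir_add_dir]
    have hm' : m = 1 := by
      by_contra hc
      rw [hi] at hA
      exact b.run_not_mem (m := m - 1) (by omega) (by omega) hA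
    refine ⟨b, hb, rfl, ?_⟩
    rw [hi, hm', Nat.sub_self, Nat.cast_zero, add_zero]

/-- The complement of the face is `A` with all other components filled in. It is finite, connected
and has a connected complement, and the two kinds of corners are its outer and inner corners. -/
theorem totalTurn_of_finite_compl (hL : Linked (A : Set Node)) (h : a.faceᶜ.Finite) :
    a.totalTurn = 6 := by
  set D := h.toFinset with hD
  have hm : ∀ u, u ∈ D ↔ u ∉ a.face := fun u => by simp [hD]
  have hcoe : (D : Set Node) = a.faceᶜ := h.coe_toFinset
  have hne : A.Nonempty := ⟨_, a.node_mem⟩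
  have := card_corners (D := D) ⟨a.node, (hm _).2 fun h => not_mem_of_mem_face h a.node_mem⟩
    (by rw [hcoe]; exact linked_compl_component hne hL a.first_not_mem)
    (by rw [hcoe, compl_compl]; exact linked_component _ _)
  rw [totalTurn_eq_corners, ← this]
  have h1 : a.runCorners = outerCorners D := by
    ext ⟨u, i⟩
    rw [mem_runCorners hL]
    simp [outerCorners, hm]
  have h2 : a.agentCorners = innerCorners D := by
    ext ⟨u, i⟩
    rw [mem_agentCorners hL]
    simp [innerCorners, hm]
  rw [h1, h2]

/-- Here the face is the finite set. The same triangles are seen from the other side, so the two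
kinds of corners exchange their roles and the sign changes. -/
theorem totalTurn_of_finite (hL : Linked (A : Set Node)) (h : a.face.Finite) :
    a.totalTurn = -6 := by
  set D := h.toFinset with hD
  have hm : ∀ u, u ∈ D ↔ u ∈ a.face := fun u => by simp [hD]
  have hcoe : (D : Set Node) = a.face := h.coe_toFinset
  have hne : A.Nonempty := ⟨_, a.node_mem⟩
  have := card_corners (D := D) ⟨_, (hm _).2 (self_mem_component _ _)⟩
    (by rw [hcoe]; exact linked_component _ _)
    (by rw [hcoe]; exact linked_compl_component hne hL a.first_not_mem)
  have c31 : (3 : ZMod 6) + 1 = 4 := by decide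
  have c41 : (4 : ZMod 6) + 1 = 5 := by decide
  have h1 : a.runCorners.card = (innerCorners D).card := by
    -- The next corner of the same triangle: `(u + dir i, i + 2)` follows `(u, i)` by
    -- `add_dir_add_dir`.
    refine card_bij (fun p _ => (p.1 + dir p.2, p.2 + 2)) ?_ ?_ ?_
    · rintro ⟨u, i⟩ hu
      rw [mem_runCorners hL] at hu
      simp only [innerCorners, mem_filter, mem_product, mem_univ, and_true,
        hm, add_dir_add_dir]
      rw [add_assoc i, show (2 : ZMod 6) + 1 = 3 by decide, add_dir_back]
      exact ⟨hu.2.1, hu.2.2, hu.1⟩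
    · rintro ⟨u, i⟩ _ ⟨u', i'⟩ _ h
      simp only [Prod.mk.injEq] at h
      have hi := add_right_cancel h.2
      subst hi
      rw [add_right_cancel h.1]
    · rintro ⟨v, j⟩ hv
      simp only [innerCorners, mem_filter, mem_product, mem_univ, and_true,
        hm] at hv
      have e4 := add_dir_four v j
      have e5 := add_dir_five v j
      refine ⟨(v + dir (j + 1), j + 4), ?_, ?_⟩
      · rw [mem_runCorners hL, e4, add_assoc j, c41, e5]
        exact ⟨hv.2.2, hv.1, hv.2.1⟩
      · rw [e4, add_assoc j, show (4 : ZMod 6) + 2 = 0 by decide, add_zero]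
  have h2 : a.agentCorners.card = (outerCorners D).card := by
    refine card_bij (fun p _ => (p.1 + dir (p.2 + 1), p.2 + 4)) ?_ ?_ ?_
    · rintro ⟨u, i⟩ hu
      rw [mem_agentCorners hL] at hu
      simp only [outerCorners, mem_filter, mem_product, mem_univ, and_true,
        hm, add_dir_four]
      rw [add_assoc i, c41, add_dir_five]
      exact ⟨hu.2.2, hu.1, hu.2.1⟩
    · rintro ⟨u, i⟩ _ ⟨u', i'⟩ _ h
      simp only [Prod.mk.injEq] at h
      have hi := add_right_cancel h.2
      subst hi
      rw [add_right_cancel h.1]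
    · rintro ⟨v, j⟩ hv
      simp only [outerCorners, mem_filter, mem_product, mem_univ, and_true,
        hm] at hv
      refine ⟨(v + dir j, j + 2), ?_, ?_⟩
      · rw [mem_agentCorners hL, add_dir_add_dir, add_assoc j, show (2 : ZMod 6) + 1 = 3 by decide,
          add_dir_back]
        exact ⟨hv.2.1, hv.2.2, hv.1⟩
      · rw [add_assoc j, show (2 : ZMod 6) + 1 = 3 by decide, add_dir_back, add_assoc j,
          show (2 : ZMod 6) + 4 = 0 by decide, add_zero]
  rw [totalTurn_eq_corners, h1, h2]
  omega

end Agent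

/-! ### The outer boundary -/

open Agent

theorem exists_adjacent (hL : Linked (A : Set Node)) (h2 : 2 ≤ A.card) {u : Node} (hu : u ∈ A) :
    ∃ i, u + dir i ∈ A := by
  by_contra hc
  push Not at hc
  have : ∀ v ∈ A, v = u := fun v hv =>
    hL (fun v => v = u) (fun x i _ hx h => absurd hx (by rw [h]; exact hc i)) u hu v hv rfl
  have := Finset.card_le_one.2 fun x hx y hy => (this x hx).trans (this y hy).symm
  omega

/-- The predecessor direction is the first occupied one met counterclockwise from `i`. It exists
because no node is isolated. -/
theorem exists_agent (hL : Linked (A : Set Node)) (h2 : 2 ≤ A.card) {u : Node} (hu : u ∈ A)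
    {i : ZMod 6} (hi : u + dir i ∉ A) : ∃ a : Agent A, a.node = u ∧ a.Faces u i := by
  obtain ⟨j, hj⟩ := exists_adjacent hL h2 hu
  have hex : ∃ m : ℕ, u + dir (i - m) ∈ A :=
    ⟨(i - j).val, by rwa [ZMod.natCast_zmod_val, sub_sub_cancel]⟩
  have hs := Nat.find_spec hex
  set m := Nat.find hex with hm
  have hm0 : m ≠ 0 := by
    intro h
    rw [h, Nat.cast_zero, sub_zero] at hs
    exact hi hs
  have hrun : ∀ k : ℕ, 1 ≤ k → k ≤ m → u + dir (i - m + k) ∉ A := by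
    intro k h1 h2
    have := Nat.find_min hex (m := m - k) (by omega)
    rw [Nat.cast_sub h2] at this
    rwa [show i - m + k = i - (m - k) by ring]
  set a : Agent A := ⟨(⟨u, hu⟩, i - m), hs, by simpa using hrun 1 le_rfl (by omega)⟩
  refine ⟨a, rfl, a, .refl a, rfl, m, by omega, ?_, ?_⟩
  · by_contra hc
    refine hrun a.span (by have := a.two_le_span; omega) (by omega) a.succ_mem
  · exact (sub_add_cancel i (m : ZMod 6)).symm

/-- The outer boundary: it turns once, and all other boundaries turn once in the other
direction. -/
theorem exists_outer_boundary (hA : (triGrid.induce (A : Set Node)).Connected)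
    (h2 : 2 ≤ A.card) :
    ∃ a : Agent A, a.totalTurn = 6 ∧ (∀ b, ¬ SameBoundary a b → b.totalTurn = -6) ∧
      A.card ≤ a.period ^ 2 := by
  have hL := linked_of_connected hA
  have hne : A.Nonempty := Finset.card_pos.1 (by omega)
  -- the last node of a line belongs to an agent that faces an infinite component
  have last : ∀ (i : ZMod 6) (f g : Node → ℤ), (∀ u, f (u + dir i) = f u + 1) →
      (∀ u, g (u + dir i) = g u) →
      ∀ y ∈ A.image g, ∃ a : Agent A, g a.node = y ∧ a.face.Infinite := by
    intro i f g hf hg y hy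
    obtain ⟨v, hv, rfl⟩ := mem_image.1 hy
    obtain ⟨u, hu, hmax⟩ := (A.filter fun u => g u = g v).exists_max_image f
      ⟨v, by simpa using hv⟩
    rw [mem_filter] at hu
    have hval : ∀ n : ℕ, f (u + (n + 1) • dir i) = f u + n + 1 ∧
        g (u + (n + 1) • dir i) = g u := by
      intro n
      induction n with
      | zero => simp [hf, hg]
      | succ n ih => rw [succ_nsmul, ← add_assoc, hf, hg, ih.1]; exact ⟨by push_cast; ring, ih.2⟩
    have hray : ∀ n : ℕ, u + (n + 1) • dir i ∉ A := fun n hmem => by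
      have := hmax _ (mem_filter.2 ⟨hmem, (hval n).2.trans hu.2⟩)
      rw [(hval n).1] at this
      omega
    obtain ⟨a, ha, hfa⟩ := exists_agent hL h2 hu.1 (i := i) (by simpa using hray 0)
    refine ⟨a, by rw [ha, hu.2],
      Set.infinite_of_injective_forall_mem (f := fun n : ℕ => u + (n + 1) • dir i) ?_ fun n => ?_⟩
    · intro n m h
      have := congrArg f h
      simp only [hval] at this
      omega
    · induction n with
      | zero => simpa using hfa.mem_face
      | succ n ih =>
        have := component_step (i := i) ih (hray n)
          (by rw [add_assoc, ← succ_nsmul]; exact hray (n + 1))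
        rwa [add_assoc, ← succ_nsmul] at this
  have row := last 0 Prod.fst Prod.snd (fun u => by simp [dir_zero]) fun u => by simp [dir_zero]
  have col := last 5 Prod.snd Prod.fst (fun u => by simp [dir_five]) fun u => by simp [dir_five]
  have hdich : ∀ b : Agent A, b.face.Infinite → b.faceᶜ.Finite := fun b hb =>
    (faces_iff_and_finite hL b).2.resolve_left hb
  have huniq : ∀ a b : Agent A, a.face.Infinite → b.face.Infinite → SameBoundary a b := by
    intro a b ha hb
    -- Both faces are infinite with finite complements, so they meet and are the same component.
    have hz : (a.face ∩ b.face).Nonempty := by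
      by_contra hc
      rw [Set.not_nonempty_iff_eq_empty] at hc
      apply hb
      refine (hdich a ha).subset fun z hz hz' => ?_
      have : z ∈ a.face ∩ b.face := ⟨hz', hz⟩
      rw [hc] at this
      exact this
    obtain ⟨z, hz1, hz2⟩ := hz
    have hfirst : b.node + dir (b.predDir + 1) ∈ a.face := by
      have := hz2 (fun v => v ∈ a.face ↔ b.node + dir (b.predDir + 1) ∈ a.face)
        (fun u i hu hui h => (component_step_iff hu hui).trans h) Iff.rfl
      exact this.1 hz1
    obtain ⟨b', hb', hn, m, h1, h2, h3⟩ :=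
      ((faces_iff_and_finite hL a).1 _ _).2 ⟨b.node_mem, hfirst⟩
    obtain ⟨rfl, -⟩ := run_unique (b := b) (m := 1) hn.symm b.two_le_span h2 (by simpa using h3)
    exact hb'
  obtain ⟨v, hv⟩ := hne
  obtain ⟨a, -, ha⟩ := row v.2 (mem_image_of_mem _ hv)
  refine ⟨a, totalTurn_of_finite_compl hL (hdich a ha), fun b hb => ?_, ?_⟩
  · by_cases hbf : b.face.Finite
    · exact totalTurn_of_finite hL hbf
    · exact absurd (huniq a b ha hbf) hb
  -- Every occupied row and column contains the node of an agent of the outer boundary, so there are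
  -- at most `a.period` of each.
  · have hr : A.image Prod.snd ⊆ a.boundary.image fun b => b.node.2 := by
      intro y hy
      obtain ⟨b, hb, hinf⟩ := row y hy
      exact Finset.mem_image.2 ⟨b, mem_boundary.2 (huniq a b ha hinf), hb⟩
    have hc : A.image Prod.fst ⊆ a.boundary.image fun b => b.node.1 := by
      intro y hy
      obtain ⟨b, hb, hinf⟩ := col y hy
      exact Finset.mem_image.2 ⟨b, mem_boundary.2 (huniq a b ha hinf), hb⟩
    have h1 := (Finset.card_le_card hr).trans Finset.card_image_le
    have h2 := (Finset.card_le_card hc).trans Finset.card_image_le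
    rw [card_boundary] at h1 h2
    have h3 : A ⊆ (A.image Prod.fst) ×ˢ (A.image Prod.snd) := fun u hu =>
      Finset.mem_product.2 ⟨mem_image_of_mem _ hu, mem_image_of_mem _ hu⟩
    have h4 := Finset.card_le_card h3
    rw [Finset.card_product] at h4
    calc A.card ≤ _ := h4
      _ ≤ a.period * a.period := Nat.mul_le_mul h2 h1
      _ = a.period ^ 2 := (sq _).symm

variable {r : ℕ} {lab : Labelling A} {tape : Tape A r} {sched : Schedule A}

/-! ### Atomic steps -/

/-- The memories of all agents. -/
abbrev Mem (A : Finset Node) (r : ℕ) : Type := Agent A → AgentState r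

/-- One agent wakes up or executes one rule. -/
inductive Step (lab : Labelling A) (tape : Tape A r) : Mem A r → Mem A r → Prop
  | wake (m : Mem A r) (a : Agent A) : (m a).awake = false →
      Step lab tape m (update m a (wake (view lab tape a) (m a)))
  | rule (m : Mem A r) (a : Agent A) (R : Rule r) : R ∈ rules r → (m a).awake = true →
      Step lab tape m (applyRule lab tape a m R)

def Reach (lab : Labelling A) (tape : Tape A r) : Mem A r → Mem A r → Prop :=
  Relation.ReflTransGen (Step lab tape)

/-- The memories that can occur in an execution. -/
def Reachable (lab : Labelling A) (tape : Tape A r) (m : Mem A r) : Prop :=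
  Reach lab tape (fun _ => .blank r) m

theorem mem_rules_iff {R : Rule r} : R ∈ rules r ↔ R = setupRule ∨ R = createRule ∨
    R = forwardRule ∨ R = activationRule ∨ (∃ ax sg, R = vectorRule ax sg) ∨
    (∃ ax, R = returnRule ax) ∨ R = angleRule ∨ R = candidateRule := by
  simp only [rules, List.mem_cons, List.not_mem_nil, or_false]
  constructor
  · rintro (h | h | h | h | h | h | h | h | h | h | h | h) <;> subst h <;>
      first
      | exact .inr (.inr (.inr (.inr (.inl ⟨_, _, rfl⟩))))
      | simp
  · rintro (h | h | h | h | ⟨ax, sg, h⟩ | ⟨ax, h⟩ | h | h) <;> subst h <;> try simp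
    · cases ax <;> cases sg <;> simp
    · cases ax <;> simp

theorem applyRule_self (a : Agent A) (m : Mem A r) (R : Rule r) :
    applyRule lab tape a m R a = (R (view lab tape a) (m a.pred) (m a) (m a.succ)).self := by
  simp only [applyRule]
  rw [update_of_ne a.succ_ne.symm, update_of_ne a.pred_ne.symm,
    update_self]

/-- The two effects are composed since the predecessor and the successor are the same agent on a
boundary of two agents. -/
theorem applyRule_of_ne {a z : Agent A} (h : z ≠ a) (m : Mem A r) (R : Rule r) :
    applyRule lab tape a m R z =
      (if z = a.succ then (R (view lab tape a) (m a.pred) (m a) (m a.succ)).succ else id)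
        ((if z = a.pred then (R (view lab tape a) (m a.pred) (m a) (m a.succ)).pred else id)
          (m z)) := by
  simp only [applyRule]
  by_cases h1 : z = a.succ
  · subst h1
    rw [update_self, if_pos rfl]
    congr 1
    by_cases h2 : a.succ = a.pred
    · rw [if_pos h2, h2, update_self, update_of_ne a.pred_ne]
    · rw [if_neg h2, update_of_ne h2, update_of_ne h, id]
  · rw [update_of_ne h1, if_neg h1, id]
    by_cases h2 : z = a.pred
    · subst h2
      rw [update_self, if_pos rfl, update_of_ne h]
    · rw [update_of_ne h2, if_neg h2, update_of_ne h, id]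

theorem applyRule_congr {β : Type*} (f : AgentState r → β) {a : Agent A} {m : Mem A r} {R : Rule r}
    (h : f (R (view lab tape a) (m a.pred) (m a) (m a.succ)).self = f (m a))
    (hp : ∀ s, f ((R (view lab tape a) (m a.pred) (m a) (m a.succ)).pred s) = f s)
    (hs : ∀ s, f ((R (view lab tape a) (m a.pred) (m a) (m a.succ)).succ s) = f s)
    (z : Agent A) : f (applyRule lab tape a m R z) = f (m z) := by
  by_cases hz : z = a
  · rw [hz, applyRule_self, h]
  · rw [applyRule_of_ne hz]
    split_ifs <;> simp [hp, hs]

/-! ### The parts of the memory that the rules change -/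

/-- The part of the memory that serves the identifier setup. -/
def AgentState.setupPart (s : AgentState r) :=
  (s.digit, s.rdigit, s.setup, s.setupDone)

/-- The part of the memory that serves the identifier comparison. -/
def AgentState.comparePart (s : AgentState r) :=
  (s.created, s.queue, s.active, s.cmp, s.beaten)

/-- The part of the memory that serves the solitude verification. -/
def AgentState.solitudePart (s : AgentState r) :=
  (s.act, s.vec, s.ret, s.report)

/-- The part of the memory that serves the boundary identification. -/
def AgentState.boundaryPart (s : AgentState r) :=
  (s.angle, s.total)

def AgentState.candidatePart (s : AgentState r) :=
  (s.cand, s.phase)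

/-- The part of the memory that is fixed at the first activation. -/
def AgentState.fixedPart (s : AgentState r) :=
  (s.awake, s.head, s.aid)

theorem receive_spec (t : DigitToken r) (s : AgentState r) :
    (receive t s).fixedPart = s.fixedPart ∧ (receive t s).setupPart = s.setupPart ∧
    (receive t s).solitudePart = s.solitudePart ∧ (receive t s).boundaryPart = s.boundaryPart ∧
    (receive t s).cand = s.cand ∧ (receive t s).created = s.created ∧
    ((receive t s).phase = s.phase ∨
      s.cand = true ∧ s.phase = .idle ∧ (receive t s).phase = .requested) := by
  unfold receive judge
  refine ⟨?_, ?_, ?_, ?_, ?_, ?_, ?_⟩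
  all_goals
    dsimp only
    split_ifs <;> (try split) <;>
      simp_all [AgentState.fixedPart, AgentState.setupPart, AgentState.solitudePart,
        AgentState.boundaryPart]

/-- A rule does not change some part of the memories. -/
def Preserves {β : Type*} (f : AgentState r → β) (R : Rule r) : Prop :=
  ∀ v p s q, f (R v p s q).self = f s ∧ (∀ x, f ((R v p s q).pred x) = f x) ∧
    ∀ x, f ((R v p s q).succ x) = f x

theorem Preserves.apply {β : Type*} {f : AgentState r → β} {R : Rule r} (h : Preserves f R)
    {lab : Labelling A} {tape : Tape A r} (a : Agent A) (m : Mem A r) (z : Agent A) :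
    f (applyRule lab tape a m R z) = f (m z) :=
  applyRule_congr f (h _ _ _ _).1 (h _ _ _ _).2.1 (h _ _ _ _).2.2 z

open AgentState

theorem setupRule_preserves : Preserves (r := r)
    (fun s => (fixedPart s, comparePart s, solitudePart s, boundaryPart s, candidatePart s))
    setupRule := by
  intro v p s q
  unfold setupRule
  refine ⟨?_, ?_, ?_⟩ <;> repeat' split
  all_goals simp [fixedPart, comparePart, solitudePart, boundaryPart, candidatePart]

theorem createRule_preserves : Preserves (r := r)
    (fun s => (fixedPart s, setupPart s, solitudePart s, boundaryPart s, candidatePart s))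
    createRule := by
  intro v p s q
  unfold createRule
  refine ⟨?_, ?_, ?_⟩ <;> repeat' split
  all_goals simp [fixedPart, setupPart, solitudePart, boundaryPart, candidatePart]

theorem forwardRule_preserves : Preserves (r := r)
    (fun s => (fixedPart s, setupPart s, solitudePart s, boundaryPart s, s.cand, s.created))
    forwardRule := by
  intro v p s q
  unfold forwardRule
  refine ⟨?_, fun x => ?_, fun x => ?_⟩ <;> repeat' split
  all_goals first
    | rfl
    | simp [receive_spec]

theorem activationRule_preserves : Preserves (r := r)
    (fun s => (fixedPart s, setupPart s, comparePart s, boundaryPart s, candidatePart s, s.report))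
    activationRule := by
  intro v p s q
  unfold activationRule
  refine ⟨?_, ?_, ?_⟩ <;> repeat' split
  all_goals try dsimp only
  all_goals simp [fixedPart, setupPart, comparePart, boundaryPart, candidatePart]

theorem vectorRule_preserves (ax : Axis) (sg : Bool) : Preserves (r := r)
    (fun s => (fixedPart s, setupPart s, comparePart s, boundaryPart s, candidatePart s, s.act,
      s.ret, s.report))
    (vectorRule ax sg) := by
  intro v p s q
  unfold vectorRule
  refine ⟨?_, ?_, ?_⟩ <;> repeat' split
  all_goals simp [fixedPart, setupPart, comparePart, boundaryPart, candidatePart, setVec]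

theorem returnRule_preserves (ax : Axis) : Preserves (r := r)
    (fun s => (fixedPart s, setupPart s, comparePart s, boundaryPart s, candidatePart s, s.act))
    (returnRule ax) := by
  intro v p s q
  unfold returnRule
  refine ⟨?_, ?_, ?_⟩ <;> repeat' split
  all_goals (try dsimp only); (repeat' split)
  all_goals simp [fixedPart, setupPart, comparePart, boundaryPart, candidatePart, setVec, setRet]

theorem angleRule_preserves : Preserves (r := r)
    (fun s => (fixedPart s, setupPart s, comparePart s, solitudePart s, candidatePart s))
    angleRule := by
  intro v p s q
  unfold angleRule
  refine ⟨?_, ?_, ?_⟩ <;> repeat' split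
  all_goals try dsimp only
  all_goals simp [fixedPart, setupPart, comparePart, solitudePart, candidatePart]

theorem candidateRule_preserves : Preserves (r := r)
    (fun s => (fixedPart s, setupPart s, comparePart s, s.vec, s.ret))
    candidateRule := by
  intro v p s q
  unfold candidateRule
  refine ⟨?_, ?_, ?_⟩ <;> repeat' split
  all_goals try dsimp only
  all_goals simp [fixedPart, setupPart, comparePart, withdraw]

theorem rule_fixedPart {R : Rule r} (hR : R ∈ rules r) (a : Agent A) (m : Mem A r) (z : Agent A) :
    (applyRule lab tape a m R z).fixedPart = (m z).fixedPart := by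
  rcases mem_rules_iff.1 hR with h | h | h | h | ⟨ax, sg, h⟩ | ⟨ax, h⟩ | h | h <;> subst h
  · exact congrArg (·.1) (setupRule_preserves.apply a m z)
  · exact congrArg (·.1) (createRule_preserves.apply a m z)
  · exact congrArg (·.1) (forwardRule_preserves.apply a m z)
  · exact congrArg (·.1) (activationRule_preserves.apply a m z)
  · exact congrArg (·.1) ((vectorRule_preserves ax sg).apply a m z)
  · exact congrArg (·.1) ((returnRule_preserves ax).apply a m z)
  · exact congrArg (·.1) (angleRule_preserves.apply a m z)
  · exact congrArg (·.1) (candidateRule_preserves.apply a m z)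

theorem rule_awake {R : Rule r} (hR : R ∈ rules r) (a : Agent A) (m : Mem A r) (z : Agent A) :
    (applyRule lab tape a m R z).awake = (m z).awake :=
  congrArg (·.1) (rule_fixedPart hR a m z)

theorem rule_head {R : Rule r} (hR : R ∈ rules r) (a : Agent A) (m : Mem A r) (z : Agent A) :
    (applyRule lab tape a m R z).head = (m z).head :=
  congrArg (·.2.1) (rule_fixedPart hR a m z)

theorem rule_aid {R : Rule r} (hR : R ∈ rules r) (a : Agent A) (m : Mem A r) (z : Agent A) :
    (applyRule lab tape a m R z).aid = (m z).aid :=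
  congrArg (·.2.2) (rule_fixedPart hR a m z)

theorem Step.awake {m m' : Mem A r} (h : Step lab tape m m') {z : Agent A}
    (hz : (m z).awake = true) : (m' z).awake = true := by
  cases h with
  | wake a ha =>
    by_cases hza : z = a
    · subst hza; rw [update_self]; rfl
    · rwa [update_of_ne hza]
  | rule a R hR _ => rwa [rule_awake hR]

theorem Reach.awake {m m' : Mem A r} (h : Reach lab tape m m') {z : Agent A}
    (hz : (m z).awake = true) : (m' z).awake = true := by
  induction h with
  | refl => exact hz
  | tail _ h ih => exact h.awake ih

/-- The candidate rule changes only its own agent. -/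
theorem candidateRule_of_ne {a z : Agent A} (h : z ≠ a) (m : Mem A r) :
    applyRule lab tape a m candidateRule z = m z := by
  rw [applyRule_of_ne h]
  have h1 : ∀ v p s q, (candidateRule (r := r) v p s q).pred = id ∧
      (candidateRule (r := r) v p s q).succ = id := by
    intro v p s q
    unfold candidateRule
    constructor <;> repeat' split
    all_goals dsimp only
  rw [(h1 _ _ _ _).1, (h1 _ _ _ _).2]
  simp

theorem forwardRule_phase (a : Agent A) (m : Mem A r) (z : Agent A) :
    (applyRule lab tape a m forwardRule z).phase = (m z).phase ∨
      (m z).cand = true ∧ (m z).phase = .idle ∧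
        (applyRule lab tape a m forwardRule z).phase = .requested := by
  by_cases hz : z = a
  · left
    rw [hz, applyRule_self]
    unfold forwardRule
    repeat' split
    all_goals rfl
  · rw [applyRule_of_ne hz]
    unfold forwardRule
    repeat' split
    all_goals try exact .inl rfl
    all_goals exact (receive_spec _ _).2.2.2.2.2.2

/-- An arriving digit token can turn an idle candidate into a requesting one. Apart from this, only
the candidate rule of the agent itself changes its candidacy or phase. The later arguments about
phases rest on these three cases. -/
theorem rule_candidatePart {R : Rule r} (hR : R ∈ rules r) (a : Agent A) (m : Mem A r)
    (z : Agent A) : (applyRule lab tape a m R z).candidatePart = (m z).candidatePart ∨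
      (R = forwardRule ∧ (m z).cand = true ∧ (m z).phase = .idle ∧
        (applyRule lab tape a m R z).cand = true ∧
        (applyRule lab tape a m R z).phase = .requested) ∨
      (R = candidateRule ∧ z = a) := by
  rcases mem_rules_iff.1 hR with h | h | h | h | ⟨ax, sg, h⟩ | ⟨ax, h⟩ | h | h <;> subst h
  · exact .inl (congrArg (·.2.2.2.2) (setupRule_preserves.apply a m z))
  · exact .inl (congrArg (·.2.2.2.2) (createRule_preserves.apply a m z))
  · have h1 : (applyRule lab tape a m forwardRule z).cand = (m z).cand :=
      congrArg (·.2.2.2.2.1) (forwardRule_preserves.apply a m z)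
    rcases forwardRule_phase (lab := lab) (tape := tape) a m z with h | ⟨h2, h3, h4⟩
    · exact .inl (Prod.ext h1 h)
    · exact .inr (.inl ⟨rfl, h2, h3, h1.trans h2, h4⟩)
  · exact .inl (congrArg (·.2.2.2.2.1) (activationRule_preserves.apply a m z))
  · exact .inl (congrArg (·.2.2.2.2.1) ((vectorRule_preserves ax sg).apply a m z))
  · exact .inl (congrArg (·.2.2.2.2.1) ((returnRule_preserves ax).apply a m z))
  · exact .inl (congrArg (·.2.2.2.2) (angleRule_preserves.apply a m z))
  · by_cases hz : z = a
    · exact .inr (.inr ⟨rfl, hz⟩)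
    · exact .inl (by rw [candidateRule_of_ne hz])

theorem candidateRule_self_spec (v : LocalView r) (p s q : AgentState r) :
    ((candidateRule v p s q).self.cand = true → s.cand = true) ∧
    (s.cand = true → (candidateRule v p s q).self.cand = false →
      (candidateRule v p s q).self.phase = .idle) ∧
    (s.cand = false → (candidateRule v p s q).self = s) ∧
    (s.phase = .won → (candidateRule v p s q).self = s) := by
  unfold candidateRule
  refine ⟨?_, ?_, ?_, ?_⟩ <;> repeat' split
  all_goals try dsimp only
  all_goals simp_all [withdraw]

/-- The basic facts about coin flips, agent identifiers and candidates. -/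
structure Basic (lab : Labelling A) (tape : Tape A r) (m : Mem A r) : Prop where
  head_eq : ∀ x, (m x).awake = true → (m x).head = (tape x).1
  aid_eq : ∀ x, (m x).awake = true → (m x).aid = lab.aid x
  coin_of_cand : ∀ x, (m x).cand = true → (tape x).1 = true
  awake_of_cand : ∀ x, (m x).cand = true → (m x).awake = true
  head_of_asleep : ∀ x, (m x).awake = false → (m x).head = false
  phase_of_not_cand : ∀ x, (m x).cand = false → (m x).phase = .idle

theorem Basic.step {m m' : Mem A r} (hm : Basic lab tape m) (h : Step lab tape m m') :
    Basic lab tape m' := by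
  cases h with
  | wake a ha =>
    have hc : (m a).cand = false := by
      by_contra hc
      rw [hm.awake_of_cand a (by simpa using hc)] at ha
      cases ha
    constructor <;> intro x <;> by_cases hx : x = a
    · subst hx; simp [wake, view]
    · rw [update_of_ne hx]; exact hm.head_eq x
    · subst hx; simp [wake, view]
    · rw [update_of_ne hx]; exact hm.aid_eq x
    · subst hx; simp [wake, view]
    · rw [update_of_ne hx]; exact hm.coin_of_cand x
    · subst hx; simp [wake]
    · rw [update_of_ne hx]; exact hm.awake_of_cand x
    · subst hx; simp [wake]
    · rw [update_of_ne hx]; exact hm.head_of_asleep x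
    · subst hx; intro _; simpa [wake] using hm.phase_of_not_cand x hc
    · rw [update_of_ne hx]; exact hm.phase_of_not_cand x
  | rule a R hR ha =>
    have hcand : ∀ x, (applyRule lab tape a m R x).cand = true → (m x).cand = true := by
      intro x hx
      rcases rule_candidatePart (lab := lab) (tape := tape) hR a m x with h | h | ⟨h, h'⟩
      · have h1 : (applyRule lab tape a m R x).cand = (m x).cand := congrArg (·.1) h
        rwa [← h1]
      · exact h.2.1
      · subst h h'
        rw [applyRule_self] at hx
        exact (candidateRule_self_spec _ _ _ _).1 hx
    constructor <;> intro x
    · rw [rule_awake hR, rule_head hR]; exact hm.head_eq x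
    · rw [rule_awake hR, rule_aid hR]; exact hm.aid_eq x
    · exact fun h => hm.coin_of_cand x (hcand x h)
    · rw [rule_awake hR]; exact fun h => hm.awake_of_cand x (hcand x h)
    · rw [rule_awake hR, rule_head hR]; exact hm.head_of_asleep x
    · intro hx
      rcases rule_candidatePart (lab := lab) (tape := tape) hR a m x with h | h | ⟨h, h'⟩
      · have h1 : (applyRule lab tape a m R x).cand = (m x).cand := congrArg (·.1) h
        have h2 : (applyRule lab tape a m R x).phase = (m x).phase := congrArg (·.2) h
        rw [h2]
        exact hm.phase_of_not_cand x (h1 ▸ hx)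
      · rw [h.2.2.2.1] at hx; cases hx
      · subst h h'
        rw [applyRule_self] at hx ⊢
        cases hc : (m x).cand
        · rw [(candidateRule_self_spec _ _ _ _).2.2.1 hc]
          exact hm.phase_of_not_cand x hc
        · exact (candidateRule_self_spec _ _ _ _).2.1 hc hx

theorem Reachable.basic {m : Mem A r} (h : Reachable lab tape m) : Basic lab tape m := by
  induction h with
  | refl => constructor <;> intro x <;> simp [blank]
  | tail _ h ih => exact ih.step h

theorem Step.won {m m' : Mem A r} (h : Step lab tape m m') {z : Agent A}
    (hz : (m z).phase = .won) : (m' z).phase = .won := by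
  cases h with
  | wake a ha =>
    by_cases hza : z = a
    · subst hza; rw [update_self]; exact hz
    · rwa [update_of_ne hza]
  | rule a R hR _ =>
    rcases rule_candidatePart (lab := lab) (tape := tape) hR a m z with h | h | ⟨h, h'⟩
    · rw [← hz]; exact congrArg (·.2) h
    · rw [hz] at h; exact absurd h.2.2.1 (by simp)
    · subst h h'
      rwa [applyRule_self, (candidateRule_self_spec _ _ _ _).2.2.2 hz]

theorem Reach.won {m m' : Mem A r} (h : Reach lab tape m m') {z : Agent A}
    (hz : (m z).phase = .won) : (m' z).phase = .won := by
  induction h with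
  | refl => exact hz
  | tail _ h ih => exact h.won ih

/-- Only the agent itself wins. -/
theorem rule_won {R : Rule r} (hR : R ∈ rules r) {a : Agent A} {m : Mem A r} {z : Agent A}
    (hza : z ≠ a) (hz : (applyRule lab tape a m R z).phase = .won) : (m z).phase = .won := by
  rcases rule_candidatePart (lab := lab) (tape := tape) hR a m z with h | h | ⟨_, h'⟩
  · rw [← hz]; exact (congrArg (·.2) h).symm
  · rw [hz] at h; exact absurd h.2.2.2.2 (by simp)
  · exact absurd h' hza

/-! ### Executions as sequences of steps -/

theorem reach_foldl_rules {L : List (Rule r)} (hL : ∀ R ∈ L, R ∈ rules r) (a : Agent A)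
    (m : Mem A r) (ha : (m a).awake = true) :
    Reach lab tape m (L.foldl (applyRule lab tape a) m) := by
  induction L generalizing m with
  | nil => exact .refl
  | cons R L ih =>
    have hR := hL R (by simp)
    refine Relation.ReflTransGen.head (Step.rule m a R hR ha) ?_
    exact ih (fun R h => hL R (by simp [h])) _ (by rwa [rule_awake hR])

theorem foldl_rules_won {L : List (Rule r)} (hL : ∀ R ∈ L, R ∈ rules r) {a z : Agent A}
    (hza : z ≠ a) (m : Mem A r)
    (hz : ((L.foldl (applyRule lab tape a) m) z).phase = .won) : (m z).phase = .won := by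
  induction L generalizing m with
  | nil => exact hz
  | cons R L ih =>
    exact rule_won (hL R (by simp)) hza (ih (fun R h => hL R (by simp [h])) _ hz)

theorem reach_activateAgent (C : Config A r) (a : Agent A) :
    Reach lab tape C.mem (activateAgent lab tape C a).mem := by
  unfold activateAgent
  split_ifs with h1 h2
  · exact .refl
  · exact reach_foldl_rules (fun _ h => h) a _ h2
  · exact .single (Step.wake _ a (by simpa using h2))

theorem reach_foldl_agents (L : List (Agent A)) (C : Config A r) :
    Reach lab tape C.mem (L.foldl (activateAgent lab tape) C).mem := by
  induction L generalizing C with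
  | nil => exact .refl
  | cons a L ih => exact (reach_activateAgent C a).trans (ih _)

theorem reach_activate (C : Config A r) (p : A) (L : List (Agent A)) :
    Reach lab tape C.mem (activate lab tape C p L).mem := by
  unfold activate
  split_ifs
  · exact .refl
  · exact reach_foldl_agents L C

theorem reach_run {sched : Schedule A} {t t' : ℕ} (h : t ≤ t') :
    Reach lab tape (run lab tape sched t).mem (run lab tape sched t').mem := by
  induction t', h using Nat.le_induction with
  | base => exact .refl
  | succ n _ ih => exact ih.trans (reach_activate _ _ _)

theorem reachable_run (sched : Schedule A) (t : ℕ) :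
    Reachable lab tape (run lab tape sched t).mem :=
  reach_run (Nat.zero_le t)

theorem leader_activateAgent_mono {C : Config A r} {a : Agent A} {p : A}
    (h : C.leader p = true) : (activateAgent lab tape C a).leader p = true := by
  unfold activateAgent
  dsimp only
  split_ifs
  · exact h
  · dsimp only
    by_cases hp : p = a.particle
    · subst hp; rw [update_self]
    · rwa [update_of_ne hp]
  · exact h
  · exact h

theorem leader_foldl_mono {L : List (Agent A)} {C : Config A r} {p : A}
    (h : C.leader p = true) : (L.foldl (activateAgent lab tape) C).leader p = true := by
  induction L generalizing C with
  | nil => exact h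
  | cons a L ih => exact ih (leader_activateAgent_mono h)

theorem leader_run_mono {sched : Schedule A} {t t' : ℕ} (h : t ≤ t') {p : A}
    (hp : (run lab tape sched t).leader p = true) : (run lab tape sched t').leader p = true := by
  induction t', h using Nat.le_induction with
  | base => exact hp
  | succ n _ ih =>
    show (activate lab tape _ _ _).leader p = true
    unfold activate
    split_ifs
    · dsimp only
      by_cases hpp : p = sched.particle n
      · subst hpp; rw [update_self]
      · rwa [update_of_ne hpp]
    · exact leader_foldl_mono ih

/-- The leaders are exactly the particles with a winning agent. -/
def LeadersWin (C : Config A r) : Prop :=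
  ∀ p, C.leader p = true ↔ ∃ a : Agent A, a.particle = p ∧ (C.mem a).phase = .won

/-- The leader bit is set in the same activation in which the agent wins, and only the activated
agent can win. -/
theorem LeadersWin.activateAgent {C : Config A r} (h : LeadersWin C) (a : Agent A) :
    LeadersWin (activateAgent lab tape C a) := by
  intro p
  constructor
  · intro hp
    by_cases hC : C.leader p = true
    · obtain ⟨b, hb, hw⟩ := (h p).1 hC
      exact ⟨b, hb, (reach_activateAgent C a).won hw⟩
    · unfold Amoebot.activateAgent at hp ⊢
      dsimp only at hp ⊢
      split_ifs at hp ⊢ with h1 h2 h3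
      · exact absurd hp hC
      · dsimp only at hp
        have hpa : p = a.particle := by
          by_contra hne
          rw [update_of_ne hne] at hp
          exact hC hp
        exact ⟨a, hpa.symm, h3⟩
      · exact absurd hp hC
      · exact absurd hp hC
  · rintro ⟨b, rfl, hb⟩
    by_cases hC : C.leader b.particle = true
    · exact leader_activateAgent_mono hC
    · have hnw : (C.mem b).phase ≠ .won := fun hw => hC ((h _).2 ⟨b, rfl, hw⟩)
      unfold Amoebot.activateAgent at hb ⊢
      dsimp only at hb ⊢
      split_ifs at hb ⊢ with h1 h2 h3
      · exact absurd hb hnw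
      · dsimp only
        by_cases hba : b = a
        · subst hba; rw [update_self]
        · exact absurd (foldl_rules_won (fun _ h => h) hba _ hb) hnw
      · by_cases hba : b = a
        · subst hba; exact absurd hb h3
        · exact absurd (foldl_rules_won (fun _ h => h) hba _ hb) hnw
      · dsimp only at hb
        by_cases hba : b = a
        · subst hba
          rw [update_self] at hb
          exact absurd hb hnw
        · rw [update_of_ne hba] at hb
          exact absurd hb hnw

/-- Every particle has a neighbour. -/
abbrev NoneIsolated (A : Finset Node) : Prop := ∀ p : A, ∃ i, (p : Node) + dir i ∈ A

theorem leadersWin_run (hA : NoneIsolated A) (sched : Schedule A) (t : ℕ) :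
    LeadersWin (run lab tape sched t) := by
  induction t with
  | zero =>
    intro p
    constructor
    · intro h; exact absurd h (by simp [run, Config.blank])
    · rintro ⟨a, _, h⟩; exact absurd h (by simp [run, Config.blank, blank])
  | succ t ih =>
    have hfold : ∀ (L : List (Agent A)) (C : Config A r), LeadersWin C →
        LeadersWin (L.foldl (activateAgent lab tape) C) := by
      intro L
      induction L with
      | nil => exact fun _ h => h
      | cons a L ihL => exact fun C h => ihL _ (h.activateAgent a)
    show LeadersWin (activate lab tape _ _ _)
    unfold activate
    split_ifs with h
    · obtain ⟨i, hi⟩ := hA (sched.particle t)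
      exact absurd hi (h i)
    · exact hfold _ _ ih

/-! ### Progress -/

/-- The execution can still be continued to one that follows the schedule. -/
def Fair (lab : Labelling A) (tape : Tape A r) (sched : Schedule A) (m : Mem A r) : Prop :=
  ∃ t, Reach lab tape m (run lab tape sched t).mem

/-- No particle ever declares itself the leader. -/
abbrev NoLeader (lab : Labelling A) (tape : Tape A r) (sched : Schedule A) : Prop :=
  ∀ t p, (run lab tape sched t).leader p = false

/-- `C` is the configuration within the activation of the particle, right before the turn of the
agent `a`. Leader bits are never cleared, so `NoLeader` ensures that this turn is not skipped. -/
theorem exists_activation (hA : NoneIsolated A) (hno : NoLeader lab tape sched) (a : Agent A) (t : ℕ) :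
    ∃ (t' : ℕ) (C : Config A r), t ≤ t' ∧ Reach lab tape (run lab tape sched t).mem C.mem ∧
      C.leader a.particle = false ∧
      Reach lab tape (activateAgent lab tape C a).mem (run lab tape sched t').mem := by
  obtain ⟨t', ht, hp⟩ := sched.fair a.particle t
  have hrun : run lab tape sched (t' + 1) =
      (sched.order t').foldl (activateAgent lab tape) (run lab tape sched t') := by
    show activate lab tape _ _ _ = _
    unfold activate
    rw [if_neg]
    intro h
    obtain ⟨i, hi⟩ := hA (sched.particle t')
    exact h i hi
  obtain ⟨L₁, L₂, hL⟩ := List.append_of_mem ((sched.mem_order t' a).2 hp.symm)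
  rw [hL, List.foldl_append, List.foldl_cons] at hrun
  set C := L₁.foldl (activateAgent lab tape) (run lab tape sched t')
  refine ⟨t' + 1, C, by omega, (reach_run ht).trans (reach_foldl_agents _ _), ?_, ?_⟩
  · by_contra hc
    have := leader_foldl_mono (lab := lab) (tape := tape) (L := L₂)
      (leader_activateAgent_mono (lab := lab) (tape := tape) (a := a)
        (show C.leader a.particle = true by simpa using hc))
    rw [← hrun, hno] at this
    cases this
  · rw [hrun]
    exact reach_foldl_agents _ _

theorem exists_awake (hA : NoneIsolated A) (hno : NoLeader lab tape sched) {m : Mem A r}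
    (hm : Fair lab tape sched m) (a : Agent A) :
    ∃ m', Reach lab tape m m' ∧ Fair lab tape sched m' ∧ (m' a).awake = true := by
  obtain ⟨t, ht⟩ := hm
  obtain ⟨t', C, _, hC, hl, hC'⟩ := exists_activation hA hno a t
  refine ⟨_, (ht.trans hC).trans (reach_activateAgent C a), ⟨t', hC'⟩, ?_⟩
  by_cases h : (C.mem a).awake = true
  · exact (reach_activateAgent C a).awake h
  · unfold activateAgent
    rw [if_neg (by simp [hl]), if_neg h]
    dsimp only
    rw [update_self]
    rfl

/-- Fairness in the form in which it is used: any chosen rule of an agent that is awake is executed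
after finitely many steps. The other rules of the same activation become part of the steps before
and after. -/
theorem exists_rule (hA : NoneIsolated A) (hno : NoLeader lab tape sched) {m : Mem A r}
    (hm : Fair lab tape sched m) {a : Agent A} (ha : (m a).awake = true) {R : Rule r}
    (hR : R ∈ rules r) :
    ∃ m', Reach lab tape m m' ∧ Fair lab tape sched (applyRule lab tape a m' R) := by
  obtain ⟨t, ht⟩ := hm
  obtain ⟨t', C, _, hC, hl, hC'⟩ := exists_activation hA hno a t
  have h := Reach.awake (ht.trans hC) ha
  obtain ⟨L₁, L₂, hL⟩ := List.append_of_mem hR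
  have hmem : (activateAgent lab tape C a).mem =
      L₂.foldl (applyRule lab tape a)
        (applyRule lab tape a (L₁.foldl (applyRule lab tape a) C.mem) R) := by
    unfold activateAgent
    rw [if_neg (by simp [hl]), if_pos h]
    dsimp only
    rw [hL, List.foldl_append, List.foldl_cons]
  have hL₁ : ∀ R ∈ L₁, R ∈ rules r := fun R h => by rw [hL]; simp [h]
  have hL₂ : ∀ R ∈ L₂, R ∈ rules r := fun R h => by rw [hL]; simp [h]
  have h1 := reach_foldl_rules (lab := lab) (tape := tape) hL₁ a C.mem h
  refine ⟨_, (ht.trans hC).trans h1, t', ?_⟩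
  rw [hmem] at hC'
  refine Relation.ReflTransGen.trans ?_ hC'
  exact reach_foldl_rules hL₂ a _ (by rw [rule_awake hR]; exact h1.awake h)

/-- The execution reaches a goal if every step preserves or decreases a measure until the goal is
reached, and some rule always decreases it. -/
theorem exists_goal (hA : NoneIsolated A) (hno : NoLeader lab tape sched) {ι α : Type*} [Preorder α]
    [WellFoundedLT α] (μ : ι → α)
    (P : ι → Mem A r → Prop) (G : Mem A r → Prop)
    (hstep : ∀ i m m', Reachable lab tape m → P i m → Step lab tape m m' →
      G m' ∨ P i m' ∨ ∃ i', μ i' < μ i ∧ P i' m')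
    (hrule : ∀ i m, Reachable lab tape m → P i m → G m ∨ ∃ a R, R ∈ rules r ∧
      (m a).awake = true ∧ ∀ m, Reachable lab tape m → P i m → (m a).awake = true →
        G (applyRule lab tape a m R) ∨ ∃ i', μ i' < μ i ∧ P i' (applyRule lab tape a m R))
    {i : ι} {m : Mem A r} (hm : Reachable lab tape m) (hf : Fair lab tape sched m) (hP : P i m) :
    ∃ m', Reach lab tape m m' ∧ Fair lab tape sched m' ∧ G m' := by
  induction hn : μ i using WellFoundedLT.induction generalizing i m with
  | ind n ih =>
    subst hn
    rcases hrule i m hm hP with hG | ⟨a, R, hR, ha, hdec⟩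
    · exact ⟨m, .refl, hf, hG⟩
    obtain ⟨m₁, h1, h2⟩ := exists_rule hA hno hf ha hR
    -- Before the chosen rule is executed, each step keeps the index `i`, reaches the goal or lowers
    -- the measure. In the last case the induction hypothesis takes over at the intermediate
    -- memories, from which the execution can still be continued.
    have key : ∀ m₂, Reach lab tape m m₂ → Reach lab tape m₂ m₁ →
        (∃ m', Reach lab tape m m' ∧ Fair lab tape sched m' ∧ G m') ∨ P i m₂ := by
      intro m₂ hr
      induction hr with
      | refl => exact fun _ => .inr hP
      | tail hr hs ihr =>
        rename_i x y
        intro hy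
        rcases ihr (Relation.ReflTransGen.head hs hy) with h | h
        · exact .inl h
        · have hfy : Fair lab tape sched y := by
            obtain ⟨t, ht⟩ := h2
            exact ⟨t, (hy.tail (Step.rule _ a R hR (h1.awake ha))).trans ht⟩
          have hry : Reach lab tape m y := hr.tail hs
          rcases hstep i x y (hm.trans hr) h hs with h | h | ⟨i', hi', h⟩
          · exact .inl ⟨y, hry, hfy, h⟩
          · exact .inr h
          · obtain ⟨m', h1, h2, h3⟩ := ih _ hi' (hm.trans hry) hfy h rfl
            exact .inl ⟨m', hry.trans h1, h2, h3⟩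
    rcases key m₁ h1 .refl with h | h
    · exact h
    · have hs : Reach lab tape m (applyRule lab tape a m₁ R) :=
        h1.tail (Step.rule _ a R hR (h1.awake ha))
      rcases hdec m₁ (hm.trans h1) h (h1.awake ha) with h | ⟨i', hi', h⟩
      · exact ⟨_, hs, h2, h⟩
      · obtain ⟨m', h1, h2, h3⟩ := ih _ hi' (hm.trans hs) h2 h rfl
        exact ⟨m', hs.trans h1, h2, h3⟩

/-! ### Segments -/

section segments

variable (tape)

/-- The coin flip of an agent came up heads: it is the first agent of a segment. -/
def IsHead (x : Agent A) : Prop := (tape x).1 = true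

/-- There is a candidate on the boundary of the agent. -/
def HasHead (x : Agent A) : Prop := ∃ k, IsHead tape (pred^[k] x)

open Classical in
/-- The position of an agent in its segment. -/
noncomputable def index (x : Agent A) : ℕ :=
  if h : HasHead tape x then Nat.find h else 0

/-- The first agent of the segment of an agent. -/
noncomputable def headOf (x : Agent A) : Agent A := pred^[index tape x] x

/-- The implication makes the search succeed for every agent. A sole head of a boundary finds itself
after one round, so its segment is the whole boundary. -/
theorem exists_next_head (x : Agent A) :
    ∃ k, 0 < k ∧ (IsHead tape x → IsHead tape (succ^[k] x)) :=
  ⟨x.period, x.period_pos, by rw [iterate_period]; exact id⟩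

open Classical in
/-- The length of the segment that starts at an agent. -/
noncomputable def segLength (x : Agent A) : ℕ := Nat.find (exists_next_head tape x)

variable {tape} {h x : Agent A}

theorem iterate_succ_pred (k : ℕ) (x : Agent A) : succ^[k] (pred^[k] x) = x :=
  Function.LeftInverse.iterate succ_pred k x

theorem iterate_pred_succ (k : ℕ) (x : Agent A) : pred^[k] (succ^[k] x) = x :=
  Function.LeftInverse.iterate pred_succ k x

theorem segLength_pos (x : Agent A) : 0 < segLength tape x := by
  classical exact (Nat.find_spec (exists_next_head tape x)).1

theorem isHead_segLength (hh : IsHead tape h) : IsHead tape (succ^[segLength tape h] h) := by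
  classical exact (Nat.find_spec (exists_next_head tape h)).2 hh

theorem not_isHead_of_lt {k : ℕ} (h0 : 0 < k) (hk : k < segLength tape h) :
    ¬ IsHead tape (succ^[k] h) := by
  classical
  intro hc
  exact Nat.find_min (exists_next_head tape h) hk ⟨h0, fun _ => hc⟩

theorem segLength_le_period (x : Agent A) : segLength tape x ≤ x.period := by
  classical
  exact Nat.find_min' _ ⟨x.period_pos, by rw [iterate_period]; exact id⟩

theorem isHead_headOf (hx : HasHead tape x) : IsHead tape (headOf tape x) := by
  classical
  rw [headOf, index, dif_pos hx]
  exact Nat.find_spec hx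

theorem iterate_headOf (x : Agent A) : succ^[index tape x] (headOf tape x) = x :=
  iterate_succ_pred _ _

/-- Otherwise the head that ends the segment would precede `x` more closely than `headOf tape x`. -/
theorem index_lt (hx : HasHead tape x) : index tape x < segLength tape (headOf tape x) := by
  classical
  by_contra hc
  push Not at hc
  set l := segLength tape (headOf tape x)
  have h1 := isHead_segLength (isHead_headOf hx)
  have key : ∀ (i : ℕ) (y x : Agent A), l ≤ i → succ^[i] y = x → pred^[i - l] x = succ^[l] y := by
    intro i y x hi h
    obtain ⟨d, rfl⟩ := Nat.exists_eq_add_of_le hi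
    rw [Nat.add_sub_cancel_left, ← h, add_comm, iterate_add_apply, iterate_pred_succ]
  have h2 := key _ _ _ hc (iterate_headOf x)
  rw [← h2] at h1
  have h3 : index tape x = Nat.find hx := by rw [index, dif_pos hx]
  have h4 := segLength_pos (tape := tape) (headOf tape x)
  exact Nat.find_min hx (m := index tape x - l) (by omega) h1

theorem IsHead.hasHead (hh : IsHead tape h) (k : ℕ) : HasHead tape (succ^[k] h) :=
  ⟨k, by rwa [iterate_pred_succ]⟩

theorem index_iterate (hh : IsHead tape h) {k : ℕ} (hk : k < segLength tape h) :
    index tape (succ^[k] h) = k := by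
  classical
  have hx := hh.hasHead k
  rw [index, dif_pos hx]
  refine (Nat.find_eq_iff hx).2 ⟨by rwa [iterate_pred_succ], fun n hn hc => ?_⟩
  rw [← Nat.sub_add_cancel hn.le, add_comm, iterate_add_apply, iterate_pred_succ] at hc
  exact not_isHead_of_lt (by omega) (by omega) hc

theorem headOf_iterate (hh : IsHead tape h) {k : ℕ} (hk : k < segLength tape h) :
    headOf tape (succ^[k] h) = h := by
  rw [headOf, index_iterate hh hk, iterate_pred_succ]

theorem headOf_self (hh : IsHead tape h) : headOf tape h = h :=
  headOf_iterate (k := 0) hh (segLength_pos h)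

theorem index_self (hh : IsHead tape h) : index tape h = 0 :=
  index_iterate (k := 0) hh (segLength_pos h)

theorem HasHead.succ (hx : HasHead tape x) : HasHead tape x.succ := by
  obtain ⟨k, hk⟩ := hx
  exact ⟨k + 1, by rwa [iterate_succ_apply, pred_succ]⟩

theorem HasHead.iterate (hx : HasHead tape x) (k : ℕ) : HasHead tape (Agent.succ^[k] x) := by
  induction k with
  | zero => exact hx
  | succ k ih => rw [iterate_succ_apply']; exact ih.succ

theorem HasHead.of_sameBoundary {y : Agent A} (hx : HasHead tape x) (h : SameBoundary x y) :
    HasHead tape y := by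
  obtain ⟨k, rfl⟩ := h
  exact hx.iterate k

theorem HasHead.pred (hx : HasHead tape x) : HasHead tape x.pred :=
  hx.of_sameBoundary (SameBoundary.refl x).pred_right

theorem isHead_succ_iff (hx : HasHead tape x) :
    IsHead tape x.succ ↔ index tape x + 1 = segLength tape (headOf tape x) := by
  have hs : x.succ = Agent.succ^[index tape x + 1] (headOf tape x) := by
    rw [iterate_succ_apply', iterate_headOf]
  have hlt := index_lt hx
  rw [hs]
  constructor
  · intro h
    by_contra hc
    exact not_isHead_of_lt (by omega) (by omega) h
  · intro h
    rw [h]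
    exact isHead_segLength (isHead_headOf hx)

theorem index_succ_of_not (hx : HasHead tape x) (h : ¬ IsHead tape x.succ) :
    index tape x.succ = index tape x + 1 ∧ headOf tape x.succ = headOf tape x := by
  rw [isHead_succ_iff hx] at h
  have hlt := index_lt hx
  have hs : x.succ = Agent.succ^[index tape x + 1] (headOf tape x) := by
    rw [iterate_succ_apply', iterate_headOf]
  rw [hs]
  exact ⟨index_iterate (isHead_headOf hx) (by omega), headOf_iterate (isHead_headOf hx) (by omega)⟩

theorem iterate_inj_of_lt_segLength {j k : ℕ} (hj : j < segLength tape h)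
    (hk : k < segLength tape h) (e : Agent.succ^[j] h = Agent.succ^[k] h) : j = k :=
  iterate_inj (hj.trans_le (segLength_le_period h)) (hk.trans_le (segLength_le_period h)) e

end segments

/-! ### The identifier setup -/

/-- An abstract machine for the setup of one segment of length `l`. Round `i` serves the positions
`i` and `l - 1 - i`: in `left i j` the token at position `j` carries the digit of `l - 1 - i` to
`i`, and in `right i j` it carries the digit of `i` to `l - 1 - i`. In `gen j` the digits are being
generated, and in `home j` the token is returning. -/
inductive SetupPhase : Type
  | asleep : SetupPhase
  | gen : ℕ → SetupPhase
  | left : ℕ → ℕ → SetupPhase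
  | right : ℕ → ℕ → SetupPhase
  | home : ℕ → SetupPhase
  | done : SetupPhase

namespace SetupPhase

def Valid (l : ℕ) : SetupPhase → Prop
  | asleep => True
  | gen j => j < l
  | left i j => i ≤ j ∧ j + i < l
  | right i j => i < j ∧ j + i < l
  | home j => j < l
  | done => True

/-- The agent at position `k` must be awake. -/
def Awake (l k : ℕ) : SetupPhase → Prop
  | asleep => False
  | gen j => k ≤ j
  | _ => k ≤ l

/-- The agent at position `k` has its digit. -/
def hasDigit (k : ℕ) : SetupPhase → Bool
  | asleep => false
  | gen j => decide (k < j)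
  | _ => true

/-- The agent at position `k` has the digit of the reversed copy. -/
def hasCopy (l k : ℕ) : SetupPhase → Bool
  | asleep => false
  | gen _ => false
  | left i _ => decide (k < i ∨ l ≤ k + i)
  | right i _ => decide (k ≤ i ∨ l ≤ k + i)
  | home _ => true
  | done => true

def tokenAt (d : ℕ → Fin r) (l k : ℕ) : SetupPhase → Option (SetupToken r)
  | asleep => none
  | gen j => if k = j then some .gen else none
  | left i j => if k = j then some (.left (some (d (l - 1 - i)))) else none
  | right i j => if k = j then some (.right (some (d i))) else none
  | home j => if k = j then some .home else none
  | done => none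

def isDone : SetupPhase → Bool
  | done => true
  | _ => false

def digitAt (d : ℕ → Fin r) (k : ℕ) (p : SetupPhase) : Option (Fin r) :=
  if p.hasDigit k then some (d k) else none

def copyAt (d : ℕ → Fin r) (l k : ℕ) (p : SetupPhase) : Option (Fin r) :=
  if p.hasCopy l k then some (d (l - 1 - k)) else none

/-- The memory of the agent at position `k`. -/
def part (d : ℕ → Fin r) (l k : ℕ) (p : SetupPhase) :
    Option (Fin r) × Option (Fin r) × Option (SetupToken r) × Bool :=
  (p.digitAt d k, p.copyAt d l k, p.tokenAt d l k, p.isDone && decide (k = 0))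

/-- The first component decreases from each pass of the token to the next one, the second decreases
along each pass. -/
def measure (l : ℕ) : SetupPhase → ℕ ×ₗ ℕ
  | asleep => toLex (2 * l + 5, 0)
  | gen j => toLex (2 * l + 4, l - j)
  | left i j => toLex (2 * (l - i) + 2, j)
  | right i j => toLex (2 * (l - i) + 1, l - j)
  | home j => toLex (1, j)
  | done => toLex (0, 0)

section

variable {d : ℕ → Fin r} {l i j k : ℕ}

theorem measure_lt_of_fst {p p' : SetupPhase} (h : (ofLex (p'.measure l)).1 < (ofLex (p.measure l)).1) :
    p'.measure l < p.measure l := by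
  rw [Prod.Lex.lt_iff]
  exact .inl h

theorem measure_lt_of_snd {p p' : SetupPhase} (h : (ofLex (p'.measure l)).1 = (ofLex (p.measure l)).1)
    (h' : (ofLex (p'.measure l)).2 < (ofLex (p.measure l)).2) :
    p'.measure l < p.measure l := by
  rw [Prod.Lex.lt_iff]
  exact .inr ⟨h, h'⟩

attribute [local grind] digitAt copyAt tokenAt hasDigit hasCopy isDone

/-- The memory of one agent changes and the token moves to another one. -/
def Move (d : ℕ → Fin r) (l j j' : ℕ) (p p' : SetupPhase) (t : Option (SetupToken r))
    (dig cop : Option (Fin r)) : Prop :=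
  ∀ k < l, p'.part d l k = if k = j then (dig, cop, t, p'.isDone && decide (k = 0)) else
    if k = j' then (p.digitAt d k, p.copyAt d l k, p'.tokenAt d l k, p.isDone && decide (k = 0)) else
      p.part d l k

theorem move_gen_gen (h : j + 1 < l) :
    Move d l j (j + 1) (gen j) (gen (j + 1)) none (some (d j)) (copyAt d l j (gen j)) := by
  intro k hk
  simp only [part, Prod.ext_iff]
  grind

theorem move_gen_left (h : j + 1 = l) :
    Move d l j j (gen j) (left 0 (l - 1)) (some (.left (some (d j)))) (some (d j))
      (copyAt d l j (gen j)) := by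
  intro k hk
  simp only [part, Prod.ext_iff]
  grind

theorem move_left_left (h : j + 1 + i < l) :
    Move d l (j + 1) j (left i (j + 1)) (left i j) none (digitAt d (j + 1) (left i (j + 1)))
      (copyAt d l (j + 1) (left i (j + 1))) := by
  intro k hk
  simp only [part, Prod.ext_iff]
  grind

theorem move_left_right (h : i + 1 + i < l) :
    Move d l i (i + 1) (left i i) (right i (i + 1)) none (digitAt d i (left i i))
      (some (d (l - 1 - i))) := by
  intro k hk
  simp only [part, Prod.ext_iff]
  grind

/-- Odd length: the middle agent is its own mirror image and ends the copying. -/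
theorem move_left_home (h : i + i + 1 = l) :
    Move d l i i (left i i) (home i) (some .home) (digitAt d i (left i i))
      (some (d (l - 1 - i))) := by
  intro k hk
  simp only [part, Prod.ext_iff]
  grind

theorem move_right_right (h : j + i + 1 < l) (hij : i < j) :
    Move d l j (j + 1) (right i j) (right i (j + 1)) none (digitAt d j (right i j))
      (copyAt d l j (right i j)) := by
  intro k hk
  simp only [part, Prod.ext_iff]
  grind

theorem move_right_left (h : j + 1 + i + 1 = l) (hij : i < j) :
    Move d l (j + 1) j (right i (j + 1)) (left (i + 1) j) none
      (digitAt d (j + 1) (right i (j + 1))) (some (d i)) := by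
  intro k hk
  simp only [part, Prod.ext_iff]
  grind

/-- Even length: the copying ends at the right one of the two middle agents. -/
theorem move_right_home (h : i + 1 + i + 1 = l) :
    Move d l (i + 1) (i + 1) (right i (i + 1)) (home (i + 1)) (some .home)
      (digitAt d (i + 1) (right i (i + 1))) (some (d i)) := by
  intro k hk
  simp only [part, Prod.ext_iff]
  grind

theorem move_home_home :
    Move d l (j + 1) j (home (j + 1)) (home j) none (digitAt d (j + 1) (home (j + 1)))
      (copyAt d l (j + 1) (home (j + 1))) := by
  intro k hk
  simp only [part, Prod.ext_iff]
  grind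

theorem move_home_done :
    Move d l 0 0 (home 0) done none (digitAt d 0 (home 0)) (copyAt d l 0 (home 0)) := by
  intro k hk
  simp only [part, Prod.ext_iff]
  grind

end

end SetupPhase

/-- The digits of a segment. -/
def segDigit (tape : Tape A r) (h : Agent A) (k : ℕ) : Fin r := (tape (succ^[k] h)).2

/-- The state of the segment that starts at `h`. -/
structure SegState (tape : Tape A r) (h : Agent A) (p : SetupPhase) (m : Mem A r) : Prop where
  valid : p.Valid (segLength tape h)
  awake : ∀ k, p.Awake (segLength tape h) k → (m (succ^[k] h)).awake = true
  asleep : p = .asleep → (m h).awake = false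
  part : ∀ k < segLength tape h, (m (succ^[k] h)).setupPart =
    p.part (segDigit tape h) (segLength tape h) k

theorem rule_setupPart {R : Rule r} (hR : R ∈ rules r) (hne : R ≠ setupRule) (a : Agent A)
    (m : Mem A r) (z : Agent A) :
    (applyRule lab tape a m R z).setupPart = (m z).setupPart := by
  rcases mem_rules_iff.1 hR with h | h | h | h | ⟨ax, sg, h⟩ | ⟨ax, h⟩ | h | h
  · exact absurd h hne
  all_goals subst h
  · exact congrArg (·.2.1) (createRule_preserves.apply a m z)
  · exact congrArg (·.2.1) (forwardRule_preserves.apply a m z)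
  · exact congrArg (·.2.1) (activationRule_preserves.apply a m z)
  · exact congrArg (·.2.1) ((vectorRule_preserves ax sg).apply a m z)
  · exact congrArg (·.2.1) ((returnRule_preserves ax).apply a m z)
  · exact congrArg (·.2.1) (angleRule_preserves.apply a m z)
  · exact congrArg (·.2.1) (candidateRule_preserves.apply a m z)

theorem SegState.congr {h : Agent A} {p : SetupPhase} {m m' : Mem A r} (hs : SegState tape h p m)
    (hpart : ∀ k < segLength tape h, (m' (succ^[k] h)).setupPart = (m (succ^[k] h)).setupPart)
    (hawake : ∀ z, (m z).awake = true → (m' z).awake = true)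
    (h0 : (m' h).awake = (m h).awake) : SegState tape h p m' where
  valid := hs.valid
  awake k hk := hawake _ (hs.awake k hk)
  asleep hp := h0.trans (hs.asleep hp)
  part k hk := (hpart k hk).trans (hs.part k hk)

/-- How a rule that does not affect the predecessor acts on a segment. -/
theorem seg_update_succ {h : Agent A} {j : ℕ} {m : Mem A r} {R : Rule r}
    {e : Effect r} (hj : j < segLength tape h)
    (he : R (view lab tape (succ^[j] h)) (m (succ^[j] h).pred) (m (succ^[j] h))
      (m (succ^[j] h).succ) = e) (hp : e.pred = id)
    (hs : e.succ = id ∨ j + 1 < segLength tape h) :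
    (∀ k < segLength tape h, applyRule lab tape (succ^[j] h) m R (succ^[k] h) =
      if k = j then e.self else if k = j + 1 then e.succ (m (succ^[k] h)) else m (succ^[k] h)) ∧
    ∀ z, (∀ k < segLength tape h, z ≠ succ^[k] h) →
      applyRule lab tape (succ^[j] h) m R z = m z := by
  constructor
  · intro k hk
    by_cases hkj : k = j
    · rw [if_pos hkj, hkj, applyRule_self, he]
    · rw [if_neg hkj, applyRule_of_ne fun e => hkj (iterate_inj_of_lt_segLength hk hj e), he, hp]
      rcases hs with hs | hs
      · simp [hs]
      · rw [← iterate_succ_apply' succ j]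
        by_cases hkj' : k = j + 1
        · simp [hkj']
        · rw [if_neg hkj', if_neg fun e => hkj' (iterate_inj_of_lt_segLength hk hs e)]
          simp
  · intro z hz
    rw [applyRule_of_ne (hz j hj), he, hp]
    rcases hs with hs | hs
    · simp [hs]
    · rw [← iterate_succ_apply' succ j, if_neg (hz _ hs)]
      simp

/-- How a rule that does not affect the successor acts on a segment. -/
theorem seg_update_pred {h : Agent A} {j : ℕ} {m : Mem A r} {R : Rule r}
    {e : Effect r} (hj : j + 1 < segLength tape h)
    (he : R (view lab tape (succ^[j + 1] h)) (m (succ^[j + 1] h).pred) (m (succ^[j + 1] h))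
      (m (succ^[j + 1] h).succ) = e) (hs : e.succ = id) :
    (∀ k < segLength tape h, applyRule lab tape (succ^[j + 1] h) m R (succ^[k] h) =
      if k = j + 1 then e.self else if k = j then e.pred (m (succ^[k] h)) else m (succ^[k] h)) ∧
    ∀ z, (∀ k < segLength tape h, z ≠ succ^[k] h) →
      applyRule lab tape (succ^[j + 1] h) m R z = m z := by
  have hpred : (succ^[j + 1] h).pred = succ^[j] h := by
    rw [iterate_succ_apply', pred_succ]
  constructor
  · intro k hk
    by_cases hkj : k = j + 1
    · rw [if_pos hkj, hkj, applyRule_self, he]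
    · rw [if_neg hkj, applyRule_of_ne fun e => hkj (iterate_inj_of_lt_segLength hk hj e), he, hs,
        hpred, ite_self, id]
      by_cases hkj' : k = j
      · simp [hkj']
      · rw [if_neg hkj', if_neg fun e => hkj' (iterate_inj_of_lt_segLength hk (by omega) e), id]
  · intro z hz
    rw [applyRule_of_ne (hz _ hj), he, hs, hpred, if_neg (hz j (by omega)), ite_self,
      id, id]

theorem SegState.fields {h : Agent A} {p : SetupPhase} {m : Mem A r} (hs : SegState tape h p m)
    {k : ℕ} (hk : k < segLength tape h) :
    (m (succ^[k] h)).digit = p.digitAt (segDigit tape h) k ∧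
    (m (succ^[k] h)).rdigit = p.copyAt (segDigit tape h) (segLength tape h) k ∧
    (m (succ^[k] h)).setup = p.tokenAt (segDigit tape h) (segLength tape h) k ∧
    (m (succ^[k] h)).setupDone = (p.isDone && decide (k = 0)) := by
  have := hs.part k hk
  simp only [setupPart, SetupPhase.part, Prod.mk.injEq] at this
  exact this

theorem setupRule_of_none {a : Agent A} {m : Mem A r} (h : (m a).setup = none) :
    applyRule lab tape a m setupRule = m := by
  have he : ∀ v p q, setupRule v p (m a) q = { self := m a } := by
    intro v p q
    simp [setupRule, h]
  funext z
  by_cases hz : z = a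
  · rw [hz, applyRule_self, he]
  · rw [applyRule_of_ne hz, he]
    simp

theorem head_iterate {h : Agent A} {m : Mem A r} (hb : Basic lab tape m) (hh : IsHead tape h)
    {k : ℕ} (hk : k ≤ segLength tape h) (hawake : (m (succ^[k] h)).awake = true) :
    (m (succ^[k] h)).head = decide (k = 0 ∨ k = segLength tape h) := by
  rw [hb.head_eq _ hawake]
  by_cases h0 : k = 0
  · subst h0
    rw [decide_eq_true (.inl rfl)]
    exact hh
  · by_cases hl : k = segLength tape h
    · subst hl
      rw [decide_eq_true (.inr rfl)]
      exact isHead_segLength hh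
    · have := not_isHead_of_lt (tape := tape) (h := h) (k := k) (by omega) (by omega)
      simpa [h0, hl, IsHead] using this

/-- One step of the setup in a segment. -/
def SegStep (lab : Labelling A) (tape : Tape A r) (h : Agent A) (p : SetupPhase) (m : Mem A r)
    (j : ℕ) : Prop :=
  (∀ z, (∀ k < segLength tape h, z ≠ succ^[k] h) →
    (applyRule lab tape (succ^[j] h) m setupRule z).setupPart = (m z).setupPart) ∧
  ∃ p', SegState tape h p' (applyRule lab tape (succ^[j] h) m setupRule) ∧
    (p' = p ∧ (m (succ^[j + 1] h)).awake = false ∨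
      p'.measure (segLength tape h) < p.measure (segLength tape h))

-- This transfers an abstract move to the memories. The three cases of `hnb` are that the token
-- stays, goes forward or goes backward.
open SetupPhase in
theorem SegState.of_move {h : Agent A} {p p' : SetupPhase} {m : Mem A r}
    (hs : SegState tape h p m) {j j' : ℕ} (hj : j < segLength tape h)
    {t : Option (SetupToken r)} {dig cop : Option (Fin r)}
    (hm : Move (segDigit tape h) (segLength tape h) j j' p p' t dig cop) {e : Effect r}
    (he : setupRule (view lab tape (succ^[j] h)) (m (succ^[j] h).pred) (m (succ^[j] h))
      (m (succ^[j] h).succ) = e)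
    (hself : e.self.setupPart = (dig, cop, t, p'.isDone && decide (j = 0)))
    (hnb : (j' = j ∧ e.pred = id ∧ e.succ = id) ∨
      (j' = j + 1 ∧ j + 1 < segLength tape h ∧ e.pred = id ∧ e.succ = fun q =>
        { q with setup := p'.tokenAt (segDigit tape h) (segLength tape h) (j + 1) }) ∨
      (j = j' + 1 ∧ e.succ = id ∧ e.pred (m (succ^[j'] h)) = { m (succ^[j'] h) with
        setup := p'.tokenAt (segDigit tape h) (segLength tape h) j' }))
    (haw : ∀ k, p'.Awake (segLength tape h) k → (m (succ^[k] h)).awake = true)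
    (hval : p'.Valid (segLength tape h) := by simp only [Valid] <;> omega)
    (hnas : p' ≠ .asleep := by simp)
    (hmeas : p'.measure (segLength tape h) < p.measure (segLength tape h) := by
      first
        | exact measure_lt_of_fst (by simp only [SetupPhase.measure, ofLex_toLex]; omega)
        | exact measure_lt_of_snd rfl (by simp only [SetupPhase.measure, ofLex_toLex]; omega)) :
    SegStep lab tape h p m j := by
  have hR : setupRule ∈ rules r := mem_rules_iff.2 (.inl rfl)
  have hawake' := fun z => rule_awake (lab := lab) (tape := tape) hR (succ^[j] h) m z
  have key : (∀ k < segLength tape h, (applyRule lab tape (succ^[j] h) m setupRule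
      (succ^[k] h)).setupPart = p'.part (segDigit tape h) (segLength tape h) k) ∧
      ∀ z, (∀ k < segLength tape h, z ≠ succ^[k] h) →
        (applyRule lab tape (succ^[j] h) m setupRule z).setupPart = (m z).setupPart := by
    rcases hnb with ⟨h1, h2, h3⟩ | ⟨h1, h2, h3, h4⟩ | ⟨h1, h2, h3⟩
    · subst h1
      obtain ⟨u1, u2⟩ := seg_update_succ (lab := lab) hj he h2 (.inl h3)
      refine ⟨fun k hk => ?_, fun z hz => by rw [u2 z hz]⟩
      rw [u1 k hk, hm k hk]
      split_ifs with h4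
      · subst h4; exact hself
      · rw [h3]; exact hs.part k hk
      · exact hs.part k hk
    · subst h1
      obtain ⟨u1, u2⟩ := seg_update_succ (lab := lab) hj he h3 (.inr h2)
      refine ⟨fun k hk => ?_, fun z hz => by rw [u2 z hz]⟩
      rw [u1 k hk, hm k hk]
      have hp := hs.part k hk
      split_ifs with h5 h6
      · subst h5; exact hself
      · subst h6; rw [h4]
        exact Prod.ext (congrArg (·.1) hp) (Prod.ext (congrArg (·.2.1) hp)
          (Prod.ext rfl (congrArg (·.2.2.2) hp)))
      · exact hp
    · subst h1
      obtain ⟨u1, u2⟩ := seg_update_pred (lab := lab) hj he h2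
      refine ⟨fun k hk => ?_, fun z hz => by rw [u2 z hz]⟩
      rw [u1 k hk, hm k hk]
      have hp := hs.part k hk
      split_ifs with h5 h6
      · subst h5; exact hself
      · subst h6; rw [h3]
        exact Prod.ext (congrArg (·.1) hp) (Prod.ext (congrArg (·.2.1) hp)
          (Prod.ext rfl (congrArg (·.2.2.2) hp)))
      · exact hp
  exact ⟨key.2, p', ⟨hval, fun k hk => by rw [hawake']; exact haw k hk, fun h => absurd h hnas,
    key.1⟩, .inr hmeas⟩

theorem setupRule_gen_last {v : LocalView r} {p s q : AgentState r} (hs : s.setup = some .gen)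
    (hq : q.awake = true) (hh : q.head = true) : setupRule v p s q = { self :=
      { s with digit := some v.digit, setup := some (.left (some v.digit)) } } := by
  simp [setupRule, hs, hq, hh]

theorem setupRule_gen_next {v : LocalView r} {p s q : AgentState r} (hs : s.setup = some .gen)
    (hq : q.awake = true) (hh : q.head = false) : setupRule v p s q = {
      self := { s with digit := some v.digit, setup := none }
      succ := fun q => { q with setup := some .gen } } := by
  simp [setupRule, hs, hq, hh]

theorem setupRule_left_home {v : LocalView r} {p s q : AgentState r} {d : Option (Fin r)}
    (hs : s.setup = some (.left d)) (hp : s.head || p.rdigit.isSome)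
    (hq : q.head || q.rdigit.isSome) : setupRule v p s q =
      { self := { s with rdigit := d, setup := some .home } } := by
  simp only [setupRule, hs, hp, hq, if_true]

theorem setupRule_left_right {v : LocalView r} {p s q : AgentState r} {d : Option (Fin r)}
    (hs : s.setup = some (.left d)) (hp : s.head || p.rdigit.isSome)
    (hq : (q.head || q.rdigit.isSome) = false) : setupRule v p s q =
      { self := { s with rdigit := d, setup := none }
        succ := fun q => { q with setup := some (.right s.digit) } } := by
  simp only [setupRule, hs, hp, hq, if_true, Bool.false_eq_true, if_false]

theorem setupRule_left_left {v : LocalView r} {p s q : AgentState r} {d : Option (Fin r)}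
    (hs : s.setup = some (.left d)) (hp : (s.head || p.rdigit.isSome) = false) :
    setupRule v p s q =
      { self := { s with setup := none }
        pred := fun p => { p with setup := some (.left d) } } := by
  simp only [setupRule, hs, hp, Bool.false_eq_true, if_false]

theorem setupRule_right_home {v : LocalView r} {p s q : AgentState r} {d : Option (Fin r)}
    (hs : s.setup = some (.right d)) (hp : p.rdigit.isSome)
    (hq : q.head || q.rdigit.isSome) : setupRule v p s q =
      { self := { s with rdigit := d, setup := some .home } } := by
  simp only [setupRule, hs, hp, hq, if_true]

theorem setupRule_right_left {v : LocalView r} {p s q : AgentState r} {d : Option (Fin r)}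
    (hs : s.setup = some (.right d)) (hp : p.rdigit.isSome = false)
    (hq : q.head || q.rdigit.isSome) : setupRule v p s q =
      { self := { s with rdigit := d, setup := none }
        pred := fun p => { p with setup := some (.left p.digit) } } := by
  simp only [setupRule, hs, hp, hq, if_true, Bool.false_eq_true, if_false]

theorem setupRule_right_right {v : LocalView r} {p s q : AgentState r} {d : Option (Fin r)}
    (hs : s.setup = some (.right d)) (hq : (q.head || q.rdigit.isSome) = false) :
    setupRule v p s q =
      { self := { s with setup := none }
        succ := fun q => { q with setup := some (.right d) } } := by
  simp only [setupRule, hs, hq, Bool.false_eq_true, if_false]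

theorem setupRule_home {v : LocalView r} {p s q : AgentState r}
    (hs : s.setup = some .home) : setupRule v p s q =
      if s.head then { self := { s with setup := none, setupDone := true } }
      else { self := { s with setup := none }
             pred := fun p => { p with setup := some .home } } := by
  simp only [setupRule, hs]

open SetupPhase in
theorem SegState.step_token {h : Agent A} {p : SetupPhase} {m : Mem A r}
    (hs : SegState tape h p m) (hb : Basic lab tape m) (hh : IsHead tape h) {j : ℕ}
    (hj : j < segLength tape h)
    (hne : p.tokenAt (segDigit tape h) (segLength tape h) j ≠ none) :
    SegStep lab tape h p m j := by
  have hit : (succ^[j] h).succ = succ^[j + 1] h := (iterate_succ_apply' _ _ _).symm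
  have hv := hs.valid
  obtain ⟨f1, f2, f3, f4⟩ := hs.fields hj
  have hpredit : ∀ i, j = i + 1 → (succ^[j] h).pred = succ^[i] h := by
    rintro i rfl
    rw [iterate_succ_apply', pred_succ]
  have hq := head_iterate hb hh (k := j + 1) (by omega)
  have hqc : j + 1 < segLength tape h → (m (succ^[j + 1] h)).rdigit.isSome =
      p.hasCopy (segLength tape h) (j + 1) := by
    intro hj'
    rw [(hs.fields hj').2.1, copyAt]
    split_ifs with h' <;> simp [h']
  have hpc : ∀ i, j = i + 1 → (m (succ^[j] h).pred).rdigit.isSome =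
      p.hasCopy (segLength tape h) i := by
    intro i hi
    rw [hpredit i hi, (hs.fields (by omega)).2.1, copyAt]
    split_ifs with h' <;> simp [h']
  have hsh := head_iterate hb hh hj.le
  rw [← hit] at hq hqc
  -- The test "the successor is a head or has its copy" asks whether the next position still lacks a
  -- copy, which is a comparison with `l - i`.
  have hqq : ∀ i, (∀ k ≤ segLength tape h, (m (succ^[k] h)).awake = true) →
      (j + 1 < segLength tape h → p.hasCopy (segLength tape h) (j + 1) =
        decide (segLength tape h ≤ j + 1 + i)) →
      ((m (succ^[j] h).succ).head || (m (succ^[j] h).succ).rdigit.isSome) =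
        decide (segLength tape h ≤ j + 1 + i) := by
    intro i haw hcop
    have hqh := hq (by rw [hit]; exact haw _ (by omega))
    rcases Nat.lt_or_ge (j + 1) (segLength tape h) with h' | h'
    · rw [hqh, hqc h', hcop h', decide_eq_false (by omega), Bool.false_or]
    · rw [hqh, decide_eq_true (.inr (by omega)), Bool.true_or, decide_eq_true (by omega)]
  cases p with
  | asleep => exact absurd rfl hne
  | done => exact absurd rfl hne
  | gen j₀ =>
    obtain rfl : j = j₀ := by_contra fun hc => hne (if_neg hc)
    rw [tokenAt, if_pos rfl] at f3
    by_cases hqa : (m (succ^[j] h).succ).awake = false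
    · have he : setupRule (view lab tape (succ^[j] h)) (m (succ^[j] h).pred) (m (succ^[j] h))
          (m (succ^[j] h).succ) = { self := m (succ^[j] h) } := by
        simp [setupRule, f3, hqa]
      have hm' : applyRule lab tape (succ^[j] h) m setupRule = m := by
        funext z
        by_cases hz : z = succ^[j] h
        · rw [hz, applyRule_self, he]
        · rw [applyRule_of_ne hz, he]
          simp
      rw [SegStep, hm', ← hit]
      exact ⟨fun _ _ => rfl, _, hs, .inl ⟨rfl, hqa⟩⟩
    · rw [Bool.not_eq_false] at hqa
      have hqh := hq hqa
      have haw : ∀ k ≤ j + 1, (m (succ^[k] h)).awake = true := by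
        intro k hk
        rcases Nat.lt_or_ge j k with hk' | hk'
        · obtain rfl : k = j + 1 := le_antisymm hk hk'
          rwa [← hit]
        · exact hs.awake k hk'
      by_cases hl : j + 1 = segLength tape h
      · rw [decide_eq_true (.inr hl)] at hqh
        refine hs.of_move hj (move_gen_left hl) (setupRule_gen_last f3 hqa hqh) ?_
          (.inl ⟨rfl, rfl, rfl⟩)
          (fun k hk => haw k ?_)
        · simp [-iterate_succ, setupPart, f2, f4, isDone, view, segDigit]
        · simp only [SetupPhase.Awake] at hk; omega
      · rw [decide_eq_false (by omega)] at hqh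
        refine hs.of_move hj (move_gen_gen (by omega)) (setupRule_gen_next f3 hqa hqh) ?_
          (.inr (.inl ⟨rfl, by omega, rfl, ?_⟩))
          (fun k hk => haw k hk)
        · simp [-iterate_succ, setupPart, f2, f4, isDone, view, segDigit]
        · simp [-iterate_succ, tokenAt]
  | left i j₀ =>
    obtain rfl : j = j₀ := by_contra fun hc => hne (if_neg hc)
    rw [tokenAt, if_pos rfl] at f3
    simp only [Valid] at hv
    have haw : ∀ k ≤ segLength tape h, (m (succ^[k] h)).awake = true := hs.awake
    replace hsh := hsh (haw _ (by omega))
    replace hqq := hqq i haw fun _ => decide_eq_decide.2 (by omega)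
    have hpp : ((m (succ^[j] h)).head || (m (succ^[j] h).pred).rdigit.isSome) =
        decide (j = i) := by
      cases j with
      | zero => rw [hsh, decide_eq_true (.inl rfl), Bool.true_or, decide_eq_true (by omega)]
      | succ j =>
        rw [hsh, hpc j rfl, hasCopy, decide_eq_false (by omega), Bool.false_or]
        exact decide_eq_decide.2 (by omega)
    by_cases hji : j = i
    · subst hji
      rw [decide_eq_true rfl] at hpp
      by_cases hl : segLength tape h ≤ j + 1 + j
      · rw [decide_eq_true hl] at hqq
        refine hs.of_move hj (move_left_home (by omega)) (setupRule_left_home f3 hpp hqq) ?_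
          (.inl ⟨rfl, rfl, rfl⟩)
          (fun k hk => haw k hk)
        · simp [-iterate_succ, setupPart, f1, f4, isDone, segDigit]
      · rw [decide_eq_false hl] at hqq
        refine hs.of_move hj (move_left_right (by omega)) (setupRule_left_right f3 hpp hqq) ?_
          (.inr (.inl ⟨rfl, by omega, rfl, ?_⟩))
          (fun k hk => haw k hk)
        · simp [-iterate_succ, setupPart, f1, f4, isDone, segDigit]
        · simp [-iterate_succ, tokenAt, f1, digitAt, hasDigit, segDigit]
    · rw [decide_eq_false hji] at hpp
      obtain ⟨j, rfl⟩ : ∃ j', j = j' + 1 := ⟨j - 1, by omega⟩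
      refine hs.of_move hj (move_left_left (by omega)) (setupRule_left_left f3 hpp) ?_
          (.inr (.inr ⟨rfl, rfl, ?_⟩))
          (fun k hk => haw k hk)
      · simp [-iterate_succ, setupPart, f1, f2, f4, isDone]
      · simp [-iterate_succ, tokenAt, segDigit]
  | right i j₀ =>
    obtain rfl : j = j₀ := by_contra fun hc => hne (if_neg hc)
    rw [tokenAt, if_pos rfl] at f3
    simp only [Valid] at hv
    have haw : ∀ k ≤ segLength tape h, (m (succ^[k] h)).awake = true := hs.awake
    replace hqq := hqq i haw fun _ => decide_eq_decide.2 (by omega)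
    obtain ⟨j, rfl⟩ : ∃ j', j = j' + 1 := ⟨j - 1, by omega⟩
    have hpp : (m (succ^[j + 1] h).pred).rdigit.isSome = decide (j = i) := by
      rw [hpc j rfl, hasCopy]
      exact decide_eq_decide.2 (by omega)
    by_cases hl : segLength tape h ≤ j + 1 + 1 + i
    · rw [decide_eq_true hl] at hqq
      by_cases hji : j = i
      · subst hji
        rw [decide_eq_true rfl] at hpp
        refine hs.of_move hj (move_right_home (by omega)) (setupRule_right_home f3 hpp hqq) ?_
          (.inl ⟨rfl, rfl, rfl⟩)
          (fun k hk => haw k hk)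
        · simp [-iterate_succ, setupPart, f1, f4, isDone, segDigit]
      · rw [decide_eq_false hji] at hpp
        refine hs.of_move hj (move_right_left (by omega) (by omega))
          (setupRule_right_left f3 hpp hqq) ?_
          (.inr (.inr ⟨rfl, rfl, ?_⟩))
          (fun k hk => haw k hk)
        · simp [-iterate_succ, setupPart, f1, f4, isDone]
        · have hd := (hs.fields (k := j) (by omega)).1.trans (if_pos rfl)
          simp only [tokenAt, if_true, hd]
          rw [show segLength tape h - 1 - (i + 1) = j by omega]
    · rw [decide_eq_false hl] at hqq
      refine hs.of_move hj (move_right_right (by omega) (by omega))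
          (setupRule_right_right f3 hqq) ?_
          (.inr (.inl ⟨rfl, by omega, rfl, ?_⟩))
          (fun k hk => haw k hk)
      · simp [-iterate_succ, setupPart, f1, f2, f4, isDone]
      · simp [-iterate_succ, tokenAt, segDigit]
  | home j₀ =>
    obtain rfl : j = j₀ := by_contra fun hc => hne (if_neg hc)
    rw [tokenAt, if_pos rfl] at f3
    simp only [Valid] at hv
    have haw : ∀ k ≤ segLength tape h, (m (succ^[k] h)).awake = true := hs.awake
    replace hsh := hsh (haw _ (by omega))
    have he := setupRule_home (v := view lab tape (succ^[j] h)) (p := m (succ^[j] h).pred)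
      (q := m (succ^[j] h).succ) f3
    cases j with
    | zero =>
      rw [hsh, if_pos (by simp)] at he
      refine hs.of_move hj move_home_done he ?_ (.inl ⟨rfl, rfl, rfl⟩)
          (fun k hk => haw k hk)
      · simp only [setupPart, f1, f2, isDone]; rfl
    | succ j =>
      rw [hsh, if_neg (by rw [decide_eq_true_eq]; omega)] at he
      refine hs.of_move hj move_home_home he ?_ (.inr (.inr ⟨rfl, rfl, ?_⟩))
          (fun k hk => haw k hk)
      · simp [-iterate_succ, setupPart, f1, f2, f4, isDone]
      · simp [-iterate_succ, tokenAt]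

theorem SetupPhase.awake_of_tokenAt {p : SetupPhase} {d : ℕ → Fin r} {l k : ℕ} (hk : k < l)
    (h : p.tokenAt d l k ≠ none) : p.Awake l k := by
  cases p with
  | asleep => exact h rfl
  | done => exact hk.le
  | gen j =>
    have : k = j := by
      by_contra hc
      exact h (if_neg hc)
    exact this.le
  | left i j => exact hk.le
  | right i j => exact hk.le
  | home j => exact hk.le

theorem eq_iterate_of_hasHead {x : Agent A} (hx : HasHead tape x) :
    ∃ j < segLength tape (headOf tape x), x = succ^[j] (headOf tape x) :=
  ⟨index tape x, index_lt hx, (iterate_headOf x).symm⟩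

/-- Each segment is in some phase of the identifier setup. -/
def SetupInv (tape : Tape A r) (m : Mem A r) : Prop :=
  ∀ h, IsHead tape h → ∃ p, SegState tape h p m

/-- Segments do not interact during the setup: the setup rule changes setup data within its own
segment only, and the other rules change none. Waking up the first agent starts the generation of
digits. -/
theorem SegState.step {m m' : Mem A r} (hi : SetupInv tape m) (hb : Basic lab tape m)
    (hst : Step lab tape m m') {h : Agent A} (hh : IsHead tape h) {p : SetupPhase}
    (hs : SegState tape h p m) :
    ∃ p', SegState tape h p' m' ∧
      (p' = p ∨ p'.measure (segLength tape h) < p.measure (segLength tape h)) := by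
  cases hst with
  | rule a R hR ha =>
    have hunch : (∀ k < segLength tape h, (applyRule lab tape a m R (succ^[k] h)).setupPart =
        (m (succ^[k] h)).setupPart) → ∃ p', SegState tape h p' (applyRule lab tape a m R) ∧
          (p' = p ∨ p'.measure (segLength tape h) < p.measure (segLength tape h)) :=
      fun hk => ⟨p, hs.congr hk (fun z hz => by rwa [rule_awake hR]) (rule_awake hR _ _ _), .inl rfl⟩
    by_cases hRs : R = setupRule
    · subst hRs
      by_cases hset : (m a).setup = none
      · rw [setupRule_of_none hset]
        exact ⟨p, hs, .inl rfl⟩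
      by_cases hx : HasHead tape a
      · obtain ⟨j, hj, hja⟩ := eq_iterate_of_hasHead hx
        have hh' := isHead_headOf hx
        set h' := headOf tape a
        clear_value h'
        subst hja
        obtain ⟨q, hq⟩ := hi h' hh'
        have hstep := fun q (hq : SegState tape h' q m) => hq.step_token hb hh' hj
          (by rwa [← (hq.fields hj).2.2.1])
        by_cases he : h' = h
        · subst he
          obtain ⟨_, p', hp', hp⟩ := hstep p hs
          exact ⟨p', hp', hp.imp (·.1) id⟩
        · refine hunch fun k hk => (hstep q hq).1 _ fun k' hk' hc => he ?_
          rw [← headOf_iterate hh' hk', ← hc, headOf_iterate hh hk]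
      · refine hunch fun k hk => ?_
        have hz : HasHead tape (succ^[k] h) := hh.hasHead k
        rw [applyRule_of_ne, if_neg, if_neg, id, id]
        · rintro hc; rw [hc] at hz
          exact hx (by simpa [succ_pred] using hz.succ)
        · rintro hc; rw [hc] at hz
          exact hx (by simpa [pred_succ] using hz.pred)
        · rintro hc; rw [hc] at hz
          exact hx hz
    · exact hunch fun k _ => rule_setupPart hR hRs a m _
  | wake a ha =>
    by_cases hah : a = h
    · subst hah
      have hp : p = .asleep := by
        cases p with
        | asleep => rfl
        | gen j => exact absurd (hs.awake 0 (Nat.zero_le _)) (by simp [ha])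
        | left i j => exact absurd (hs.awake 0 (Nat.zero_le _)) (by simp [ha])
        | right i j => exact absurd (hs.awake 0 (Nat.zero_le _)) (by simp [ha])
        | home j => exact absurd (hs.awake 0 (Nat.zero_le _)) (by simp [ha])
        | done => exact absurd (hs.awake 0 (Nat.zero_le _)) (by simp [ha])
      subst hp
      refine ⟨.gen 0, ⟨segLength_pos a, ?_, by simp, ?_⟩, .inr (SetupPhase.measure_lt_of_fst ?_)⟩
      · intro k hk
        obtain rfl : k = 0 := Nat.le_zero.1 hk
        show (update m a _ a).awake = true
        rw [update_self]
        rfl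
      · intro k hk
        have hp := hs.part k hk
        by_cases hk0 : k = 0
        · subst hk0
          show (update m a _ a).setupPart = _
          rw [update_self]
          have h1 : (tape a).1 = true := hh
          exact Prod.ext (congrArg (·.1) hp) (Prod.ext (congrArg (·.2.1) hp)
            (Prod.ext (if_pos h1) (congrArg (·.2.2.2) hp)))
        · rw [update_of_ne, hp]
          · simp [SetupPhase.part, SetupPhase.digitAt, SetupPhase.copyAt, SetupPhase.tokenAt,
              SetupPhase.hasDigit, SetupPhase.hasCopy, SetupPhase.isDone, hk0]
          · intro hc
            exact hk0 (iterate_inj_of_lt_segLength (k := 0) hk (segLength_pos a) hc)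
      · simp only [SetupPhase.measure, ofLex_toLex]; omega
    · refine ⟨p, hs.congr ?_ (fun z hz => ?_) ?_, .inl rfl⟩
      · intro k hk
        by_cases hka : succ^[k] h = a
        · rw [← hka] at ha ⊢
          rw [update_self]
          have hcoin : ¬ (tape (succ^[k] h)).1 = true := by
            refine not_isHead_of_lt (Nat.pos_of_ne_zero ?_) hk
            rintro rfl
            exact hah hka.symm
          -- Tokens are held by agents that are awake only, so waking up destroys none.
          have hset : (m (succ^[k] h)).setup = none := by
            by_contra hc
            rw [(hs.fields hk).2.2.1] at hc
            rw [hs.awake k (SetupPhase.awake_of_tokenAt hk hc)] at ha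
            cases ha
          refine Prod.ext rfl (Prod.ext rfl (Prod.ext ?_ rfl))
          simp only [setupPart, hset]
          exact if_neg hcoin
        · rw [update_of_ne hka]
      · exact (Step.wake m a ha).awake hz
      · rw [update_of_ne (Ne.symm hah)]

theorem Reachable.setupInv {m : Mem A r} (h : Reachable lab tape m) : SetupInv tape m := by
  induction h with
  | refl =>
    intro h _
    refine ⟨.asleep, trivial, fun k hk => hk.elim, fun _ => rfl, fun k _ => rfl⟩
  | tail hr h ih =>
    intro x hx
    obtain ⟨p, hp⟩ := ih x hx
    obtain ⟨p', hp', _⟩ := hp.step ih (Reachable.basic hr) h hx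
    exact ⟨p', hp'⟩

theorem SegState.done_step {m m' : Mem A r} (hm : Reachable lab tape m)
    (hst : Step lab tape m m') {h : Agent A} (hh : IsHead tape h)
    (hs : SegState tape h .done m) : SegState tape h .done m' := by
  obtain ⟨p', hp', rfl | hlt⟩ := hs.step hm.setupInv hm.basic hst hh
  · exact hp'
  · exact absurd hlt (by rw [Prod.Lex.lt_iff]; simp [SetupPhase.measure])

theorem done_of_setupDone {m : Mem A r} (hm : Reachable lab tape m) {h : Agent A}
    (hh : IsHead tape h) (hd : (m h).setupDone = true) : SegState tape h .done m := by
  obtain ⟨p, hp⟩ := hm.setupInv h hh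
  have := (hp.fields (k := 0) (segLength_pos h)).2.2.2
  cases p with
  | done => exact hp
  | _ => exact absurd (hd.symm.trans this) (by simp [SetupPhase.isDone])

theorem exists_all_awake (hA : NoneIsolated A) (hno : NoLeader lab tape sched) {m : Mem A r}
    (hf : Fair lab tape sched m) :
    ∃ m', Reach lab tape m m' ∧ Fair lab tape sched m' ∧ ∀ a, (m' a).awake = true := by
  classical
  have : ∀ S : Finset (Agent A), ∃ m', Reach lab tape m m' ∧ Fair lab tape sched m' ∧
      ∀ a ∈ S, (m' a).awake = true := by
    intro S
    induction S using Finset.induction_on with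
    | empty => exact ⟨m, .refl, hf, by simp⟩
    | insert a S _ ih =>
      obtain ⟨m₁, h1, h2, h3⟩ := ih
      obtain ⟨m₂, h4, h5, h6⟩ := exists_awake hA hno h2 a
      refine ⟨m₂, h1.trans h4, h5, fun b hb => ?_⟩
      rcases Finset.mem_insert.1 hb with rfl | hb
      · exact h6
      · exact h4.awake (h3 b hb)
  obtain ⟨m', h1, h2, h3⟩ := this univ
  exact ⟨m', h1, h2, fun a => h3 a (mem_univ a)⟩

/-- Once all agents are awake, an unfinished segment has a token, and the setup rule at its holder
decreases the measure of the phase. -/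
theorem exists_segment_done (hA : NoneIsolated A) (hno : NoLeader lab tape sched) {m : Mem A r}
    (hm : Reachable lab tape m) (hf : Fair lab tape sched m) (hw : ∀ a, (m a).awake = true)
    {h : Agent A} (hh : IsHead tape h) :
    ∃ m', Reach lab tape m m' ∧ Fair lab tape sched m' ∧ SegState tape h .done m' := by
  obtain ⟨p, hp⟩ := hm.setupInv h hh
  refine exists_goal hA hno (fun p : SetupPhase => p.measure (segLength tape h))
    (fun p m => SegState tape h p m ∧ ∀ a, (m a).awake = true) (fun m => SegState tape h .done m)
    ?_ ?_ hm hf ⟨hp, hw⟩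
  · rintro p m m' hm ⟨hp, hw⟩ hst
    obtain ⟨p', hp', rfl | hlt⟩ := hp.step hm.setupInv hm.basic hst hh
    · exact .inr (.inl ⟨hp', fun a => hst.awake (hw a)⟩)
    · exact .inr (.inr ⟨p', hlt, hp', fun a => hst.awake (hw a)⟩)
  · rintro p m hm ⟨hp, hw⟩
    by_cases hd : p = .done
    · exact .inl (hd ▸ hp)
    right
    have htok : ∃ j < segLength tape h,
        p.tokenAt (segDigit tape h) (segLength tape h) j ≠ none := by
      have hv := hp.valid
      cases p with
      | asleep => exact absurd (hw h) (by simp [hp.asleep rfl])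
      | done => exact absurd rfl hd
      | gen j => exact ⟨j, hv, by simp [SetupPhase.tokenAt]⟩
      | left i j => exact ⟨j, by have := hv.2; omega, by simp [SetupPhase.tokenAt]⟩
      | right i j => exact ⟨j, by have := hv.2; omega, by simp [SetupPhase.tokenAt]⟩
      | home j => exact ⟨j, hv, by simp [SetupPhase.tokenAt]⟩
    obtain ⟨j, hj, hne⟩ := htok
    refine ⟨succ^[j] h, setupRule, mem_rules_iff.2 (.inl rfl), hw _, ?_⟩
    rintro m hm ⟨hp, hw⟩ ha
    obtain ⟨_, p', hp', h' | hlt⟩ := hp.step_token hm.basic hh hj hne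
    · rw [hw] at h'; exact absurd h'.2 (by simp)
    · exact .inr ⟨p', hlt, hp', fun a => by
        rw [rule_awake (mem_rules_iff.2 (.inl rfl))]; exact hw a⟩

/-! ### The identifiers -/

section identifiers

variable (tape)

instance : DecidablePred (IsHead tape) := fun x => inferInstanceAs (Decidable ((tape x).1 = true))

/-- The digit of weight `r ^ w` of the identifier of a segment. -/
noncomputable def weightDigit (h : Agent A) (w : ℕ) : Fin r := segDigit tape h (segLength tape h - 1 - w)

/-- The number that the last `n` digits of the identifier of a segment represent. -/
noncomputable def lowNumber (h : Agent A) (n : ℕ) : ℕ := ∑ w ∈ range n, (weightDigit tape h w : ℕ) * r ^ w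

/-- The length and the number of a segment, in lexicographic order. -/
noncomputable def key (h : Agent A) : ℕ ×ₗ ℕ :=
  toLex (segLength tape h, lowNumber tape h (segLength tape h))

/-- The comparison of the last `n` digits of two identifiers. -/
noncomputable def compareLow (g h : Agent A) : ℕ → Ordering
  | 0 => .eq
  | n + 1 => (compare (weightDigit tape g n) (weightDigit tape h n)).then (compareLow g h n)

variable {tape}

theorem lowNumber_lt (h : Agent A) (n : ℕ) : lowNumber tape h n < r ^ n := by
  induction n with
  | zero => simp [lowNumber]
  | succ n ih =>
    rw [lowNumber, sum_range_succ, ← lowNumber, pow_succ]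
    have := (weightDigit tape h n).isLt
    calc _ < r ^ n + (weightDigit tape h n : ℕ) * r ^ n := by omega
      _ = (weightDigit tape h n + 1 : ℕ) * r ^ n := by ring
      _ ≤ r * r ^ n := by gcongr; omega
      _ = _ := mul_comm _ _

/-- In positional notation the lower digits contribute less than one unit of the next weight, so the
most significant differing digit decides. -/
theorem compareLow_eq (g h : Agent A) (n : ℕ) :
    compareLow tape g h n = compare (lowNumber tape g n) (lowNumber tape h n) := by
  induction n with
  | zero => simp [compareLow, lowNumber]
  | succ n ih =>
    have h1 := lowNumber_lt (tape := tape) g n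
    have h2 := lowNumber_lt (tape := tape) h n
    have hsum : ∀ g, lowNumber tape g (n + 1) =
        lowNumber tape g n + (weightDigit tape g n : ℕ) * r ^ n :=
      fun g => sum_range_succ _ _
    rw [compareLow, ih, hsum, hsum]
    have key : ∀ (a b : Fin r) (x y : ℕ), a < b → x < r ^ n → x + a * r ^ n < y + b * r ^ n := by
      intro a b x y hab hx
      have : ((a : ℕ) + 1) * r ^ n ≤ b * r ^ n := Nat.mul_le_mul_right _ hab
      rw [add_mul, one_mul] at this
      omega
    rcases lt_trichotomy (weightDigit tape g n) (weightDigit tape h n) with hl | hl | hl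
    · rw [compare_lt_iff_lt.2 hl, compare_lt_iff_lt.2 (key _ _ _ _ hl h1)]
      rfl
    · rw [hl, compare_eq_iff_eq.2 rfl, Ordering.eq_then, Nat.compare_eq_ite_lt, Nat.compare_eq_ite_lt]
      simp only [Nat.add_lt_add_iff_right]
    · rw [compare_gt_iff_gt.2 hl, compare_gt_iff_gt.2 (key _ _ _ _ hl h2)]
      rfl

theorem weightDigit_eq_of_compareLow {g h : Agent A} {n : ℕ} (hc : compareLow tape g h n = .eq)
    {w : ℕ} (hw : w < n) : weightDigit tape g w = weightDigit tape h w := by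
  induction n with
  | zero => omega
  | succ n ih =>
    rw [compareLow, Ordering.then_eq_eq] at hc
    rcases Nat.lt_succ_iff_lt_or_eq.1 hw with hw | rfl
    · exact ih hc.2 hw
    · exact compare_eq_iff_eq.1 hc.1

theorem compare_key (g h : Agent A) :
    compare (key tape g) (key tape h) = (compare (segLength tape g) (segLength tape h)).then
      (compare (lowNumber tape g (segLength tape g)) (lowNumber tape h (segLength tape h))) := by
  rcases lt_trichotomy (segLength tape g) (segLength tape h) with hl | hl | hl
  · rw [compare_lt_iff_lt.2 hl, compare_lt_iff_lt.2 (Prod.Lex.lt_iff.2 (.inl hl))]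
    rfl
  · rw [hl, compare_eq_iff_eq.2 (rfl : segLength tape h = _), Ordering.eq_then]
    rcases lt_trichotomy (lowNumber tape g (segLength tape h))
      (lowNumber tape h (segLength tape h)) with h' | h' | h'
    · have : key tape g < key tape h := Prod.Lex.lt_iff.2 (.inr ⟨hl, by simpa [key, hl] using h'⟩)
      rw [compare_lt_iff_lt.2 h', compare_lt_iff_lt.2 this]
    · rw [h', compare_eq_iff_eq.2 (rfl : lowNumber tape h _ = _), compare_eq_iff_eq, key, key, hl,
        h']
    · have : key tape h < key tape g :=
        Prod.Lex.lt_iff.2 (.inr ⟨hl.symm, by simpa [key, hl] using h'⟩)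
      rw [compare_gt_iff_gt.2 h', compare_gt_iff_gt.2 this]
  · rw [compare_gt_iff_gt.2 hl, compare_gt_iff_gt.2 (Prod.Lex.lt_iff.2 (.inl hl))]
    rfl

/-- The positional representation is injective. Hence a tie of two segments makes all their digits
agree, and this is what makes ties improbable. -/
theorem digit_eq_of_key_eq {g h : Agent A} (hk : key tape g = key tape h) :
    segLength tape g = segLength tape h ∧ ∀ k < segLength tape g,
      (tape (succ^[k] g)).2 = (tape (succ^[k] h)).2 := by
  have h1 : segLength tape g = segLength tape h := congrArg (fun x => (ofLex x).1) hk
  have h2 : lowNumber tape g _ = lowNumber tape h _ := congrArg (fun x => (ofLex x).2) hk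
  refine ⟨h1, fun k hlt => ?_⟩
  have := weightDigit_eq_of_compareLow (tape := tape) (g := g) (h := h) (n := segLength tape g)
    (by rw [compareLow_eq, compare_eq_iff_eq, h2, h1]) (w := segLength tape g - 1 - k) (by omega)
  rw [weightDigit, weightDigit, ← h1,
    show segLength tape g - 1 - (segLength tape g - 1 - k) = k by omega] at this
  exact this

end identifiers

/-! ### The digit tokens that pass an agent -/

/-- The comparison after an agent with digit `d` has received the token `t`. -/
def nextCmp (d : Fin r) (t : DigitToken r) (st : Bool × Ordering) : Ordering :=
  if st.1 && t.active then compare t.val d else st.2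

/-- The token and the state of an agent with digit `d` that receives the token `t`. -/
def absorb (d : Fin r) (t : DigitToken r) (st : Bool × Ordering) :
    DigitToken r × Bool × Ordering :=
  if t.delim then
    ({ t with active := t.active && !st.1, res := (nextCmp d t st).then t.res }, true, .eq)
  else ({ t with active := t.active && !st.1 }, st.1 && !t.active, nextCmp d t st)

/-- The conclusion from a token. -/
def judgment (d : Fin r) (t : DigitToken r) (st : Bool × Ordering) : Option Ordering :=
  if t.delim && t.active then
    if st.1 then some ((nextCmp d t st).then t.res) else some .gt
  else none

theorem receive_eq {t : DigitToken r} {s : AgentState r} {d : Fin r} (hd : s.digit = some d) :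
    (receive t s).queue = s.queue.push (absorb d t (s.active, s.cmp)).1 ∧
    (receive t s).active = (absorb d t (s.active, s.cmp)).2.1 ∧
    (receive t s).cmp = (absorb d t (s.active, s.cmp)).2.2 ∧
    (receive t s).beaten = (s.beaten ||
      (s.head && decide (judgment d t (s.active, s.cmp) = some .gt))) ∧
    (receive t s).phase = (if s.head = true ∧ judgment d t (s.active, s.cmp) = some .eq ∧
      s.cand = true ∧ s.phase = .idle then .requested else s.phase) := by
  obtain ⟨tv, td, ta, tr⟩ := t
  unfold receive absorb judgment nextCmp judge
  simp only [hd]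
  cases td
  · simp
  · cases ta
    · simp
    · cases hh : s.head
      · simp
      · cases ha : s.active
        · simp
        · simp only [Bool.and_self, if_true]
          refine ⟨?_, ?_, ?_, ?_, ?_⟩ <;> cases hc : (compare tv d).then tr <;> simp <;>
            split_ifs <;> simp_all

/-- A token as it is forwarded by the agent `x`. -/
def activated (tape : Tape A r) (x : Agent A) (t : DigitToken r) : DigitToken r :=
  if (tape x).1 then { t with active := true, res := .eq } else t

theorem activated_of_not {x : Agent A} (h : ¬ IsHead tape x) (t : DigitToken r) :
    activated tape x t = t := if_neg h

/-- The digit token that an agent creates. -/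
noncomputable def ownToken (tape : Tape A r) (x : Agent A) : DigitToken r where
  val := weightDigit tape (headOf tape x) (index tape x)
  delim := (tape x.succ).1
  active := false
  res := .eq

/-- The `k`-th token after its arrival at an agent, and the state of the agent afterwards. -/
noncomputable def trace (tape : Tape A r) : ℕ → Agent A → DigitToken r × Bool × Ordering
  | 0, x => (ownToken tape x, true, .eq)
  | k + 1, x => absorb (tape x).2 (activated tape x.succ (trace tape k x.succ).1) (trace tape k x).2

/-- The conclusion from the `k`-th token. -/
noncomputable def verdict (tape : Tape A r) (k : ℕ) (x : Agent A) : Option Ordering :=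
  judgment (tape x).2 (activated tape x.succ (trace tape k x.succ).1) (trace tape k x).2

theorem digit_eq_weightDigit {x : Agent A} (hx : HasHead tape x) : (tape x).2 =
    weightDigit tape (headOf tape x) (segLength tape (headOf tape x) - 1 - index tape x) := by
  have := index_lt hx
  rw [weightDigit, segDigit, show segLength tape (headOf tape x) - 1 -
    (segLength tape (headOf tape x) - 1 - index tape x) = index tape x by omega, iterate_headOf]

/-- The token of agent `z` on its arrival at agent `x` in another segment. -/
noncomputable def tokenAt (tape : Tape A r) (x z : Agent A) (n : ℕ) : DigitToken r where
  val := weightDigit tape (headOf tape z) (index tape z)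
  delim := (tape z.succ).1
  active := decide (segLength tape (headOf tape x) ≤ n + index tape z)
  res := if (tape z.succ).1 then compareLow tape (headOf tape z) (headOf tape x)
    (min (segLength tape (headOf tape x) - n) (segLength tape (headOf tape z))) else .eq

/-- The state of agent `x` after tokens of a segment `g`. -/
noncomputable def stateAfter (tape : Tape A r) (x g : Agent A) (n : ℕ) : Bool × Ordering :=
  (decide (index tape x + n < segLength tape (headOf tape x)),
    if index tape x + n < segLength tape (headOf tape x) then .eq else
      compare (weightDigit tape g (segLength tape (headOf tape x) - 1 - index tape x)) (tape x).2)

theorem headOf_iterate_of_lt {x : Agent A} (hx : HasHead tape x) {k : ℕ}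
    (hk : k + index tape x < segLength tape (headOf tape x)) :
    index tape (succ^[k] x) = k + index tape x ∧ headOf tape (succ^[k] x) = headOf tape x := by
  have : succ^[k] x = succ^[k + index tape x] (headOf tape x) := by
    rw [iterate_add_apply, iterate_headOf]
  rw [this]
  exact ⟨index_iterate (isHead_headOf hx) hk, headOf_iterate (isHead_headOf hx) hk⟩

/-- The `k`-th token at `x` is the one that `succ^[k] x` created. As long as that agent is reached
within the segment of `x`, the token is inactive and nothing is compared. Afterwards, in a segment
of length `l`, the token with digit weight `r ^ i` is matched at position `l - 1 - i`, by the agent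
whose digit has the same weight. If there is no such position, it stays active throughout the
segment. -/
def TraceSpec (tape : Tape A r) (k : ℕ) (x : Agent A) : Prop :=
  if k + index tape x < segLength tape (headOf tape x) then
    trace tape k x = (ownToken tape (succ^[k] x), true, .eq)
  else (trace tape k x).1 = tokenAt tape x (succ^[k] x) (index tape x) ∧
    (trace tape k x).2 = if (tape (succ^[k + 1] x)).1 then (true, .eq)
      else stateAfter tape x (headOf tape (succ^[k] x)) (index tape (succ^[k] x) + 1)

/-- The arriving token and the state of the agent before, for a token of another segment. -/
theorem trace_before {x : Agent A} (hx : HasHead tape x) {k : ℕ}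
    (ih : ∀ x, HasHead tape x → TraceSpec tape k x)
    (hk : ¬ k + 1 + index tape x < segLength tape (headOf tape x)) :
    activated tape x.succ (trace tape k x.succ).1 =
      tokenAt tape x (succ^[k + 1] x) (index tape x + 1) ∧
    (trace tape k x).2 =
      stateAfter tape x (headOf tape (succ^[k + 1] x)) (index tape (succ^[k + 1] x)) := by
  have hlt := index_lt hx
  constructor
  · have hs := ih _ hx.succ
    rw [TraceSpec, ← iterate_succ_apply succ k] at hs
    by_cases hh : IsHead tape x.succ
    · have hl := (isHead_succ_iff hx).1 hh
      have hact : ∀ t : DigitToken r, activated tape x.succ t =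
          { t with active := true, res := .eq } := fun t => if_pos hh
      have hz : tokenAt tape x (succ^[k + 1] x) (index tape x + 1) =
          { ownToken tape (succ^[k + 1] x) with active := true, res := .eq } := by
        rw [tokenAt, ownToken, decide_eq_true (by omega), hl, Nat.sub_self, Nat.zero_min]
        rw [compareLow, ite_self]
      rw [hact, hz]
      by_cases h1 : k + index tape x.succ < segLength tape (headOf tape x.succ)
      · rw [if_pos h1] at hs
        rw [hs]
      · rw [if_neg h1] at hs
        rw [hs.1, tokenAt, ownToken]
    · obtain ⟨h1, h2⟩ := index_succ_of_not hx hh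
      rw [h1, h2, if_neg (by omega)] at hs
      rw [activated_of_not hh, hs.1, tokenAt, tokenAt, h2]
  · have hs := ih _ hx
    rw [TraceSpec] at hs
    by_cases hh : IsHead tape (succ^[k + 1] x)
    · rw [stateAfter, index_self hh, add_zero, if_pos hlt, decide_eq_true hlt]
      split_ifs at hs with h1 h2
      · rw [hs]
      · exact hs.2
      · exact absurd hh h2
    · have hne : ¬ k + index tape x < segLength tape (headOf tape x) := by
        intro h1
        obtain ⟨h2, h3⟩ := headOf_iterate_of_lt hx h1
        rw [iterate_succ_apply', isHead_succ_iff (hx.iterate k), h2, h3] at hh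
        omega
      rw [if_neg hne, if_neg (show ¬ (tape (succ^[k + 1] x)).1 = true from hh)] at hs
      rw [hs.2]
      rw [iterate_succ_apply'] at hh ⊢
      obtain ⟨h1, h2⟩ := index_succ_of_not (hx.iterate k) hh
      rw [h1, h2]

/-- The queues are first-in first-out, so `trace` is a recursion in the number of the token alone,
without a schedule. The description is proved by induction on this number, for all agents at once.
-/
theorem trace_spec (k : ℕ) : ∀ x, HasHead tape x → TraceSpec tape k x := by
  induction k with
  | zero =>
    intro x hx
    rw [TraceSpec, if_pos (by simpa using index_lt hx)]
    rfl
  | succ k ih =>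
    intro x hx
    have hlt := index_lt hx
    rw [TraceSpec]
    by_cases hk : k + 1 + index tape x < segLength tape (headOf tape x)
    · rw [if_pos hk]
      have hh : ¬ IsHead tape x.succ := by rw [isHead_succ_iff hx]; omega
      obtain ⟨h1, h2⟩ := index_succ_of_not hx hh
      have hs := ih _ hx.succ
      rw [TraceSpec, h1, h2, if_pos (by omega), ← iterate_succ_apply succ k] at hs
      have hs' := ih _ hx
      rw [TraceSpec, if_pos (by omega)] at hs'
      rw [trace, hs, hs', activated_of_not hh]
      simp only [absorb, nextCmp, ownToken]
      split_ifs <;> simp_all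
    · rw [if_neg hk]
      obtain ⟨h1, h2⟩ := trace_before hx ih hk
      rw [trace, h1, h2]
      set z := succ^[k + 1] x
      have hz : HasHead tape z := hx.iterate _
      have hzlt := index_lt hz
      have hzs : succ^[k + 1 + 1] x = z.succ := iterate_succ_apply' _ _ _
      rw [hzs]
      have hd := digit_eq_weightDigit hx
      -- An active token meets an active agent exactly if `index tape x + index tape z + 1` is the
      -- length of the segment. Otherwise the stored comparison is kept.
      have hcmp : nextCmp (tape x).2 (tokenAt tape x z (index tape x + 1))
          (stateAfter tape x (headOf tape z) (index tape z)) =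
          (stateAfter tape x (headOf tape z) (index tape z + 1)).2 := by
        rw [nextCmp, stateAfter, stateAfter, tokenAt]
        dsimp only
        rw [← Bool.decide_and]
        rcases lt_trichotomy (index tape x + index tape z + 1) (segLength tape (headOf tape x))
          with h | h | h
        · rw [decide_eq_false (by omega), if_neg (by simp), if_pos (by omega), if_pos (by omega)]
        · rw [decide_eq_true (by omega), if_pos rfl, if_neg (by omega),
            show segLength tape (headOf tape x) - 1 - index tape x = index tape z by omega]
        · rw [decide_eq_false (by omega), if_neg (by simp), if_neg (by omega), if_neg (by omega)]
      have hact : ((tokenAt tape x z (index tape x + 1)).active &&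
          !(stateAfter tape x (headOf tape z) (index tape z)).1) =
          (tokenAt tape x z (index tape x)).active := by
        rw [tokenAt, stateAfter, tokenAt]
        dsimp only
        rw [← decide_not, ← Bool.decide_and]
        exact decide_eq_decide.2 (by omega)
      by_cases hdel : (tape z.succ).1 = true
      · have hl := (isHead_succ_iff hz).1 hdel
        rw [absorb, if_pos (by exact hdel), if_pos hdel, hact, hcmp]
        refine ⟨?_, rfl⟩
        rw [tokenAt, tokenAt, if_pos hdel, if_pos hdel, stateAfter]
        dsimp only
        -- Either the token sequence is too short to have a digit for `x`, or the digit of `x`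
        -- becomes the most significant one compared so far.
        by_cases h : index tape x + (index tape z + 1) < segLength tape (headOf tape x)
        · rw [if_pos h, Ordering.eq_then, min_eq_right (by omega), min_eq_right (by omega)]
        · rw [if_neg h, min_eq_left (by omega), min_eq_left (by omega), hd,
            show segLength tape (headOf tape x) - index tape x =
              segLength tape (headOf tape x) - (index tape x + 1) + 1 by omega, compareLow,
            show segLength tape (headOf tape x) - 1 - index tape x =
              segLength tape (headOf tape x) - (index tape x + 1) by omega]
      · rw [absorb, if_neg (by exact hdel), if_neg hdel, hact, hcmp]
        refine ⟨?_, Prod.ext ?_ rfl⟩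
        · rw [tokenAt, tokenAt, if_neg hdel, if_neg hdel]
        · rw [stateAfter, tokenAt, stateAfter]
          dsimp only
          rw [← decide_not, ← Bool.decide_and]
          exact decide_eq_decide.2 (by omega)

/-- The conclusion at the first agent of a segment compares the identifiers. -/
theorem verdict_eq {x : Agent A} (hx : IsHead tape x) (k : ℕ) :
    verdict tape k x = if IsHead tape (succ^[k + 2] x) ∧ segLength tape x ≤ k + 1 ∧
      segLength tape x ≤ segLength tape (headOf tape (succ^[k + 1] x)) then
        some (compare (key tape (headOf tape (succ^[k + 1] x))) (key tape x)) else none := by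
  have hx' : HasHead tape x := hx.hasHead 0
  have h0 := index_self hx
  have hh := headOf_self hx
  have hlt := index_lt hx'
  rw [verdict]
  by_cases hk : k + 1 + index tape x < segLength tape (headOf tape x)
  · have hhs : ¬ IsHead tape x.succ := by rw [isHead_succ_iff hx']; omega
    obtain ⟨h1, h2⟩ := index_succ_of_not hx' hhs
    have hs := trace_spec (tape := tape) k _ hx'.succ
    rw [TraceSpec, h1, h2, if_pos (by omega), ← iterate_succ_apply succ k] at hs
    rw [hs, activated_of_not hhs, judgment, if_neg, if_neg]
    · rw [h0, hh] at hk
      omega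
    · simp [ownToken]
  · obtain ⟨h1, h2⟩ := trace_before hx' (trace_spec k) hk
    rw [h1, h2]
    rw [h0, hh] at hk
    have hzs : succ^[k + 2] x = (succ^[k + 1] x).succ := iterate_succ_apply' _ _ _
    rw [hzs]
    set z := succ^[k + 1] x
    have hz : HasHead tape z := hx'.iterate _
    have hzlt := index_lt hz
    by_cases hdel : IsHead tape z.succ
    · have hl := (isHead_succ_iff hz).1 hdel
      have hdel' : (tape z.succ).1 = true := hdel
      by_cases hlen : segLength tape x ≤ segLength tape (headOf tape z)
      · rw [if_pos ⟨hdel, by omega, hlen⟩, judgment, if_pos]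
        swap
        · simp [tokenAt, hdel', hh, h0]; omega
        rw [compare_key]
        -- A longer token sequence finds `x` inactive. For equal lengths `x` is still active and
        -- itself compares the most significant digit with the delimiter.
        rcases Nat.lt_or_ge (segLength tape x) (segLength tape (headOf tape z)) with h | h
        · rw [if_neg (by simp [stateAfter, h0, hh]; omega), compare_gt_iff_gt.2 h]
          rfl
        · have he : segLength tape (headOf tape z) = segLength tape x := le_antisymm h hlen
          rw [if_pos (by simp [stateAfter, h0, hh]; omega), he,
            compare_eq_iff_eq.2 (rfl : segLength tape x = _), Ordering.eq_then, ← compareLow_eq]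
          congr 1
          have hd := digit_eq_weightDigit hx'
          rw [h0, hh] at hd
          rw [nextCmp, if_pos, tokenAt, hd]
          · dsimp only
            rw [if_pos hdel', h0, hh, he, min_eq_left (by omega)]
            obtain ⟨n, hn⟩ : ∃ n, segLength tape x = n + 1 := ⟨segLength tape x - 1, by omega⟩
            rw [hn, compareLow, show index tape z = n by omega]
            simp
          · simp [stateAfter, tokenAt, h0, hh]; omega
      · rw [if_neg (fun h => hlen h.2.2), judgment, if_neg]
        simp [tokenAt, hdel', hh, h0]; omega
    · rw [if_neg (fun h => hdel h.1), judgment, if_neg]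
      have hdel' : (tape z.succ).1 = false := by simpa [IsHead] using hdel
      simp [tokenAt, hdel']

/-! ### The identifier comparison -/

/-- The buffer that holds `n` consecutive tokens of a sequence. -/
def bufOf {α : Type} (f : ℕ → α) (a : ℕ) : ℕ → Buf α
  | 0 => .empty
  | 1 => .one (f a)
  | _ + 2 => .two (f a) (f (a + 1))

theorem push_bufOf {α : Type} (f : ℕ → α) (a n : ℕ) (hn : n < 2) :
    (bufOf f a n).push (f (a + n)) = bufOf f a (n + 1) := by
  interval_cases n <;> rfl

theorem pop_bufOf {α : Type} (f : ℕ → α) (a n : ℕ) (hn : n < 2) :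
    (bufOf f a (n + 1)).pop = some (f a, bufOf f (a + 1) n) := by
  interval_cases n <;> rfl

theorem size_bufOf {α : Type} (f : ℕ → α) (a n : ℕ) (hn : n ≤ 2) : (bufOf f a n).size = n := by
  interval_cases n <;> rfl

/-- The comparison part of the memory of agent `x`, if each agent `z` has forwarded `F z` tokens. -/
structure DigitAt (tape : Tape A r) (F : Agent A → ℕ) (m : Mem A r) (x : Agent A) : Prop where
  fresh : (m x).created = false → F x = 0 ∧ F x.succ = 0 ∧ (m x).queue = .empty ∧
    (m x).cmp = .eq ∧ (m x).active = (m x).awake ∧ (m x).beaten = false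
  awake : (m x).created = true → (m x).awake = true
  setup : (m x).created = true → (m (headOf tape x)).setupDone = true
  le : (m x).created = true → F x ≤ F x.succ + 1 ∧ F x.succ ≤ F x + 1
  queue : (m x).created = true →
    (m x).queue = bufOf (fun k => (trace tape k x).1) (F x) (F x.succ + 1 - F x)
  state : (m x).created = true → ((m x).active, (m x).cmp) = (trace tape (F x.succ) x).2
  beaten : (m x).created = true → ((m x).beaten = true ↔
    IsHead tape x ∧ ∃ k < F x.succ, verdict tape k x = some .gt)

/-- `F` is a ghost counter. After its own token and those forwarded by its successor, an agent has
had `F x.succ + 1` tokens, of which the first `F x` are gone, and its state is the one that `trace`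
predicts. -/
def DigitInv (tape : Tape A r) (F : Agent A → ℕ) (m : Mem A r) : Prop :=
  ∀ x, HasHead tape x → DigitAt tape F m x

theorem DigitAt.congr {F F' : Agent A → ℕ} {m m' : Mem A r} {x : Agent A} (h : DigitAt tape F m x)
    (hc : (m' x).comparePart = (m x).comparePart) (hw : (m' x).awake = (m x).awake)
    (hs : (m (headOf tape x)).setupDone = true → (m' (headOf tape x)).setupDone = true)
    (h1 : F' x = F x) (h2 : F' x.succ = F x.succ) : DigitAt tape F' m' x := by
  simp only [comparePart, Prod.mk.injEq] at hc
  obtain ⟨c1, c2, c3, c4, c5⟩ := hc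
  constructor
  · rw [c1, c2, c3, c4, c5, hw, h1, h2]; exact h.fresh
  · rw [c1, hw]; exact h.awake
  · rw [c1]; exact fun hx => hs (h.setup hx)
  · rw [c1, h1, h2]; exact h.le
  · rw [c1, c2, h1, h2]; exact h.queue
  · rw [c1, c3, c4, h2]; exact h.state
  · rw [c1, c5, h2]; exact h.beaten

theorem createRule_of_ne {a z : Agent A} (h : z ≠ a) (m : Mem A r) :
    applyRule lab tape a m createRule z = m z := by
  rw [applyRule_of_ne h]
  have h1 : ∀ v p s q, (createRule (r := r) v p s q).pred = id ∧
      (createRule (r := r) v p s q).succ = id := by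
    intro v p s q
    unfold createRule
    constructor <;> repeat' split
    all_goals rfl
  rw [(h1 _ _ _ _).1, (h1 _ _ _ _).2]
  simp

theorem setupDone_step {m m' : Mem A r} (hm : Reachable lab tape m) (hst : Step lab tape m m')
    {h : Agent A} (hh : IsHead tape h) (hd : (m h).setupDone = true) :
    (m' h).setupDone = true := by
  have := (done_of_setupDone hm hh hd).done_step hm hst hh
  exact (this.fields (k := 0) (segLength_pos h)).2.2.2

/-- The facts about an agent whose segment has completed the setup. -/
theorem setup_facts {m : Mem A r} (hm : Reachable lab tape m) {x : Agent A}
    (hx : HasHead tape x) (hd : (m (headOf tape x)).setupDone = true) :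
    (m x).digit = some (tape x).2 ∧
    (m x).rdigit = some (weightDigit tape (headOf tape x) (index tape x)) ∧
    (m x).awake = true ∧ (m x.succ).awake = true := by
  have hs := done_of_setupDone hm (isHead_headOf hx) hd
  have hl := index_lt hx
  have hf := hs.fields hl
  rw [iterate_headOf] at hf
  refine ⟨hf.1.trans ((if_pos rfl).trans ?_), hf.2.1.trans rfl, ?_, ?_⟩
  · rw [segDigit, iterate_headOf]
  · have := hs.awake (index tape x) hl.le
    rwa [iterate_headOf] at this
  · have := hs.awake (index tape x + 1) hl
    rwa [iterate_succ_apply', iterate_headOf] at this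

theorem headOf_pred {x : Agent A} (hx : HasHead tape x) (h : ¬ IsHead tape x) :
    headOf tape x.pred = headOf tape x := by
  have := (index_succ_of_not hx.pred (by rwa [succ_pred])).2
  rw [succ_pred] at this
  exact this.symm

/-- An agent receives no token before it has created its own, so the own token has number 0 and
finds the queue empty. -/
theorem DigitInv.create {F : Agent A → ℕ} {m : Mem A r} (hi : DigitInv tape F m)
    (hm : Reachable lab tape m) {a : Agent A} (ha : (m a).awake = true) :
    DigitInv tape F (applyRule lab tape a m createRule) := by
  have hR : createRule ∈ rules r := mem_rules_iff.2 (.inr (.inl rfl))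
  intro x hx
  have hsd : ∀ z, (applyRule lab tape a m createRule z).setupDone = (m z).setupDone :=
    fun z => congrArg (·.2.1.2.2.2) (createRule_preserves.apply a m z)
  have hdx := hi x hx
  by_cases hxa : x = a
  swap
  · exact hdx.congr (by rw [createRule_of_ne hxa]) (by rw [createRule_of_ne hxa])
      (fun h => by rwa [hsd]) rfl rfl
  subst hxa
  have hhead := hm.basic.head_eq x ha
  by_cases hc : (m x).created = false ∧
      (if (m x).head then (m x).setupDone else (m x.pred).created) = true
  · obtain ⟨hc, hc'⟩ := hc
    have hd : (m (headOf tape x)).setupDone = true := by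
      by_cases hh : IsHead tape x
      · rw [headOf_self hh]
        rwa [hhead, if_pos (show (tape x).1 = true from hh)] at hc'
      · rw [hhead, if_neg (show ¬ (tape x).1 = true from hh)] at hc'
        have := (hi _ hx.pred).setup hc'
        rwa [headOf_pred hx hh] at this
    obtain ⟨_, f2, _, f4⟩ := setup_facts hm hx hd
    obtain ⟨g1, g2, g3, g4, g5, g6⟩ := hdx.fresh hc
    have hself : applyRule lab tape x m createRule x = { m x with
        created := true, queue := .one (ownToken tape x) } := by
      have he : ∀ v p s q, s.rdigit = some (weightDigit tape (headOf tape x) (index tape x)) →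
          (s.created = false ∧ (if s.head then s.setupDone else p.created) = true) →
          (createRule (r := r) v p s q).self = { s with
            created := true
            queue := s.queue.push { val := weightDigit tape (headOf tape x) (index tape x),
                                    delim := q.head, active := false, res := .eq } } := by
        intro v p s q h1 h2
        simp only [createRule, h1, if_pos h2]
      rw [applyRule_self, he _ _ _ _ f2 ⟨hc, hc'⟩, g3, hm.basic.head_eq _ f4]
      rfl
    constructor
    · rw [hself]; exact fun h => absurd h (by simp)
    · rw [hself]; exact fun _ => ha
    · rw [hsd]; exact fun _ => hd
    · rw [g1, g2]; exact fun _ => by simp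
    · rw [hself, g1, g2]; exact fun _ => rfl
    · rw [hself, g2]; intro _; dsimp only; rw [g4, g5, ha]; rfl
    · rw [hself, g2]; intro _; dsimp only; rw [g6]; simp
  · have hself : applyRule lab tape x m createRule x = m x := by
      rw [applyRule_self, createRule]
      split
      · rfl
      · rw [if_neg hc]
    exact hdx.congr (by rw [hself]) (by rw [hself]) (fun h => by rwa [hsd]) rfl rfl

/-- An agent can forward a token. -/
def CanForward (F : Agent A → ℕ) (m : Mem A r) (a : Agent A) : Prop :=
  (m a).created = true ∧ (m a.pred).created = true ∧ F a ≤ F a.succ ∧ F a ≤ F a.pred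

theorem DigitInv.forward_of_not {F : Agent A → ℕ} {m : Mem A r} (hi : DigitInv tape F m)
    {a : Agent A} (ha : HasHead tape a) (hf : ¬ CanForward F m a) :
    applyRule lab tape a m forwardRule = m := by
  have he : forwardRule (view lab tape a) (m a.pred) (m a) (m a.succ) = { self := m a } := by
    rw [forwardRule]
    cases hc : (m a).created with
    | false => rw [((hi a ha).fresh hc).2.2.1]; rfl
    | true =>
      have hle := (hi a ha).le hc
      rw [(hi a ha).queue hc]
      by_cases h : F a ≤ F a.succ
      · obtain ⟨n, hn⟩ : ∃ n, F a.succ + 1 - F a = n + 1 := ⟨F a.succ - F a, by omega⟩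
        rw [hn, pop_bufOf _ _ _ (by omega)]
        dsimp only
        rw [if_neg]
        rintro ⟨hp, hs⟩
        have hle' := (hi _ ha.pred).le hp
        rw [(hi _ ha.pred).queue hp, size_bufOf _ _ _ (by rw [succ_pred] at hle' ⊢; omega),
          succ_pred] at hs
        exact hf ⟨hc, hp, h, by omega⟩
      · rw [show F a.succ + 1 - F a = 0 by omega]
        rfl
  funext z
  by_cases hz : z = a
  · rw [hz, applyRule_self, he]
  · rw [applyRule_of_ne hz, he]
    simp

/-- The forwarded token is number `F a + 1` in the trace of the predecessor. At this moment the
verdict number `F a` takes effect there. -/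
theorem DigitInv.forward {F : Agent A → ℕ} {m : Mem A r} (hi : DigitInv tape F m)
    (hm : Reachable lab tape m) {a : Agent A} (hx : HasHead tape a)
    (hf : CanForward F m a) :
    DigitInv tape (update F a (F a + 1)) (applyRule lab tape a m forwardRule) ∧
    (IsHead tape a.pred → verdict tape (F a) a.pred = some .eq → (m a.pred).cand = true →
      (m a.pred).phase = .idle → (applyRule lab tape a m forwardRule a.pred).phase = .requested) := by
  have hR : forwardRule ∈ rules r := mem_rules_iff.2 (.inr (.inr (.inl rfl)))
  obtain ⟨hc, hcp, h1, h2⟩ := hf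
  have hda := hi a hx
  have hdp := hi _ hx.pred
  have hle := hda.le hc
  have hle' := hdp.le hcp
  have hq' := hdp.queue hcp
  have hst' := hdp.state hcp
  have hbt' := hdp.beaten hcp
  rw [succ_pred] at hle' hq' hst' hbt'
  obtain ⟨n, hn⟩ : ∃ n, F a.succ + 1 - F a = n + 1 := ⟨F a.succ - F a, by omega⟩
  have he : forwardRule (view lab tape a) (m a.pred) (m a) (m a.succ) =
      { self := { m a with queue := bufOf (fun k => (trace tape k a).1) (F a + 1) n }
        pred := receive (activated tape a (trace tape (F a) a).1) } := by
    rw [forwardRule, hda.queue hc, hn, pop_bufOf _ _ _ (by omega)]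
    dsimp only
    rw [if_pos ⟨hcp, by rw [hq', size_bufOf _ _ _ (by omega)]; omega⟩,
      hm.basic.head_eq _ (hda.awake hc)]
    rfl
  have hself : applyRule lab tape a m forwardRule a =
      { m a with queue := bufOf (fun k => (trace tape k a).1) (F a + 1) n } := by
    rw [applyRule_self, he]
  have hpred : applyRule lab tape a m forwardRule a.pred =
      receive (activated tape a (trace tape (F a) a).1) (m a.pred) := by
    rw [applyRule_of_ne a.pred_ne, he, if_pos rfl]
    simp
  have hother : ∀ z, z ≠ a → z ≠ a.pred → applyRule lab tape a m forwardRule z = m z := by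
    intro z hz hz'
    rw [applyRule_of_ne hz, he, if_neg hz']
    simp
  have hsd : ∀ z, (applyRule lab tape a m forwardRule z).setupDone = (m z).setupDone :=
    fun z => congrArg (·.2.1.2.2.2) (forwardRule_preserves.apply a m z)
  obtain ⟨q1, q2, q3, q4, q5⟩ := receive_eq (t := activated tape a (trace tape (F a) a).1)
    (setup_facts hm hx.pred (hdp.setup hcp)).1
  have hsucc : a.pred.succ = a := succ_pred a
  have htr : trace tape (F a + 1) a.pred = absorb (tape a.pred).2
      (activated tape a (trace tape (F a) a).1) ((m a.pred).active, (m a.pred).cmp) := by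
    rw [trace, hsucc, hst']
  have hver : verdict tape (F a) a.pred = judgment (tape a.pred).2
      (activated tape a (trace tape (F a) a).1) ((m a.pred).active, (m a.pred).cmp) := by
    rw [verdict, hsucc, hst']
  have hhp := hm.basic.head_eq _ (hdp.awake hcp)
  constructor
  · intro x hx
    by_cases hxa : x = a
    · subst hxa
      have hc' : (applyRule lab tape x m forwardRule x).created = true := by rw [hself]; exact hc
      constructor
      · exact fun h => absurd (hc'.symm.trans h) (by simp)
      · rw [hself]; exact fun _ => hda.awake hc
      · rw [hsd]; exact fun _ => hda.setup hc
      · rw [update_self, update_of_ne x.succ_ne]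
        exact fun _ => ⟨by omega, by omega⟩
      · rw [update_self, update_of_ne x.succ_ne, hself]
        intro _
        dsimp only
        rw [show F x.succ + 1 - (F x + 1) = n by omega]
      · rw [update_of_ne x.succ_ne, hself]; exact hda.state
      · rw [update_of_ne x.succ_ne, hself]; exact hda.beaten
    · by_cases hxp : x = a.pred
      · subst hxp
        have hc' : (applyRule lab tape a m forwardRule a.pred).created = true := by
          rw [hpred, (receive_spec _ _).2.2.2.2.2.1]; exact hcp
        constructor
        · exact fun h => absurd (hc'.symm.trans h) (by simp)
        · rw [rule_awake hR]; exact fun _ => hdp.awake hcp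
        · rw [hsd]; exact fun _ => hdp.setup hcp
        · rw [hsucc, update_self, update_of_ne a.pred_ne]
          exact fun _ => ⟨by omega, by omega⟩
        · rw [hsucc, update_self, update_of_ne a.pred_ne, hpred, q1, hq', ← htr]
          intro _
          have := push_bufOf (fun k => (trace tape k a.pred).1) (F a.pred) (F a + 1 - F a.pred)
            (by omega)
          rw [show F a.pred + (F a + 1 - F a.pred) = F a + 1 by omega] at this
          rw [this, show F a + 1 + 1 - F a.pred = F a + 1 - F a.pred + 1 by omega]
        · rw [hsucc, update_self, hpred, q2, q3, htr]
          exact fun _ => rfl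
        · rw [hsucc, update_self, hpred, q4, ← hver, hhp, Bool.or_eq_true, hbt']
          intro _
          rw [Bool.and_eq_true, decide_eq_true_eq]
          constructor
          · rintro (⟨h, k, hk, h'⟩ | ⟨h, h'⟩)
            · exact ⟨h, k, by omega, h'⟩
            · exact ⟨h, F a, by omega, h'⟩
          · rintro ⟨h, k, hk, h'⟩
            rcases Nat.lt_succ_iff_lt_or_eq.1 hk with hk | rfl
            · exact .inl ⟨h, k, hk, h'⟩
            · exact .inr ⟨h, h'⟩
      · have hs : x.succ ≠ a := by
          rintro rfl
          exact hxp (pred_succ x).symm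
        exact (hi x hx).congr (by rw [hother x hxa hxp]) (by rw [hother x hxa hxp])
          (fun h => by rwa [hsd]) (update_of_ne hxa _ _) (update_of_ne hs _ _)
  · intro hh hv hca hph
    rw [hpred, q5, ← hver, hhp, if_pos ⟨hh, hv, hca, hph⟩]

/-- How a step changes the numbers of forwarded tokens. -/
structure ForwardStep (tape : Tape A r) (F F' : Agent A → ℕ) (m m' : Mem A r) : Prop where
  le : F ≤ F'
  eq : ∀ x, HasHead tape x → F' x.succ = F x.succ ∨ F' x.succ = F x.succ + 1 ∧
    (IsHead tape x → verdict tape (F x.succ) x = some .eq → (m x).cand = true →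
      (m x).phase = .idle → (m' x).phase = .requested)

/-- Only the creating and the forwarding rule touch these data, and a completed setup remains
complete. -/
theorem DigitInv.step {F : Agent A → ℕ} {m m' : Mem A r} (hi : DigitInv tape F m)
    (hm : Reachable lab tape m) (hst : Step lab tape m m') :
    ∃ F', DigitInv tape F' m' ∧ ForwardStep tape F F' m m' := by
  have hsame : ForwardStep tape F F m m' := ⟨le_rfl, fun _ _ => .inl rfl⟩
  have hst' := hst
  cases hst with
  | wake a ha =>
    refine ⟨F, fun x hx => ?_, hsame⟩
    have hdx := hi x hx
    have hsd := fun h => setupDone_step hm hst' (isHead_headOf hx) h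
    by_cases hxa : x = a
    · subst hxa
      have hc : (m x).created = false := by
        by_contra hc
        rw [hdx.awake (by simpa using hc)] at ha
        cases ha
      have hc' : (update m x (wake (view lab tape x) (m x)) x).created = false := by
        rw [update_self]; exact hc
      obtain ⟨g1, g2, g3, g4, g5, g6⟩ := hdx.fresh hc
      constructor
      · rw [update_self]; exact fun _ => ⟨g1, g2, g3, g4, rfl, g6⟩
      all_goals exact fun h => absurd (hc'.symm.trans h) (by simp)
    · exact hdx.congr (by rw [update_of_ne hxa]) (by rw [update_of_ne hxa]) hsd
        rfl rfl
  | rule a R hR ha =>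
    have hpart : R ≠ createRule → R ≠ forwardRule → ∀ z,
        (applyRule lab tape a m R z).comparePart = (m z).comparePart := by
      intro h1 h2 z
      rcases mem_rules_iff.1 hR with h | h | h | h | ⟨ax, sg, h⟩ | ⟨ax, h⟩ | h | h
      · subst h; exact congrArg (·.2.1) (setupRule_preserves.apply a m z)
      · exact absurd h h1
      · exact absurd h h2
      · subst h; exact congrArg (·.2.2.1) (activationRule_preserves.apply a m z)
      · subst h; exact congrArg (·.2.2.1) ((vectorRule_preserves ax sg).apply a m z)
      · subst h; exact congrArg (·.2.2.1) ((returnRule_preserves ax).apply a m z)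
      · subst h; exact congrArg (·.2.2.1) (angleRule_preserves.apply a m z)
      · subst h; exact congrArg (·.2.2.1) (candidateRule_preserves.apply a m z)
    by_cases h1 : R = createRule
    · subst h1
      exact ⟨F, hi.create hm ha, hsame⟩
    by_cases h2 : R = forwardRule
    · subst h2
      by_cases hx : HasHead tape a
      · by_cases hf : CanForward F m a
        · obtain ⟨g1, g2⟩ := hi.forward hm hx hf
          refine ⟨_, g1, fun x => ?_, fun x hx' => ?_⟩
          · by_cases hxa : x = a
            · subst hxa; rw [update_self]; exact Nat.le_succ _
            · rw [update_of_ne hxa]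
          · by_cases hxa : x.succ = a
            · subst hxa
              rw [update_self]
              rw [pred_succ] at g2
              exact .inr ⟨rfl, g2⟩
            · rw [update_of_ne hxa]; exact .inl rfl
        · rw [hi.forward_of_not hx hf]
          exact ⟨F, hi, le_rfl, fun _ _ => .inl rfl⟩
      · refine ⟨F, fun x hx' => ?_, hsame⟩
        have hxa : x ≠ a := by rintro rfl; exact hx hx'
        have hu : applyRule lab tape a m forwardRule x = m x := by
          rw [applyRule_of_ne hxa, if_neg, if_neg, id, id]
          · rintro rfl; exact hx (by simpa [succ_pred] using hx'.succ)
          · rintro rfl; exact hx (by simpa [pred_succ] using hx'.pred)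
        exact (hi x hx').congr (by rw [hu]) (by rw [hu])
          (fun h => setupDone_step hm hst' (isHead_headOf hx') h) rfl rfl
    · exact ⟨F, fun x hx => (hi x hx).congr (hpart h1 h2 x) (rule_awake hR _ _ _)
        (fun h => setupDone_step hm hst' (isHead_headOf hx) h) rfl rfl, hsame⟩

theorem Reachable.digitInv {m : Mem A r} (h : Reachable lab tape m) :
    ∃ F, DigitInv tape F m := by
  induction h with
  | refl =>
    refine ⟨fun _ => 0, fun x _ => ?_⟩
    constructor <;> simp [blank]
  | tail hr h ih =>
    obtain ⟨F, hF⟩ := ih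
    obtain ⟨F', hF', _⟩ := hF.step hr h
    exact ⟨F', hF'⟩

/-! ### The positive and negative tokens of the solitude verification -/

namespace Buf

/-- Some token has settled. -/
def hasSettled : Buf Bool → Bool
  | empty => false
  | one s => s
  | two s t => s || t

/-- The weights are chosen such that settling a token gains one unit and moving an unsettled token
one position backward gains two. -/
def weight (k : ℕ) : Buf Bool → ℕ
  | empty => 0
  | one s => 2 * k + 1 + (!s).toNat
  | two s t => (2 * k + 1 + (!s).toNat) + (2 * k + 1 + (!t).toNat)

theorem size_settleAll (b : Buf Bool) : (settleAll b).size = b.size := by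
  cases b <;> rfl

theorem weight_settleAll_le (k : ℕ) (b : Buf Bool) : (settleAll b).weight k ≤ b.weight k := by
  cases b <;> simp [settleAll, weight]
  omega

theorem weight_settleAll_lt (k : ℕ) {b : Buf Bool} (h : b ≠ settleAll b) :
    (settleAll b).weight k < b.weight k := by
  rcases b with _ | s | ⟨s, t⟩
  · exact absurd rfl h
  · cases s
    · simp [settleAll, weight]
    · exact absurd rfl h
  · cases s <;> cases t
    · simp [settleAll, weight]; omega
    · simp [settleAll, weight]
    · simp [settleAll, weight]
    · exact absurd rfl h

theorem size_le_two {α : Type} (b : Buf α) : b.size ≤ 2 := by cases b <;> simp [size]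

theorem size_eq_zero {α : Type} {b : Buf α} : b.size = 0 ↔ b = empty := by cases b <;> simp [size]

theorem eq_two_of_size {b : Buf Bool} (h : b = settleAll b) (h2 : ¬ b.size < 2) :
    b = two true true := by
  rcases b with _ | s | ⟨s, t⟩ <;> simp_all [size, settleAll]

theorem hasSettled_of_settled {b : Buf Bool} (h : b = settleAll b) (h2 : b ≠ empty) :
    b.hasSettled = true := by
  rcases b with _ | s | ⟨s, t⟩ <;> simp_all [hasSettled, settleAll]

end Buf

/-- The tokens of one kind lie before position `n`, and a token has settled only if all positions
before are full. -/
structure Tokens (b : ℕ → Buf Bool) (n : ℕ) : Prop where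
  empty : ∀ k, n ≤ k → b k = .empty
  chain : ∀ k, (b (k + 1)).hasSettled = true → b k = .two true true

/-- The number of tokens. -/
def total (b : ℕ → Buf Bool) (n : ℕ) : ℕ := ∑ k ∈ range n, (b k).size

namespace Tokens

variable {b : ℕ → Buf Bool} {n k : ℕ}

theorem total_eq (h : Tokens b n) {n' : ℕ} (hn : n ≤ n') : total b n' = total b n := by
  rw [total, total]
  symm
  refine Finset.sum_subset (fun x hx => ?_) fun x _ hx => ?_
  · rw [mem_range] at hx ⊢; omega
  · rw [h.empty x (by simpa using hx)]; rfl

theorem full (h : Tokens b n) (hs : (b k).hasSettled = true) : ∀ i < k, b i = .two true true := by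
  induction k with
  | zero => intro i hi; omega
  | succ k ih =>
    intro i hi
    have hk := h.chain k hs
    rcases Nat.lt_succ_iff_lt_or_eq.1 hi with hi | rfl
    · exact ih (by rw [hk]; rfl) i hi
    · exact hk

/-- A settled token at position `k` forces two tokens on each of the `k` positions before. -/
theorem total_of_settled (h : Tokens b (k + 1)) (hs : (b k).hasSettled = true) :
    total b (k + 1) = 2 * k + (b k).size := by
  rw [total, sum_range_succ, sum_congr rfl
    fun i hi => by rw [h.full hs i (Finset.mem_range.1 hi)]]
  simp [Buf.size, mul_comm]

theorem total_le (b : ℕ → Buf Bool) (n : ℕ) : total b n ≤ 2 * n := by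
  refine (Finset.sum_le_card_nsmul _ _ 2 fun k _ => (b k).size_le_two).trans ?_
  simp [mul_comm]

/-- The decision at the first settled tokens is correct. -/
theorem size_eq_iff {b' : ℕ → Buf Bool} (h : Tokens b (k + 1)) (h' : Tokens b' (k + 1))
    (hs : b k = settleAll (b k)) (hs' : b' k = settleAll (b' k))
    (h0 : ¬ (b k = .empty ∧ b' k = .empty) ∨ k = 0) :
    (b k).size = (b' k).size ↔ total b (k + 1) = total b' (k + 1) := by
  have hsum : ∀ b : ℕ → Buf Bool, total b (k + 1) = total b k + (b k).size :=
    fun b => sum_range_succ _ _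
  rcases Nat.eq_zero_or_pos k with rfl | hk
  · rw [hsum, hsum]; simp [total]
  have h0 : ¬ (b k = .empty ∧ b' k = .empty) := h0.resolve_right hk.ne'
  have hb := total_le b k
  have hb' := total_le b' k
  -- A kind that is present at position `k` has more than `2 * k` tokens, a kind that is absent
  -- there has at most `2 * k`. So comparing the sizes at `k` amounts to comparing the totals.
  by_cases he : b k = .empty
  · have he' : b' k ≠ .empty := fun h => h0 ⟨he, h⟩
    have hz := mt Buf.size_eq_zero.1 he'
    rw [h'.total_of_settled (Buf.hasSettled_of_settled hs' he'), hsum, he]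
    simp only [Buf.size] at hz ⊢
    omega
  · rw [h.total_of_settled (Buf.hasSettled_of_settled hs he)]
    by_cases he' : b' k = .empty
    · have hz := mt Buf.size_eq_zero.1 he
      rw [hsum, he']
      simp only [Buf.size] at hz ⊢
      omega
    · rw [h'.total_of_settled (Buf.hasSettled_of_settled hs' he')]
      omega

theorem settle (h : Tokens b n) (hk : ∀ i, k = i + 1 → b i = .two true true) :
    Tokens (update b k (settleAll (b k))) n := by
  constructor
  · intro i hi
    by_cases hik : i = k
    · subst hik; rw [update_self, h.empty i hi]; rfl
    · rw [update_of_ne hik, h.empty i hi]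
  · intro i hi
    by_cases hik : i + 1 = k
    · rw [update_of_ne (by omega)]
      exact hk i hik.symm
    · rw [update_of_ne hik] at hi
      have := h.chain i hi
      by_cases hik' : i = k
      · subst hik'; rw [update_self, this]; rfl
      · rwa [update_of_ne hik']

theorem total_settle (b : ℕ → Buf Bool) (k n : ℕ) :
    total (update b k (settleAll (b k))) n = total b n := by
  refine sum_congr rfl fun i _ => ?_
  by_cases hik : i = k
  · subst hik; rw [update_self, Buf.size_settleAll]
  · rw [update_of_ne hik]

/-- The effect of moving a token from position `k + 1` to position `k`. -/
def moved (b : ℕ → Buf Bool) (k : ℕ) (t : Bool) (rest : Buf Bool) : ℕ → Buf Bool :=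
  update (update b (k + 1) rest) k ((b k).push t)

theorem moved_self (t : Bool) (rest : Buf Bool) : moved b k t rest k = (b k).push t :=
  update_self _ _ _

theorem moved_succ (t : Bool) (rest : Buf Bool) : moved b k t rest (k + 1) = rest := by
  rw [moved, update_of_ne (by omega), update_self]

theorem moved_of_ne (t : Bool) (rest : Buf Bool) {i : ℕ} (h : i ≠ k) (h' : i ≠ k + 1) :
    moved b k t rest i = b i := by
  rw [moved, update_of_ne h, update_of_ne h']

theorem unsettled_of_ne (h : Tokens b n) (hne : b k ≠ .two true true) :
    (b (k + 1)).hasSettled = false := by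
  by_contra hc
  exact hne (h.chain k (by simpa using hc))

theorem pop_spec {b : Buf Bool} {t : Bool} {rest : Buf Bool} (hp : b.pop = some (t, rest))
    (hs : b.hasSettled = false) : t = false ∧ rest.hasSettled = false ∧
      b.size = rest.size + 1 ∧ b ≠ .empty ∧ ∀ k, b.weight k = rest.weight k + (2 * k + 2) := by
  rcases b with _ | s | ⟨s, u⟩ <;> simp [Buf.pop, Buf.hasSettled] at hp hs
  · obtain ⟨rfl, rfl⟩ := hp
    subst hs
    simp [Buf.hasSettled, Buf.size, Buf.weight]
  · obtain ⟨rfl, rfl⟩ := hp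
    obtain ⟨rfl, rfl⟩ := hs
    simp [Buf.hasSettled, Buf.size, Buf.weight]

theorem push_spec {b : Buf Bool} (h2 : b.size < 2) : (b.push false).hasSettled = b.hasSettled ∧
    (b.push false).size = b.size + 1 ∧
    ∀ k, (b.push false).weight k = b.weight k + (2 * k + 2) := by
  rcases b with _ | s | ⟨s, u⟩ <;> simp_all [Buf.push, Buf.hasSettled, Buf.size, Buf.weight]

/-- Position `k` is not full of settled tokens, so no token at `k + 1` has settled. The moved token
is unsettled, and no new settled token arises. -/
theorem move (h : Tokens b n) (hne : b k ≠ .two true true) {t : Bool} {rest : Buf Bool}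
    (hp : (b (k + 1)).pop = some (t, rest)) (h2 : (b k).size < 2) : Tokens (moved b k t rest) n := by
  obtain ⟨rfl, p2, p3, p4, -⟩ := pop_spec hp (h.unsettled_of_ne hne)
  obtain ⟨q1, q2, -⟩ := push_spec h2
  have hkn : k + 1 < n := by
    by_contra hc
    exact p4 (h.empty _ (by omega))
  constructor
  · intro i hi
    rw [moved_of_ne _ _ (by omega) (by omega)]
    exact h.empty i hi
  · intro i hi
    rcases eq_or_ne i k with rfl | hik
    · rw [moved_succ, p2] at hi; cases hi
    rcases eq_or_ne i (k + 1) with rfl | hik'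
    · rw [moved_of_ne _ _ (by omega) (by omega)] at hi
      have h3 := h.chain _ hi
      have h4 := h.unsettled_of_ne hne
      rw [h3] at h4
      cases h4
    rw [moved_of_ne _ _ hik hik']
    rcases eq_or_ne (i + 1) k with hik2 | hik2
    · subst hik2
      rw [moved_self, q1] at hi
      exact h.chain i hi
    · rw [moved_of_ne _ _ hik2 (by omega)] at hi
      exact h.chain i hi

theorem sum_moved {n : ℕ} (f : ℕ → Buf Bool → ℕ) {rest : Buf Bool} (hk : k + 1 < n) {t : Bool}
    (c d : ℕ) (h1 : f (k + 1) (b (k + 1)) = f (k + 1) rest + c)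
    (h2 : f k ((b k).push t) = f k (b k) + d) :
    ∑ i ∈ range n, f i (moved b k t rest i) + c =
      ∑ i ∈ range n, f i (b i) + d := by
  have e1 : ∀ g : ℕ → ℕ, ∑ i ∈ range n, g i = g k + (g (k + 1) +
      ∑ i ∈ ((range n).erase k).erase (k + 1), g i) := by
    intro g
    rw [← Finset.add_sum_erase _ _ (show k ∈ range n by simp; omega),
      ← Finset.add_sum_erase _ _ (show k + 1 ∈ (range n).erase k by simp; omega)]
  rw [e1, e1 (fun i => f i (b i)), moved_self, moved_succ, h1, h2]
  have : ∑ i ∈ ((range n).erase k).erase (k + 1), f i (moved b k t rest i) =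
      ∑ i ∈ ((range n).erase k).erase (k + 1), f i (b i) := by
    refine sum_congr rfl fun i hi => ?_
    simp only [Finset.mem_erase] at hi
    rw [moved_of_ne _ _ hi.2.1 hi.1]
  omega

theorem lt_of_pop (h : Tokens b n) {t : Bool} {rest : Buf Bool}
    (hp : (b (k + 1)).pop = some (t, rest)) : k + 1 < n := by
  by_contra hc
  rw [h.empty (k + 1) (by omega)] at hp
  cases hp

theorem total_move (h : Tokens b n) (hne : b k ≠ .two true true) {t : Bool} {rest : Buf Bool}
    (hp : (b (k + 1)).pop = some (t, rest)) (h2 : (b k).size < 2) :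
    total (moved b k t rest) n = total b n := by
  obtain ⟨rfl, -, p3, -, -⟩ := pop_spec hp (h.unsettled_of_ne hne)
  obtain ⟨-, q2, -⟩ := push_spec h2
  have := sum_moved (b := b) (fun _ b => b.size) (rest := rest) (h.lt_of_pop hp) (t := false) 1 1
    p3 q2
  rw [total, total]
  omega

/-- The weight of the tokens. -/
def weight (b : ℕ → Buf Bool) (n : ℕ) : ℕ := ∑ k ∈ range n, (b k).weight k

theorem weight_move (h : Tokens b n) (hne : b k ≠ .two true true) {t : Bool} {rest : Buf Bool}
    (hp : (b (k + 1)).pop = some (t, rest)) (h2 : (b k).size < 2) {N : ℕ} (hN : n ≤ N) :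
    weight (moved b k t rest) N < weight b N := by
  obtain ⟨rfl, -, -, -, p5⟩ := pop_spec hp (h.unsettled_of_ne hne)
  obtain ⟨-, -, q3⟩ := push_spec h2
  have hk := h.lt_of_pop hp
  have := sum_moved (b := b) (fun k b => b.weight k) (rest := rest) (n := N) (by omega) (t := false)
    (2 * (k + 1) + 2) (2 * k + 2) (p5 _) (q3 _)
  rw [weight, weight]
  omega

theorem weight_settle_lt {b : ℕ → Buf Bool} {k N : ℕ} (hk : k < N) (h : b k ≠ settleAll (b k)) :
    weight (update b k (settleAll (b k))) N < weight b N := by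
  refine sum_lt_sum (fun i _ => ?_) ⟨k, by simpa using hk, ?_⟩
  · by_cases hik : i = k
    · subst hik; rw [update_self]; exact Buf.weight_settleAll_le _ _
    · rw [update_of_ne hik]
  · rw [update_self]; exact Buf.weight_settleAll_lt _ h

/-- Removing the tokens at the last position. -/
theorem erase (h : Tokens b (n + 1)) : Tokens (update b n .empty) n := by
  constructor
  · intro i hi
    rcases eq_or_ne i n with rfl | hin
    · rw [update_self]
    · rw [update_of_ne hin]; exact h.empty i (by omega)
  · intro i hi
    rcases eq_or_ne (i + 1) n with rfl | hin
    · rw [update_self] at hi; cases hi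
    · rw [update_of_ne hin] at hi
      rw [update_of_ne]
      · exact h.chain i hi
      · rintro rfl
        rw [h.empty _ le_rfl] at hi; cases hi

theorem weight_erase_le (b : ℕ → Buf Bool) (n N : ℕ) :
    weight (update b n .empty) N ≤ weight b N := by
  refine Finset.sum_le_sum fun i _ => ?_
  rcases eq_or_ne i n with rfl | hin
  · rw [update_self]; exact Nat.zero_le _
  · rw [update_of_ne hin]

/-- A token is created at the next position. -/
theorem create (h : Tokens b n) (c : Buf Bool) (hc : c.hasSettled = false) :
    Tokens (update b n c) (n + 1) := by
  constructor
  · intro i hi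
    rw [update_of_ne (by omega)]; exact h.empty i (by omega)
  · intro i hi
    rcases eq_or_ne (i + 1) n with rfl | hin
    · rw [update_self, hc] at hi; cases hi
    · rw [update_of_ne hin] at hi
      rw [update_of_ne]
      · exact h.chain i hi
      · rintro rfl
        rw [h.empty _ (by omega)] at hi; cases hi

theorem total_create (b : ℕ → Buf Bool) (c : Buf Bool) :
    total (update b n c) (n + 1) = total b n + c.size := by
  rw [total, sum_range_succ, update_self, total]
  congr 1
  refine sum_congr rfl fun i hi => ?_
  rw [update_of_ne (Finset.mem_range.1 hi).ne]

/-- If there is an unsettled token, then some token can settle or move. -/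
theorem exists_enabled (h : b n ≠ settleAll (b n)) :
    ∃ k ≤ n, b k ≠ settleAll (b k) ∧
      (k = 0 ∨ ∃ i, k = i + 1 ∧ (b i = .two true true ∨ b i ≠ .two true true ∧ (b i).size < 2)) := by
  classical
  have hex : ∃ k, b k ≠ settleAll (b k) := ⟨n, h⟩
  -- At the lowest position with an unsettled token, the position before has settled tokens only, so
  -- it is full or has room for another one.
  refine ⟨Nat.find hex, Nat.find_min' hex h, Nat.find_spec hex, ?_⟩
  rcases Nat.eq_zero_or_pos (Nat.find hex) with h0 | h0
  · exact .inl h0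
  · refine .inr ⟨Nat.find hex - 1, by omega, ?_⟩
    have hm := Nat.find_min hex (m := Nat.find hex - 1) (by omega)
    rw [not_not] at hm
    by_cases h2 : (b (Nat.find hex - 1)).size < 2
    · refine .inr ⟨fun he => ?_, h2⟩
      rw [he] at h2
      exact absurd h2 (by simp [Buf.size])
    · exact .inl (Buf.eq_two_of_size hm h2)

end Tokens

/-! ### The stages of the solitude verification -/

/-- The way back of the activation token, for one axis: its position, its decision, its report. -/
inductive AxisStage : Type
  | undecided : ℕ → AxisStage
  | decided : ℕ → Bool → AxisStage
  | reported : Bool → AxisStage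

/-- In `forth j` the activation token is at position `j`. In `back e s` it has turned in front of
the candidate `succ^[e] c`, and it returns separately for each axis. -/
inductive Stage : Type
  | clean : Stage
  | forth : ℕ → Stage
  | back : ℕ → (Axis → AxisStage) → Stage

/-- The state of the solitude verification of a candidate, with the buffers of the tokens. -/
structure VState : Type where
  stage : Stage
  vec : Axis → Bool → ℕ → Buf Bool

/-- The number of agents that take part. -/
def Stage.extent : Stage → ℕ
  | clean => 0
  | forth j => j + 1
  | back e _ => e

/-- The direction in which the boundary leaves the `k`-th agent after `c`, in port labels of `c`. -/
def outDir (lab : Labelling A) (c : Agent A) (k : ℕ) : ZMod 6 :=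
  (succ^[k] c).succDir - lab.offset c.particle

def inDir (lab : Labelling A) (c : Agent A) (k : ℕ) : ZMod 6 :=
  (succ^[k] c).predDir + 3 - lab.offset c.particle

theorem inDir_succ (c : Agent A) (k : ℕ) : inDir lab c (k + 1) = outDir lab c k := by
  rw [inDir, outDir, iterate_succ_apply', predDir_succ, add_assoc,
    show (3 + 3 : ZMod 6) = 0 from rfl, add_zero]

theorem inDir_add_turn (c : Agent A) (k : ℕ) :
    inDir lab c k + ((succ^[k] c).turn : ZMod 6) = outDir lab c k := by
  rw [inDir, outDir, turn, succDir_eq]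
  push_cast
  ring

/-- The number of edges with a given coordinate. -/
def edgeCount (lab : Labelling A) (c : Agent A) (ax : Axis) (sg : Bool) : ℕ → ℕ
  | 0 => 0
  | n + 1 => edgeCount lab c ax sg n +
    if coord ax (outDir lab c n) = (if sg then 1 else -1) then 1 else 0

def Balanced (lab : Labelling A) (c : Agent A) (ax : Axis) (e : ℕ) : Prop :=
  edgeCount lab c ax true e = edgeCount lab c ax false e

/-- While undecided, no token lies beyond the returning one and none has been lost, so the totals
still count the edges. After the decision only its correctness matters, because tokens are being
deleted. -/
def AxisStage.Valid (lab : Labelling A) (c : Agent A) (e : ℕ) (ax : Axis)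
    (b : Bool → ℕ → Buf Bool) : AxisStage → Prop
  | undecided p => p < e ∧
      ∀ sg, Tokens (b sg) (p + 1) ∧ total (b sg) (p + 1) = edgeCount lab c ax sg e
  | decided p z => p < e ∧ (z = true ↔ Balanced lab c ax e) ∧ ∀ sg, Tokens (b sg) (p + 1)
  | reported z => (z = true ↔ Balanced lab c ax e ∧ lab.aid (succ^[e] c) = lab.aid c) ∧
      ∀ sg, Tokens (b sg) 0

def Stage.Valid (lab : Labelling A) (c : Agent A) (vec : Axis → Bool → ℕ → Buf Bool) :
    Stage → Prop
  | clean => True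
  | forth j => ∀ ax sg, Tokens (vec ax sg) j ∧ total (vec ax sg) j = edgeCount lab c ax sg j
  | back e s => 0 < e ∧ ∀ ax, (s ax).Valid lab c e ax (vec ax)

def AxisStage.retAt (aid : Fin 3) (k : ℕ) : AxisStage → Option ReturnToken
  | undecided p => if k = p then some ⟨aid, none⟩ else none
  | decided p z => if k = p then some ⟨aid, some z⟩ else none
  | reported _ => none

def AxisStage.report : AxisStage → Option Bool
  | reported b => some b
  | _ => none

def Stage.actAt (lab : Labelling A) (c : Agent A) (k : ℕ) : Stage → Option (ZMod 6)
  | forth j => if k = j then some (inDir lab c k) else none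
  | _ => none

def Stage.retAt (lab : Labelling A) (c : Agent A) (k : ℕ) (ax : Axis) :
    Stage → Option ReturnToken
  | back e s => (s ax).retAt (lab.aid (succ^[e] c)) k
  | _ => none

def Stage.report (ax : Axis) : Stage → Option Bool
  | back _ s => (s ax).report
  | _ => none

/-- The part of the memory that holds the tokens of the solitude verification. -/
def AgentState.tokenPart (s : AgentState r) := (s.act, s.vec, s.ret)

def cleanPart : Option (ZMod 6) × (Axis → Bool → Buf Bool) × (Axis → Option ReturnToken) :=
  (none, fun _ _ => .empty, fun _ => none)

def VState.part (lab : Labelling A) (c : Agent A) (k : ℕ) (st : VState) :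
    Option (ZMod 6) × (Axis → Bool → Buf Bool) × (Axis → Option ReturnToken) :=
  (st.stage.actAt lab c k, fun ax sg => st.vec ax sg k, fun ax => st.stage.retAt lab c k ax)

/-- The solitude verification of `c` is in the given state. -/
structure VerAt (lab : Labelling A) (m : Mem A r) (c : Agent A) (st : VState) : Prop where
  valid : st.stage.Valid lab c st.vec
  phase : (m c).phase = .solitude ↔ st.stage ≠ .clean
  cover : ∀ k, 0 < k → k < st.stage.extent →
    (m (succ^[k] c)).awake = true ∧ (m (succ^[k] c)).cand = false
  part : ∀ k < st.stage.extent, (m (succ^[k] c)).tokenPart = st.part lab c k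
  report : ∀ ax, (m c).report ax = st.stage.report ax

/-- `S` is ghost data: it assigns to every agent the stage of the verification that it has started,
if any. A verification occupies a stretch of agents that begins at its candidate. Agents outside all
stretches hold no tokens of step 4. -/
structure VerInv (lab : Labelling A) (m : Mem A r) (S : Agent A → VState) : Prop where
  at' : ∀ c, VerAt lab m c (S c)
  clean : ∀ x, (∀ c, ∀ k < (S c).stage.extent, x ≠ succ^[k] c) → (m x).tokenPart = cleanPart

theorem VerInv.cand {m : Mem A r} {S : Agent A → VState} (h : VerInv lab m S)
    (hb : Basic lab tape m) {c : Agent A} (hc : (S c).stage ≠ .clean) : (m c).cand = true := by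
  have := ((h.at' c).phase).2 hc
  by_contra hcc
  rw [hb.phase_of_not_cand c (by simpa using hcc)] at this
  cases this

theorem stage_ne_clean_of_lt {s : Stage} {k : ℕ} (h : k < s.extent) : s ≠ .clean := by
  rintro rfl
  exact absurd h (Nat.not_lt_zero k)

/-- If two stretches overlapped, the start of one would lie strictly inside the other. But starts
are candidates, and inner agents are not. -/
theorem VerInv.disjoint {m : Mem A r} {S : Agent A → VState} (h : VerInv lab m S)
    (hb : Basic lab tape m) {c c' : Agent A} {k k' : ℕ} (hk : k < (S c).stage.extent)
    (hk' : k' < (S c').stage.extent) (he : succ^[k] c = succ^[k'] c') : c = c' ∧ k = k' := by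
  have key : ∀ {c c' : Agent A} {k k' : ℕ}, k < (S c).stage.extent → k' < (S c').stage.extent →
      k' ≤ k → succ^[k] c = succ^[k'] c' → c = c' ∧ k = k' := by
    intro c c' k k' hk hk' hle he
    obtain ⟨d, rfl⟩ := Nat.exists_eq_add_of_le hle
    rw [iterate_add_apply] at he
    have := succ_injective.iterate k' he
    rcases Nat.eq_zero_or_pos d with rfl | hd
    · exact ⟨this, by omega⟩
    · have h1 := ((h.at' c).cover d hd (by omega)).2
      rw [this, h.cand hb (stage_ne_clean_of_lt hk')] at h1
      cases h1
  rcases le_total k' k with hle | hle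
  · exact key hk hk' hle he
  · obtain ⟨h1, h2⟩ := key hk' hk hle he.symm
    exact ⟨h1.symm, h2.symm⟩

/-- What a step does not change. -/
structure Frame (m m' : Mem A r) (c : Agent A) : Prop where
  awake : ∀ x, (m x).awake = true → (m' x).awake = true
  cand : ∀ x, (m x).awake = true → (m x).cand = false → (m' x).cand = false
  phase : ∀ x, x ≠ c → ((m' x).phase = .solitude ↔ (m x).phase = .solitude)
  report : ∀ x, x ≠ c → (m' x).report = (m x).report

theorem VerAt.congr {m m' : Mem A r} {c : Agent A} {st : VState} (h : VerAt lab m c st)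
    (hw : ∀ x, (m x).awake = true → (m' x).awake = true)
    (hca : ∀ x, (m x).awake = true → (m x).cand = false → (m' x).cand = false)
    (hph : (m' c).phase = .solitude ↔ (m c).phase = .solitude)
    (hre : (m' c).report = (m c).report)
    (hpart : ∀ k < st.stage.extent, (m' (succ^[k] c)).tokenPart = (m (succ^[k] c)).tokenPart) :
    VerAt lab m' c st where
  valid := h.valid
  phase := hph.trans h.phase
  cover k h0 hk := ⟨hw _ (h.cover k h0 hk).1, hca _ (h.cover k h0 hk).1 (h.cover k h0 hk).2⟩
  part k hk := (hpart k hk).trans (h.part k hk)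
  report ax := by rw [hre]; exact h.report ax

theorem VerInv.congr {m m' : Mem A r} {S : Agent A → VState} (h : VerInv lab m S)
    (hw : ∀ x, (m x).awake = true → (m' x).awake = true)
    (hca : ∀ x, (m x).awake = true → (m x).cand = false → (m' x).cand = false)
    (hph : ∀ x, (m' x).phase = .solitude ↔ (m x).phase = .solitude)
    (hsol : ∀ x, (m' x).solitudePart = (m x).solitudePart) : VerInv lab m' S := by
  have hpart : ∀ x, (m' x).tokenPart = (m x).tokenPart := fun x =>
    congrArg (fun p => (p.1, p.2.1, p.2.2.1)) (hsol x)
  exact ⟨fun c => (h.at' c).congr hw hca (hph c) (congrArg (·.2.2.2) (hsol c)) fun k _ => hpart _,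
    fun x hx => (hpart x).trans (h.clean x hx)⟩

open Classical in
/-- A step that concerns the verification of one candidate. -/
theorem VerInv.of_update {m m' : Mem A r} {S : Agent A → VState} (h : VerInv lab m S)
    (hb : Basic lab tape m) {c : Agent A} {st : VState} (hc : VerAt lab m' c st)
    (hf : Frame m m' c)
    (hother : ∀ x, (∀ k < (S c).stage.extent, x ≠ succ^[k] c) →
      (∀ k < st.stage.extent, x ≠ succ^[k] c) → (m' x).tokenPart = (m x).tokenPart)
    (hnew : ∀ k < st.stage.extent, k < (S c).stage.extent ∨
      ∀ c', ∀ k' < (S c').stage.extent, succ^[k] c ≠ succ^[k'] c')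
    (hold : ∀ k < (S c).stage.extent, k < st.stage.extent ∨
      (m' (succ^[k] c)).tokenPart = cleanPart) :
    VerInv lab m' (update S c st) := by
  constructor
  · intro c'
    by_cases hcc : c' = c
    · subst hcc; rw [update_self]; exact hc
    · rw [update_of_ne hcc]
      refine (h.at' c').congr hf.awake hf.cand (hf.phase c' hcc) (hf.report c' hcc) fun k hk => ?_
      refine hother _ (fun k' hk' he => hcc (h.disjoint hb hk hk' he).1) fun k' hk' he => ?_
      rcases hnew k' hk' with h1 | h1
      · exact hcc (h.disjoint hb hk h1 he).1
      · exact h1 c' k hk he.symm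
  · intro x hx
    have hxc : ∀ k < st.stage.extent, x ≠ succ^[k] c := by
      have := hx c
      rwa [update_self] at this
    by_cases hx' : ∃ k < (S c).stage.extent, x = succ^[k] c
    · obtain ⟨k, hk, rfl⟩ := hx'
      rcases hold k hk with h1 | h1
      · exact absurd rfl (hxc k h1)
      · exact h1
    · push Not at hx'
      rw [hother x hx' hxc]
      refine h.clean x fun c' k hk => ?_
      by_cases hcc : c' = c
      · subst hcc; exact hx' k hk
      · have := hx c' k
        rw [update_of_ne hcc] at this
        exact this hk

theorem rule_frame {R : Rule r} (hR : R ∈ rules r) {a : Agent A} {m : Mem A r} {c : Agent A}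
    (hcp : ∀ x, (applyRule lab tape a m R x).candidatePart = (m x).candidatePart)
    (hrep : ∀ x, x ≠ c → (applyRule lab tape a m R x).report = (m x).report) :
    Frame m (applyRule lab tape a m R) c where
  awake x := by rw [rule_awake hR]; exact id
  cand x _ hx := (congrArg (·.1) (hcp x)).trans hx
  phase x _ := Eq.congr_left (congrArg (·.2) (hcp x))
  report := hrep

/-- The extent of a verification is less than the period. -/
theorem VerInv.extent_le {m : Mem A r} {S : Agent A → VState} (h : VerInv lab m S)
    (hb : Basic lab tape m) (c : Agent A) : (S c).stage.extent ≤ c.period := by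
  by_contra hc
  push Not at hc
  have := ((h.at' c).cover _ c.period_pos hc).2
  rw [iterate_period, h.cand hb (stage_ne_clean_of_lt hc)] at this
  cases this

theorem VerInv.iterate_ne {m : Mem A r} {S : Agent A → VState} (h : VerInv lab m S)
    (hb : Basic lab tape m) {c : Agent A} {k k' : ℕ} (hk : k < (S c).stage.extent)
    (hk' : k' < (S c).stage.extent) (hne : k ≠ k') : succ^[k] c ≠ succ^[k'] c :=
  fun he => hne (h.disjoint hb hk hk' he).2

/-! #### The measure of the verification -/

def AxisStage.weight : AxisStage → ℕ
  | undecided p => 2 * p + 3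
  | decided p _ => 2 * p + 2
  | reported _ => 0

def VState.vecWeight (st : VState) (ax : Axis) (N : ℕ) : ℕ :=
  Tokens.weight (st.vec ax true) N + Tokens.weight (st.vec ax false) N

/-- On the way forth new tokens increase the weights, so the remaining distance comes first in the
lexicographic order. After the turn no token is created, and positions and weights can simply be
added. -/
def VState.measure (N : ℕ) (st : VState) : ℕ ×ₗ ℕ :=
  match st.stage with
  | .clean => toLex (0, 0)
  | .forth j => toLex (N - j + 1, st.vecWeight .x N + st.vecWeight .y N)
  | .back _ s => toLex (0, ((s .x).weight + st.vecWeight .x N) + ((s .y).weight + st.vecWeight .y N))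

def VState.setVec (st : VState) (ax : Axis) (sg : Bool) (b : ℕ → Buf Bool) : VState :=
  { st with vec := fun ax' sg' => if ax' = ax ∧ sg' = sg then b else st.vec ax' sg' }

theorem VState.setVec_measure_lt {st : VState} {ax : Axis} {sg : Bool} {b : ℕ → Buf Bool} {N : ℕ}
    (hs : st.stage ≠ .clean) (h : Tokens.weight b N < Tokens.weight (st.vec ax sg) N) :
    (st.setVec ax sg b).measure N < st.measure N := by
  have h1 : ∀ ax', (st.setVec ax sg b).vecWeight ax' N ≤ st.vecWeight ax' N := by
    intro ax'
    cases ax <;> cases ax' <;> cases sg <;> simp [setVec, vecWeight] <;> omega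
  have h2 : (st.setVec ax sg b).vecWeight ax N < st.vecWeight ax N := by
    cases ax <;> cases sg <;> simp [setVec, vecWeight] <;> omega
  have hx := h1 .x
  have hy := h1 .y
  have hlt : (st.setVec ax sg b).vecWeight .x N + (st.setVec ax sg b).vecWeight .y N <
      st.vecWeight .x N + st.vecWeight .y N := by
    cases ax <;> omega
  have hst : (st.setVec ax sg b).stage = st.stage := rfl
  rw [VState.measure, VState.measure, hst]
  cases hsta : st.stage with
  | clean => exact absurd hsta hs
  | forth j => exact Prod.Lex.lt_iff.2 (.inr ⟨rfl, hlt⟩)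
  | back e s => exact Prod.Lex.lt_iff.2 (.inr ⟨rfl, by simp only [ofLex_toLex]; omega⟩)

/-- The stages refer to the buffers only by bounds on positions and by totals, and settling or
moving a token preserves both. -/
theorem VState.setVec_valid {st : VState} {c : Agent A} {ax : Axis} {sg : Bool}
    {b : ℕ → Buf Bool} (hv : st.stage.Valid lab c st.vec)
    (hb : ∀ n, Tokens (st.vec ax sg) n → Tokens b n ∧ total b n = total (st.vec ax sg) n) :
    (st.setVec ax sg b).stage.Valid lab c (st.setVec ax sg b).vec := by
  have key : ∀ ax' sg' n, Tokens (st.vec ax' sg') n →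
      Tokens ((st.setVec ax sg b).vec ax' sg') n ∧
        total ((st.setVec ax sg b).vec ax' sg') n = total (st.vec ax' sg') n := by
    intro ax' sg' n hn
    by_cases h : ax' = ax ∧ sg' = sg
    · obtain ⟨rfl, rfl⟩ := h
      simp only [setVec, and_self, if_true]
      exact hb n hn
    · simp only [setVec, if_neg h]
      exact ⟨hn, trivial⟩
  have hst : (st.setVec ax sg b).stage = st.stage := rfl
  rw [hst]
  cases hsta : st.stage with
  | clean => trivial
  | forth j =>
    rw [hsta] at hv
    exact fun ax' sg' => ⟨(key _ _ _ (hv ax' sg').1).1, (key _ _ _ (hv ax' sg').1).2.trans (hv ax' sg').2⟩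
  | back e s =>
    rw [hsta] at hv
    refine ⟨hv.1, fun ax' => ?_⟩
    have := hv.2 ax'
    cases hs : s ax' with
    | undecided p =>
      rw [hs] at this
      exact ⟨this.1, fun sg' => ⟨(key _ _ _ (this.2 sg').1).1,
        (key _ _ _ (this.2 sg').1).2.trans (this.2 sg').2⟩⟩
    | decided p z =>
      rw [hs] at this
      exact ⟨this.1, this.2.1, fun sg' => (key _ _ _ (this.2.2 sg')).1⟩
    | reported z =>
      rw [hs] at this
      exact ⟨this.1, fun sg' => (key _ _ _ (this.2 sg')).1⟩

/-- Every stage bounds the positions of the tokens. -/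
theorem exists_tokens {st : VState} {c : Agent A} (hs : st.stage ≠ .clean)
    (hv : st.stage.Valid lab c st.vec) (ax : Axis) (sg : Bool) :
    ∃ n ≤ st.stage.extent, Tokens (st.vec ax sg) n := by
  cases hsta : st.stage with
  | clean => exact absurd hsta hs
  | forth j =>
    rw [hsta] at hv
    exact ⟨j, Nat.le_succ j, (hv ax sg).1⟩
  | back e s =>
    rw [hsta] at hv
    have := hv.2 ax
    cases hs : s ax with
    | undecided p => rw [hs] at this; exact ⟨p + 1, this.1, (this.2 sg).1⟩
    | decided p z => rw [hs] at this; exact ⟨p + 1, this.1, this.2.2 sg⟩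
    | reported z => rw [hs] at this; exact ⟨0, Nat.zero_le _, this.2 sg⟩

/-! #### The positive and negative tokens -/

theorem vectorRule_mem (ax : Axis) (sg : Bool) : vectorRule ax sg ∈ rules r :=
  mem_rules_iff.2 (.inr (.inr (.inr (.inr (.inl ⟨ax, sg, rfl⟩)))))

theorem VerInv.setVec {m : Mem A r} {S : Agent A → VState} (h : VerInv lab m S)
    (hb : Basic lab tape m) {c a : Agent A} {ax : Axis} {sg : Bool} (hs : (S c).stage ≠ .clean)
    {b : ℕ → Buf Bool}
    (hval : ∀ n, Tokens ((S c).vec ax sg) n → Tokens b n ∧ total b n = total ((S c).vec ax sg) n)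
    (hpart : ∀ k < (S c).stage.extent,
      (applyRule lab tape a m (vectorRule ax sg) (succ^[k] c)).vec = fun ax' sg' =>
        if ax' = ax ∧ sg' = sg then b k else (m (succ^[k] c)).vec ax' sg')
    (hother : ∀ x, (∀ k < (S c).stage.extent, x ≠ succ^[k] c) →
      applyRule lab tape a m (vectorRule ax sg) x = m x) :
    VerInv lab (applyRule lab tape a m (vectorRule ax sg))
      (update S c ((S c).setVec ax sg b)) := by
  classical
  have hpres := (vectorRule_preserves (r := r) ax sg).apply (lab := lab) (tape := tape) a m
  have hf : Frame m (applyRule lab tape a m (vectorRule ax sg)) c :=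
    rule_frame (vectorRule_mem ax sg) (fun x => congrArg (·.2.2.2.2.1) (hpres x))
      fun x _ => congrArg (·.2.2.2.2.2.2.2) (hpres x)
  have hc := h.at' c
  refine h.of_update hb ⟨VState.setVec_valid hc.valid hval, ?_, ?_, ?_, ?_⟩ hf
    (fun x hx _ => by rw [hother x hx]) (fun k hk => .inl hk) (fun k hk => .inl hk)
  · exact (Eq.congr_left (congrArg (·.2.2.2.2.1.2) (hpres c))).trans hc.phase
  · intro k h0 hk
    have := hc.cover k h0 hk
    exact ⟨hf.awake _ this.1, hf.cand _ this.1 this.2⟩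
  · intro k hk
    have hp := hc.part k hk
    have h1 : (applyRule lab tape a m (vectorRule ax sg) (succ^[k] c)).act = (m (succ^[k] c)).act :=
      congrArg (·.2.2.2.2.2.1) (hpres _)
    have h2 : (applyRule lab tape a m (vectorRule ax sg) (succ^[k] c)).ret = (m (succ^[k] c)).ret :=
      congrArg (·.2.2.2.2.2.2.1) (hpres _)
    rw [tokenPart, h1, h2, hpart k hk]
    refine Prod.ext (congrArg (·.1) hp) (Prod.ext ?_ (congrArg (·.2.2) hp))
    have h3 : (m (succ^[k] c)).vec = fun ax' sg' => (S c).vec ax' sg' k := congrArg (·.2.1) hp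
    funext ax' sg'
    simp only [VState.part, VState.setVec, h3]
    split_ifs <;> rfl
  · have h1 : (applyRule lab tape a m (vectorRule ax sg) c).report = (m c).report :=
      congrArg (·.2.2.2.2.2.2.2) (hpres c)
    rw [h1]
    exact hc.report

theorem setVec_self (s : AgentState r) (ax : Axis) (sg : Bool) :
    setVec s ax sg (s.vec ax sg) = s := by
  have : (fun ax' sg' => if ax' = ax ∧ sg' = sg then s.vec ax sg else s.vec ax' sg') = s.vec := by
    funext ax' sg'
    split_ifs with h
    · rw [h.1, h.2]
    · rfl
  simp only [setVec, this]

theorem VerInv.vec_eq {m : Mem A r} {S : Agent A → VState} (h : VerInv lab m S) {c : Agent A}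
    {k : ℕ} (hk : k < (S c).stage.extent) (ax : Axis) (sg : Bool) :
    (m (succ^[k] c)).vec ax sg = (S c).vec ax sg k :=
  congrFun (congrFun (congrArg (·.2.1) ((h.at' c).part k hk)) ax) sg

theorem VerInv.settle {m : Mem A r} {S : Agent A → VState} (h : VerInv lab m S)
    (hb : Basic lab tape m) {c : Agent A} {ax : Axis} {sg : Bool} {k : ℕ}
    (hk : k < (S c).stage.extent)
    (hcond : k = 0 ∨ ∃ i, k = i + 1 ∧ (S c).vec ax sg i = .two true true) :
    VerInv lab (applyRule lab tape (succ^[k] c) m (vectorRule ax sg)) (update S c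
      ((S c).setVec ax sg (update ((S c).vec ax sg) k
        (settleAll ((S c).vec ax sg k))))) := by
  have hs := stage_ne_clean_of_lt hk
  have hif : (m (succ^[k] c)).cand = true ∨ (m (succ^[k] c).pred).vec ax sg = .two true true := by
    rcases hcond with rfl | ⟨i, rfl, hi⟩
    · exact .inl (h.cand hb hs)
    · right
      rw [iterate_succ_apply', pred_succ, h.vec_eq (by omega), hi]
  have he : vectorRule ax sg (view lab tape (succ^[k] c)) (m (succ^[k] c).pred) (m (succ^[k] c))
      (m (succ^[k] c).succ) =
      { self := Amoebot.setVec (m (succ^[k] c)) ax sg (settleAll ((m (succ^[k] c)).vec ax sg)) } := by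
    rw [vectorRule, if_pos hif]
  have hne : ∀ x, x ≠ succ^[k] c →
      applyRule lab tape (succ^[k] c) m (vectorRule ax sg) x = m x := by
    intro x hx
    rw [applyRule_of_ne hx, he]
    simp
  refine h.setVec hb hs (fun n hn => ⟨hn.settle ?_, Tokens.total_settle _ _ _⟩) ?_
    fun x hx => hne x (hx k hk)
  · rintro i rfl
    obtain ⟨i', h1, h2⟩ := hcond.resolve_left (by omega)
    obtain rfl : i = i' := by omega
    exact h2
  · intro k' hk'
    by_cases hkk : k' = k
    · subst hkk
      rw [applyRule_self, he, update_self, ← h.vec_eq hk]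
      rfl
    · rw [hne _ (h.iterate_ne hb hk' hk hkk), update_of_ne hkk, ← h.vec_eq hk' ax sg]
      exact (congrArg (·.vec) (setVec_self (m (succ^[k'] c)) ax sg)).symm

theorem VerInv.move {m : Mem A r} {S : Agent A → VState} (h : VerInv lab m S)
    (hb : Basic lab tape m) {c : Agent A} {ax : Axis} {sg : Bool} {k : ℕ}
    (hk : k + 1 < (S c).stage.extent) (hne2 : (S c).vec ax sg k ≠ .two true true)
    {t : Bool} {rest : Buf Bool} (hp : ((S c).vec ax sg (k + 1)).pop = some (t, rest))
    (h2 : ((S c).vec ax sg k).size < 2) :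
    VerInv lab (applyRule lab tape (succ^[k + 1] c) m (vectorRule ax sg)) (update S c
      ((S c).setVec ax sg (Tokens.moved ((S c).vec ax sg) k t rest))) := by
  have hs := stage_ne_clean_of_lt hk
  have hpred : (succ^[k + 1] c).pred = succ^[k] c := by
    rw [iterate_succ_apply', pred_succ]
  have hcov := ((h.at' c).cover (k + 1) (by omega) hk).2
  have he : vectorRule ax sg (view lab tape (succ^[k + 1] c)) (m (succ^[k + 1] c).pred)
      (m (succ^[k + 1] c)) (m (succ^[k + 1] c).succ) =
      { self := Amoebot.setVec (m (succ^[k + 1] c)) ax sg rest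
        pred := fun p => Amoebot.setVec p ax sg ((p.vec ax sg).push t) } := by
    rw [vectorRule, hpred, h.vec_eq hk, hp, h.vec_eq (Nat.lt_of_succ_lt hk), hcov,
      if_neg (by simpa using hne2)]
    dsimp only
    rw [if_pos h2]
  have hvals : ∀ x, x ≠ succ^[k + 1] c → x ≠ succ^[k] c →
      applyRule lab tape (succ^[k + 1] c) m (vectorRule ax sg) x = m x := by
    intro x hx hx'
    rw [applyRule_of_ne hx, he, hpred, if_neg hx', ite_self]
    rfl
  refine h.setVec hb hs (fun n hn => ⟨hn.move hne2 hp h2, hn.total_move hne2 hp h2⟩) ?_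
    fun x hx => hvals x (hx _ hk) (hx _ (by omega))
  intro k' hk'
  by_cases hkk : k' = k + 1
  · subst hkk
    rw [applyRule_self, he, Tokens.moved_succ]
    rfl
  by_cases hkk' : k' = k
  · subst hkk'
    rw [applyRule_of_ne (h.iterate_ne hb hk' hk hkk), he, hpred, if_pos rfl, Tokens.moved_self,
      ← h.vec_eq hk']
    dsimp only
    rw [ite_self]
    rfl
  · rw [hvals _ (h.iterate_ne hb hk' hk hkk) (h.iterate_ne hb hk' (by omega) hkk'),
      Tokens.moved_of_ne _ _ hkk' hkk, ← h.vec_eq hk' ax sg]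
    exact (congrArg (·.vec) (setVec_self (m (succ^[k'] c)) ax sg)).symm

/-- How the verification of a candidate advances in one step. -/
def Advance (st st' : VState) (c : Agent A) (m : Mem A r) : Prop :=
  st.stage ≠ .clean ∧ st'.stage ≠ .clean ∧ st'.measure c.period < st.measure c.period ∧
    ∀ e s, st'.stage = .back e s → (∃ s', st.stage = .back e s') ∨ (m (succ^[e] c)).cand = true

theorem advance_setVec {st : VState} {ax : Axis} {sg : Bool} {b : ℕ → Buf Bool} {c : Agent A}
    {m : Mem A r} (hs : st.stage ≠ .clean)
    (h : Tokens.weight b c.period < Tokens.weight (st.vec ax sg) c.period) :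
    Advance st (st.setVec ax sg b) c m :=
  ⟨hs, hs, VState.setVec_measure_lt hs h, fun _ s hse => .inl ⟨s, hse⟩⟩

theorem applyRule_eq_self {a : Agent A} {m : Mem A r} {R : Rule r}
    (he : R (view lab tape a) (m a.pred) (m a) (m a.succ) = { self := m a }) :
    applyRule lab tape a m R = m := by
  funext z
  by_cases hz : z = a
  · rw [hz, applyRule_self, he]
  · rw [applyRule_of_ne hz, he]
    simp

theorem VerInv.vec_of_outside {m : Mem A r} {S : Agent A → VState} (h : VerInv lab m S)
    {x : Agent A} (hx : ∀ c, ∀ k < (S c).stage.extent, x ≠ succ^[k] c) :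
    (m x).act = none ∧ (∀ ax sg, (m x).vec ax sg = .empty) ∧ ∀ ax, (m x).ret ax = none := by
  have hp := h.clean x hx
  exact ⟨congrArg (·.1) hp, fun ax sg => congrFun (congrFun (congrArg (·.2.1) hp) ax) sg,
    fun ax => congrFun (congrArg (·.2.2) hp) ax⟩

-- The rule has no effect, settles tokens or moves one backward, and the last two decrease the total
-- weight.
open Classical in
theorem VerInv.vector_step {m : Mem A r} {S : Agent A → VState} (h : VerInv lab m S)
    (hb : Basic lab tape m) (a : Agent A) (ax : Axis) (sg : Bool) :
    applyRule lab tape a m (vectorRule ax sg) = m ∨ ∃ c st,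
      VerInv lab (applyRule lab tape a m (vectorRule ax sg)) (update S c st) ∧
      Advance (S c) st c m := by
  by_cases hout : ∃ c, ∃ k < (S c).stage.extent, a = succ^[k] c
  swap
  · left
    push Not at hout
    have hv := (h.vec_of_outside hout).2.1 ax sg
    refine applyRule_eq_self ?_
    rw [vectorRule, hv]
    split
    · rw [show settleAll Buf.empty = (m a).vec ax sg from hv.symm, setVec_self]
    · rfl
  obtain ⟨c, k, hk, rfl⟩ := hout
  have hs := stage_ne_clean_of_lt hk
  have hper := h.extent_le hb c
  by_cases hcond : k = 0 ∨ ∃ i, k = i + 1 ∧ (S c).vec ax sg i = .two true true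
  · by_cases hset : (S c).vec ax sg k = settleAll ((S c).vec ax sg k)
    · left
      refine applyRule_eq_self ?_
      have hif : (m (succ^[k] c)).cand = true ∨
          (m (succ^[k] c).pred).vec ax sg = .two true true := by
        rcases hcond with rfl | ⟨i, rfl, hi⟩
        · exact .inl (h.cand hb hs)
        · right
          rw [iterate_succ_apply', pred_succ, h.vec_eq (by omega), hi]
      rw [vectorRule, if_pos hif, h.vec_eq hk, ← hset, ← h.vec_eq hk, setVec_self]
    · right
      exact ⟨c, _, h.settle hb hk hcond,
        advance_setVec hs (Tokens.weight_settle_lt (by omega) hset)⟩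
  · obtain ⟨k, rfl⟩ : ∃ k', k = k' + 1 := ⟨k - 1, by omega⟩
    have hne2 : (S c).vec ax sg k ≠ .two true true := fun h' => hcond (.inr ⟨k, rfl, h'⟩)
    obtain ⟨n, hn, htok⟩ := exists_tokens hs (h.at' c).valid ax sg
    by_cases hmv : (∃ t rest, ((S c).vec ax sg (k + 1)).pop = some (t, rest)) ∧
        ((S c).vec ax sg k).size < 2
    · obtain ⟨⟨t, rest, hp⟩, h2⟩ := hmv
      right
      exact ⟨c, _, h.move hb hk hne2 hp h2,
        advance_setVec hs (htok.weight_move hne2 hp h2 (by omega))⟩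
    · left
      refine applyRule_eq_self ?_
      have hpred : (succ^[k + 1] c).pred = succ^[k] c := by
        rw [iterate_succ_apply', pred_succ]
      rw [vectorRule, hpred, h.vec_eq hk, h.vec_eq (Nat.lt_of_succ_lt hk),
        ((h.at' c).cover (k + 1) (by omega) hk).2, if_neg (by simpa using hne2)]
      cases hpop : ((S c).vec ax sg (k + 1)).pop with
      | none => rfl
      | some p =>
        dsimp only
        rw [if_neg fun h2 => hmv ⟨⟨p.1, p.2, hpop⟩, h2⟩]

/-! #### The activation token on its way forth -/

theorem activationRule_mem : activationRule ∈ rules r :=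
  mem_rules_iff.2 (.inr (.inr (.inr (.inl rfl))))

/-- The tokens after the activation token has left position `k`. -/
def VState.leave (lab : Labelling A) (c : Agent A) (k : ℕ) (st : VState) :
    Axis → Bool → ℕ → Buf Bool := fun ax sg => update (st.vec ax sg) k
  (if coord ax (outDir lab c k) = (if sg then 1 else -1) then .one false else .empty)

theorem leave_spec {st : VState} {c : Agent A} {k : ℕ} (hv : (Stage.forth k).Valid lab c st.vec)
    (ax : Axis) (sg : Bool) : Tokens (st.leave lab c k ax sg) (k + 1) ∧
      total (st.leave lab c k ax sg) (k + 1) = edgeCount lab c ax sg (k + 1) := by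
  obtain ⟨h1, h2⟩ := hv ax sg
  refine ⟨h1.create _ (by split_ifs <;> rfl), ?_⟩
  rw [VState.leave, Tokens.total_create, h2, edgeCount]
  split_ifs <;> rfl

theorem VerInv.act_eq {m : Mem A r} {S : Agent A → VState} (h : VerInv lab m S) {c : Agent A}
    {k : ℕ} (hk : k < (S c).stage.extent) :
    (m (succ^[k] c)).act = (S c).stage.actAt lab c k :=
  congrArg (·.1) ((h.at' c).part k hk)

theorem VerInv.ret_eq {m : Mem A r} {S : Agent A → VState} (h : VerInv lab m S) {c : Agent A}
    {k : ℕ} (hk : k < (S c).stage.extent) (ax : Axis) :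
    (m (succ^[k] c)).ret ax = (S c).stage.retAt lab c k ax :=
  congrFun (congrArg (·.2.2) ((h.at' c).part k hk)) ax

/-- Tokens move backward only, so the activation token always finds empty buffers on its way forth.
-/
theorem activation_vec {m : Mem A r} {S : Agent A → VState} (h : VerInv lab m S) {c : Agent A}
    {k : ℕ} (hs : (S c).stage = .forth k) :
    (fun ax sg => if coord ax (outDir lab c k) = (if sg then 1 else -1) then
      ((m (succ^[k] c)).vec ax sg).push false else (m (succ^[k] c)).vec ax sg) =
      fun ax sg => (S c).leave lab c k ax sg k := by
  have hv := (h.at' c).valid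
  rw [hs] at hv
  funext ax sg
  rw [h.vec_eq (by rw [hs]; exact Nat.lt_succ_self k), (hv ax sg).1.empty k le_rfl, VState.leave,
    update_self]
  rfl

theorem VerInv.activation_effect {m : Mem A r} {S : Agent A → VState} (h : VerInv lab m S)
    {c : Agent A} {k : ℕ} (hs : (S c).stage = .forth k)
    (hw : (m (succ^[k + 1] c)).awake = true) :
    activationRule (view lab tape (succ^[k] c)) (m (succ^[k] c).pred) (m (succ^[k] c))
      (m (succ^[k] c).succ) =
      if (m (succ^[k + 1] c)).cand then
        { self := { m (succ^[k] c) with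
                      act := none
                      vec := fun ax sg => (S c).leave lab c k ax sg k
                      ret := fun _ => some ⟨(m (succ^[k + 1] c)).aid, none⟩ } }
      else
        { self := { m (succ^[k] c) with
                      act := none, vec := fun ax sg => (S c).leave lab c k ax sg k }
          succ := fun q => { q with act := some (outDir lab c k) } } := by
  have hact := h.act_eq (c := c) (k := k) (by rw [hs]; exact Nat.lt_succ_self k)
  rw [hs, Stage.actAt, if_pos rfl] at hact
  have hout : inDir lab c k + ((view lab tape (succ^[k] c)).turn : ZMod 6) = outDir lab c k :=
    inDir_add_turn c k
  rw [iterate_succ_apply'] at hw ⊢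
  simp only [activationRule, hact, hout, activation_vec h hs]
  rw [if_neg (by rw [hw]; simp)]

theorem activation_frame (a : Agent A) (m : Mem A r) (c : Agent A) :
    Frame m (applyRule lab tape a m activationRule) c :=
  rule_frame activationRule_mem
    (fun x => congrArg (·.2.2.2.2.1) (activationRule_preserves.apply a m x))
    (fun x _ => congrArg (·.2.2.2.2.2) (activationRule_preserves.apply a m x))

/-- The next agent does not take part in any verification. -/
theorem VerInv.next_outside {m : Mem A r} {S : Agent A → VState} (h : VerInv lab m S)
    (hb : Basic lab tape m) {c : Agent A} {k : ℕ} (hs : (S c).stage = .forth k)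
    (hc : (m (succ^[k + 1] c)).cand = false) :
    ∀ c', ∀ k' < (S c').stage.extent, succ^[k + 1] c ≠ succ^[k'] c' := by
  intro c' k' hk' he
  have hkext : k < (S c).stage.extent := by rw [hs]; exact Nat.lt_succ_self k
  rcases Nat.eq_zero_or_pos k' with rfl | h0
  · rw [he] at hc
    have := h.cand hb (stage_ne_clean_of_lt hk')
    rw [iterate_zero, id] at hc
    rw [hc] at this
    cases this
  -- If the next agent were an inner agent of some stretch, the agent before it would lie in that
  -- stretch too, which must then be the one of `c` itself.
  · obtain ⟨k', rfl⟩ : ∃ i, k' = i + 1 := ⟨k' - 1, by omega⟩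
    rw [iterate_succ_apply', iterate_succ_apply'] at he
    obtain ⟨rfl, rfl⟩ := h.disjoint hb hkext (Nat.lt_of_succ_lt hk') (succ_injective he)
    rw [hs] at hk'
    exact absurd hk' (lt_irrefl _)

-- The stretch grows by one agent, and by `VerInv.next_outside` this agent belongs to no other
-- stretch.
open Classical in
theorem VerInv.advance_forth {m : Mem A r} {S : Agent A → VState} (h : VerInv lab m S)
    (hb : Basic lab tape m) {c : Agent A} {k : ℕ} (hs : (S c).stage = .forth k)
    (hw : (m (succ^[k + 1] c)).awake = true) (hc : (m (succ^[k + 1] c)).cand = false) :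
    VerInv lab (applyRule lab tape (succ^[k] c) m activationRule)
      (update S c ⟨.forth (k + 1), (S c).leave lab c k⟩) := by
  have hkext : k < (S c).stage.extent := by rw [hs]; exact Nat.lt_succ_self k
  have he := h.activation_effect (tape := tape) hs hw
  rw [hc] at he
  simp only [Bool.false_eq_true, if_false] at he
  have hnext := h.next_outside hb hs hc
  have hv := (h.at' c).valid
  rw [hs] at hv
  have hsucc : (succ^[k] c).succ = succ^[k + 1] c := (iterate_succ_apply' _ _ _).symm
  have hne : succ^[k + 1] c ≠ succ^[k] c := hnext c k hkext
  have hval : ∀ x, x ≠ succ^[k] c → x ≠ succ^[k + 1] c →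
      applyRule lab tape (succ^[k] c) m activationRule x = m x := by
    intro x hx hx'
    rw [applyRule_of_ne hx, he, hsucc, if_neg hx', ite_self]
    rfl
  have hf := activation_frame (lab := lab) (tape := tape) (succ^[k] c) m c
  have hcat := h.at' c
  refine h.of_update hb ⟨fun ax sg => leave_spec hv ax sg, ?_, ?_, ?_, ?_⟩ hf ?_ ?_ ?_
  · refine (Eq.congr_left ?_).trans (hcat.phase.trans ?_)
    · exact congrArg (·.2.2.2.2.1.2) (activationRule_preserves.apply (succ^[k] c) m c)
    · rw [hs]; simp
  · intro i h0 hi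
    have hi' : i < k + 1 ∨ i = k + 1 := by
      have : i < k + 1 + 1 := hi
      omega
    rcases hi' with hi' | rfl
    · have := hcat.cover i h0 (by rw [hs]; exact hi')
      exact ⟨hf.awake _ this.1, hf.cand _ this.1 this.2⟩
    · exact ⟨hf.awake _ hw, hf.cand _ hw hc⟩
  · intro i hi
    have hi3 : i < k + 1 + 1 := hi
    rcases Nat.lt_trichotomy i k with hik | rfl | hik
    · have hiext : i < (S c).stage.extent := by rw [hs]; exact Nat.lt_succ_of_lt hik
      rw [hval _ (h.iterate_ne hb hiext hkext hik.ne) fun h' => hnext c i hiext h'.symm,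
        hcat.part i hiext]
      refine Prod.ext ?_ (Prod.ext ?_ ?_)
      · simp only [VState.part, hs, Stage.actAt, if_neg hik.ne, if_neg (show i ≠ k + 1 by omega)]
      · funext ax sg
        simp only [VState.part, VState.leave]
        rw [update_of_ne hik.ne]
      · funext ax
        simp only [VState.part, hs, Stage.retAt]
    · rw [applyRule_self, he]
      refine Prod.ext ?_ (Prod.ext rfl ?_)
      · simp only [VState.part, Stage.actAt, if_neg (show i ≠ i + 1 by omega)]
        rfl
      · funext ax
        show (m (succ^[i] c)).ret ax = _
        rw [h.ret_eq hkext, hs]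
        rfl
    · obtain rfl : i = k + 1 := by omega
      have hcl := h.clean _ hnext
      rw [applyRule_of_ne hne, he, hsucc, if_pos rfl, ite_self]
      refine Prod.ext ?_ (Prod.ext ?_ ?_)
      · simp only [VState.part, Stage.actAt, if_true, inDir_succ]
        rfl
      · refine (congrArg (·.2.1) hcl).trans ?_
        funext ax sg
        exact ((leave_spec hv ax sg).1.empty (k + 1) le_rfl).symm
      · exact congrArg (·.2.2) hcl
  · intro ax
    have h1 := congrArg (·.2.2.2.2.2) (activationRule_preserves.apply (lab := lab) (tape := tape) (succ^[k] c) m c)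
    dsimp only at h1
    rw [h1, hcat.report, hs]
    rfl
  · intro x hx hx'
    rw [hval x (hx k hkext) (hx' (k + 1) (Nat.lt_succ_self _))]
  · intro i hi
    have hi3 : i < k + 1 + 1 := hi
    rcases Nat.lt_succ_iff_lt_or_eq.1 hi3 with hi4 | rfl
    · left; rw [hs]; exact hi4
    · exact .inr hnext
  · intro i hi
    left
    rw [hs] at hi
    exact Nat.lt_succ_of_lt hi

-- The next candidate does not join the stretch, but the edge to it has been counted.
open Classical in
theorem VerInv.turn_back {m : Mem A r} {S : Agent A → VState} (h : VerInv lab m S)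
    (hb : Basic lab tape m) {c : Agent A} {k : ℕ} (hs : (S c).stage = .forth k)
    (hw : (m (succ^[k + 1] c)).awake = true) (hc : (m (succ^[k + 1] c)).cand = true) :
    VerInv lab (applyRule lab tape (succ^[k] c) m activationRule)
      (update S c ⟨.back (k + 1) fun _ => .undecided k, (S c).leave lab c k⟩) := by
  have hkext : k < (S c).stage.extent := by rw [hs]; exact Nat.lt_succ_self k
  have he := h.activation_effect (tape := tape) hs hw
  rw [hc, if_pos rfl, hb.aid_eq _ hw] at he
  have hv := (h.at' c).valid
  rw [hs] at hv
  have hval : ∀ x, x ≠ succ^[k] c →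
      applyRule lab tape (succ^[k] c) m activationRule x = m x := by
    intro x hx
    rw [applyRule_of_ne hx, he]
    simp only [ite_self]
    rfl
  have hf := activation_frame (lab := lab) (tape := tape) (succ^[k] c) m c
  have hcat := h.at' c
  refine h.of_update hb ⟨⟨Nat.succ_pos k, fun ax => ⟨Nat.lt_succ_self k, leave_spec hv ax⟩⟩,
    ?_, ?_, ?_, ?_⟩ hf ?_ ?_ ?_
  · refine (Eq.congr_left ?_).trans (hcat.phase.trans ?_)
    · exact congrArg (·.2.2.2.2.1.2) (activationRule_preserves.apply (succ^[k] c) m c)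
    · rw [hs]; simp
  · intro i h0 hi
    have := hcat.cover i h0 (by rw [hs]; exact hi)
    exact ⟨hf.awake _ this.1, hf.cand _ this.1 this.2⟩
  · intro i hi
    have hiext : i < (S c).stage.extent := by rw [hs]; exact hi
    by_cases hik : i = k
    · subst hik
      rw [applyRule_self, he]
      refine Prod.ext rfl (Prod.ext rfl ?_)
      funext ax
      simp only [VState.part, Stage.retAt, AxisStage.retAt, if_true]
      rfl
    · rw [hval _ (h.iterate_ne hb hiext hkext hik), hcat.part i hiext]
      refine Prod.ext ?_ (Prod.ext ?_ ?_)
      · simp only [VState.part, hs, Stage.actAt, if_neg hik]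
      · funext ax sg
        simp only [VState.part, VState.leave]
        rw [update_of_ne hik]
      · funext ax
        simp only [VState.part, hs, Stage.retAt, AxisStage.retAt, if_neg hik]
  · intro ax
    have h1 := congrArg (·.2.2.2.2.2) (activationRule_preserves.apply (lab := lab) (tape := tape) (succ^[k] c) m c)
    dsimp only at h1
    rw [h1, hcat.report, hs]
    rfl
  · intro x hx _
    rw [hval x (hx k hkext)]
  · intro i hi
    left; rw [hs]; exact hi
  · intro i hi
    left; rw [hs] at hi; exact hi

open Classical in
theorem VerInv.activation_progress {m : Mem A r} {S : Agent A → VState} (h : VerInv lab m S)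
    (hb : Basic lab tape m) {c : Agent A} {k : ℕ} (hs : (S c).stage = .forth k)
    (hw : (m (succ^[k + 1] c)).awake = true) : ∃ st,
      VerInv lab (applyRule lab tape (succ^[k] c) m activationRule) (update S c st) ∧
      Advance (S c) st c m := by
  have hper := h.extent_le hb c
  have hext : (S c).stage.extent = k + 1 := by rw [hs]; rfl
  have hne : (S c).stage ≠ .clean := by rw [hs]; simp
  cases hc : (m (succ^[k + 1] c)).cand
  · refine ⟨_, h.advance_forth hb hs hw hc, hne, by simp, ?_, by simp⟩
    rw [VState.measure, VState.measure, hs]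
    refine Prod.Lex.lt_iff.2 (.inl ?_)
    simp only [ofLex_toLex]
    omega
  · refine ⟨_, h.turn_back hb hs hw hc, hne, by simp, ?_, ?_⟩
    · rw [VState.measure, VState.measure, hs]
      refine Prod.Lex.lt_iff.2 (.inl ?_)
      simp only [ofLex_toLex]
      omega
    · intro e s hse
      simp only [Stage.back.injEq] at hse
      rw [← hse.1]
      exact .inr hc

open Classical in
theorem VerInv.activation_step {m : Mem A r} {S : Agent A → VState} (h : VerInv lab m S)
    (hb : Basic lab tape m) (a : Agent A) :
    applyRule lab tape a m activationRule = m ∨ ∃ c st,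
      VerInv lab (applyRule lab tape a m activationRule) (update S c st) ∧
      Advance (S c) st c m := by
  cases hact : (m a).act with
  | none =>
    left
    refine applyRule_eq_self ?_
    simp [activationRule, hact]
  | some i =>
    by_cases hout : ∃ c, ∃ k < (S c).stage.extent, a = succ^[k] c
    swap
    · push Not at hout
      rw [(h.vec_of_outside hout).1] at hact
      cases hact
    obtain ⟨c, k, hk, rfl⟩ := hout
    have h1 := h.act_eq hk
    rw [hact] at h1
    cases hs : (S c).stage with
    | clean => rw [hs] at h1; cases h1
    | back e s => rw [hs] at h1; cases h1
    | forth j =>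
      rw [hs, Stage.actAt] at h1
      obtain rfl : k = j := by
        by_contra hkj
        rw [if_neg hkj] at h1
        cases h1
      by_cases hw : (m (succ^[k + 1] c)).awake = true
      · exact .inr ⟨c, h.activation_progress hb hs hw⟩
      · left
        rw [iterate_succ_apply'] at hw
        refine applyRule_eq_self ?_
        simp [activationRule, hact, hw]

/-! #### The activation token on its way back -/

theorem returnRule_mem (ax : Axis) : returnRule ax ∈ rules r :=
  mem_rules_iff.2 (.inr (.inr (.inr (.inr (.inr (.inl ⟨ax, rfl⟩))))))

/-- The agent forgets all tokens of an axis. -/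
def clearAxis (s : AgentState r) (ax : Axis) : AgentState r :=
  setRet (setVec (setVec s ax true .empty) ax false .empty) ax none

theorem clearAxis_vec (s : AgentState r) (ax : Axis) :
    (clearAxis s ax).vec = fun ax' sg => if ax' = ax then .empty else s.vec ax' sg := by
  funext ax' sg
  simp only [clearAxis, setRet, setVec]
  cases sg <;> by_cases h : ax' = ax <;> simp [h]

theorem returnRule_none {ax : Axis} {v : LocalView r} {p s q : AgentState r}
    (h : s.ret ax = none) : returnRule ax v p s q = { self := s } := by
  simp [returnRule, h]

theorem returnRule_wait {ax : Axis} {v : LocalView r} {p s q : AgentState r} {i : Fin 3}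
    (h : s.ret ax = some ⟨i, none⟩)
    (hs : ¬ (s.vec ax true = settleAll (s.vec ax true) ∧ s.vec ax false = settleAll (s.vec ax false))) :
    returnRule ax v p s q = { self := s } := by
  simp only [returnRule, h, if_neg hs]

theorem returnRule_move {ax : Axis} {v : LocalView r} {p s q : AgentState r} {i : Fin 3}
    (h : s.ret ax = some ⟨i, none⟩) (h1 : s.vec ax true = .empty) (h2 : s.vec ax false = .empty)
    (hc : s.cand = false) : returnRule ax v p s q =
      { self := setRet s ax none, pred := fun p => setRet p ax (some ⟨i, none⟩) } := by
  simp only [returnRule, h, h1, h2, hc]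
  rfl

theorem returnRule_go {ax : Axis} {v : LocalView r} {p s q : AgentState r} {i : Fin 3} {z : Bool}
    (h : s.ret ax = some ⟨i, some z⟩ ∨ s.ret ax = some ⟨i, none⟩ ∧
      (s.vec ax true = settleAll (s.vec ax true) ∧ s.vec ax false = settleAll (s.vec ax false)) ∧
      ¬ (s.vec ax true = .empty ∧ s.vec ax false = .empty ∧ s.cand = false) ∧
      z = decide ((s.vec ax true).size = (s.vec ax false).size)) :
    returnRule ax v p s q =
      if s.cand then
        { self := { clearAxis s ax with
            report := fun ax' =>
              if ax' = ax then some (z && decide (i = s.aid)) else s.report ax' } }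
      else
        { self := clearAxis s ax, pred := fun p => setRet p ax (some ⟨i, some z⟩) } := by
  rcases h with h | ⟨h, h1, h2, rfl⟩
  · simp only [returnRule, h]
    rfl
  · simp only [returnRule, h, if_pos h1, if_neg h2]
    rfl

theorem return_candidatePart (ax : Axis) (a : Agent A) (m : Mem A r) (x : Agent A) :
    (applyRule lab tape a m (returnRule ax) x).candidatePart = (m x).candidatePart :=
  congrArg (·.2.2.2.2.1) ((returnRule_preserves ax).apply a m x)

theorem return_act (ax : Axis) (a : Agent A) (m : Mem A r) (x : Agent A) :
    (applyRule lab tape a m (returnRule ax) x).act = (m x).act :=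
  congrArg (·.2.2.2.2.2) ((returnRule_preserves ax).apply a m x)

/-- A step of the activation token on its way back, in terms of the new memories. -/
theorem VerInv.return_update {m : Mem A r} {S : Agent A → VState} (h : VerInv lab m S)
    (hb : Basic lab tape m) {c a : Agent A} {e : ℕ} {s s' : Axis → AxisStage} {ax : Axis}
    {vec : Axis → Bool → ℕ → Buf Bool}
    (hs : (S c).stage = .back e s) (hs' : ∀ ax' ≠ ax, s' ax' = s ax')
    (hval : (s' ax).Valid lab c e ax (vec ax)) (hvec : ∀ ax' ≠ ax, vec ax' = (S c).vec ax')
    (hother : ∀ x, (∀ k < e, x ≠ succ^[k] c) → applyRule lab tape a m (returnRule ax) x = m x)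
    (hv : ∀ k < e, ∀ ax' sg, (applyRule lab tape a m (returnRule ax) (succ^[k] c)).vec ax' sg =
      if ax' = ax then vec ax sg k else (m (succ^[k] c)).vec ax' sg)
    (hr : ∀ k < e, ∀ ax', (applyRule lab tape a m (returnRule ax) (succ^[k] c)).ret ax' =
      if ax' = ax then (s' ax).retAt (lab.aid (succ^[e] c)) k else (m (succ^[k] c)).ret ax')
    (hrep : ∀ x ≠ c, (applyRule lab tape a m (returnRule ax) x).report = (m x).report)
    (hrep' : ∀ ax', (applyRule lab tape a m (returnRule ax) c).report ax' =
      if ax' = ax then (s' ax).report else (m c).report ax') :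
    VerInv lab (applyRule lab tape a m (returnRule ax)) (update S c ⟨.back e s', vec⟩) := by
  classical
  have hf : Frame m (applyRule lab tape a m (returnRule ax)) c :=
    rule_frame (returnRule_mem ax) (return_candidatePart ax a m) hrep
  have hcat := h.at' c
  have hvalid := hcat.valid
  rw [hs] at hvalid
  have hext : (S c).stage.extent = e := by rw [hs]; rfl
  refine h.of_update hb ⟨⟨hvalid.1, fun ax' => ?_⟩, ?_, ?_, ?_, ?_⟩ hf
    (fun x hx _ => by rw [hother x (by rwa [hext] at hx)]) (fun k hk => .inl (by rwa [hext]))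
    (fun k hk => .inl (by rwa [hext] at hk))
  · by_cases hax : ax' = ax
    · subst hax; exact hval
    · dsimp only
      rw [hs' ax' hax, hvec ax' hax]
      exact hvalid.2 ax'
  · refine (Eq.congr_left (congrArg (·.2) (return_candidatePart ax a m c))).trans
      (hcat.phase.trans ?_)
    rw [hs]; simp
  · intro i h0 hi
    have := hcat.cover i h0 (by rw [hext]; exact hi)
    exact ⟨hf.awake _ this.1, hf.cand _ this.1 this.2⟩
  · intro i hi
    have hi' : i < e := hi
    have hp := hcat.part i (by rwa [hext])
    refine Prod.ext ?_ (Prod.ext ?_ ?_)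
    · refine (return_act ax a m _).trans ((congrArg (·.1) hp).trans ?_)
      simp only [VState.part, hs, Stage.actAt]
    · funext ax' sg
      refine (hv i hi' ax' sg).trans ?_
      simp only [VState.part]
      split_ifs with hax
      · rw [hax]
      · rw [hvec ax' hax]
        exact congrFun (congrFun (congrArg (·.2.1) hp) ax') sg
    · funext ax'
      refine (hr i hi' ax').trans ?_
      simp only [VState.part, Stage.retAt]
      split_ifs with hax
      · rw [hax]
      · rw [hs' ax' hax]
        refine (congrFun (congrArg (·.2.2) hp) ax').trans ?_
        simp only [VState.part, hs, Stage.retAt]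
  · intro ax'
    rw [hrep' ax']
    simp only [Stage.report]
    split_ifs with hax
    · rw [hax]
    · rw [hs' ax' hax, hcat.report, hs]
      rfl

-- Nothing is lost by leaving an empty position: all tokens lie before it, and their totals are
-- unchanged.
open Classical in
theorem VerInv.retreat {m : Mem A r} {S : Agent A → VState} (h : VerInv lab m S)
    (hb : Basic lab tape m) {c : Agent A} {e p : ℕ} {s : Axis → AxisStage} {ax : Axis}
    (hs : (S c).stage = .back e s) (hax : s ax = .undecided (p + 1))
    (h1 : (S c).vec ax true (p + 1) = .empty) (h2 : (S c).vec ax false (p + 1) = .empty) :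
    VerInv lab (applyRule lab tape (succ^[p + 1] c) m (returnRule ax))
      (update S c ⟨.back e (update s ax (.undecided p)), (S c).vec⟩) := by
  have hcat := h.at' c
  have hvalid := hcat.valid
  rw [hs] at hvalid
  have hvax := hvalid.2 ax
  rw [hax] at hvax
  obtain ⟨hpe, htok⟩ := hvax
  have hext : (S c).stage.extent = e := by rw [hs]; rfl
  have hpred : (succ^[p + 1] c).pred = succ^[p] c := by
    rw [iterate_succ_apply', pred_succ]
  have hk : p + 1 < (S c).stage.extent := by rwa [hext]
  have hk' : p < (S c).stage.extent := by omega
  have hret := h.ret_eq hk ax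
  rw [hs, Stage.retAt, hax, AxisStage.retAt, if_pos rfl] at hret
  have he : returnRule ax (view lab tape (succ^[p + 1] c)) (m (succ^[p + 1] c).pred)
      (m (succ^[p + 1] c)) (m (succ^[p + 1] c).succ) = _ :=
    returnRule_move hret (by rw [h.vec_eq hk, h1]) (by rw [h.vec_eq hk, h2])
      (hcat.cover (p + 1) (by omega) hk).2
  have hne := h.iterate_ne hb hk' hk (by omega)
  have v1 : applyRule lab tape (succ^[p + 1] c) m (returnRule ax) (succ^[p + 1] c) =
      setRet (m (succ^[p + 1] c)) ax none := by rw [applyRule_self, he]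
  have v2 : applyRule lab tape (succ^[p + 1] c) m (returnRule ax) (succ^[p] c) =
      setRet (m (succ^[p] c)) ax (some ⟨lab.aid (succ^[e] c), none⟩) := by
    rw [applyRule_of_ne hne, he, hpred, if_pos rfl, ite_self]; rfl
  have v3 : ∀ x, x ≠ succ^[p + 1] c → x ≠ succ^[p] c →
      applyRule lab tape (succ^[p + 1] c) m (returnRule ax) x = m x := by
    intro x hx hx'
    rw [applyRule_of_ne hx, he, hpred, if_neg hx', ite_self]; rfl
  have hrep : ∀ x, (applyRule lab tape (succ^[p + 1] c) m (returnRule ax) x).report =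
      (m x).report := by
    intro x
    by_cases hx : x = succ^[p + 1] c
    · rw [hx, v1]; rfl
    by_cases hx' : x = succ^[p] c
    · rw [hx', v2]; rfl
    rw [v3 x hx hx']
  have htok' : ∀ sg, Tokens ((S c).vec ax sg) (p + 1) := by
    intro sg
    have := (htok sg).1.erase
    rwa [Function.update_eq_self_iff.2] at this
    cases sg
    · exact h2.symm
    · exact h1.symm
  refine h.return_update hb hs (fun ax' hax' => update_of_ne hax' _ _) ?_
    (fun _ _ => rfl) (fun x hx => v3 x (hx _ hpe) (hx _ (by omega))) ?_ ?_ (fun x _ => hrep x) ?_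
  · rw [update_self]
    exact ⟨by omega, fun sg => ⟨htok' sg, by
      rw [← (htok sg).2, (htok' sg).total_eq (Nat.le_succ _)]⟩⟩
  · intro k hke ax' sg
    have : (applyRule lab tape (succ^[p + 1] c) m (returnRule ax) (succ^[k] c)).vec =
        (m (succ^[k] c)).vec := by
      by_cases hx : succ^[k] c = succ^[p + 1] c
      · rw [hx, v1]; rfl
      by_cases hx' : succ^[k] c = succ^[p] c
      · rw [hx', v2]; rfl
      rw [v3 _ hx hx']
    rw [this]
    split_ifs with hax'
    · rw [hax', h.vec_eq (by rwa [hext])]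
    · rfl
  · intro k hke ax'
    have hkext : k < (S c).stage.extent := by rwa [hext]
    rw [update_self, AxisStage.retAt]
    by_cases hx : k = p + 1
    · subst hx
      rw [v1, if_neg (show p + 1 ≠ p by omega)]
      rfl
    by_cases hx' : k = p
    · subst hx'
      rw [v2, if_pos rfl]
      rfl
    · rw [v3 _ (h.iterate_ne hb hkext hk hx) (h.iterate_ne hb hkext hk' hx'), if_neg hx']
      split_ifs with hax'
      · rw [hax', h.ret_eq hkext, hs, Stage.retAt, hax, AxisStage.retAt, if_neg hx]
      · rfl
  · intro ax'
    rw [hrep c, update_self]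
    split_ifs with hax'
    · rw [hax', hcat.report, hs, Stage.report, hax]
      rfl
    · rfl

/-- The decision is made, or has been made, at position `p`. -/
def Deciding (st : VState) (ax : Axis) (p : ℕ) (z : Bool) : AxisStage → Prop
  | .decided q z' => q = p ∧ z' = z
  | .undecided q => q = p ∧ (st.vec ax true p = settleAll (st.vec ax true p) ∧
      st.vec ax false p = settleAll (st.vec ax false p)) ∧
      (¬ (st.vec ax true p = .empty ∧ st.vec ax false p = .empty) ∨ p = 0) ∧
      z = decide ((st.vec ax true p).size = (st.vec ax false p).size)
  | .reported _ => False

/-- At position 0 the decision is reported, combined with the comparison `b` of the agent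
identifiers; elsewhere it is carried one position back. -/
def AxisStage.next (b : Bool) (z : Bool) : ℕ → AxisStage
  | 0 => .reported (z && b)
  | p + 1 => .decided p z

-- This treats the moment of the decision, which is correct by `Tokens.size_eq_iff`, together with
-- the transport of a decision already made. In both cases the tokens at the position are erased, so
-- nothing remains behind the returning token.
open Classical in
theorem VerInv.decide {m : Mem A r} {S : Agent A → VState} (h : VerInv lab m S)
    (hb : Basic lab tape m) {c : Agent A} {e p : ℕ} {s : Axis → AxisStage} {ax : Axis} {z : Bool}
    (hs : (S c).stage = .back e s) (hd : Deciding (S c) ax p z (s ax)) :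
    VerInv lab (applyRule lab tape (succ^[p] c) m (returnRule ax)) (update S c
      ⟨.back e (update s ax
        (.next (Decidable.decide (lab.aid (succ^[e] c) = lab.aid c)) z p)), fun ax' sg =>
          if ax' = ax then update ((S c).vec ax' sg) p .empty else (S c).vec ax' sg⟩) := by
  have hcat := h.at' c
  have hvalid := hcat.valid
  rw [hs] at hvalid
  have hvax := hvalid.2 ax
  have hext : (S c).stage.extent = e := by rw [hs]; rfl
  have hne : (S c).stage ≠ .clean := by rw [hs]; simp
  have hcc := h.cand hb hne
  -- facts about the position and the decision
  obtain ⟨hpe, htok, hz⟩ : p < e ∧ (∀ sg, Tokens ((S c).vec ax sg) (p + 1)) ∧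
      (z = true ↔ Balanced lab c ax e) := by
    cases hsa : s ax with
    | reported b => rw [hsa] at hd; exact hd.elim
    | decided q z' =>
      rw [hsa] at hd hvax
      obtain ⟨rfl, rfl⟩ := hd
      exact ⟨hvax.1, hvax.2.2, hvax.2.1⟩
    | undecided q =>
      rw [hsa] at hd hvax
      obtain ⟨rfl, ⟨d1, d2⟩, d3, rfl⟩ := hd
      refine ⟨hvax.1, fun sg => (hvax.2 sg).1, ?_⟩
      rw [decide_eq_true_eq, (hvax.2 true).1.size_eq_iff (hvax.2 false).1 d1 d2 d3,
        (hvax.2 true).2, (hvax.2 false).2]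
      rfl
  have hk : p < (S c).stage.extent := by rwa [hext]
  have hcand : (m (succ^[p] c)).cand = Decidable.decide (p = 0) := by
    rcases Nat.eq_zero_or_pos p with rfl | h0
    · exact hcc
    · rw [(hcat.cover p h0 hk).2, decide_eq_false h0.ne']
  have hret := h.ret_eq hk ax
  rw [hs, Stage.retAt] at hret
  have hgo : (m (succ^[p] c)).ret ax = some ⟨lab.aid (succ^[e] c), some z⟩ ∨
      (m (succ^[p] c)).ret ax = some ⟨lab.aid (succ^[e] c), none⟩ ∧
      ((m (succ^[p] c)).vec ax true = settleAll ((m (succ^[p] c)).vec ax true) ∧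
        (m (succ^[p] c)).vec ax false = settleAll ((m (succ^[p] c)).vec ax false)) ∧
      ¬ ((m (succ^[p] c)).vec ax true = .empty ∧ (m (succ^[p] c)).vec ax false = .empty ∧
        (m (succ^[p] c)).cand = false) ∧
      z = Decidable.decide (((m (succ^[p] c)).vec ax true).size =
        ((m (succ^[p] c)).vec ax false).size) := by
    rw [h.vec_eq hk, h.vec_eq hk, hret]
    cases hsa : s ax with
    | reported b => rw [hsa] at hd; exact hd.elim
    | decided q z' =>
      rw [hsa] at hd
      obtain ⟨rfl, rfl⟩ := hd
      exact .inl (if_pos rfl)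
    | undecided q =>
      rw [hsa] at hd
      obtain ⟨rfl, d1, d3, d4⟩ := hd
      refine .inr ⟨if_pos rfl, d1, ?_, d4⟩
      rintro ⟨e1, e2, e3⟩
      rw [hcand, decide_eq_false_iff_not] at e3
      exact (d3.resolve_right e3) ⟨e1, e2⟩
  have hret' : ∀ k < e, k ≠ p → (m (succ^[k] c)).ret ax = none := by
    intro k hke hkp
    rw [h.ret_eq (by rwa [hext]), hs, Stage.retAt]
    cases hsa : s ax with
    | reported b => rfl
    | decided q z' =>
      rw [hsa] at hd
      obtain ⟨rfl, rfl⟩ := hd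
      exact if_neg hkp
    | undecided q =>
      rw [hsa] at hd
      obtain ⟨rfl, -⟩ := hd
      exact if_neg hkp
  have hrepc : (m c).report ax = none := by
    rw [hcat.report, hs, Stage.report]
    cases hsa : s ax with
    | reported b => rw [hsa] at hd; exact hd.elim
    | decided q z' => rfl
    | undecided q => rfl
  have he : returnRule ax (view lab tape (succ^[p] c)) (m (succ^[p] c).pred)
      (m (succ^[p] c)) (m (succ^[p] c).succ) = _ := returnRule_go hgo
  rw [hcand] at he
  have herase : ∀ sg, Tokens (update ((S c).vec ax sg) p .empty) p :=
    fun sg => (htok sg).erase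
  have hvecs : ∀ x : Agent A, ∀ k < e, succ^[k] c = x → ∀ ax' sg,
      (if k = p then (clearAxis (m x) ax).vec ax' sg else (m x).vec ax' sg) =
      if ax' = ax then (if ax = ax then update ((S c).vec ax sg) p .empty
        else (S c).vec ax sg) k else (m x).vec ax' sg := by
    rintro x k hke rfl ax' sg
    rw [clearAxis_vec, if_pos rfl]
    by_cases hax : ax' = ax
    · subst hax
      by_cases hkp : k = p
      · subst hkp; simp
      · rw [if_neg hkp, if_pos rfl, update_of_ne hkp, h.vec_eq (by rwa [hext])]
    · simp [hax]
  cases p with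
  | zero =>
    rw [decide_eq_true rfl, if_pos rfl] at he
    have v1 : applyRule lab tape (succ^[0] c) m (returnRule ax) c = _ :=
      (applyRule_self c _ _).trans (congrArg Effect.self he)
    have v3 : ∀ x, x ≠ c → applyRule lab tape (succ^[0] c) m (returnRule ax) x = m x := by
      intro x hx
      rw [iterate_zero, id]
      have he' := he
      rw [iterate_zero, id] at he'
      rw [applyRule_of_ne hx, he', ite_self, ite_self]; rfl
    refine h.return_update hb hs (fun ax' hax' => update_of_ne hax' _ _) ?_
      (fun ax' hax' => by simp [hax']) (fun x hx => v3 x (hx 0 hpe)) ?_ ?_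
      (fun x hx => by rw [v3 x hx]) ?_
    · rw [update_self]
      refine ⟨?_, fun sg => ?_⟩
      · rw [Bool.and_eq_true, hz, decide_eq_true_eq]
      · dsimp only; rw [if_pos rfl]; exact herase sg
    · intro k hke ax' sg
      rw [← hvecs _ k hke rfl ax' sg]
      by_cases hk0 : k = 0
      · subst hk0
        rw [if_pos rfl]
        show (applyRule lab tape (succ^[0] c) m (returnRule ax) c).vec ax' sg = _
        rw [v1]
      · rw [if_neg hk0, v3 _ (h.iterate_ne hb (k' := 0) (by rwa [hext]) hk hk0)]
    · intro k hke ax'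
      rw [update_self]
      simp only [AxisStage.next, AxisStage.retAt]
      by_cases hk0 : k = 0
      · subst hk0
        show (applyRule lab tape (succ^[0] c) m (returnRule ax) c).ret ax' = _
        rw [v1]
        rfl
      · rw [v3 _ (h.iterate_ne hb (k' := 0) (by rwa [hext]) hk hk0)]
        split_ifs with hax
        · rw [hax, hret' k hke hk0]
        · rfl
    · intro ax'
      rw [v1, update_self]
      simp only [AxisStage.next, AxisStage.report, iterate_zero, id]
      have haid := hb.aid_eq _ (hb.awake_of_cand _ hcc)
      congr 3
      exact decide_eq_decide.2 (by rw [← haid])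
  | succ p =>
    rw [decide_eq_false (Nat.succ_ne_zero p), if_neg (by simp)] at he
    have hpred : (succ^[p + 1] c).pred = succ^[p] c := by
      rw [iterate_succ_apply', pred_succ]
    have hk' : p < (S c).stage.extent := by omega
    have hnep := h.iterate_ne hb hk' hk (by omega)
    have v1 : applyRule lab tape (succ^[p + 1] c) m (returnRule ax) (succ^[p + 1] c) =
        clearAxis (m (succ^[p + 1] c)) ax := by rw [applyRule_self, he]
    have v2 : applyRule lab tape (succ^[p + 1] c) m (returnRule ax) (succ^[p] c) =
        setRet (m (succ^[p] c)) ax (some ⟨lab.aid (succ^[e] c), some z⟩) := by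
      rw [applyRule_of_ne hnep, he, hpred, if_pos rfl, ite_self]; rfl
    have v3 : ∀ x, x ≠ succ^[p + 1] c → x ≠ succ^[p] c →
        applyRule lab tape (succ^[p + 1] c) m (returnRule ax) x = m x := by
      intro x hx hx'
      rw [applyRule_of_ne hx, he, hpred, if_neg hx', ite_self]; rfl
    have hrep : ∀ x, (applyRule lab tape (succ^[p + 1] c) m (returnRule ax) x).report =
        (m x).report := by
      intro x
      by_cases hx : x = succ^[p + 1] c
      · rw [hx, v1]; rfl
      by_cases hx' : x = succ^[p] c
      · rw [hx', v2]; rfl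
      rw [v3 x hx hx']
    refine h.return_update hb hs (fun ax' hax' => update_of_ne hax' _ _) ?_
      (fun ax' hax' => by simp [hax']) (fun x hx => v3 x (hx _ hpe) (hx _ (by omega))) ?_ ?_
      (fun x _ => hrep x) ?_
    · rw [update_self]
      refine ⟨by omega, hz, fun sg => ?_⟩
      dsimp only; rw [if_pos rfl]; exact herase sg
    · intro k hke ax' sg
      have hkext : k < (S c).stage.extent := by rwa [hext]
      rw [← hvecs _ k hke rfl ax' sg]
      by_cases hx : k = p + 1
      · subst hx
        rw [if_pos rfl, v1]
      rw [if_neg hx]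
      by_cases hx' : k = p
      · subst hx'
        rw [v2]; rfl
      · rw [v3 _ (h.iterate_ne hb hkext hk hx) (h.iterate_ne hb hkext hk' hx')]
    · intro k hke ax'
      have hkext : k < (S c).stage.extent := by rwa [hext]
      rw [update_self]
      simp only [AxisStage.next, AxisStage.retAt]
      by_cases hx : k = p + 1
      · subst hx
        rw [v1, if_neg (show p + 1 ≠ p by omega)]
        rfl
      by_cases hx' : k = p
      · subst hx'
        rw [v2, if_pos rfl]
        rfl
      · rw [v3 _ (h.iterate_ne hb hkext hk hx) (h.iterate_ne hb hkext hk' hx'), if_neg hx']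
        split_ifs with hax'
        · rw [hax', hret' k hke hx]
        · rfl
    · intro ax'
      rw [hrep c, update_self]
      simp only [AxisStage.next, AxisStage.report]
      split_ifs with hax'
      · rw [hax', hrepc]
      · rfl

/-- The measure decreases if one axis advances. -/
theorem advance_axis {st : VState} {c : Agent A} {m : Mem A r} {e : ℕ} {s : Axis → AxisStage}
    {ax : Axis} {a : AxisStage} {vec : Axis → Bool → ℕ → Buf Bool} (hs : st.stage = .back e s)
    (ha : a.weight < (s ax).weight)
    (hv : ∀ ax' sg, Tokens.weight (vec ax' sg) c.period ≤ Tokens.weight (st.vec ax' sg) c.period) :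
    Advance st ⟨.back e (update s ax a), vec⟩ c m := by
  refine ⟨by rw [hs]; simp, by simp, ?_, fun e' s' hse => ?_⟩
  · rw [VState.measure, VState.measure, hs]
    refine Prod.Lex.lt_iff.2 (.inr ⟨rfl, ?_⟩)
    have h1 := hv .x true
    have h2 := hv .x false
    have h3 := hv .y true
    have h4 := hv .y false
    cases ax <;> simp [VState.vecWeight] <;> omega
  · simp only [Stage.back.injEq] at hse
    exact .inl ⟨s, by rw [hs, hse.1]⟩

theorem advance_decide {st : VState} {c : Agent A} {m : Mem A r} {e p : ℕ} {s : Axis → AxisStage}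
    {ax : Axis} {z b : Bool} (hs : st.stage = .back e s) (hd : Deciding st ax p z (s ax)) :
    Advance st ⟨.back e (update s ax (.next b z p)), fun ax' sg =>
      if ax' = ax then update (st.vec ax' sg) p .empty else st.vec ax' sg⟩ c m := by
  refine advance_axis hs ?_ fun ax' sg => ?_
  · cases hsa : s ax with
    | reported b => rw [hsa] at hd; exact hd.elim
    | decided q z' =>
      rw [hsa] at hd
      obtain ⟨rfl, rfl⟩ := hd
      cases q <;> simp [AxisStage.next, AxisStage.weight]
    | undecided q =>
      rw [hsa] at hd
      obtain ⟨rfl, -⟩ := hd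
      cases q <;> simp [AxisStage.next, AxisStage.weight]
  · split_ifs
    · exact Tokens.weight_erase_le _ _ _
    · exact le_rfl

open Classical in
theorem VerInv.return_step {m : Mem A r} {S : Agent A → VState} (h : VerInv lab m S)
    (hb : Basic lab tape m) (a : Agent A) (ax : Axis) :
    applyRule lab tape a m (returnRule ax) = m ∨ ∃ c st,
      VerInv lab (applyRule lab tape a m (returnRule ax)) (update S c st) ∧
      Advance (S c) st c m := by
  by_cases hret : (m a).ret ax = none
  · exact .inl (applyRule_eq_self (returnRule_none hret))
  by_cases hout : ∃ c, ∃ k < (S c).stage.extent, a = succ^[k] c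
  swap
  · push Not at hout
    exact absurd ((h.vec_of_outside hout).2.2 ax) hret
  obtain ⟨c, k, hk, rfl⟩ := hout
  have h1 := h.ret_eq hk ax
  cases hs : (S c).stage with
  | clean => rw [hs] at h1; exact absurd h1 hret
  | forth j => rw [hs] at h1; exact absurd h1 hret
  | back e s =>
    rw [hs, Stage.retAt] at h1
    cases hsa : s ax with
    | reported b => rw [hsa] at h1; exact absurd h1 hret
    | decided q z =>
      rw [hsa, AxisStage.retAt] at h1
      obtain rfl : k = q := by
        by_contra hkq
        rw [if_neg hkq] at h1
        exact hret h1
      have hd : Deciding (S c) ax k z (s ax) := by rw [hsa]; exact ⟨rfl, rfl⟩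
      exact .inr ⟨c, _, h.decide hb hs hd, advance_decide hs hd⟩
    | undecided q =>
      rw [hsa, AxisStage.retAt] at h1
      obtain rfl : k = q := by
        by_contra hkq
        rw [if_neg hkq] at h1
        exact hret h1
      rw [if_pos rfl] at h1
      by_cases hset : (S c).vec ax true k = settleAll ((S c).vec ax true k) ∧
          (S c).vec ax false k = settleAll ((S c).vec ax false k)
      · right
        by_cases h0 : ¬ ((S c).vec ax true k = .empty ∧ (S c).vec ax false k = .empty) ∨ k = 0
        · have hd : Deciding (S c) ax k
              (Decidable.decide (((S c).vec ax true k).size = ((S c).vec ax false k).size))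
              (s ax) := by
            rw [hsa]; exact ⟨rfl, hset, h0, rfl⟩
          exact ⟨c, _, h.decide hb hs hd, advance_decide hs hd⟩
        · push Not at h0
          obtain ⟨⟨e1, e2⟩, hk0⟩ := h0
          obtain ⟨k, rfl⟩ : ∃ k', k = k' + 1 := ⟨k - 1, by omega⟩
          exact ⟨c, _, h.retreat hb hs hsa e1 e2, advance_axis hs
            (by rw [hsa]; simp [AxisStage.weight]) fun _ _ => le_rfl⟩
      · left
        refine applyRule_eq_self (returnRule_wait h1 ?_)
        rwa [h.vec_eq hk, h.vec_eq hk]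

/-! #### The decisions of a candidate -/

theorem candidateRule_eq (a : Agent A) (m : Mem A r) [DecidableEq (Agent A)] :
    applyRule lab tape a m candidateRule = update m a
      (candidateRule (view lab tape a) (m a.pred) (m a) (m a.succ)).self := by
  funext x
  by_cases hx : x = a
  · subst hx; rw [applyRule_self, update_self]
  · rw [candidateRule_of_ne hx, update_of_ne hx]

/-- The effect of the candidate rule. -/
inductive CandidateCase (v : LocalView r) (s : AgentState r) : AgentState r → Prop
  | same : CandidateCase v s s
  | withdraw : s.cand = true → s.beaten = true → (s.phase = .idle ∨ s.phase = .requested) →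
      CandidateCase v s (withdraw s)
  | start : s.cand = true → s.beaten = false → s.phase = .requested →
      CandidateCase v s { s with phase := .solitude, act := some v.inDir }
  | verified (b₁ b₂ : Bool) : s.cand = true → s.phase = .solitude → s.report .x = some b₁ →
      s.report .y = some b₂ → CandidateCase v s
        (if s.beaten then Amoebot.withdraw { s with report := fun _ => none }
          else if b₁ && b₂ then
            { s with report := fun _ => none, phase := .boundary, angle := some 0 }
          else { s with report := fun _ => none, phase := .idle })
  | identified (k : ZMod 5) : s.cand = true → s.phase = .boundary → s.total = some k →
      CandidateCase v s (if k = 1 then { s with phase := .won, total := none }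
        else Amoebot.withdraw { s with total := none })

theorem candidateRule_case (v : LocalView r) (p s q : AgentState r) :
    CandidateCase v s (candidateRule v p s q).self := by
  obtain ⟨awake, head, cand, aid, digit, rdigit, setup, setupDone, created, queue, active, cmp,
    beaten, phase, act, vec, ret, report, angle, total⟩ := s
  cases cand with
  | false => exact .same
  | true =>
    rw [candidateRule, if_neg (by simp)]
    cases phase with
    | idle =>
      cases beaten with
      | true => exact .withdraw rfl rfl (.inl rfl)
      | false => exact .same
    | requested =>
      cases beaten with
      | true => exact .withdraw rfl rfl (.inr rfl)
      | false => exact .start rfl rfl rfl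
    | solitude =>
      dsimp only
      cases hx : report .x with
      | none => exact .same
      | some b₁ =>
        cases hy : report .y with
        | none => exact .same
        | some b₂ => exact .verified b₁ b₂ rfl rfl hx hy
    | boundary =>
      cases total with
      | none => exact .same
      | some k => exact .identified k rfl rfl rfl
    | won => exact .same

theorem VerInv.not_mem_of_cand {m : Mem A r} {S : Agent A → VState} (h : VerInv lab m S)
    {a : Agent A} (hc : (m a).cand = true) (ha : (S a).stage = .clean) (c : Agent A) (k : ℕ)
    (hk : k < (S c).stage.extent) : a ≠ succ^[k] c := by
  rintro rfl
  rcases Nat.eq_zero_or_pos k with rfl | h0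
  · exact stage_ne_clean_of_lt hk ha
  · rw [((h.at' c).cover k h0 hk).2] at hc
    cases hc

theorem VerInv.stage_eq {m : Mem A r} {S : Agent A → VState} (h : VerInv lab m S) {a : Agent A}
    (ha : (m a).phase ≠ .solitude) : (S a).stage = .clean :=
  not_not.1 fun hs => ha ((h.at' a).phase.2 hs)

-- A candidate that is not verifying lies outside all stretches, so its buffers are empty and a new
-- stretch of length one can begin there.
open Classical in
theorem VerInv.start {m : Mem A r} {S : Agent A → VState} (h : VerInv lab m S)
    (hb : Basic lab tape m) {a : Agent A} (hc : (m a).cand = true)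
    (hph : (m a).phase = .requested) :
    VerInv lab (update m a { m a with
      phase := .solitude, act := some (view lab tape a).inDir })
      (update S a ⟨.forth 0, fun _ _ _ => .empty⟩) := by
  have hs : (S a).stage = .clean := h.stage_eq (by rw [hph]; simp)
  have hout := h.not_mem_of_cand hc hs
  have hclean := h.vec_of_outside (hout)
  refine h.of_update hb ⟨?_, ?_, ?_, ?_, ?_⟩ ⟨?_, ?_, ?_, ?_⟩ ?_ ?_ ?_
  · exact fun ax sg => ⟨⟨fun _ _ => rfl, fun i hi => absurd hi (by simp [Buf.hasSettled])⟩, rfl⟩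
  · rw [update_self]; simp
  · intro k h0 hk
    exact absurd (show k < 1 from hk) (by omega)
  · intro k hk
    obtain rfl : k = 0 := by have : k < 1 := hk; omega
    rw [iterate_zero, id, update_self]
    refine Prod.ext rfl (Prod.ext ?_ ?_)
    · funext ax sg; exact hclean.2.1 ax sg
    · funext ax; exact hclean.2.2 ax
  · intro ax
    rw [update_self]
    have := (h.at' a).report ax
    rw [hs] at this
    exact this
  · intro x hx
    by_cases hxa : x = a
    · subst hxa; rw [update_self]; exact hx
    · rwa [update_of_ne hxa]
  · intro x _ hx
    by_cases hxa : x = a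
    · subst hxa; rw [update_self]; exact hx
    · rwa [update_of_ne hxa]
  · intro x hx; rw [update_of_ne hx]
  · intro x hx; rw [update_of_ne hx]
  · intro x _ hx
    rw [update_of_ne (show x ≠ a from hx 0 Nat.one_pos)]
  · intro k hk
    obtain rfl : k = 0 := by have : k < 1 := hk; omega
    exact .inr hout
  · intro k hk
    rw [hs] at hk
    exact absurd hk (Nat.not_lt_zero k)

theorem VerInv.stage_of_reported {m : Mem A r} {S : Agent A → VState} (h : VerInv lab m S)
    {a : Agent A} {b : Axis → Bool} (hr : ∀ ax, (m a).report ax = some (b ax)) :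
    ∃ e, (S a).stage = .back e fun ax => .reported (b ax) := by
  have hx := fun ax => ((h.at' a).report ax).symm.trans (hr ax)
  cases hs : (S a).stage with
  | clean => rw [hs] at hx; exact absurd (hx .x) (by simp [Stage.report])
  | forth j => rw [hs] at hx; exact absurd (hx .x) (by simp [Stage.report])
  | back e s =>
    rw [hs] at hx
    refine ⟨e, congrArg _ (funext fun ax => ?_)⟩
    have := hx ax
    simp only [Stage.report] at this
    cases hsa : s ax with
    | reported z => rw [hsa] at this; simpa [AxisStage.report] using this
    | undecided p => rw [hsa] at this; simp [AxisStage.report] at this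
    | decided p z => rw [hsa] at this; simp [AxisStage.report] at this

-- When both axes have reported, all tokens of the stretch have been erased. So the stretch can be
-- dissolved, whatever the candidate decides.
open Classical in
theorem VerInv.finish {m : Mem A r} {S : Agent A → VState} (h : VerInv lab m S)
    (hb : Basic lab tape m) {a : Agent A} {b : Axis → Bool}
    (hr : ∀ ax, (m a).report ax = some (b ax)) {s : AgentState r} (hw : s.awake = (m a).awake)
    (hca : (m a).cand = false → s.cand = false) (hph : s.phase ≠ .solitude)
    (hp : s.tokenPart = (m a).tokenPart) (hre : ∀ ax, s.report ax = none) :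
    VerInv lab (update m a s) (update S a ⟨.clean, (S a).vec⟩) := by
  obtain ⟨e, hs⟩ := h.stage_of_reported hr
  have hv := (h.at' a).valid
  rw [hs] at hv
  refine h.of_update hb ⟨trivial, ?_, ?_, ?_, ?_⟩ ⟨?_, ?_, ?_, ?_⟩ ?_ ?_ ?_
  · rw [update_self]; simpa using hph
  · exact fun k _ hk => absurd hk (Nat.not_lt_zero k)
  · exact fun k hk => absurd hk (Nat.not_lt_zero k)
  · intro ax; rw [update_self]; exact hre ax
  · intro x hx
    by_cases hxa : x = a
    · subst hxa; rw [update_self, hw]; exact hx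
    · rwa [update_of_ne hxa]
  · intro x _ hx
    by_cases hxa : x = a
    · subst hxa; rw [update_self]; exact hca hx
    · rwa [update_of_ne hxa]
  · intro x hx; rw [update_of_ne hx]
  · intro x hx; rw [update_of_ne hx]
  · intro x hx _
    rw [update_of_ne (show x ≠ a from hx 0 (by rw [hs]; exact hv.1))]
  · exact fun k hk => absurd hk (Nat.not_lt_zero k)
  · intro k hk
    right
    have h1 : (update m a s (succ^[k] a)).tokenPart = (m (succ^[k] a)).tokenPart := by
      by_cases hxa : succ^[k] a = a
      · rw [hxa, update_self, hp]
      · rw [update_of_ne hxa]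
    rw [h1, (h.at' a).part k hk]
    refine Prod.ext ?_ (Prod.ext ?_ ?_)
    · simp only [VState.part, hs]; rfl
    · funext ax sg
      exact ((hv.2 ax).2 sg).empty k (Nat.zero_le k)
    · funext ax
      simp only [VState.part, hs]
      rfl

open Classical in
/-- How the state of the verification of a candidate changes in a step. -/
def Moved (m : Mem A r) (c : Agent A) (s s' : VState) : Prop :=
  s' = s ∨ Advance s s' c m ∨ s.stage = .clean ∧ s' = ⟨.forth 0, fun _ _ _ => .empty⟩ ∨
    s'.stage = .clean

/-- A step leaves all verifications alone, advances a single one, or is a decision of a candidate,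
which may begin or end its own. -/
theorem VerInv.step {m m' : Mem A r} {S : Agent A → VState} (h : VerInv lab m S)
    (hb : Basic lab tape m) (hs : Step lab tape m m') :
    ∃ S', VerInv lab m' S' ∧ ∀ c, Moved m c (S c) (S' c) := by
  have hsame : VerInv lab m' S → ∃ S', VerInv lab m' S' ∧ ∀ c, Moved m c (S c) (S' c) :=
    fun h' => ⟨S, h', fun c => .inl rfl⟩
  have hadv : (m' = m ∨ ∃ c st, VerInv lab m' (update S c st) ∧ Advance (S c) st c m) →
      ∃ S', VerInv lab m' S' ∧ ∀ c, Moved m c (S c) (S' c) := by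
    rintro (rfl | ⟨c, st, h1, h2⟩)
    · exact hsame h
    · refine ⟨_, h1, fun c' => ?_⟩
      by_cases hcc : c' = c
      · subst hcc; rw [update_self]; exact .inr (.inl h2)
      · rw [update_of_ne hcc]; exact .inl rfl
  have hplain : ∀ {a : Agent A} (R : Rule r), R ∈ rules r → m' = applyRule lab tape a m R →
      (∀ x, (m' x).solitudePart = (m x).solitudePart) →
      (∀ x, (m' x).candidatePart = (m x).candidatePart ∨ (m x).cand = true ∧
        (m x).phase = .idle ∧ (m' x).phase = .requested) → ∃ S', VerInv lab m' S' ∧ ∀ c, Moved m c (S c) (S' c) := by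
    rintro a R hR rfl hp hcp
    refine hsame (h.congr (fun x => by rw [rule_awake hR]; exact id) (fun x _ hx => ?_)
      (fun x => ?_) hp)
    · rcases hcp x with h1 | h1
      · exact (congrArg (·.1) h1).trans hx
      · rw [h1.1] at hx; cases hx
    · rcases hcp x with h1 | h1
      · exact Eq.congr_left (congrArg (·.2) h1)
      · rw [h1.2.1, h1.2.2]; simp
  have hdec : ∀ {a : Agent A} {s : AgentState r}, ((m a).awake = true → s.awake = true) →
      ((m a).awake = true → (m a).cand = false → s.cand = false) →
      (s.phase = .solitude ↔ (m a).phase = .solitude) → s.solitudePart = (m a).solitudePart →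
      VerInv lab (update m a s) S := by
    intro a s h1 h2 h3 h4
    refine h.congr ?_ ?_ ?_ ?_ <;> intro x <;> by_cases hxa : x = a
    · subst hxa; rwa [update_self]
    · rw [update_of_ne hxa]; exact id
    · subst hxa; rwa [update_self]
    · rw [update_of_ne hxa]; exact fun _ h => h
    · subst hxa; rwa [update_self]
    · rw [update_of_ne hxa]
    · subst hxa; rwa [update_self]
    · rw [update_of_ne hxa]
  cases hs with
  | wake a ha => exact hsame (hdec (by rw [ha]; simp) (by rw [ha]; simp) Iff.rfl rfl)
  | rule a R hR ha =>
    rcases mem_rules_iff.1 hR with h1 | h1 | h1 | h1 | ⟨ax, sg, h1⟩ | ⟨ax, h1⟩ | h1 | h1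
    · subst h1
      exact hplain _ hR rfl (fun x => congrArg (·.2.2.1) (setupRule_preserves.apply a m x))
        fun x => .inl (congrArg (·.2.2.2.2) (setupRule_preserves.apply a m x))
    · subst h1
      exact hplain _ hR rfl (fun x => congrArg (·.2.2.1) (createRule_preserves.apply a m x))
        fun x => .inl (congrArg (·.2.2.2.2) (createRule_preserves.apply a m x))
    · subst h1
      refine hplain _ hR rfl (fun x => congrArg (·.2.2.1) (forwardRule_preserves.apply a m x))
        fun x => ?_
      rcases forwardRule_phase (lab := lab) (tape := tape) a m x with h1 | ⟨h1, h2, h3⟩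
      · exact .inl (Prod.ext (congrArg (·.2.2.2.2.1) (forwardRule_preserves.apply a m x)) h1)
      · exact .inr ⟨h1, h2, h3⟩
    · subst h1; exact hadv (h.activation_step hb a)
    · subst h1; exact hadv (h.vector_step hb a ax sg)
    · subst h1; exact hadv (h.return_step hb a ax)
    · subst h1
      exact hplain _ hR rfl (fun x => congrArg (·.2.2.2.1) (angleRule_preserves.apply a m x))
        fun x => .inl (congrArg (·.2.2.2.2) (angleRule_preserves.apply a m x))
    · subst h1
      rw [candidateRule_eq] at hsame ⊢
      have hcase := candidateRule_case (view lab tape a) (m a.pred) (m a) (m a.succ)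
      generalize (candidateRule (view lab tape a) (m a.pred) (m a) (m a.succ)).self = s at *
      cases hcase with
      | same => rw [update_eq_self] at hsame ⊢; exact hsame h
      | withdraw _ _ hph =>
        exact hsame (hdec id (fun _ _ => rfl)
          (by rcases hph with h | h <;> rw [h] <;> simp [withdraw]) rfl)
      | start hc _ hph =>
        refine ⟨_, h.start (tape := tape) hb hc hph, fun c => ?_⟩
        by_cases hca : c = a
        · subst hca
          rw [update_self]
          exact .inr (.inr (.inl ⟨h.stage_eq (by rw [hph]; simp), rfl⟩))
        · rw [update_of_ne hca]; exact .inl rfl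
      | verified b₁ b₂ hc hph hx hy =>
        refine ⟨_, h.finish hb (b := fun ax => match ax with | .x => b₁ | .y => b₂)
          (by rintro (_ | _) <;> assumption) ?_ ?_ ?_ ?_ ?_, fun c => ?_⟩
        · split_ifs <;> rfl
        · rw [hc]; exact fun h => absurd h (by simp)
        · split_ifs <;> simp [withdraw]
        · split_ifs <;> rfl
        · intro ax; split_ifs <;> rfl
        · by_cases hca : c = a
          · subst hca
            rw [update_self]
            exact .inr (.inr (.inr rfl))
          · rw [update_of_ne hca]; exact .inl rfl
      | identified k hc hph ht =>
        exact hsame (hdec (by split_ifs <;> exact id) (by rw [hc]; simp)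
          (by rw [hph]; split_ifs <;> simp [withdraw]) (by split_ifs <;> rfl))

theorem Reachable.verInv {m : Mem A r} (h : Reachable lab tape m) : ∃ S, VerInv lab m S := by
  induction h with
  | refl =>
    refine ⟨fun _ => ⟨.clean, fun _ _ _ => .empty⟩, fun c => ⟨trivial, ?_, ?_, ?_, fun ax => rfl⟩,
      fun x _ => rfl⟩
    · simp [blank]
    · exact fun k _ hk => absurd hk (Nat.not_lt_zero k)
    · exact fun k hk => absurd hk (Nat.not_lt_zero k)
  | tail hm hs ih =>
    obtain ⟨S, hS⟩ := ih
    obtain ⟨S', hS', -⟩ := hS.step (Reachable.basic hm) hs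
    exact ⟨S', hS'⟩

/-! #### The meaning of the result -/

theorem node_iterate_succ (c : Agent A) (n : ℕ) :
    (succ^[n] c).node = c.node + ∑ k ∈ range n, dir (succ^[k] c).succDir := by
  induction n with
  | zero => simp
  | succ n ih =>
    rw [iterate_succ_apply', node_succ, ih, sum_range_succ, add_assoc]

theorem dir_add_one (i : ZMod 6) : dir (i + 1) = ((dir i).1 + (dir i).2, -(dir i).1) := by
  revert i; decide

/-- A sum of vectors that vanishes still vanishes after a rotation by multiples of 60 degrees. So
the coordinate system chosen by the candidate is irrelevant. -/
theorem sum_dir_rotate {s : Finset ℕ} {f : ℕ → ZMod 6} (h : ∑ k ∈ s, dir (f k) = 0) (i : ZMod 6) :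
    ∑ k ∈ s, dir (f k + i) = 0 := by
  obtain ⟨n, rfl⟩ := ZMod.natCast_zmod_surjective i
  induction n with
  | zero => simpa using h
  | succ n ih =>
    rw [Prod.ext_iff, Prod.fst_sum, Prod.snd_sum] at ih
    have h1 : ∀ k, dir (f k + ((n + 1 : ℕ) : ZMod 6)) =
        ((dir (f k + n)).1 + (dir (f k + n)).2, -(dir (f k + n)).1) := by
      intro k
      rw [Nat.cast_add, Nat.cast_one, ← add_assoc, dir_add_one]
    simp only [h1]
    rw [Prod.ext_iff, Prod.fst_sum, Prod.snd_sum]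
    simp only [sum_add_distrib, Finset.sum_neg_distrib]
    rw [ih.1, ih.2]
    simp

theorem edgeCount_sub (c : Agent A) (ax : Axis) (n : ℕ) :
    (edgeCount lab c ax true n : ℤ) - edgeCount lab c ax false n =
      ∑ k ∈ range n, coord ax (outDir lab c k) := by
  induction n with
  | zero => simp [edgeCount]
  | succ n ih =>
    rw [sum_range_succ, ← ih]
    have key : ∀ i : ZMod 6, coord ax i = 1 ∨ coord ax i = 0 ∨ coord ax i = -1 := by
      intro i; cases ax <;> revert i <;> decide
    simp only [edgeCount]
    rcases key (outDir lab c n) with h | h | h <;> rw [h] <;> push_cast <;> simp <;> ring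

/-- The numbers of positive and negative edges differ by the coordinate of the sum of all edges
traversed, and this sum is the difference of the nodes of `succ^[n] c` and `c`, up to a rotation. -/
theorem balanced_iff (c : Agent A) (n : ℕ) :
    (∀ ax, Balanced lab c ax n) ↔ (succ^[n] c).node = c.node := by
  have h1 : ∀ ax, Balanced lab c ax n ↔ ∑ k ∈ range n, coord ax (outDir lab c k) = 0 := by
    intro ax
    rw [← edgeCount_sub, sub_eq_zero, Nat.cast_inj]
    rfl
  have h2 : (∀ ax, Balanced lab c ax n) ↔
      ∑ k ∈ range n, dir (outDir lab c k) = 0 := by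
    rw [Prod.ext_iff, Prod.fst_sum, Prod.snd_sum]
    refine ⟨fun h => ⟨(h1 .x).1 (h .x), (h1 .y).1 (h .y)⟩, fun h ax => (h1 ax).2 ?_⟩
    cases ax
    · exact h.1
    · exact h.2
  rw [h2, node_iterate_succ, add_eq_left]
  constructor <;> intro h
  · simpa [outDir] using sum_dir_rotate h (lab.offset c.particle)
  · simpa [outDir, sub_eq_add_neg] using sum_dir_rotate h (-lab.offset c.particle)

/-- The result of the verification is positive if and only if it has returned to the candidate. -/
theorem reported_true_iff {st : VState} {c : Agent A} {e : ℕ} {b : Axis → Bool}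
    (hv : st.stage.Valid lab c st.vec) (hs : st.stage = .back e fun ax => .reported (b ax)) :
    (∀ ax, b ax = true) ↔ succ^[e] c = c := by
  rw [hs] at hv
  have h1 : (∀ ax, b ax = true) ↔ (∀ ax, Balanced lab c ax e) ∧
      lab.aid (succ^[e] c) = lab.aid c :=
    ⟨fun h => ⟨fun ax => ((hv.2 ax).1.1 (h ax)).1, ((hv.2 .x).1.1 (h .x)).2⟩,
      fun h ax => (hv.2 ax).1.2 ⟨h.1 ax, h.2⟩⟩
  rw [h1, balanced_iff]
  constructor
  · rintro ⟨h2, h3⟩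
    exact lab.aid_injective _ _ (particle_eq_iff.2 h2) h3
  · intro h
    rw [h]
    exact ⟨rfl, rfl⟩

/-- A candidate whose verification succeeds is the only one on its boundary. -/
theorem VerInv.sole {m : Mem A r} {S : Agent A → VState} (h : VerInv lab m S)
    (hb : Basic lab tape m) {c : Agent A} {e : ℕ} {s : Axis → AxisStage}
    (hs : (S c).stage = .back e s) (he : succ^[e] c = c) {x : Agent A} (hx : SameBoundary c x)
    (hne : x ≠ c) : (m x).awake = true ∧ (m x).cand = false := by
  have hext : (S c).stage.extent = e := by rw [hs]; rfl
  have hv := (h.at' c).valid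
  rw [hs] at hv
  -- A return to `c` takes at least one round, so the stretch covers the whole boundary and all
  -- other agents in it are not candidates.
  have hper := period_le_of_iterate_eq hv.1 he
  obtain ⟨k, hk, rfl⟩ := hx.exists_lt
  refine (h.at' c).cover k ?_ (by omega)
  rcases Nat.eq_zero_or_pos k with rfl | h0
  · exact absurd rfl hne
  · exact h0

/-! #### Progress -/

open Classical in
theorem VerInv.vector_progress {m : Mem A r} {S : Agent A → VState} (h : VerInv lab m S)
    (hb : Basic lab tape m) {c : Agent A} {ax : Axis} {sg : Bool} {k : ℕ}
    (hk : k < (S c).stage.extent) (hset : (S c).vec ax sg k ≠ settleAll ((S c).vec ax sg k))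
    (hcond : k = 0 ∨ ∃ i, k = i + 1 ∧ ((S c).vec ax sg i = .two true true ∨
      (S c).vec ax sg i ≠ .two true true ∧ ((S c).vec ax sg i).size < 2)) : ∃ st,
      VerInv lab (applyRule lab tape (succ^[k] c) m (vectorRule ax sg)) (update S c st) ∧
      Advance (S c) st c m := by
  have hs := stage_ne_clean_of_lt hk
  have hper := h.extent_le hb c
  by_cases h1 : k = 0 ∨ ∃ i, k = i + 1 ∧ (S c).vec ax sg i = .two true true
  · exact ⟨_, h.settle hb hk h1, advance_setVec hs (Tokens.weight_settle_lt (by omega) hset)⟩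
  · push Not at h1
    obtain ⟨i, rfl, h2⟩ := hcond.resolve_left h1.1
    obtain ⟨h3, h4⟩ := h2.resolve_left (h1.2 i rfl)
    obtain ⟨n, hn, htok⟩ := exists_tokens hs (h.at' c).valid ax sg
    obtain ⟨t, rest, hp⟩ : ∃ t rest, ((S c).vec ax sg (i + 1)).pop = some (t, rest) := by
      cases hbuf : (S c).vec ax sg (i + 1) with
      | empty => rw [hbuf] at hset; exact absurd rfl hset
      | one s => exact ⟨_, _, rfl⟩
      | two s t => exact ⟨_, _, rfl⟩
    exact ⟨_, h.move hb hk h3 hp h4, advance_setVec hs (htok.weight_move h3 hp h4 (by omega))⟩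

open Classical in
/-- Until both results are reported, some rule makes progress. -/
theorem exists_progress {c : Agent A} {st : VState} (hv : st.stage.Valid lab c st.vec)
    (hne : st.stage ≠ .clean) (hrep : ∀ e (b : Axis → Bool), st.stage ≠ .back e fun ax => .reported (b ax)) :
    ∃ k, ∃ R ∈ rules r, ∀ (m : Mem A r) (S : Agent A → VState), VerInv lab m S →
      Basic lab tape m → S c = st → (∀ x, (m x).awake = true) → ∃ st',
        VerInv lab (applyRule lab tape (succ^[k] c) m R) (update S c st') ∧
        Advance st st' c m := by
  cases hs : st.stage with
  | clean => exact absurd hs hne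
  | forth k =>
    refine ⟨k, activationRule, activationRule_mem, ?_⟩
    rintro m S h hb rfl hw
    exact h.activation_progress hb hs (hw _)
  | back e s =>
    rw [hs] at hv hrep
    obtain ⟨ax, hax⟩ : ∃ ax, ∀ b, s ax ≠ .reported b := by
      by_contra hc
      push Not at hc
      choose b hb using hc
      exact hrep e b (congrArg _ (funext hb))
    have hvax := hv.2 ax
    cases hsa : s ax with
    | reported b => exact absurd hsa (hax b)
    | decided p z =>
      refine ⟨p, returnRule ax, returnRule_mem ax, ?_⟩
      rintro m S h hb rfl hw
      have hd : Deciding (S c) ax p z (s ax) := by rw [hsa]; exact ⟨rfl, rfl⟩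
      exact ⟨_, h.decide hb hs hd, advance_decide hs hd⟩
    | undecided p =>
      rw [hsa] at hvax
      by_cases hset : st.vec ax true p = settleAll (st.vec ax true p) ∧
          st.vec ax false p = settleAll (st.vec ax false p)
      · refine ⟨p, returnRule ax, returnRule_mem ax, ?_⟩
        rintro m S h hb rfl hw
        by_cases h0 : ¬ ((S c).vec ax true p = .empty ∧ (S c).vec ax false p = .empty) ∨ p = 0
        · have hd : Deciding (S c) ax p
              (Decidable.decide (((S c).vec ax true p).size = ((S c).vec ax false p).size))
              (s ax) := by
            rw [hsa]; exact ⟨rfl, hset, h0, rfl⟩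
          exact ⟨_, h.decide hb hs hd, advance_decide hs hd⟩
        · push Not at h0
          obtain ⟨⟨e1, e2⟩, hp0⟩ := h0
          obtain ⟨p, rfl⟩ : ∃ p', p = p' + 1 := ⟨p - 1, by omega⟩
          exact ⟨_, h.retreat hb hs hsa e1 e2, advance_axis hs
            (by rw [hsa]; simp [AxisStage.weight]) fun _ _ => le_rfl⟩
      · obtain ⟨sg, hsg⟩ : ∃ sg, st.vec ax sg p ≠ settleAll (st.vec ax sg p) := by
          by_contra hc
          push Not at hc
          exact hset ⟨hc true, hc false⟩
        -- The returning token waits for an unsettled token at its position; then some token at or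
        -- before this position can settle or move.
        obtain ⟨k, hkp, h1, h2⟩ := Tokens.exists_enabled hsg
        refine ⟨k, vectorRule ax sg, vectorRule_mem ax sg, ?_⟩
        rintro m S h hb rfl hw
        exact h.vector_progress hb (by rw [hs]; exact lt_of_le_of_lt hkp hvax.1) h1 h2

open Classical in
/-- Every solitude verification comes to an end. -/
theorem exists_verified (hA : NoneIsolated A) (hno : NoLeader lab tape sched) {c : Agent A} {K : ℕ → Prop}
    {Q : Mem A r → Prop} (hQ : ∀ m m', Reachable lab tape m → Step lab tape m m' → Q m → Q m')
    (hK : ∀ m e, Q m → (m (succ^[e] c)).cand = true → K e) {m : Mem A r}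
    (hm : Reachable lab tape m) (hf : Fair lab tape sched m) (hw : ∀ x, (m x).awake = true)
    (hph : (m c).phase = .solitude) (hq : Q m) (hstart : ∀ S, VerInv lab m S →
      ∀ e s, (S c).stage = .back e s → K e) :
    ∃ m₁, Reach lab tape m m₁ ∧ Fair lab tape sched (applyRule lab tape c m₁ candidateRule) ∧
      Q m₁ ∧ (m₁ c).phase = .solitude ∧ ∃ (S : Agent A → VState) (e : ℕ) (b : Axis → Bool), VerInv lab m₁ S ∧
        (S c).stage = .back e (fun ax => .reported (b ax)) ∧ K e := by
  obtain ⟨S₀, hS₀⟩ := hm.verInv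
  -- The goal is the memory right after the decision of `c`, since any step after both reports may
  -- be this decision. `K` records what is known about the position where the activation token
  -- turned; by `hK` it holds whenever the turn happens at a candidate under `Q`.
  have key := exists_goal hA hno (fun st : VState => st.measure c.period)
    (fun st m' => Reach lab tape m m' ∧ Q m' ∧ (∀ x, (m' x).awake = true) ∧ st.stage ≠ .clean ∧
      (∀ e s, st.stage = .back e s → K e) ∧ ∃ S, VerInv lab m' S ∧ S c = st)
    (fun m' => ∃ m₁, m' = applyRule lab tape c m₁ candidateRule ∧ Reach lab tape m m₁ ∧
      Q m₁ ∧ (m₁ c).phase = .solitude ∧ ∃ (S : Agent A → VState) (e : ℕ) (b : Axis → Bool), VerInv lab m₁ S ∧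
        (S c).stage = .back e (fun ax => .reported (b ax)) ∧ K e)
    ?_ ?_ hm hf (i := S₀ c) ⟨.refl, hq, hw, ((hS₀.at' c).phase).1 hph, hstart _ hS₀, S₀, hS₀, rfl⟩
  · obtain ⟨m', -, h2, m₁, rfl, h4, h5, h6, h7⟩ := key
    exact ⟨m₁, h4, h2, h5, h6, h7⟩
  · rintro st m₁ m₂ hm₁ ⟨hr, hq, hw, hne, hKe, S, hS, rfl⟩ hst
    have hsol : (m₁ c).phase = .solitude := ((hS.at' c).phase).2 hne
    obtain ⟨S', hS', h'⟩ := hS.step hm₁.basic hst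
    by_cases hph' : (m₂ c).phase = .solitude
    · right
      have hne' := ((hS'.at' c).phase).1 hph'
      have hcommon : (∀ e s, (S' c).stage = .back e s → K e) → Reach lab tape m m₂ ∧ Q m₂ ∧
          (∀ x, (m₂ x).awake = true) ∧ (S' c).stage ≠ .clean ∧
          (∀ e s, (S' c).stage = .back e s → K e) ∧ ∃ S, VerInv lab m₂ S ∧ S c = S' c :=
        fun h => ⟨hr.tail hst, hQ _ _ hm₁ hst hq, fun x => hst.awake (hw x), hne', h, S', hS', rfl⟩
      rcases h' c with h1 | h1 | h1 | h1
      · left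
        have := hcommon (by rw [h1]; exact hKe)
        rw [h1] at this
        exact this
      · right
        refine ⟨S' c, h1.2.2.1, hcommon fun e s hes => ?_⟩
        rcases h1.2.2.2 e s hes with ⟨s', hs'⟩ | hc
        · exact hKe e s' hs'
        · exact hK _ _ hq hc
      · exact absurd h1.1 hne
      · exact absurd h1 hne'
    · left
      cases hst with
      | wake a ha => 
        exfalso
        apply hph'
        by_cases hca : c = a
        · subst hca; rw [update_self]; exact hsol
        · rwa [update_of_ne hca]
      | rule a R hR ha =>
        rcases rule_candidatePart (lab := lab) (tape := tape) hR a m₁ c with h1 | h1 | ⟨h1, h2⟩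
        · exact absurd ((congrArg (·.2) h1).trans hsol) hph'
        · rw [hsol] at h1; exact absurd h1.2.2.1 (by simp)
        · subst h1 h2
          have hcase := candidateRule_case (view lab tape c) (m₁ c.pred) (m₁ c) (m₁ c.succ)
          rw [applyRule_self] at hph'
          generalize (candidateRule (view lab tape c) (m₁ c.pred) (m₁ c) (m₁ c.succ)).self = s at *
          cases hcase with
          | same => exact absurd hsol hph'
          | withdraw _ _ h => rw [hsol] at h; simp at h
          | start _ _ h => rw [hsol] at h; simp at h
          | identified _ _ h => rw [hsol] at h; simp at h
          | verified b₁ b₂ hc _ hx hy =>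
            obtain ⟨e, he⟩ := hS.stage_of_reported (b := fun ax => match ax with | .x => b₁ | .y => b₂)
              (by rintro (_ | _) <;> assumption)
            exact ⟨m₁, rfl, hr, hq, hsol, S, e, _, hS, he, hKe _ _ he⟩
  · rintro st m₁ hm₁ ⟨hr, hq, hw, hne, hKe, S, hS, rfl⟩
    right
    by_cases hrep : ∃ e, ∃ b : Axis → Bool, (S c).stage = .back e fun ax => .reported (b ax)
    · obtain ⟨e, b, he⟩ := hrep
      refine ⟨c, candidateRule, mem_rules_iff.2 (by simp), hw _, ?_⟩
      rintro m₂ hm₂ ⟨hr', hq', hw', -, hKe', S', hS', hSc⟩ -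
      left
      rw [← hSc] at he hne
      exact ⟨m₂, rfl, hr', hq', ((hS'.at' c).phase).2 hne, S', e, b, hS', he,
        hKe _ _ (hSc ▸ he)⟩
    · push Not at hrep
      obtain ⟨k, R, hR, hprog⟩ := exists_progress (tape := tape) (r := r) (hS.at' c).valid hne hrep
      refine ⟨succ^[k] c, R, hR, hw _, ?_⟩
      rintro m₂ hm₂ ⟨hr', hq', hw', -, hKe', S', hS', hSc⟩ ha
      right
      obtain ⟨st', h1, h2⟩ := hprog m₂ S' hS' hm₂.basic hSc hw'
      have hst : Step lab tape m₂ (applyRule lab tape (succ^[k] c) m₂ R) := .rule _ _ _ hR ha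
      refine ⟨st', h2.2.2.1, hr'.tail hst, hQ _ _ hm₂ hst hq', fun x => hst.awake (hw' x), h2.2.1,
        fun e s hes => ?_, _, h1, update_self _ _ _⟩
      rcases h2.2.2.2 e s hes with ⟨s', hs'⟩ | hc
      · exact hKe e s' hs'
      · exact hK _ _ hq' hc

/-! ### Boundary identification -/

/-- No other agent of the boundary is a candidate. -/
def Sole (m : Mem A r) (c : Agent A) : Prop :=
  ∀ x, SameBoundary c x → x ≠ c → (m x).awake = true ∧ (m x).cand = false

/-- The tokens at the `k`-th agent after `c`, where the token of the boundary identification is at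
the given position or has been reported. -/
noncomputable def anglePart (c : Agent A) (k : ℕ) (o : Option ℕ) : Option (ZMod 5) × Option (ZMod 5) :=
  (if o = some k then some (∑ i ∈ range k, ((succ^[i] c).turn : ZMod 5)) else none,
    if k = 0 ∧ o = none then some (c.totalTurn : ZMod 5) else none)

theorem anglePart_some (c : Agent A) (k j : ℕ) : anglePart c k (some j) =
    (if j = k then some (∑ i ∈ range k, ((succ^[i] c).turn : ZMod 5)) else none, none) := by
  simp [anglePart]

theorem anglePart_none (c : Agent A) (k : ℕ) : anglePart c k none =
    (none, if k = 0 then some (c.totalTurn : ZMod 5) else none) := by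
  simp [anglePart]

/-- The token of the boundary identification that `c` started is at the given position. -/
def AngleAt (m : Mem A r) (c : Agent A) (o : Option ℕ) : Prop :=
  (∀ j, o = some j → j < c.period) ∧
    ∀ k < c.period, (m (succ^[k] c)).boundaryPart = anglePart c k o

/-- The state of a boundary with respect to the boundary identification. -/
inductive BoundaryState (m : Mem A r) (c : Agent A) : Prop
  | running (d : Agent A) (o : Option ℕ) : SameBoundary c d → (m d).phase = .boundary →
      Sole m d → AngleAt m d o → BoundaryState m c
  | quiet : (∀ x, SameBoundary c x → (m x).phase ≠ .boundary ∧
      (m x).boundaryPart = (none, none) ∧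
      ((m x).phase = .won → Sole m x ∧ (x.totalTurn : ZMod 5) = 1)) → BoundaryState m c

theorem Sole.congr {m m' : Mem A r} {c : Agent A} (h : Sole m c)
    (hw : ∀ x, (m x).awake = true → (m' x).awake = true)
    (hca : ∀ x, (m x).awake = true → (m x).cand = false → (m' x).cand = false) : Sole m' c :=
  fun x hx hne => ⟨hw x (h x hx hne).1, hca x (h x hx hne).1 (h x hx hne).2⟩

theorem BoundaryState.trans {m : Mem A r} {c c' : Agent A} (h : BoundaryState m c)
    (hc : SameBoundary c' c) : BoundaryState m c' := by
  cases h with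
  | running d o h1 h2 h3 h4 => exact .running d o (hc.trans h1) h2 h3 h4
  | quiet h => exact .quiet fun x hx => h x (hc.symm.trans hx)

theorem BoundaryState.congr {m m' : Mem A r} {c : Agent A} (h : BoundaryState m c)
    (hw : ∀ x, (m x).awake = true → (m' x).awake = true)
    (hca : ∀ x, (m x).awake = true → (m x).cand = false → (m' x).cand = false)
    (hb : ∀ x, SameBoundary c x → ((m' x).phase = .boundary ↔ (m x).phase = .boundary))
    (hwon : ∀ x, SameBoundary c x → (m' x).phase = .won → (m x).phase = .won)
    (hp : ∀ x, SameBoundary c x → (m' x).boundaryPart = (m x).boundaryPart) :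
    BoundaryState m' c := by
  cases h with
  | running d o h1 h2 h3 h4 =>
    exact .running d o h1 ((hb d h1).2 h2) (h3.congr hw hca) ⟨h4.1, fun k hk => by
      rw [hp _ (h1.trans ⟨k, rfl⟩), h4.2 k hk]⟩
  | quiet h =>
    refine .quiet fun x hx => ⟨fun hx' => (h x hx).1 ((hb x hx).1 hx'), ?_, fun hx' => ?_⟩
    · rw [hp x hx]; exact (h x hx).2.1
    · have := (h x hx).2.2 (hwon x hx hx')
      exact ⟨this.1.congr hw hca, this.2⟩

/-- No other agent of the boundary is a candidate, so the token stops only after a full round, and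
the reported sum is the total turn. -/
theorem AngleAt.step {m : Mem A r} {d : Agent A} {o : Option ℕ} (h : AngleAt m d o)
    (hd : (m d).cand = true) (h3 : Sole m d) {j : ℕ} (hj : j < d.period) :
    o ≠ some j ∧ applyRule lab tape (succ^[j] d) m angleRule = m ∨
    o = some j ∧ AngleAt (applyRule lab tape (succ^[j] d) m angleRule) d
      (if j + 1 < d.period then some (j + 1) else none) := by
  obtain ⟨h4, h5⟩ := h
  have h6 : (m (succ^[j] d)).angle = _ := congrArg (·.1) (h5 j hj)
  simp only [anglePart] at h6
  by_cases hoj : o = some j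
  swap
  · rw [if_neg hoj] at h6
    exact .inl ⟨hoj, applyRule_eq_self (by simp [angleRule, h6])⟩
  right
  refine ⟨hoj, ?_⟩
  subst hoj
  rw [if_pos rfl] at h6
  set s := ∑ i ∈ range j, ((succ^[i] d).turn : ZMod 5)
  have hang := h6
  have hsucc : (succ^[j] d).succ = succ^[j + 1] d := (iterate_succ_apply' _ _ _).symm
  have hsum : s + ((succ^[j] d).turn : ZMod 5) =
      ∑ i ∈ range (j + 1), ((succ^[i] d).turn : ZMod 5) := by
    rw [sum_range_succ]
  have hne := (succ^[j] d).succ_ne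
  have hother : ∀ x, x ≠ succ^[j] d → x ≠ (succ^[j] d).succ →
      (applyRule lab tape (succ^[j] d) m angleRule x).boundaryPart = (m x).boundaryPart := by
    intro x hx hx'
    rw [applyRule_of_ne hx, if_neg hx']
    simp only [angleRule, hang]
    split_ifs <;> rfl
  have hself : (applyRule lab tape (succ^[j] d) m angleRule (succ^[j] d)).boundaryPart =
      (none, (m (succ^[j] d)).total) := by
    rw [applyRule_self]
    simp only [angleRule, hang]
    split_ifs <;> rfl
  have hnext : (applyRule lab tape (succ^[j] d) m angleRule (succ^[j] d).succ).boundaryPart =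
      if (m (succ^[j] d).succ).cand then
        ((m (succ^[j] d).succ).angle, some (s + ((succ^[j] d).turn : ZMod 5)))
      else (some (s + ((succ^[j] d).turn : ZMod 5)), (m (succ^[j] d).succ).total) := by
    rw [applyRule_of_ne hne, if_pos rfl]
    simp only [angleRule, hang]
    split_ifs <;> rfl
  refine ⟨fun k hk => ?_, fun k hk => ?_⟩
  · split_ifs at hk with hlt
    · cases hk; exact hlt
  · have hk5 := h5 k hk
    rw [anglePart_some] at hk5
    have htot : (m (succ^[k] d)).total = none := congrArg (·.2) hk5
    have h2p := d.two_le_period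
    by_cases hkj : k = j
    · rw [hkj, hself, ← hkj, htot]
      split_ifs with hlt
      · rw [anglePart_some, if_neg (by omega)]
      · rw [anglePart_none, if_neg (by omega)]
    rw [if_neg (Ne.symm hkj)] at hk5
    have hang' : (m (succ^[k] d)).angle = none := congrArg (·.1) hk5
    by_cases hlt : j + 1 < d.period
    · rw [if_pos hlt, anglePart_some]
      by_cases hkj' : k = j + 1
      · have hnc := (h3 (succ^[j + 1] d) ⟨_, rfl⟩ fun he => by
          have := iterate_inj (a := d) (j := j + 1) (k := 0) hlt d.period_pos he
          omega).2
        rw [hsucc, hnc, ← hkj', htot, hkj', hsum] at hnext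
        rw [hkj', hnext, if_pos rfl]
        rfl
      · rw [hother _ (fun he => hkj (iterate_inj hk hj he))
          (fun he => hkj' (iterate_inj hk hlt (he.trans hsucc))), hk5, if_neg (Ne.symm hkj')]
    · have hper : d.period = j + 1 := by omega
      have hback : (succ^[j] d).succ = d := by rw [hsucc, ← hper, iterate_period]
      rw [if_neg hlt, anglePart_none]
      by_cases hk0 : k = 0
      · subst hk0
        rw [hback, hd, if_pos rfl, show (m d).angle = none from hang', hsum, ← hper] at hnext
        rw [if_pos rfl]
        refine Eq.trans hnext ?_
        rw [totalTurn]
        push_cast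
        rfl
      · rw [hother _ (fun he => hkj (iterate_inj hk hj he)) (fun he => hk0 (iterate_inj hk
          d.period_pos (he.trans hback))), hk5, if_neg hk0]

theorem angleRule_step {m : Mem A r} (hb : Basic lab tape m) {a : Agent A}
    (h : BoundaryState m a) : BoundaryState (applyRule lab tape a m angleRule) a := by
  have hpres := angleRule_preserves.apply (lab := lab) (tape := tape) a m
  have hcp : ∀ x, (applyRule lab tape a m angleRule x).candidatePart = (m x).candidatePart :=
    fun x => congrArg (·.2.2.2.2) (hpres x)
  cases h with
  | quiet h =>
    have : (m a).angle = none := congrArg (·.1) (h a (.refl a)).2.1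
    rw [applyRule_eq_self (by simp [angleRule, this])]
    exact .quiet h
  | running d o h1 h2 h3 h4 =>
    obtain ⟨j, hj, rfl⟩ := h1.symm.exists_lt
    have hd : (m d).cand = true := by
      by_contra hc
      rw [hb.phase_of_not_cand d (by simpa using hc)] at h2
      cases h2
    rcases h4.step (lab := lab) (tape := tape) hd h3 hj with ⟨-, h⟩ | ⟨-, h⟩
    · rw [h]; exact .running d o h1 h2 h3 h4
    · exact .running d _ h1 ((congrArg (·.2) (hcp d)).trans h2)
        (h3.congr (fun x => by rw [rule_awake (mem_rules_iff.2 (by simp))]; exact id)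
          fun x _ hx => (congrArg (·.1) (hcp x)).trans hx) h

/-- The effect of the candidate rule on the boundary identification. -/
theorem candidateRule_step {m : Mem A r} {S : Agent A → VState} (h : VerInv lab m S)
    (hb : Basic lab tape m) {a : Agent A} (hB : BoundaryState m a) :
    BoundaryState (applyRule lab tape a m candidateRule) a := by
  classical
  have hw : ∀ x, (m x).awake = true → (applyRule lab tape a m candidateRule x).awake = true :=
    fun x => by rw [rule_awake (mem_rules_iff.2 (by simp))]; exact id
  have hne : ∀ x, x ≠ a → applyRule lab tape a m candidateRule x = m x :=
    fun x hx => candidateRule_of_ne hx m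
  have hself : applyRule lab tape a m candidateRule a = _ := applyRule_self a m candidateRule
  have hspec := candidateRule_self_spec (view lab tape a) (m a.pred) (m a) (m a.succ)
  have hcase := candidateRule_case (view lab tape a) (m a.pred) (m a) (m a.succ)
  generalize (candidateRule (view lab tape a) (m a.pred) (m a) (m a.succ)).self = s at *
  generalize applyRule lab tape a m candidateRule = m' at *
  have hca : ∀ x, (m x).awake = true → (m x).cand = false → (m' x).cand = false := by
    intro x _ hx
    by_cases hxa : x = a
    · subst hxa
      rw [hself, hspec.2.2.1 hx]
      exact hx
    · rwa [hne x hxa]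
  have hplain : ((m a).phase ≠ .boundary) → s.phase ≠ .boundary → s.phase ≠ .won →
      s.boundaryPart = (m a).boundaryPart → BoundaryState m' a := by
    intro h1 h2 h3 h4
    refine hB.congr hw hca ?_ ?_ ?_ <;> intro x _ <;> by_cases hxa : x = a
    · subst hxa; rw [hself]; exact ⟨fun h => absurd h h2, fun h => absurd h h1⟩
    · rw [hne x hxa]
    · subst hxa; rw [hself]; exact fun h => absurd h h3
    · rw [hne x hxa]; exact id
    · subst hxa; rw [hself, h4]
    · rw [hne x hxa]
  cases hcase with
  | same =>
    have : m' = m := by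
      funext x
      by_cases hxa : x = a
      · subst hxa; exact hself
      · exact hne x hxa
    rwa [this]
  | withdraw _ _ hph =>
    exact hplain (by rcases hph with h | h <;> rw [h] <;> simp) (by simp [withdraw])
      (by simp [withdraw]) rfl
  | start _ _ hph => exact hplain (by rw [hph]; simp) (by simp) (by simp) rfl
  | verified b₁ b₂ hc hph hx hy =>
    by_cases hgo : (m a).beaten = false ∧ b₁ = true ∧ b₂ = true
    swap
    · refine hplain (by rw [hph]; simp) ?_ ?_ ?_
      · split_ifs with h1 h2
        · simp [withdraw]
        · exact absurd ⟨by simpa using h1, by simpa using h2⟩ hgo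
        · simp
      · split_ifs <;> simp [withdraw]
      · split_ifs with h1 h2
        · rfl
        · exact absurd ⟨by simpa using h1, by simpa using h2⟩ hgo
        · rfl
    · obtain ⟨hbeat, rfl, rfl⟩ := hgo
      rw [hbeat] at hself
      obtain ⟨e, he⟩ := h.stage_of_reported (b := fun _ => true)
        (by rintro (_ | _) <;> assumption)
      -- A positive result means that the activation token has come back to `a` after passing all
      -- other agents as non-candidates.
      have hsole : Sole m a := fun x hx hxa =>
        h.sole hb he ((reported_true_iff (h.at' a).valid he).1 fun _ => rfl) hx hxa
      -- No other boundary identification can be in progress here: its candidate would be another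
      -- agent, and all these have withdrawn or never were candidates.
      have hclean : ∀ x, SameBoundary a x → (m x).boundaryPart = (none, none) := by
        cases hB with
        | quiet hq => exact fun x hx => (hq x hx).2.1
        | running d o h1 h2 h3 =>
          exfalso
          by_cases hda : d = a
          · subst hda; rw [hph] at h2; cases h2
          · rw [hb.phase_of_not_cand d (hsole d h1 hda).2] at h2
            cases h2
      refine .running a (some 0) (.refl a) (by rw [hself]; rfl) (hsole.congr hw hca)
        ⟨fun j hj => by cases hj; exact a.period_pos, fun k hk => ?_⟩
      have hk' := hclean _ ⟨k, rfl⟩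
      rw [anglePart_some]
      by_cases hk0 : k = 0
      · subst hk0
        show (m' a).boundaryPart = _
        rw [hself]
        exact Prod.ext rfl (congrArg (·.2) hk')
      · rw [hne _ fun he' => hk0 (iterate_inj hk a.period_pos he'), hk', if_neg (Ne.symm hk0)]
  | identified k hc hph ht =>
    cases hB with
    | quiet hq => exact absurd hph (hq a (.refl a)).1
    | running d o h1 h2 h3 h4 =>
      obtain ⟨h4, h5⟩ := h4
      obtain rfl : d = a := by
        by_contra hda
        have := (h3 a h1.symm (Ne.symm hda)).2
        rw [hc] at this
        cases this
      have h50 := h5 0 d.period_pos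
      have htot : (m d).total = _ := congrArg (·.2) h50
      cases o with
      | some j => rw [anglePart_some, ht] at htot; cases htot
      | none =>
      rw [anglePart_none, ht, if_pos rfl, Option.some.injEq] at htot
      refine .quiet fun x hx => ?_
      by_cases hxd : x = d
      · subst hxd
        have hang : (m x).angle = none := congrArg (·.1) (h50.trans (anglePart_none _ _))
        rw [hself]
        refine ⟨?_, ?_, fun hwon => ⟨h3.congr hw hca, ?_⟩⟩
        · split_ifs <;> simp [withdraw]
        · split_ifs
          · exact Prod.ext hang rfl
          · exact Prod.ext hang rfl
        · by_contra hne1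
          rw [if_neg fun hk1 => hne1 (htot.symm.trans hk1)] at hwon
          cases hwon
      · have hidle := hb.phase_of_not_cand x (h3 x hx hxd).2
        rw [hne x hxd, hidle]
        refine ⟨by simp, ?_, fun hwon => by cases hwon⟩
        obtain ⟨k', hk', rfl⟩ := hx.exists_lt
        rw [h5 k' hk', anglePart_none, if_neg]
        rintro rfl
        exact hxd rfl

theorem rule_boundaryPart {R : Rule r} (hR : R ∈ rules r) (h1 : R ≠ angleRule)
    (h2 : R ≠ candidateRule) (a : Agent A) (m : Mem A r) (x : Agent A) :
    (applyRule lab tape a m R x).boundaryPart = (m x).boundaryPart := by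
  rcases mem_rules_iff.1 hR with h | h | h | h | ⟨ax, sg, h⟩ | ⟨ax, h⟩ | h | h
  · subst h; exact congrArg (·.2.2.2.1) (setupRule_preserves.apply a m x)
  · subst h; exact congrArg (·.2.2.2.1) (createRule_preserves.apply a m x)
  · subst h; exact congrArg (·.2.2.2.1) (forwardRule_preserves.apply a m x)
  · subst h; exact congrArg (·.2.2.2.1) (activationRule_preserves.apply a m x)
  · subst h; exact congrArg (·.2.2.2.1) ((vectorRule_preserves ax sg).apply a m x)
  · subst h; exact congrArg (·.2.2.2.1) ((returnRule_preserves ax).apply a m x)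
  · exact absurd h h1
  · exact absurd h h2

theorem angleRule_of_ne {a x : Agent A} (m : Mem A r) (h : ¬ SameBoundary x a) :
    (applyRule lab tape a m angleRule x).boundaryPart = (m x).boundaryPart := by
  have hxa : x ≠ a := by rintro rfl; exact h (.refl x)
  have hxs : x ≠ a.succ := by
    rintro rfl
    exact h (SameBoundary.symm ⟨1, rfl⟩)
  rw [applyRule_of_ne hxa, if_neg hxs]
  unfold angleRule
  repeat' split
  all_goals rfl

/-- On a given boundary, only the rule of step 5 and the candidate rule at agents of this boundary
need an argument; all other steps preserve the data. -/
theorem Reachable.boundaryState {m : Mem A r} (h : Reachable lab tape m) (c : Agent A) :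
    BoundaryState m c := by
  induction h generalizing c with
  | refl => exact .quiet fun x _ => ⟨by simp [blank], rfl, fun h => by simp [blank] at h⟩
  | tail hm hs ih =>
    rename_i m m'
    have hb := Reachable.basic hm
    obtain ⟨S, hS⟩ := Reachable.verInv hm
    cases hs with
    | wake a ha =>
      classical
      refine (ih c).congr ?_ ?_ ?_ ?_ ?_ <;> intro x <;> by_cases hxa : x = a
      · subst hxa; rw [ha]; exact fun h => absurd h (by simp)
      · rw [update_of_ne hxa]; exact id
      · subst hxa; rw [ha]; exact fun h => absurd h (by simp)
      · rw [update_of_ne hxa]; exact fun _ h => h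
      · subst hxa; rw [update_self]; exact fun _ => Iff.rfl
      · rw [update_of_ne hxa]; exact fun _ => Iff.rfl
      · subst hxa; rw [update_self]; exact fun _ => id
      · rw [update_of_ne hxa]; exact fun _ => id
      · subst hxa; rw [update_self]; exact fun _ => rfl
      · rw [update_of_ne hxa]; exact fun _ => rfl
    | rule a R hR ha =>
      have hw : ∀ x, (m x).awake = true → (applyRule lab tape a m R x).awake = true :=
        fun x => by rw [rule_awake hR]; exact id
      have hcp := fun x => rule_candidatePart (lab := lab) (tape := tape) hR a m x
      have hca : ∀ x, (m x).awake = true → (m x).cand = false →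
          (applyRule lab tape a m R x).cand = false := by
        intro x _ hx
        rcases hcp x with h1 | h1 | ⟨rfl, rfl⟩
        · exact (congrArg (·.1) h1).trans hx
        · rw [h1.2.1] at hx; cases hx
        · rw [applyRule_self, (candidateRule_self_spec _ _ _ _).2.2.1 hx]; exact hx
      have hphase : ∀ x, (R = candidateRule → x ≠ a) →
          ((applyRule lab tape a m R x).phase = .boundary ↔ (m x).phase = .boundary) ∧
          ((applyRule lab tape a m R x).phase = .won → (m x).phase = .won) := by
        intro x hx
        rcases hcp x with h1 | h1 | h1
        · have : (applyRule lab tape a m R x).phase = (m x).phase := congrArg (·.2) h1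
          rw [this]; exact ⟨Iff.rfl, id⟩
        · rw [h1.2.2.1, h1.2.2.2.2]; simp
        · exact absurd h1.2 (hx h1.1)
      have hlocal : (R = candidateRule → BoundaryState (applyRule lab tape a m R) a) →
          (∀ x, ¬ SameBoundary c a ∨ R ≠ candidateRule → SameBoundary c x →
            (applyRule lab tape a m R x).boundaryPart = (m x).boundaryPart) →
          BoundaryState (applyRule lab tape a m R) c := by
        intro h1 h2
        by_cases hRc : R = candidateRule ∧ SameBoundary c a
        · exact (h1 hRc.1).trans hRc.2
        · have h3 : ∀ x, SameBoundary c x → R = candidateRule → x ≠ a := by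
            rintro x hx hR rfl
            exact hRc ⟨hR, hx⟩
          exact (ih c).congr hw hca (fun x hx => (hphase x (h3 x hx)).1)
            (fun x hx => (hphase x (h3 x hx)).2)
            fun x hx => h2 x (not_and_or.1 hRc).symm hx
      by_cases hRc : R = candidateRule
      · subst hRc
        refine hlocal (fun _ => candidateRule_step hS hb (ih a)) fun x hx hcx => ?_
        rw [candidateRule_of_ne]
        rintro rfl
        exact (hx.resolve_right (by simp)) hcx
      by_cases hRa : R = angleRule
      · subst hRa
        by_cases hca' : SameBoundary c a
        · exact (angleRule_step hb (ih a)).trans hca'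
        · exact hlocal (fun h => absurd h hRc) fun x _ hcx =>
            angleRule_of_ne m fun h => hca' (hcx.trans h)
      · exact hlocal (fun h => absurd h hRc) fun x _ _ => rule_boundaryPart hR hRa hRc a m x

/-! ### Progress of the comparison -/

theorem receive_beaten (t : DigitToken r) (s : AgentState r) (h : s.beaten = true) :
    (receive t s).beaten = true := by
  unfold receive judge
  dsimp only
  split_ifs <;> (try split) <;> simp_all

theorem Step.compare {m m' : Mem A r} (h : Step lab tape m m') (z : Agent A) :
    ((m z).created = true → (m' z).created = true) ∧ ((m z).beaten = true → (m' z).beaten = true) := by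
  have key : (m' z).comparePart = (m z).comparePart →
      ((m z).created = true → (m' z).created = true) ∧
      ((m z).beaten = true → (m' z).beaten = true) := fun he =>
    ⟨fun h => (congrArg (·.1) he).trans h, fun h => (congrArg (·.2.2.2.2) he).trans h⟩
  cases h with
  | wake a ha =>
    by_cases hza : z = a
    · subst hza; rw [update_self]; exact ⟨id, id⟩
    · rw [update_of_ne hza]; exact ⟨id, id⟩
  | rule a R hR _ =>
    rcases mem_rules_iff.1 hR with h | h | h | h | ⟨ax, sg, h⟩ | ⟨ax, h⟩ | h | h <;> subst h
    · exact key (congrArg (·.2.1) (setupRule_preserves.apply a m z))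
    · by_cases hz : z = a
      · rw [hz, applyRule_self]
        unfold createRule
        split
        · exact ⟨id, id⟩
        · split_ifs <;> exact ⟨fun h => by first | rfl | exact h, fun h => h⟩
      · rw [createRule_of_ne hz]; exact ⟨id, id⟩
    · refine ⟨fun h => (congrArg (·.2.2.2.2.2) (forwardRule_preserves.apply a m z)).trans h, ?_⟩
      by_cases hz : z = a
      · rw [hz, applyRule_self]
        unfold forwardRule
        split
        · exact id
        · split_ifs <;> exact id
      · rw [applyRule_of_ne hz]
        unfold forwardRule
        repeat' split
        all_goals first | exact id | exact receive_beaten _ _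
    · exact key (congrArg (·.2.2.1) (activationRule_preserves.apply a m z))
    · exact key (congrArg (·.2.2.1) ((vectorRule_preserves ax sg).apply a m z))
    · exact key (congrArg (·.2.2.1) ((returnRule_preserves ax).apply a m z))
    · exact key (congrArg (·.2.2.1) (angleRule_preserves.apply a m z))
    · exact key (congrArg (·.2.2.1) (candidateRule_preserves.apply a m z))

theorem Reach.preserve {B : Mem A r → Prop}
    (hB : ∀ m m', Reachable lab tape m → Step lab tape m m' → B m → B m') {m m' : Mem A r}
    (hm : Reachable lab tape m) (h : Reach lab tape m m') (hb : B m) : B m' := by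
  induction h with
  | refl => exact hb
  | tail hr hs ih => exact hB _ _ (hm.trans hr) hs ih

/-- Finitely many goals that persist can be reached one after the other. -/
theorem exists_all {β : Type*} [Finite β] {G : β → Mem A r → Prop} {B : Mem A r → Prop}
    (hB : ∀ m m', Reachable lab tape m → Step lab tape m m' → B m → B m')
    (hG : ∀ b m m', Reachable lab tape m → Step lab tape m m' → G b m → G b m')
    (hreach : ∀ b m, Reachable lab tape m → Fair lab tape sched m → B m →
      ∃ m', Reach lab tape m m' ∧ Fair lab tape sched m' ∧ G b m') {m : Mem A r}
    (hm : Reachable lab tape m) (hf : Fair lab tape sched m) (hb : B m) :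
    ∃ m', Reach lab tape m m' ∧ Fair lab tape sched m' ∧ ∀ b, G b m' := by
  classical
  cases nonempty_fintype β
  have key : ∀ s : Finset β, ∃ m', Reach lab tape m m' ∧ Fair lab tape sched m' ∧
      ∀ b ∈ s, G b m' := by
    intro s
    induction s using Finset.induction_on with
    | empty => exact ⟨m, .refl, hf, by simp⟩
    | insert b s _ ih =>
      obtain ⟨m₁, h1, h2, h3⟩ := ih
      obtain ⟨m₂, h4, h5, h6⟩ := hreach b m₁ (hm.trans h1) h2 (h1.preserve hB hm hb)
      refine ⟨m₂, h1.trans h4, h5, fun b' hb' => ?_⟩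
      rcases Finset.mem_insert.1 hb' with rfl | hb'
      · exact h6
      · exact Reach.preserve (hG b') (hm.trans h1) h4 (h3 b' hb')
  obtain ⟨m', h1, h2, h3⟩ := key univ
  exact ⟨m', h1, h2, fun b => h3 b (mem_univ b)⟩

theorem createRule_created {m : Mem A r} (hm : Reachable lab tape m) {h : Agent A}
    (hh : IsHead tape h) (hs : SegState tape h .done m) {k : ℕ} (hk : k < segLength tape h)
    (hw : (m (succ^[k] h)).awake = true)
    (hp : k ≠ 0 → (m (succ^[k] h).pred).created = true) :
    (applyRule lab tape (succ^[k] h) m createRule (succ^[k] h)).created = true := by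
  obtain ⟨-, h2, -, h4⟩ := hs.fields hk
  have hhead := head_iterate hm.basic hh hk.le hw
  have h2' : (m (succ^[k] h)).rdigit = some (segDigit tape h (segLength tape h - 1 - k)) := h2
  rw [applyRule_self]
  unfold createRule
  rw [h2']
  dsimp only
  by_cases hc : (m (succ^[k] h)).created = false ∧ (if (m (succ^[k] h)).head then
      (m (succ^[k] h)).setupDone else (m (succ^[k] h).pred).created) = true
  · rw [if_pos hc]
  · rw [if_neg hc]
    by_contra hne
    refine hc ⟨by simpa using hne, ?_⟩
    rw [hhead, h4]
    by_cases h0 : k = 0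
    · simp [h0, SetupPhase.isDone]
    · rw [if_neg (by simpa using ⟨h0, hk.ne⟩)]
      exact hp h0

/-- Creation of the digit tokens spreads from the first agent of the segment, so this is an
induction on the position. -/
theorem exists_created (hA : NoneIsolated A) (hno : NoLeader lab tape sched) {m : Mem A r}
    (hm : Reachable lab tape m) (hf : Fair lab tape sched m) (hw : ∀ a, (m a).awake = true)
    {h : Agent A} (hh : IsHead tape h) (hs : SegState tape h .done m) {k : ℕ}
    (hk : k < segLength tape h) :
    ∃ m', Reach lab tape m m' ∧ Fair lab tape sched m' ∧ (m' (succ^[k] h)).created = true := by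
  induction k with
  | zero =>
    obtain ⟨m₁, h1, h2⟩ := exists_rule hA hno hf (hw h) (R := createRule) (mem_rules_iff.2 (by simp))
    have hs₁ := Reach.preserve (fun m m' hm hst hs => hs.done_step hm hst hh) hm h1 hs
    exact ⟨_, h1.tail (.rule _ _ _ (mem_rules_iff.2 (by simp)) (h1.awake (hw _))), h2,
      createRule_created (hm.trans h1) hh hs₁ hk (h1.awake (hw _)) fun h => absurd rfl h⟩
  | succ k ih =>
    obtain ⟨m₀, h0, hf₀, hc⟩ := ih (by omega)
    have hw₀ : ∀ a, (m₀ a).awake = true := fun a => h0.awake (hw a)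
    obtain ⟨m₁, h1, h2⟩ := exists_rule hA hno hf₀ (hw₀ (succ^[k + 1] h)) (R := createRule)
      (mem_rules_iff.2 (by simp))
    have h01 := h0.trans h1
    have hs₁ := Reach.preserve (fun m m' hm hst hs => hs.done_step hm hst hh) hm h01 hs
    have hc₁ := Reach.preserve (B := fun m => (m (succ^[k] h)).created = true)
      (fun m m' _ hst => (hst.compare _).1) (hm.trans h0) h1 hc
    refine ⟨_, h01.tail (.rule _ _ _ (mem_rules_iff.2 (by simp)) (h1.awake (hw₀ _))), h2,
      createRule_created (hm.trans h01) hh hs₁ hk (h1.awake (hw₀ _)) fun _ => ?_⟩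
    rwa [iterate_succ_apply', pred_succ]

/-- All digit tokens are created. -/
theorem exists_all_created (hA : NoneIsolated A) (hno : NoLeader lab tape sched) {m : Mem A r}
    (hm : Reachable lab tape m) (hf : Fair lab tape sched m) (hw : ∀ a, (m a).awake = true) :
    ∃ m', Reach lab tape m m' ∧ Fair lab tape sched m' ∧
      ∀ x, HasHead tape x → (m' x).created = true := by
  obtain ⟨m₁, h1, h2, h3⟩ := exists_all (β := {h : Agent A // IsHead tape h})
    (G := fun h m => SegState tape h.1 .done m) (B := fun m => ∀ a, (m a).awake = true)
    (fun m m' _ hst hw a => hst.awake (hw a))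
    (fun b m m' hm hst hs => hs.done_step hm hst b.2)
    (fun b m hm hf hw => exists_segment_done hA hno hm hf hw b.2) hm hf hw
  obtain ⟨m₂, h4, h5, h6⟩ := exists_all (β := {x : Agent A // HasHead tape x})
    (G := fun x m => (m x.1).created = true) (B := fun m => (∀ a, (m a).awake = true) ∧
      ∀ h : {h : Agent A // IsHead tape h}, SegState tape h.1 .done m)
    (fun m m' hm hst hw => ⟨fun a => hst.awake (hw.1 a), fun b => (hw.2 b).done_step hm hst b.2⟩)
    (fun b m m' _ hst => (hst.compare _).1)
    (fun b m hm hf hw => by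
      have := exists_created hA hno hm hf hw.1 (isHead_headOf b.2)
        (hw.2 ⟨_, isHead_headOf b.2⟩) (index_lt b.2)
      rwa [iterate_headOf] at this) (hm.trans h1) h2 ⟨fun a => h1.awake (hw a), h3⟩
  exact ⟨m₂, h1.trans h4, h5, fun x hx => h6 ⟨x, hx⟩⟩

theorem DigitInv.forward_step {F : Agent A → ℕ} {m : Mem A r} (hi : DigitInv tape F m)
    (hm : Reachable lab tape m) {a : Agent A} (hx : HasHead tape a) (hf : CanForward F m a) :
    ForwardStep tape F (update F a (F a + 1)) m (applyRule lab tape a m forwardRule) := by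
  have g2 := (hi.forward hm hx hf).2
  refine ⟨fun x => ?_, fun x hx' => ?_⟩
  · by_cases hxa : x = a
    · subst hxa; rw [update_self]; exact Nat.le_succ _
    · rw [update_of_ne hxa]
  · by_cases hxa : x.succ = a
    · subst hxa
      rw [update_self]
      rw [pred_succ] at g2
      exact .inr ⟨rfl, g2⟩
    · rw [update_of_ne hxa]; exact .inl rfl

/-- The digit tokens keep moving until a goal is reached. -/
theorem exists_forward (hA : NoneIsolated A) (hno : NoLeader lab tape sched) (n : ℕ)
    {Q : (Agent A → ℕ) → Mem A r → Prop} {G : Mem A r → Prop} {h : Agent A}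
    (hh : IsHead tape h)
    (hQ : ∀ F F' m m', Reachable lab tape m → Q F m → ForwardStep tape F F' m m' →
      Step lab tape m m' → Q F' m' ∨ G m')
    (hG : ∀ F m, Reachable lab tape m → DigitInv tape F m → Q F m →
      (∀ x, SameBoundary h x → n ≤ F x) → G m) {F : Agent A → ℕ}
    {m : Mem A r} (hm : Reachable lab tape m) (hf : Fair lab tape sched m)
    (hi : DigitInv tape F m) (hq : Q F m) (hc : ∀ x, HasHead tape x → (m x).created = true) :
    ∃ m', Reach lab tape m m' ∧ Fair lab tape sched m' ∧ G m' := by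
  have hbd : ∀ x, x ∈ h.boundary → HasHead tape x := fun x hx =>
    (hh.hasHead 0).of_sameBoundary (mem_boundary.1 hx)
  have hlt : ∀ {F F' : Agent A → ℕ} {x : Agent A}, F ≤ F' → x ∈ h.boundary → F x < n → F x < F' x →
      ∑ x ∈ h.boundary, (n - F' x) < ∑ x ∈ h.boundary, (n - F x) := by
    intro F F' x hle hx h1 h2
    refine sum_lt_sum (fun y _ => ?_) ⟨x, hx, by omega⟩
    have : F y ≤ F' y := hle y
    omega
  -- The counters grow without bound, so the index is the tuple of counters cut off at `n`. It is an
  -- index and not a function of the memories, because the ghost counters are not determined by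
  -- them.
  refine exists_goal hA hno (ι := Agent A → ℕ) (fun f => ∑ x ∈ h.boundary, (n - f x))
    (fun f m => (∃ F, DigitInv tape F m ∧ Q F m ∧ ∀ x ∈ h.boundary, f x = min n (F x)) ∧
      ∀ x, HasHead tape x → (m x).created = true) G ?_ ?_ hm hf (i := fun x => min n (F x))
    ⟨⟨F, hi, hq, fun _ _ => rfl⟩, hc⟩
  · rintro f m m' hm ⟨⟨F, hi, hq, hfF⟩, hc⟩ hst
    obtain ⟨F', hi', hfs⟩ := hi.step hm hst
    rcases hQ F F' m m' hm hq hfs hst with hq' | hg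
    swap
    · exact .inl hg
    right
    have hc' : ∀ x, HasHead tape x → (m' x).created = true := fun x hx =>
      (hst.compare x).1 (hc x hx)
    by_cases heq : ∀ x ∈ h.boundary, f x = min n (F' x)
    · exact .inl ⟨⟨F', hi', hq', heq⟩, hc'⟩
    · right
      push Not at heq
      obtain ⟨x, hx, hne⟩ := heq
      refine ⟨fun x => min n (F' x), ?_, ⟨F', hi', hq', fun _ _ => rfl⟩, hc'⟩
      have h1 := hfF x hx
      have h2 : F x ≤ F' x := hfs.le x
      refine sum_lt_sum (fun y hy => ?_) ⟨x, hx, by dsimp only; omega⟩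
      have h3 := hfF y hy
      have h4 : F y ≤ F' y := hfs.le y
      dsimp only
      omega
  · rintro f m hm ⟨⟨F, hi, hq, hfF⟩, hc⟩
    by_cases hall : ∀ x ∈ h.boundary, n ≤ f x
    · exact .inl (hG F m hm hi hq fun x hx => by
        have h1 := hfF x (mem_boundary.2 hx)
        have h2 := hall x (mem_boundary.2 hx)
        omega)
    right
    push Not at hall
    obtain ⟨x₀, hx₀, hlt₀⟩ := hall
    -- An agent with the smallest counter holds a token, and its predecessor has room for it. So the
    -- boundary never blocks.
    obtain ⟨x, hx, hmin⟩ := Finset.exists_min_image h.boundary f ⟨x₀, hx₀⟩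
    have hxn : f x < n := (hmin x₀ hx₀).trans_lt hlt₀
    have hR : forwardRule ∈ rules r := mem_rules_iff.2 (by simp)
    refine ⟨x, forwardRule, hR, ((hi x (hbd x hx)).awake (hc x (hbd x hx))), ?_⟩
    rintro m' hm' ⟨⟨F', hi', hq', hfF'⟩, hc'⟩ ha
    have hsucc : x.succ ∈ h.boundary := mem_boundary.2 (mem_boundary.1 hx).succ_right
    have hpred : x.pred ∈ h.boundary := mem_boundary.2 (mem_boundary.1 hx).pred_right
    have hcan : CanForward F' m' x := by
      have h1 := hfF' x hx
      have h2 := hfF' _ hsucc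
      have h3 := hfF' _ hpred
      have h4 := hmin _ hsucc
      have h5 := hmin _ hpred
      exact ⟨hc' _ (hbd _ hx), hc' _ (hbd _ hpred), by omega, by omega⟩
    have hfs := hi'.forward_step (lab := lab) hm' (hbd x hx) hcan
    have hst : Step lab tape m' (applyRule lab tape x m' forwardRule) := .rule _ _ _ hR ha
    rcases hQ _ _ _ _ hm' hq' hfs hst with hq'' | hg
    swap
    · exact .inl hg
    right
    refine ⟨fun y => min n (update F' x (F' x + 1) y), ?_,
      ⟨_, (hi'.forward hm' (hbd x hx) hcan).1, hq'', fun _ _ => rfl⟩,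
      fun y hy => (hst.compare y).1 (hc' y hy)⟩
    refine sum_lt_sum (fun y hy => ?_) ⟨x, hx, ?_⟩
    · have h1 := hfF' y hy
      have h2 : F' y ≤ update F' x (F' x + 1) y := hfs.le y
      dsimp only
      omega
    · have h1 := hfF' x hx
      dsimp only
      rw [update_self]
      omega

/-! ### The candidate with the greatest identifier -/

/-- The segment of `M` has the greatest identifier of its boundary. -/
structure IsGreatest (tape : Tape A r) (M : Agent A) : Prop where
  head : IsHead tape M
  max : ∀ h, IsHead tape h → SameBoundary M h → h ≠ M → key tape h < key tape M

theorem sameBoundary_headOf (x : Agent A) : SameBoundary x (headOf tape x) :=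
  SameBoundary.symm ⟨_, iterate_headOf x⟩

theorem IsGreatest.verdict_ne {M : Agent A} (h : IsGreatest tape M) (k : ℕ) :
    verdict tape k M ≠ some .gt := by
  rw [verdict_eq h.head]
  split_ifs with hc
  · intro he
    rw [Option.some.injEq, compare_gt_iff_gt] at he
    have hM : SameBoundary M (headOf tape (succ^[k + 1] M)) :=
      SameBoundary.trans ⟨_, rfl⟩ (sameBoundary_headOf _)
    by_cases hne : headOf tape (succ^[k + 1] M) = M
    · rw [hne] at he; exact lt_irrefl _ he
    · exact lt_asymm he (h.max _ (isHead_headOf (h.head.hasHead _)) hM hne)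
  · simp

/-- An agent is beaten only through a verdict `.gt`, and no token sequence compares greater than the
greatest segment. -/
theorem IsGreatest.not_beaten {M : Agent A} (h : IsGreatest tape M) {m : Mem A r}
    (hm : Reachable lab tape m) : (m M).beaten = false := by
  obtain ⟨F, hF⟩ := hm.digitInv
  have hd := hF M (h.head.hasHead 0)
  cases hc : (m M).created with
  | false => exact (hd.fresh hc).2.2.2.2.2
  | true =>
    by_contra hb
    obtain ⟨-, k, -, hk⟩ := (hd.beaten hc).1 (by simpa using hb)
    exact h.verdict_ne k hk

/-- The delimiter of the segment of `M` comes from its last agent, at distance `j + segLength tape M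
- 1` from `x`, and this distance is its number in the trace of `x`. Verdict `k` concerns the token
with number `k + 1`. -/
theorem verdict_at {M x : Agent A} (hM : IsHead tape M) (hx : IsHead tape x) {j : ℕ} (hj : 0 < j)
    (hjM : succ^[j] x = M) (hl : segLength tape x ≤ segLength tape M)
    (hl' : segLength tape x ≤ j + segLength tape M - 1) :
    verdict tape (j + segLength tape M - 2) x = some (compare (key tape M) (key tape x)) := by
  have h0 := segLength_pos (tape := tape) M
  have h1 : succ^[j + segLength tape M - 2 + 2] x = succ^[segLength tape M] M := by
    rw [show j + segLength tape M - 2 + 2 = segLength tape M + j by omega,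
      iterate_add_apply, hjM]
  have h2 : succ^[j + segLength tape M - 2 + 1] x = succ^[segLength tape M - 1] M := by
    rw [show j + segLength tape M - 2 + 1 = segLength tape M - 1 + j by omega,
      iterate_add_apply, hjM]
  rw [verdict_eq hx, h1, h2, headOf_iterate hM (by omega), if_pos]
  exact ⟨isHead_segLength hM, by omega, hl⟩

/-- The greatest segment is at least as long as that of `x`, so its delimiter arrives at `x` active.
Distance and length are at most one period each, hence the bound. -/
theorem IsGreatest.exists_gt {M x : Agent A} (h : IsGreatest tape M) (hx : IsHead tape x)
    (hMx : SameBoundary M x) (hne : x ≠ M) :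
    ∃ k < 2 * M.period, verdict tape k x = some .gt := by
  obtain ⟨j, hj, hjM⟩ := hMx.symm.exists_lt
  have hper := hMx.period_eq
  have hj0 : 0 < j := by
    rcases Nat.eq_zero_or_pos j with rfl | h0
    · exact absurd hjM hne
    · exact h0
  have hlt := h.max x hx hMx hne
  have hl : segLength tape x ≤ segLength tape M := by
    rcases Prod.Lex.lt_iff.1 hlt with h1 | h1
    · exact h1.le
    · exact h1.1.le
  have hjl : segLength tape x ≤ j := by
    by_contra hc
    exact not_isHead_of_lt hj0 (not_le.1 hc) (hjM ▸ h.head)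
  have h0 := segLength_pos (tape := tape) M
  have h1 := segLength_le_period (tape := tape) M
  refine ⟨_, ?_, (verdict_at h.head hx hj0 hjM hl (by omega)).trans ?_⟩
  · omega
  · rw [Option.some.injEq, compare_gt_iff_gt]; exact hlt

/-- The delimiter of the segment of `M` reaches `M` again after any number of rounds. -/
theorem exists_verdict_eq {M : Agent A} (hM : IsHead tape M) (n : ℕ) :
    ∃ k, n ≤ k ∧ verdict tape k M = some .eq := by
  have h0 := segLength_pos (tape := tape) M
  have h1 := segLength_le_period (tape := tape) M
  have h2 := M.two_le_period
  have hper : succ^[M.period * (n + 1)] M = M := by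
    rw [← iterate_mod, Nat.mul_mod_right]; rfl
  have h3 : M.period ≤ M.period * (n + 1) := Nat.le_mul_of_pos_right _ (by omega)
  have h4 : 2 * (n + 1) ≤ M.period * (n + 1) := Nat.mul_le_mul_right _ h2
  refine ⟨_, ?_, (verdict_at hM hM (by omega) hper le_rfl (by omega)).trans ?_⟩
  · omega
  · rw [Option.some.injEq, compare_eq_iff_eq]

/-! ### The candidates -/

theorem Step.candidate {m m' : Mem A r} (h : Step lab tape m m') {x : Agent A}
    (hx : (m x).awake = true) : (m' x).candidatePart = (m x).candidatePart ∨
      ((m x).cand = true ∧ (m x).phase = .idle ∧ (m' x).cand = true ∧ (m' x).phase = .requested) ∨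
      m' = applyRule lab tape x m candidateRule := by
  cases h with
  | wake a ha =>
    left
    rw [update_of_ne]
    rintro rfl
    rw [hx] at ha
    cases ha
  | rule a R hR _ =>
    rcases rule_candidatePart (lab := lab) (tape := tape) hR a m x with h | h | ⟨rfl, rfl⟩
    · exact .inl h
    · exact .inr (.inl h.2)
    · exact .inr (.inr rfl)

theorem Step.not_cand {m m' : Mem A r} (h : Step lab tape m m') {x : Agent A}
    (hx : (m x).awake = true) (hc : (m x).cand = false) : (m' x).cand = false := by
  rcases h.candidate hx with h | h | rfl
  · exact (congrArg (·.1) h).trans hc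
  · rw [h.1] at hc; cases hc
  · rw [applyRule_self, (candidateRule_self_spec _ _ _ _).2.2.1 hc]; exact hc

theorem Sole.step {m m' : Mem A r} {c : Agent A} (h : Sole m c) (hs : Step lab tape m m') :
    Sole m' c := h.congr (fun _ => hs.awake) fun _ => hs.not_cand

theorem candidateRule_spec (v : LocalView r) (p s q : AgentState r) (hc : s.cand = true) :
    (s.beaten = true → s.phase = .idle ∨ s.phase = .requested →
      (candidateRule v p s q).self.cand = false) ∧
    (s.beaten = false → s.phase = .idle → (candidateRule v p s q).self = s) ∧
    (s.beaten = false → s.phase = .requested →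
      (candidateRule v p s q).self = { s with phase := .solitude, act := some v.inDir }) ∧
    (∀ b : Axis → Bool, s.phase = .solitude → (∀ ax, s.report ax = some (b ax)) →
      (s.beaten = true → (candidateRule v p s q).self.cand = false) ∧
      (s.beaten = false → (candidateRule v p s q).self.cand = true ∧
        ((candidateRule v p s q).self.phase = .idle ∨ (candidateRule v p s q).self.phase = .boundary)
        ∧ ((∀ ax, b ax = true) → (candidateRule v p s q).self.phase = .boundary))) ∧
    (s.phase = .boundary → s.total = none → (candidateRule v p s q).self = s) ∧
    (s.phase = .boundary → s.total = some 1 → (candidateRule v p s q).self.phase = .won) := by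
  obtain ⟨awake, head, cand, aid, digit, rdigit, setup, setupDone, created, queue, active, cmp,
    beaten, phase, act, vec, ret, report, angle, total⟩ := s
  dsimp only at hc
  subst hc
  refine ⟨?_, ?_, ?_, ?_, ?_, ?_⟩ <;> dsimp only
  · rintro rfl (rfl | rfl) <;> rfl
  · rintro rfl rfl; rfl
  · rintro rfl rfl; rfl
  · rintro b rfl hr
    have he : candidateRule v p ⟨awake, head, true, aid, digit, rdigit, setup, setupDone, created,
        queue, active, cmp, beaten, .solitude, act, vec, ret, report, angle, total⟩ q =
        { self := if beaten then withdraw ⟨awake, head, true, aid, digit, rdigit, setup, setupDone,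
            created, queue, active, cmp, beaten, .solitude, act, vec, ret, fun _ => none, angle, total⟩
          else if b .x && b .y then ⟨awake, head, true, aid, digit, rdigit, setup, setupDone,
            created, queue, active, cmp, beaten, .boundary, act, vec, ret, fun _ => none, some 0, total⟩
          else ⟨awake, head, true, aid, digit, rdigit, setup, setupDone,
            created, queue, active, cmp, beaten, .idle, act, vec, ret, fun _ => none, angle, total⟩ } := by
      rw [candidateRule, if_neg (by simp)]
      dsimp only
      rw [hr .x, hr .y]
    rw [he]
    refine ⟨?_, ?_⟩
    · rintro rfl; rfl
    · rintro rfl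
      rw [if_neg (by simp)]
      refine ⟨by split_ifs <;> rfl, ?_, fun hb => ?_⟩
      · split_ifs
        · exact .inr rfl
        · exact .inl rfl
      · rw [hb, hb]; rfl
  · rintro rfl rfl; rfl
  · rintro rfl rfl; rfl

/-- These phases are entered after a successful verification only, and being alone is permanent. -/
theorem sole_of_phase {m : Mem A r} (hm : Reachable lab tape m) {x : Agent A}
    (h : (m x).phase = .boundary ∨ (m x).phase = .won) : Sole m x := by
  have hb := hm.basic
  cases hm.boundaryState x with
  | quiet hq => exact ((hq x (.refl x)).2.2 (h.resolve_left (hq x (.refl x)).1)).1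
  | running d o h1 h2 h3 =>
    by_cases hxd : x = d
    · subst hxd; exact h3
    · rw [hb.phase_of_not_cand x (h3 x h1.symm hxd).2] at h
      simp at h

theorem turn_of_won {m : Mem A r} (hm : Reachable lab tape m) {x : Agent A}
    (h : (m x).phase = .won) : (x.totalTurn : ZMod 5) = 1 := by
  cases hm.boundaryState x with
  | quiet hq => exact ((hq x (.refl x)).2.2 h).2
  | running d o h1 h2 h3 =>
    by_cases hxd : x = d
    · subst hxd; rw [h] at h2; cases h2
    · rw [hm.basic.phase_of_not_cand x (h3 x h1.symm hxd).2] at h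
      cases h

/-- The total that is reported is the total turn of the boundary. -/
theorem total_eq {m : Mem A r} (hm : Reachable lab tape m) {x : Agent A}
    (h : (m x).phase = .boundary) {k : ZMod 5} (hk : (m x).total = some k) :
    k = x.totalTurn := by
  cases hm.boundaryState x with
  | quiet hq => exact absurd h (hq x (.refl x)).1
  | running d o h1 h2 h3 h4 =>
    obtain rfl : x = d := by
      by_contra hxd
      rw [hm.basic.phase_of_not_cand x (h3 x h1.symm hxd).2] at h
      cases h
    have htot : (m x).total = _ := congrArg (·.2) (h4.2 0 x.period_pos)
    rw [hk] at htot
    cases o with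
    | some j => rw [anglePart_some] at htot; cases htot
    | none =>
      rw [anglePart_none, if_pos rfl, Option.some.injEq] at htot
      exact htot

/-- The greatest candidate of a boundary with the right total turn never withdraws. -/
theorem IsGreatest.cand {M : Agent A} (h : IsGreatest tape M)
    (hT : (M.totalTurn : ZMod 5) = 1) {m : Mem A r} (hm : Reachable lab tape m)
    (hw : (m M).awake = true) : (m M).cand = true := by
  induction hm with
  | refl => simp [blank] at hw
  | tail hr hs ih =>
    rename_i m m'
    by_cases hw' : (m M).awake = true
    · have hc := ih hw'
      rcases hs.candidate hw' with h1 | h1 | rfl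
      · exact (congrArg (·.1) h1).trans hc
      · exact h1.2.2.1
      · rw [applyRule_self]
        have hcase := candidateRule_case (view lab tape M) (m M.pred) (m M) (m M.succ)
        have hnb := h.not_beaten (lab := lab) hr
        have htot := fun hph k hk => total_eq (lab := lab) hr (x := M) (k := k) hph hk
        generalize (candidateRule (view lab tape M) (m M.pred) (m M) (m M.succ)).self = s at *
        cases hcase with
        | same => exact hc
        | withdraw _ hb => rw [hnb] at hb; cases hb
        | start => exact hc
        -- A failed verification only makes the candidate idle again, since it is not beaten.
        | verified => rw [if_neg (by rw [hnb]; simp)]; split_ifs <;> exact hc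
        | identified k _ hph ht =>
          rw [if_pos ((htot hph k ht).trans hT)]
          exact hc
    · cases hs with
      | wake a ha =>
        by_cases hMa : M = a
        · subst hMa; rw [update_self]; exact h.head
        · rw [update_of_ne hMa] at hw; exact absurd hw hw'
      | rule a R hR _ => rw [rule_awake hR] at hw; exact absurd hw hw'

/-! ### Every execution elects a leader -/

theorem candidateRule_mem : candidateRule ∈ rules r := mem_rules_iff.2 (by simp)

/-- A candidate that keeps its state until it is activated makes its decision. -/
theorem exists_decision (hA : NoneIsolated A) (hno : NoLeader lab tape sched) {x : Agent A} {P G : Mem A r → Prop}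
    (hP : ∀ m m', Reachable lab tape m → P m → Step lab tape m m' → G m' ∨ P m')
    (hG : ∀ m, Reachable lab tape m → P m → G (applyRule lab tape x m candidateRule)) {m : Mem A r}
    (hm : Reachable lab tape m) (hf : Fair lab tape sched m) (hw : (m x).awake = true) (hp : P m) :
    ∃ m', Reach lab tape m m' ∧ Fair lab tape sched m' ∧ G m' :=
  exists_goal hA hno (ι := Unit) (fun _ => (0 : ℕ)) (fun _ m => P m ∧ (m x).awake = true) G
    (fun _ m m' hm hp hst => (hP m m' hm hp.1 hst).imp_right fun h => .inl ⟨h, hst.awake hp.2⟩)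
    (fun _ m hm hp => .inr ⟨x, candidateRule, candidateRule_mem, hp.2,
      fun m hm hp _ => .inl (hG m hm hp.1)⟩) hm hf (i := ()) ⟨hp, hw⟩

theorem report_of_stage {m : Mem A r} {S : Agent A → VState} (h : VerInv lab m S) {c : Agent A}
    {e : ℕ} {b : Axis → Bool} (hs : (S c).stage = .back e fun ax => .reported (b ax)) (ax : Axis) :
    (m c).report ax = some (b ax) := by
  rw [(h.at' c).report, hs]; rfl

/-- A candidate that has seen a higher identifier withdraws, unless it is alone. -/
theorem exists_withdrawn (hA : NoneIsolated A) (hno : NoLeader lab tape sched) {x : Agent A} {m : Mem A r}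
    (hm : Reachable lab tape m) (hf : Fair lab tape sched m) (hw : ∀ a, (m a).awake = true)
    (hb : (m x).beaten = true) (hsole : ¬ Sole m x) :
    ∃ m', Reach lab tape m m' ∧ Fair lab tape sched m' ∧ (m' x).cand = false := by
  by_cases hc : (m x).cand = false
  · exact ⟨m, .refl, hf, hc⟩
  have hc : (m x).cand = true := by simpa using hc
  have hwait : (m x).phase = .idle ∨ (m x).phase = .requested →
      ∃ m', Reach lab tape m m' ∧ Fair lab tape sched m' ∧ (m' x).cand = false := fun hph =>
    exists_decision hA hno (x := x) (P := fun m => (m x).awake = true ∧ (m x).beaten = true ∧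
      (m x).cand = true ∧ ((m x).phase = .idle ∨ (m x).phase = .requested))
      (G := fun m => (m x).cand = false)
      (fun m m' _ hp hst => by
        obtain ⟨h1, h2, h3, h4⟩ := hp
        rcases hst.candidate h1 with h | h | rfl
        · right
          have hph : (m' x).phase = (m x).phase := congrArg (·.2) h
          exact ⟨hst.awake h1, (hst.compare x).2 h2, (congrArg (·.1) h).trans h3, by rwa [hph]⟩
        · exact .inr ⟨hst.awake h1, (hst.compare x).2 h2, h.2.2.1, .inr h.2.2.2⟩
        · left
          rw [applyRule_self]
          exact (candidateRule_spec _ _ _ _ h3).1 h2 h4)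
      (fun m _ hp => by
        rw [applyRule_self]
        exact (candidateRule_spec _ _ _ _ hp.2.2.1).1 hp.2.1 hp.2.2.2)
      hm hf (hw x) ⟨hw x, hb, hc, hph⟩
  cases hph : (m x).phase with
  | idle => exact hwait (.inl hph)
  | requested => exact hwait (.inr hph)
  | boundary => exact absurd (sole_of_phase hm (.inl hph)) hsole
  | won => exact absurd (sole_of_phase hm (.inr hph)) hsole
  -- A verification in progress is completed first. Being beaten is permanent, so the candidate
  -- withdraws afterwards whatever the result is.
  | solitude =>
    obtain ⟨m₁, h1, h2, h3, h4, S, e, b, h5, h6, -⟩ := exists_verified hA hno (c := x)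
      (K := fun _ => True) (Q := fun m => (m x).beaten = true)
      (fun _ _ _ hst => (hst.compare x).2) (fun _ _ _ _ => trivial) hm hf hw hph hb
      (fun _ _ _ _ _ => trivial)
    refine ⟨_, h1.tail (.rule _ _ _ candidateRule_mem (h1.awake (hw x))), h2, ?_⟩
    rw [applyRule_self]
    have hc₁ : (m₁ x).cand = true := h5.cand (Reachable.basic (hm.trans h1)) (by rw [h6]; simp)
    exact ((candidateRule_spec _ _ _ _ hc₁).2.2.2.1 b h4 (report_of_stage h5 h6)).1 h3

/-- All candidates but the greatest one withdraw. -/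
theorem exists_sole (hA : NoneIsolated A) (hno : NoLeader lab tape sched) {M : Agent A}
    (hM : IsGreatest tape M) (hT : (M.totalTurn : ZMod 5) = 1) {m : Mem A r}
    (hm : Reachable lab tape m) (hf : Fair lab tape sched m) (hw : ∀ a, (m a).awake = true)
    (hc : ∀ x, HasHead tape x → (m x).created = true) :
    ∃ m', Reach lab tape m m' ∧ Fair lab tape sched m' ∧ Sole m' M := by
  obtain ⟨F, hF⟩ := hm.digitInv
  -- After this many tokens, every other candidate of the boundary has received the delimiter of the
  -- greatest segment, by `IsGreatest.exists_gt`.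
  obtain ⟨m₁, h1, h2, F₁, h3, h4⟩ := exists_forward hA hno (2 * M.period) hM.head
    (Q := fun _ _ => True)
    (G := fun m => ∃ F, DigitInv tape F m ∧ ∀ x, SameBoundary M x → 2 * M.period ≤ F x)
    (fun _ _ _ _ _ _ _ _ => .inl trivial) (fun F m _ hi _ hn => ⟨F, hi, hn⟩) hm hf hF trivial hc
  have hw₁ : ∀ a, (m₁ a).awake = true := fun a => h1.awake (hw a)
  have hbeat : ∀ x, SameBoundary M x → IsHead tape x → x ≠ M → (m₁ x).beaten = true := by
    intro x hMx hx hne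
    obtain ⟨k, hk, hv⟩ := hM.exists_gt hx hMx hne
    have hx' := hx.hasHead 0
    have hcx := h1.preserve (B := fun m => (m x).created = true)
      (fun m m' _ hst => (hst.compare x).1) hm (hc x hx')
    exact ((h3 x hx').beaten hcx).2 ⟨hx, k, hk.trans_le (h4 _ hMx.succ_right), hv⟩
  obtain ⟨m₂, h5, h6, h7⟩ := exists_all (lab := lab) (tape := tape) (sched := sched)
    (β := {x : Agent A // SameBoundary M x ∧ x ≠ M})
    (G := fun x m => (m x.1).awake = true ∧ (m x.1).cand = false)
    (B := fun m => (∀ a, (m a).awake = true) ∧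
      ∀ x, SameBoundary M x → IsHead tape x → x ≠ M → (m x).beaten = true)
    (fun m m' _ hst h => ⟨fun a => hst.awake (h.1 a), fun x h1 h2 h3 => (hst.compare x).2 (h.2 x h1 h2 h3)⟩)
    (fun x m m' _ hst h => ⟨hst.awake h.1, hst.not_cand h.1 h.2⟩)
    (fun x m hm hf h => by
      obtain ⟨x, hMx, hne⟩ := x
      by_cases hx : IsHead tape x
      -- `M` is still a candidate, so `x` is not alone.
      · obtain ⟨m', g1, g2, g3⟩ := exists_withdrawn hA hno hm hf h.1 (h.2 x hMx hx hne)
          fun hsole => by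
            have := (hsole M hMx.symm hne.symm).2
            rw [hM.cand hT hm (h.1 M)] at this
            cases this
        exact ⟨m', g1, g2, g1.awake (h.1 x), g3⟩
      · refine ⟨m, .refl, hf, h.1 x, ?_⟩
        by_contra hcx
        exact hx (hm.basic.coin_of_cand x (by simpa using hcx)))
    (hm.trans h1) h2 ⟨hw₁, hbeat⟩
  exact ⟨m₂, h1.trans h5, h6, fun x hx hne => h7 ⟨x, hx, hne⟩⟩

section sole

variable {M : Agent A}

/-- The greatest candidate requests a solitude verification again and again. -/
theorem exists_requested (hA : NoneIsolated A) (hno : NoLeader lab tape sched)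
    (hM : IsGreatest tape M) (hT : (M.totalTurn : ZMod 5) = 1) {m : Mem A r}
    (hm : Reachable lab tape m) (hf : Fair lab tape sched m) (hw : ∀ a, (m a).awake = true)
    (hc : ∀ x, HasHead tape x → (m x).created = true) (hph : (m M).phase = .idle) :
    ∃ m', Reach lab tape m m' ∧ Fair lab tape sched m' ∧ (m' M).phase = .requested := by
  obtain ⟨F, hF⟩ := hm.digitInv
  -- A verdict of equality that is still to come. If `M` is idle when it comes, `M` requests a
  -- verification.
  obtain ⟨k, hk, hv⟩ := exists_verdict_eq hM.head (F M.succ)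
  refine exists_forward hA hno (k + 1) hM.head
    (Q := fun F m => (m M).awake = true ∧ (m M).phase = .idle ∧ F M.succ ≤ k)
    (G := fun m => (m M).phase = .requested) ?_ ?_ hm hf hF ⟨hw M, hph, hk⟩ hc
  · rintro F F' m m' hm ⟨h1, h2, h3⟩ hfs hst
    have hcM := hM.cand hT hm h1
    have hph' : (m' M).phase = .idle ∨ (m' M).phase = .requested := by
      rcases hst.candidate h1 with h | h | rfl
      · exact .inl ((congrArg (·.2) h).trans h2)
      · exact .inr h.2.2.2
      · left
        rw [applyRule_self, (candidateRule_spec _ _ _ _ hcM).2.1 (hM.not_beaten hm) h2]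
        exact h2
    rcases hph' with hph' | hph'
    swap
    · exact .inr hph'
    rcases hfs.eq M (hM.head.hasHead 0) with h | ⟨h, h'⟩
    · exact .inl ⟨hst.awake h1, hph', by rwa [h]⟩
    · by_cases hFk : F M.succ = k
      · exact .inr (h' hM.head (by rw [hFk]; exact hv) hcM h2)
      · exact .inl ⟨hst.awake h1, hph', by omega⟩
  · rintro F m hm hi ⟨h1, h2, h3⟩ hn
    have := hn M.succ (SameBoundary.refl M).succ_right
    omega

/-- The token advances along the boundary while `M` waits for it. The total it reports is 1, so `M`
wins. -/
theorem exists_identified (hA : NoneIsolated A) (hno : NoLeader lab tape sched)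
    (hT : (M.totalTurn : ZMod 5) = 1) {m : Mem A r}
    (hm : Reachable lab tape m) (hf : Fair lab tape sched m) (hw : ∀ a, (m a).awake = true)
    (hph : (m M).phase = .boundary) :
    ∃ m', Reach lab tape m m' ∧ Fair lab tape sched m' ∧ (m' M).phase = .won := by
  have hcand : ∀ {m : Mem A r}, Reachable lab tape m → (m M).phase = .boundary →
      (m M).cand = true := by
    intro m hm h
    by_contra hc
    rw [hm.basic.phase_of_not_cand M (by simpa using hc)] at h
    cases h
  have hat : ∀ {m : Mem A r}, Reachable lab tape m → (m M).phase = .boundary →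
      ∃ o, AngleAt m M o := by
    intro m hm h
    cases hm.boundaryState M with
    | quiet hq => exact absurd h (hq M (.refl M)).1
    | running d o h1 h2 h3 h4 =>
      obtain rfl : M = d := by
        by_contra hxd
        rw [hm.basic.phase_of_not_cand M (h3 M h1.symm hxd).2] at h
        cases h
      exact ⟨o, h4⟩
  have htotal : ∀ {m : Mem A r} {o : Option ℕ}, AngleAt m M o → (m M).total =
      if o = none then some 1 else none := by
    intro m o h
    have htot : (m M).total = _ := congrArg (·.2) (h.2 0 M.period_pos)
    rw [htot]
    cases o with
    | none => rw [anglePart_none, hT]; rfl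
    | some j => rw [anglePart_some]; rfl
  have hR : (angleRule : Rule r) ∈ rules r := mem_rules_iff.2 (by simp)
  let μ : Option ℕ → ℕ := fun o => match o with
    | none => 0
    | some j => M.period - j
  obtain ⟨o, ho⟩ := hat hm hph
  have hangle : ∀ {m : Mem A r} {o : Option ℕ} {j : ℕ}, Reachable lab tape m →
      (m M).phase = .boundary → AngleAt m M o → j < M.period →
      (o ≠ some j ∧ applyRule lab tape (succ^[j] M) m angleRule = m) ∨ o = some j ∧ ∃ o',
        μ o' < μ o ∧ AngleAt (applyRule lab tape (succ^[j] M) m angleRule) M o' ∧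
        (applyRule lab tape (succ^[j] M) m angleRule M).phase = .boundary := by
    intro m o j hm hph ho hj
    rcases ho.step (lab := lab) (tape := tape) (hcand hm hph) (sole_of_phase hm (.inl hph)) hj with
      h | ⟨rfl, h⟩
    · exact .inl h
    · refine .inr ⟨rfl, _, ?_, h, (congrArg (·.2.2.2.2.2)
        (angleRule_preserves.apply (lab := lab) (tape := tape) _ m M)).trans hph⟩
      split_ifs <;> simp only [μ] <;> omega
  refine exists_goal hA hno μ (fun o m => (∀ a, (m a).awake = true) ∧ (m M).phase = .boundary ∧
    AngleAt m M o) (fun m => (m M).phase = .won) ?_ ?_ hm hf ⟨hw, hph, ho⟩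
  · rintro o m m' hm ⟨hw, hph, ho⟩ hst
    have hw' : ∀ a, (m' a).awake = true := fun a => hst.awake (hw a)
    have hsame : (m' M).phase = .boundary → (∀ x, SameBoundary M x →
        (m' x).boundaryPart = (m x).boundaryPart) → (∀ a, (m' a).awake = true) ∧
        (m' M).phase = .boundary ∧ AngleAt m' M o := fun h1 h2 =>
      ⟨hw', h1, ho.1, fun k hk => (h2 _ ⟨k, rfl⟩).trans (ho.2 k hk)⟩
    have hsole := sole_of_phase hm (.inl hph)
    cases hst with
    | wake a ha => rw [hw a] at ha; cases ha
    | rule a R hR' _ =>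
    by_cases hRc : R = candidateRule
    · subst hRc
      by_cases haM : a = M
      · subst haM
        cases o with
        | none =>
          left
          rw [applyRule_self]
          exact (candidateRule_spec _ _ _ _ (hcand hm hph)).2.2.2.2.2 hph (htotal ho)
        | some j =>
          right; left
          have he : applyRule lab tape a m candidateRule = m := by
            classical
            rw [candidateRule_eq, (candidateRule_spec _ _ _ _ (hcand hm hph)).2.2.2.2.1 hph
              (htotal ho), update_eq_self]
          rw [he]
          exact ⟨hw, hph, ho⟩
      · refine .inr (.inl (hsame (by rw [candidateRule_of_ne (Ne.symm haM)]; exact hph)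
          fun x hx => ?_))
        by_cases hxa : x = a
        · rw [hxa] at hx ⊢
          rw [applyRule_self, (candidateRule_self_spec _ _ _ _).2.2.1 (hsole a hx haM).2]
        · rw [candidateRule_of_ne hxa]
    have hph' : (applyRule lab tape a m R M).phase = .boundary := by
      rcases rule_candidatePart (lab := lab) (tape := tape) hR' a m M with h | h | h
      · exact (congrArg (·.2) h).trans hph
      · rw [hph] at h; simp at h
      · exact absurd h.1 hRc
    by_cases hRa : R = angleRule
    · subst hRa
      by_cases hMa : SameBoundary M a
      · obtain ⟨j, hj, rfl⟩ := hMa.exists_lt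
        right
        rcases hangle hm hph ho hj with ⟨-, h⟩ | ⟨-, o', h1, h2, h3⟩
        · rw [h]; exact .inl ⟨hw, hph, ho⟩
        · exact .inr ⟨o', h1, hw', h3, h2⟩
      · exact .inr (.inl (hsame hph' fun x hx => angleRule_of_ne m fun h => hMa (hx.trans h)))
    · exact .inr (.inl (hsame hph' fun x _ => rule_boundaryPart hR' hRa hRc a m x))
  · rintro o m hm ⟨hw, hph, ho⟩
    right
    cases o with
    | none =>
      refine ⟨M, candidateRule, candidateRule_mem, hw M, ?_⟩
      rintro m hm ⟨hw, hph, ho⟩ -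
      left
      rw [applyRule_self]
      exact (candidateRule_spec _ _ _ _ (hcand hm hph)).2.2.2.2.2 hph (htotal ho)
    | some j =>
      refine ⟨succ^[j] M, angleRule, hR, hw _, ?_⟩
      rintro m hm ⟨hw, hph, ho⟩ -
      right
      rcases hangle hm hph ho (ho.1 j rfl) with ⟨h, -⟩ | ⟨-, o', h1, h2, h3⟩
      · exact absurd rfl h
      · exact ⟨o', h1, fun a => by rw [rule_awake hR]; exact hw a, h3, h2⟩

/-- The verification of the only candidate succeeds. -/
theorem exists_boundary (hA : NoneIsolated A) (hno : NoLeader lab tape sched)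
    (hM : IsGreatest tape M) (hT : (M.totalTurn : ZMod 5) = 1) {m : Mem A r}
    (hm : Reachable lab tape m) (hf : Fair lab tape sched m) (hw : ∀ a, (m a).awake = true)
    (hsole : Sole m M) (hph : (m M).phase = .requested) :
    ∃ m', Reach lab tape m m' ∧ Fair lab tape sched m' ∧ (m' M).phase = .boundary := by
  -- The activation token is still at `M` after this decision, so the verification has not turned
  -- yet. It will turn at a candidate, and `M` is the only one.
  have hdecide : ∀ m : Mem A r, Reachable lab tape m →
      (m M).awake = true ∧ (m M).phase = .requested →
      (applyRule lab tape M m candidateRule M).phase = .solitude ∧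
        (applyRule lab tape M m candidateRule M).act ≠ none := by
    rintro m hm ⟨h1, h2⟩
    rw [applyRule_self, (candidateRule_spec _ _ _ _ (hM.cand hT hm h1)).2.2.1
      (hM.not_beaten hm) h2]
    exact ⟨rfl, by simp⟩
  obtain ⟨m₁, h1, h2, h3, h4⟩ := exists_decision hA hno (x := M)
    (P := fun m => (m M).awake = true ∧ (m M).phase = .requested)
    (G := fun m => (m M).phase = .solitude ∧ (m M).act ≠ none)
    (fun m m' hm hP hst => by
      rcases hst.candidate hP.1 with h | h | rfl
      · exact .inr ⟨hst.awake hP.1, (congrArg (·.2) h).trans hP.2⟩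
      · rw [hP.2] at h; simp at h
      · exact .inl (hdecide m hm hP))
    hdecide hm hf (hw M) ⟨hw M, hph⟩
  have hm₁ : Reachable lab tape m₁ := hm.trans h1
  have hw₁ : ∀ a, (m₁ a).awake = true := fun a => h1.awake (hw a)
  obtain ⟨m₂, h5, h6, h7, h8, S, e, b, h9, h10, h11⟩ := exists_verified hA hno (c := M)
    (K := fun e => succ^[e] M = M) (Q := fun m => Sole m M) (fun _ _ _ hst h => h.step hst)
    (fun m e hs he => by
      by_contra hne
      rw [(hs _ ⟨e, rfl⟩ hne).2] at he
      cases he) hm₁ h2 hw₁ h3 (h1.preserve (B := fun m => Sole m M) (fun _ _ _ hst h => h.step hst) hm hsole)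
    (fun S hS e s hes => by
      have hk : 0 < (S M).stage.extent := by
        have := (hS.at' M).valid
        rw [hes] at this ⊢
        exact this.1
      have hact := hS.act_eq hk
      rw [hes] at hact
      exact absurd hact h4)
  have hm₂ : Reachable lab tape m₂ := hm₁.trans h5
  have hw₂ : (m₂ M).awake = true := h5.awake (hw₁ M)
  refine ⟨_, (h1.trans h5).tail (.rule _ _ _ candidateRule_mem hw₂), h6, ?_⟩
  rw [applyRule_self]
  exact (((candidateRule_spec _ _ _ _ (hM.cand hT hm₂ hw₂)).2.2.2.1 b h8
    (report_of_stage h9 h10)).2 (hM.not_beaten hm₂)).2.2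
      ((reported_true_iff (h9.at' M).valid h10).2 h11)

/-- A verification that was started while others were candidates may fail. Then `M` is idle again,
requests another one, and this one succeeds. -/
theorem exists_won (hA : NoneIsolated A) (hno : NoLeader lab tape sched)
    (hM : IsGreatest tape M) (hT : (M.totalTurn : ZMod 5) = 1) {m : Mem A r}
    (hm : Reachable lab tape m) (hf : Fair lab tape sched m) (hw : ∀ a, (m a).awake = true)
    (hc : ∀ x, HasHead tape x → (m x).created = true) (hsole : Sole m M) :
    ∃ m', Reach lab tape m m' ∧ Fair lab tape sched m' ∧ (m' M).phase = .won := by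
  have hboundary : ∀ {m₁ : Mem A r}, Reach lab tape m m₁ → Fair lab tape sched m₁ →
      (m₁ M).phase = .boundary →
      ∃ m', Reach lab tape m m' ∧ Fair lab tape sched m' ∧ (m' M).phase = .won := by
    intro m₁ h1 h2 h3
    obtain ⟨m', h4, h5, h6⟩ := exists_identified hA hno hT (hm.trans h1) h2
      (fun a => h1.awake (hw a)) h3
    exact ⟨m', h1.trans h4, h5, h6⟩
  have hrequested : ∀ {m₁ : Mem A r}, Reach lab tape m m₁ → Fair lab tape sched m₁ →
      (m₁ M).phase = .requested →
      ∃ m', Reach lab tape m m' ∧ Fair lab tape sched m' ∧ (m' M).phase = .won := by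
    intro m₁ h1 h2 h3
    obtain ⟨m', h4, h5, h6⟩ := exists_boundary hA hno hM hT (hm.trans h1) h2
      (fun a => h1.awake (hw a)) (h1.preserve (B := fun m => Sole m M) (fun _ _ _ hst h => h.step hst) hm hsole) h3
    exact hboundary (h1.trans h4) h5 h6
  have hidle : ∀ {m₁ : Mem A r}, Reach lab tape m m₁ → Fair lab tape sched m₁ →
      (m₁ M).phase = .idle →
      ∃ m', Reach lab tape m m' ∧ Fair lab tape sched m' ∧ (m' M).phase = .won := by
    intro m₁ h1 h2 h3
    obtain ⟨m', h4, h5, h6⟩ := exists_requested hA hno hM hT (hm.trans h1) h2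
      (fun a => h1.awake (hw a)) (fun x hx => h1.preserve (B := fun m => (m x).created = true)
        (fun _ _ _ hst => (hst.compare x).1) hm (hc x hx)) h3
    exact hrequested (h1.trans h4) h5 h6
  cases hph : (m M).phase with
  | idle => exact hidle .refl hf hph
  | requested => exact hrequested .refl hf hph
  | boundary => exact hboundary .refl hf hph
  | won => exact ⟨m, .refl, hf, hph⟩
  | solitude =>
    obtain ⟨m₁, h1, h2, h3, h4, S, e, b, h5, h6, -⟩ := exists_verified hA hno (c := M)
      (K := fun _ => True) (Q := fun _ => True) (fun _ _ _ _ _ => trivial)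
      (fun _ _ _ _ => trivial) hm hf hw hph trivial (fun _ _ _ _ _ => trivial)
    have hm₁ : Reachable lab tape m₁ := hm.trans h1
    have hw₁ : (m₁ M).awake = true := h1.awake (hw M)
    have hst := h1.tail (Step.rule m₁ M _ candidateRule_mem hw₁)
    have hspec := (((candidateRule_spec (view lab tape M) (m₁ M.pred) _ (m₁ M.succ)
      (hM.cand hT hm₁ hw₁)).2.2.2.1 b h4 (report_of_stage h5 h6)).2 (hM.not_beaten hm₁)).2.1
    rw [← applyRule_self] at hspec
    rcases hspec with h | h
    · exact hidle hst h2 h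
    · exact hboundary hst h2 h

end sole

/-- If some boundary is the only one whose total turn is 1 modulo 5, and one candidate of it has
a higher identifier than all others, then every execution elects its particle as the leader. -/
theorem electsLeader (hA : NoneIsolated A) {M : Agent A}
    (hM : IsGreatest tape M) (hT : (M.totalTurn : ZMod 5) = 1)
    (hother : ∀ x : Agent A, ¬ SameBoundary M x → (x.totalTurn : ZMod 5) ≠ 1)
    (lab : Labelling A) (sched : Schedule A) : ElectsLeader lab tape sched := by
  -- The total turn of a winner is 1 modulo 5, which determines its boundary. There a winner is the
  -- only candidate, but `M` never withdraws.
  have honly : ∀ t p, (run lab tape sched t).leader p = true → p = M.particle := by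
    intro t p hp
    obtain ⟨a, rfl, ha⟩ := (leadersWin_run hA sched t p).1 hp
    have hm := reachable_run (lab := lab) (tape := tape) sched t
    have hMa : SameBoundary M a := by
      by_contra hc
      exact hother a hc (turn_of_won hm ha)
    by_contra hne
    have hs := sole_of_phase hm (.inr ha) M hMa.symm fun he => hne (congrArg particle he.symm)
    rw [hM.cand hT hm hs.1] at hs
    cases hs.2
  have hex : ∃ t, (run lab tape sched t).leader M.particle = true := by
    -- By `honly` the failure of `M` would mean that nobody ever becomes the leader, and this is the
    -- hypothesis of all progress lemmas.
    by_contra hc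
    have hno : NoLeader lab tape sched := by
      intro t p
      by_contra hp
      have hp : (run lab tape sched t).leader p = true := by simpa using hp
      exact hc ⟨t, honly t p hp ▸ hp⟩
    have hf₀ : Fair lab tape sched (run lab tape sched 0).mem := ⟨0, .refl⟩
    obtain ⟨m₁, h1, h2, h3⟩ := exists_all_awake hA hno hf₀
    have hm₁ : Reachable lab tape m₁ := h1
    obtain ⟨m₂, h4, h5, h6⟩ := exists_all_created hA hno hm₁ h2 h3
    have hm₂ : Reachable lab tape m₂ := hm₁.trans h4
    have hw₂ : ∀ a, (m₂ a).awake = true := fun a => h4.awake (h3 a)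
    obtain ⟨m₃, h7, h8, h9⟩ := exists_sole hA hno hM hT hm₂ h5 hw₂ h6
    obtain ⟨m₄, h10, ⟨t, h11⟩, h12⟩ := exists_won hA hno hM hT (hm₂.trans h7) h8
      (fun a => h7.awake (hw₂ a)) (fun x hx => h7.preserve (B := fun m => (m x).created = true)
        (fun _ _ _ hst => (hst.compare x).1) hm₂ (h6 x hx)) h9
    exact hc ⟨t, (leadersWin_run hA sched t _).2 ⟨M, rfl, h11.won h12⟩⟩
  classical
  refine ⟨M.particle, ⟨Nat.find hex, fun t => ⟨fun h => Nat.find_min' hex h, fun h =>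
    leader_run_mono h (Nat.find_spec hex)⟩⟩, fun q hq t => ?_⟩
  by_contra hc
  exact hq (honly t q (by simpa using hc))

/-! ### Numerical estimates -/

theorem exists_forall_mul_sq_le_two_pow (C : ℕ) : ∃ m₀, ∀ m ≥ m₀, C * m ^ 2 ≤ 2 ^ m := by
  have h := (tendsto_pow_const_div_const_pow_of_one_lt 2 (one_lt_two (α := ℝ))).eventually
    (gt_mem_nhds (show (0 : ℝ) < 1 / (C + 1) by positivity))
  obtain ⟨m₀, h⟩ := Filter.eventually_atTop.1 h
  refine ⟨m₀, fun m hm => ?_⟩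
  have := h m hm
  rw [div_lt_div_iff₀ (by positivity) (by positivity), one_mul] at this
  have h2 : (C : ℝ) * m ^ 2 ≤ 2 ^ m := by nlinarith [sq_nonneg (m : ℝ)]
  exact_mod_cast h2

/-- The power is at most `1 / e`. -/
theorem one_sub_half_pow_le (m : ℕ) : (1 - (1 / 2 : ℝ) ^ m) ^ 2 ^ m ≤ 1 / 2 := by
  have h := Real.one_sub_div_pow_le_exp_neg (n := 2 ^ m) (t := 1) (by exact_mod_cast Nat.one_le_two_pow)
  rw [Nat.cast_pow, Nat.cast_ofNat, ← one_div_pow] at h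
  refine h.trans ?_
  rw [Real.exp_neg, one_div]
  exact inv_anti₀ two_pos Real.exp_one_gt_two.le

/-- The length of the windows in a boundary of `L` agents suits the error probability. -/
theorem error_le {c m L n r : ℕ} (hm : 1 ≤ m) (hc : (8 * c + 1) * m ^ 2 ≤ 2 ^ m)
    (hL : 2 ^ (2 * m) ≤ L) (hL' : L ≤ 2 ^ (2 * m + 2)) (hn : 1 ≤ n) (hnL : n ≤ L ^ 2)
    (hr : 2 ^ (8 * c + 9) ≤ r) :
    (1 - (1 / 2 : ℝ) ^ m) ^ (L / m) + (L : ℝ) ^ 2 * (r : ℝ)⁻¹ ^ m ≤ ((n : ℝ) ^ c)⁻¹ := by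
  have hpow : (n : ℝ) ^ c ≤ 2 ^ ((4 * m + 4) * c) := by
    have : n ≤ 2 ^ (4 * m + 4) := hnL.trans ((Nat.pow_le_pow_left hL' 2).trans_eq (by
      rw [← pow_mul]; congr 1; ring))
    rw [pow_mul]
    gcongr
    exact_mod_cast this
  have hinv : ((2 : ℝ) ^ ((4 * m + 4) * c))⁻¹ ≤ ((n : ℝ) ^ c)⁻¹ :=
    inv_anti₀ (by positivity) hpow
  have hq0 : (0 : ℝ) ≤ 1 - (1 / 2) ^ m := by
    rw [sub_nonneg]; exact pow_le_one₀ (by norm_num) (by norm_num)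
  have hq1 : 1 - (1 / 2 : ℝ) ^ m ≤ 1 := by simp
  -- Each of the two summands is at most half of `2 ^ (-(4 * m + 4) * c)`. For this one, `m * ((4 *
  -- m + 4) * c + 1) ≤ (8 * c + 1) * m ^ 2 ≤ 2 ^ m` is needed, and this is where the constant in
  -- `hc` comes from.
  have h1 : (1 - (1 / 2 : ℝ) ^ m) ^ (L / m) ≤ (1 / 2) ^ ((4 * m + 4) * c + 1) := by
    have hle : 2 ^ m * ((4 * m + 4) * c + 1) ≤ L / m := by
      rw [Nat.le_div_iff_mul_le hm]
      refine le_trans ?_ hL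
      rw [two_mul, pow_add, mul_assoc]
      refine Nat.mul_le_mul_left _ (le_trans ?_ hc)
      nlinarith [Nat.mul_le_mul_left (c * m) hm, Nat.mul_le_mul_left m hm]
    calc _ ≤ (1 - (1 / 2 : ℝ) ^ m) ^ (2 ^ m * ((4 * m + 4) * c + 1)) :=
          pow_le_pow_of_le_one hq0 hq1 hle
      _ ≤ _ := by
          rw [pow_mul]
          exact pow_le_pow_left₀ (pow_nonneg hq0 _) (one_sub_half_pow_le m) _
  -- Since `m` is at least 1, `(8 * c + 9) * m` is at least `(4 * m + 4) + ((4 * m + 4) * c + 1)`.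
  -- This is where the bound on `r` comes from.
  have h2 : (L : ℝ) ^ 2 * (r : ℝ)⁻¹ ^ m ≤ (1 / 2) ^ ((4 * m + 4) * c + 1) := by
    have hL2 : (L : ℝ) ^ 2 ≤ 2 ^ (4 * m + 4) := by
      have : (L : ℝ) ≤ 2 ^ (2 * m + 2) := by exact_mod_cast hL'
      calc (L : ℝ) ^ 2 ≤ (2 ^ (2 * m + 2)) ^ 2 := by gcongr
        _ = _ := by rw [← pow_mul]; congr 1; ring
    have hr2 : (r : ℝ)⁻¹ ≤ (1 / 2) ^ (8 * c + 9) := by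
      rw [one_div, inv_pow]
      exact inv_anti₀ (by positivity) (by exact_mod_cast hr)
    calc (L : ℝ) ^ 2 * (r : ℝ)⁻¹ ^ m ≤ 2 ^ (4 * m + 4) * ((1 / 2) ^ (8 * c + 9)) ^ m := by
          gcongr
      _ ≤ 2 ^ (4 * m + 4) * (1 / 2) ^ ((4 * m + 4) + ((4 * m + 4) * c + 1)) := by
          rw [← pow_mul]
          gcongr 2 ^ (4 * m + 4) * ?_
          exact pow_le_pow_of_le_one (by norm_num) (by norm_num) (by nlinarith)
      _ = _ := by rw [pow_add (1 / 2 : ℝ) (4 * m + 4), ← mul_assoc, ← mul_pow]; norm_num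
  refine le_trans (add_le_add h1 h2) (le_trans (le_of_eq ?_) hinv)
  rw [pow_succ, one_div, inv_pow]
  ring

/-! ### Probabilities of coin and digit patterns in windows -/

open MeasureTheory ProbabilityTheory

section product

variable {ι X : Type*} [Fintype ι] [Finite X] [MeasurableSpace X] [MeasurableSingletonClass X]
  (μ : Measure X) [IsProbabilityMeasure μ]

theorem pi_real_forall (T : Finset ι) (s : ι → Set X) :
    (Measure.pi fun _ : ι => μ).real {f | ∀ i ∈ T, f i ∈ s i} = ∏ i ∈ T, μ.real (s i) := by
  classical
  have h : {f : ι → X | ∀ i ∈ T, f i ∈ s i} =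
      Set.univ.pi fun i => if i ∈ T then s i else Set.univ := by
    ext f
    simp only [Set.mem_ofPred_eq, Set.mem_pi, Set.mem_univ, true_implies]
    exact forall_congr' fun i => by by_cases hi : i ∈ T <;> simp [hi]
  rw [h, Measure.real, Measure.pi_pi, ENNReal.toReal_prod,
    ← Finset.prod_subset (Finset.subset_univ T) fun i _ hi => by simp [hi]]
  exact prod_congr rfl fun i hi => by simp [hi, Measure.real]

/-- The probability that a pattern occurs in none of several disjoint windows. -/
theorem pi_real_forall_not {m : ℕ} {p : ℕ → Fin m → ι} {G : Fin m → Set X} {q : ℝ}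
    (hG : ∀ k, μ.real (G k) = q) (W : ℕ)
    (hp : ∀ v < W, ∀ w < W, ∀ k l, p v k = p w l → v = w ∧ k = l) :
    (Measure.pi fun _ : ι => μ).real {f | ∀ w < W, ¬ ∀ k, f (p w k) ∈ G k} =
      (1 - q ^ m) ^ W := by
  classical
  induction W with
  | zero => simp
  | succ W ih =>
    have hinj : Function.Injective (p W) := fun k l h =>
      (hp W (by omega) W (by omega) k l h).2
    have hwin : (Measure.pi fun _ : ι => μ).real {f | ∀ k, f (p W k) ∈ G k} = q ^ m := by
      have he : {f : ι → X | ∀ k, f (p W k) ∈ G k} = {f | ∀ i ∈ Finset.univ.image (p W),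
          f i ∈ {x | ∀ k, p W k = i → x ∈ G k}} := by
        ext f
        constructor
        · rintro h i - k rfl
          exact h k
        · exact fun h k => h _ (by simp) k rfl
      rw [he, pi_real_forall, prod_image fun _ _ _ _ h => hinj h,
        prod_congr rfl fun k _ => ?_, Finset.prod_const, Finset.card_fin]
      rw [← hG k]
      congr 1
      ext x
      exact ⟨fun h => h k rfl, fun h l hl => hinj hl ▸ h⟩
    -- The earlier windows and the last one use disjoint sets of coordinates, so the two events are
    -- independent.
    let S : Finset ι := (range W).biUnion fun w => Finset.univ.image (p w)
    let T : Finset ι := Finset.univ.image (p W)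
    have hS : ∀ w < W, ∀ k, p w k ∈ S := fun w hw k =>
      Finset.mem_biUnion.2 ⟨w, Finset.mem_range.2 hw, mem_image_of_mem _ (mem_univ k)⟩
    have hT : ∀ k, p W k ∈ T := fun k => mem_image_of_mem _ (mem_univ k)
    have hST : Disjoint S T := by
      simp only [S, T, Finset.disjoint_left, Finset.mem_biUnion, mem_image, mem_range,
        mem_univ, true_and]
      rintro _ ⟨w, hw, k, rfl⟩ ⟨l, hl⟩
      have := (hp W (by omega) w (by omega) _ _ hl).1
      omega
    have hindep := (iIndepFun_pi (μ := fun _ : ι => μ) (X := fun _ => id)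
      fun _ => aemeasurable_id).indepFun_finset S T hST
      fun i => measurable_id.comp (measurable_pi_apply i)
    have key := hindep.measure_inter_preimage_eq_mul
      {g | ∀ w, ∀ hw : w < W, ¬ ∀ k, g ⟨p w k, hS w hw k⟩ ∈ G k}
      {g | ¬ ∀ k, g ⟨p W k, hT k⟩ ∈ G k}
      (Set.toFinite _).measurableSet (Set.toFinite _).measurableSet
    have he : {f : ι → X | ∀ w < W + 1, ¬ ∀ k, f (p w k) ∈ G k} =
        {f | ∀ w < W, ¬ ∀ k, f (p w k) ∈ G k} ∩ {f | ∀ k, f (p W k) ∈ G k}ᶜ := by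
      ext f
      exact Nat.forall_lt_succ_right
    rw [he, pow_succ, ← ih fun v hv w hw => hp v (by omega) w (by omega), ← hwin,
      ← probReal_compl_eq_one_sub (Set.toFinite _).measurableSet]
    exact (congrArg ENNReal.toReal key).trans ENNReal.toReal_mul

/-- The probability that two disjoint windows agree. -/
theorem pi_real_agree_le {m r : ℕ} {p q : Fin m → ι} (hp : Function.Injective p)
    (hq : Function.Injective q) (hpq : ∀ k l, p k ≠ q l) (g : X → Fin r)
    (hg : ∀ d, μ.real (g ⁻¹' {d}) = (r : ℝ)⁻¹) :
    (Measure.pi fun _ : ι => μ).real {f | ∀ k, g (f (p k)) = g (f (q k))} ≤ ((r : ℝ)⁻¹) ^ m := by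
  classical
  -- A union over the `r ^ m` possible common words, each of which fills both windows with
  -- probability `r ^ (-2 * m)`.
  have hsub : {f : ι → X | ∀ k, g (f (p k)) = g (f (q k))} ⊆ ⋃ d : Fin m → Fin r,
      {f | ∀ i ∈ Finset.univ.image p ∪ Finset.univ.image q,
        f i ∈ {x | ∀ k, p k = i ∨ q k = i → g x = d k}} := by
    intro f hf
    refine Set.mem_iUnion.2 ⟨fun k => g (f (p k)), fun i _ k hk => ?_⟩
    rcases hk with rfl | rfl
    exacts [rfl, (hf k).symm]
  refine (measureReal_mono hsub (measure_ne_top _ _)).trans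
    ((measureReal_iUnion_fintype_le _).trans ?_)
  have hd : ∀ d : Fin m → Fin r, (Measure.pi fun _ : ι => μ).real
      {f | ∀ i ∈ Finset.univ.image p ∪ Finset.univ.image q,
        f i ∈ {x | ∀ k, p k = i ∨ q k = i → g x = d k}} = ((r : ℝ)⁻¹) ^ m * ((r : ℝ)⁻¹) ^ m := by
    intro d
    rw [pi_real_forall, Finset.prod_union, prod_image fun _ _ _ _ h => hp h,
      prod_image fun _ _ _ _ h => hq h]
    · congr 1 <;>
      · rw [prod_congr rfl fun k _ => ?_, Finset.prod_const, Finset.card_fin]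
        rw [← hg (d k)]
        congr 1
        ext x
        refine ⟨fun h => h k (by simp), ?_⟩
        rintro h l (hl | hl)
        · first | exact hp hl ▸ h | exact absurd hl (hpq _ _)
        · first | exact hq hl ▸ h | exact absurd hl.symm (hpq _ _)
    · simp only [Finset.disjoint_left, mem_image, mem_univ, true_and]
      rintro _ ⟨k, rfl⟩ ⟨l, hl⟩
      exact hpq k l hl.symm
  simp only [hd, Finset.sum_const, Finset.card_univ, Fintype.card_fun, Fintype.card_fin,
    nsmul_eq_mul, Nat.cast_pow]
  rcases Nat.eq_zero_or_pos r with rfl | hr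
  · cases m <;> simp
  · rw [← mul_assoc, ← mul_pow, mul_inv_cancel₀ (by positivity), one_pow, one_mul]

end product

theorem segLength_ge {m : ℕ} {x : Agent A} (hx : IsHead tape x)
    (h : ∀ k < m, 0 < k → ¬ IsHead tape (succ^[k] x)) : m ≤ segLength tape x := by
  by_contra! hlt
  exact h _ hlt (segLength_pos x) (isHead_segLength hx)

/-- A long segment exists, and long disjoint windows have different digits. -/
theorem exists_isGreatest {m : ℕ} {a x₀ : Agent A} (h₀ : SameBoundary a x₀) (hx₀ : IsHead tape x₀)
    (hlen : m ≤ segLength tape x₀)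
    (hne : ∀ x y, SameBoundary a x → SameBoundary a y →
      (∀ k < m, ∀ l < m, succ^[k] x ≠ succ^[l] y) →
      ∃ k < m, (tape (succ^[k] x)).2 ≠ (tape (succ^[k] y)).2) :
    ∃ M, SameBoundary a M ∧ IsGreatest tape M := by
  classical
  -- A head with maximal key. Length comes first in the order, so its segment has length at least
  -- `m`. In a tie, the first `m` digits of two disjoint segments would agree.
  obtain ⟨M, hM, hmax⟩ := Finset.exists_max_image (a.boundary.filter (IsHead tape ·)) (key tape)
    ⟨x₀, Finset.mem_filter.2 ⟨mem_boundary.2 h₀, hx₀⟩⟩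
  obtain ⟨hMa, hMh⟩ := Finset.mem_filter.1 hM
  rw [mem_boundary] at hMa
  refine ⟨M, hMa, hMh, fun h hh hMb hne' => lt_of_le_of_ne
    (hmax h (Finset.mem_filter.2 ⟨mem_boundary.2 (hMa.trans hMb), hh⟩)) fun he => ?_⟩
  have hm : m ≤ segLength tape M := by
    have := hmax x₀ (Finset.mem_filter.2 ⟨mem_boundary.2 h₀, hx₀⟩)
    rcases (Prod.Lex.le_iff).1 this with h | h
    exacts [hlen.trans h.le, hlen.trans h.1.le]
  obtain ⟨h1, h2⟩ := digit_eq_of_key_eq he.symm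
  obtain ⟨k, hk, hd⟩ := hne M h hMa (hMa.trans hMb) fun k hk l hl e => hne' (by
    rw [← headOf_iterate hMh (hk.trans_le hm), e, headOf_iterate hh (h1 ▸ hl.trans_le hm)])
  exact hd (h2 k (hk.trans_le hm))

section probability

variable (A r) [NeZero r]

noncomputable instance : IsProbabilityMeasure (tapeMeasure A r) := by
  unfold tapeMeasure; infer_instance

variable {A}

theorem ofReal_one_sub_le {Ω : Type*} [MeasurableSpace Ω] {μ : Measure Ω} [IsProbabilityMeasure μ]
    {B S : Set Ω} {ε : ℝ} (hm : MeasurableSet B) (hB : μ.real B ≤ ε) (h : Bᶜ ⊆ S) :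
    ENNReal.ofReal (1 - ε) ≤ μ S := by
  refine le_trans ?_ (measure_mono h)
  rw [← ofReal_measureReal (measure_ne_top _ _), probReal_compl_eq_one_sub hm]
  exact ENNReal.ofReal_le_ofReal (sub_le_sub_left hB 1)

/-- No window at a multiple of `m` starts with a candidate followed by other agents. -/
theorem tapeMeasure_no_window (a : Agent A) (m : ℕ) :
    (tapeMeasure A r).real {tape | ∀ w < a.period / m, ¬ ∀ k : Fin m,
      tape (succ^[w * m + k] a) ∈ {x | x.1 = decide ((k : ℕ) = 0)}} =
      (1 - (1 / 2) ^ m) ^ (a.period / m) := by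
  refine pi_real_forall_not (p := fun w k => succ^[w * m + k] a) _ (fun k => ?_) _
    fun v hv w hw k l h => ?_
  · have : {x : Bool × Fin r | x.1 = decide ((k : ℕ) = 0)} =
        {decide ((k : ℕ) = 0)} ×ˢ Set.univ := by ext x; simp
    rw [this, Measure.real, Measure.prod_prod, uniformOn_univ, measure_univ]
    simp
  · have hlt : ∀ v < a.period / m, ∀ k : Fin m, v * m + k < a.period := fun v hv k =>
      calc v * m + k < v * m + m := by omega
        _ = (v + 1) * m := by ring
        _ ≤ a.period / m * m := Nat.mul_le_mul_right _ hv
        _ ≤ _ := Nat.div_mul_le_self _ _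
    have he := iterate_inj (hlt v hv k) (hlt w hw l) h
    have hm : 0 < m := k.pos
    have hvw : v = w := by
      have h1 := congrArg (· / m) he
      simpa [mul_comm _ m, Nat.mul_add_div hm, Nat.div_eq_of_lt] using h1
    subst hvw
    exact ⟨rfl, Fin.ext (by omega)⟩

/-- A union bound over all pairs of agents of the boundary. Pairs whose windows overlap contribute
the empty event. -/
theorem tapeMeasure_agree_le (a : Agent A) {m : ℕ} (hm : m ≤ a.period) :
    (tapeMeasure A r).real (⋃ z ∈ a.boundary ×ˢ a.boundary, {tape : Tape A r |
      (∀ k < m, ∀ l < m, succ^[k] z.1 ≠ succ^[l] z.2) ∧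
        ∀ k : Fin m, (tape (succ^[k] z.1)).2 = (tape (succ^[k] z.2)).2}) ≤
      (a.period : ℝ) ^ 2 * (r : ℝ)⁻¹ ^ m := by
  refine (measureReal_biUnion_finset_le _ _).trans ((Finset.sum_le_card_nsmul _ _
    ((r : ℝ)⁻¹ ^ m) fun z hz => ?_).trans_eq ?_)
  · by_cases hd : ∀ k < m, ∀ l < m, succ^[k] z.1 ≠ succ^[l] z.2
    · simp only [mem_product, mem_boundary] at hz
      have hinj : ∀ x, SameBoundary a x → Function.Injective fun k : Fin m => succ^[k] x :=
        fun x hx k l h => Fin.ext (iterate_inj (by rw [hx.period_eq]; omega)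
          (by rw [hx.period_eq]; omega) h)
      refine le_trans (le_of_eq (congrArg _ ?_)) (pi_real_agree_le _ (hinj _ hz.1) (hinj _ hz.2)
        (fun k l => hd k k.2 l l.2) (Prod.snd : Bool × Fin r → Fin r) fun d => ?_)
      · ext tape
        exact and_iff_right hd
      · have : (Prod.snd ⁻¹' {d} : Set (Bool × Fin r)) = Set.univ ×ˢ {d} := by ext x; simp
        rw [this, Measure.real, Measure.prod_prod, uniformOn_univ (Ω := Fin r), measure_univ]
        simp
    · simp [hd]
  · rw [Finset.card_product, card_boundary, nsmul_eq_mul]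
    push_cast
    ring

end probability

end Amoebot

/-! ### The main theorem -/

open Amoebot Agent MeasureTheory in
theorem mainTheorem2 (c : ℝ) (hc : 1 < c) :
    ∃ r₀ N : ℕ, ∀ r : ℕ, r₀ ≤ r →
      ∀ A : Finset Amoebot.Node, N ≤ A.card →
        (Amoebot.triGrid.induce (A : Set Amoebot.Node)).Connected →
          ∀ lab : Amoebot.Labelling A,
            ENNReal.ofReal (1 - (A.card : ℝ) ^ (-c)) ≤
              Amoebot.tapeMeasure A r
                {tape | ∀ sched : Amoebot.Schedule A, Amoebot.ElectsLeader lab tape sched} := by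
  obtain ⟨m₀, hm₀⟩ := exists_forall_mul_sq_le_two_pow (8 * ⌈c⌉₊ + 1)
  -- The number of particles is at most the square of the length of the outer boundary, so this `N`
  -- makes that length at least `2 ^ (2 * m₀ + 2)`.
  refine ⟨2 ^ (8 * ⌈c⌉₊ + 9), (2 ^ (2 * m₀ + 2)) ^ 2, fun r hr A hN hA lab => ?_⟩
  have hr0 : NeZero r := ⟨by have := Nat.one_le_two_pow (n := 8 * ⌈c⌉₊ + 9); omega⟩
  have h2 : 2 ≤ A.card := le_trans (by
    rw [← pow_mul]; exact Nat.le_self_pow (by omega) 2) hN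
  obtain ⟨a, hturn, hother, hcard⟩ := exists_outer_boundary hA h2
  have hL : 2 ^ (2 * m₀ + 2) ≤ a.period :=
    (Nat.pow_le_pow_iff_left two_ne_zero).1 (hN.trans hcard)
  -- The window length: half the binary logarithm. A segment of this length is likely to occur, and
  -- its digits are unlikely to be repeated.
  obtain ⟨m, hm⟩ : ∃ m, m = Nat.log 2 a.period / 2 := ⟨_, rfl⟩
  have hlog : 2 * m₀ + 2 ≤ Nat.log 2 a.period := Nat.le_log_of_pow_le one_lt_two hL
  have hL1 : 2 ^ (2 * m) ≤ a.period :=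
    (Nat.pow_le_pow_right two_pos (by omega)).trans (Nat.pow_log_le_self 2 a.period_pos.ne')
  have hL2 : a.period ≤ 2 ^ (2 * m + 2) :=
    (Nat.lt_pow_succ_log_self one_lt_two _).le.trans (Nat.pow_le_pow_right two_pos (by omega))
  have hmL : m ≤ a.period := (Nat.lt_two_pow_self (n := m)).le.trans
    ((Nat.pow_le_pow_right two_pos (by omega)).trans hL1)
  have herr := error_le (by omega) (hm₀ m (by omega)) hL1 hL2 (by omega) hcard hr
  rw [← tapeMeasure_no_window r a m] at herr
  have herr' := (add_le_add_right (tapeMeasure_agree_le r a hmL) _).trans herr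
  have hpow : ((A.card : ℝ) ^ ⌈c⌉₊)⁻¹ ≤ (A.card : ℝ) ^ (-c) := by
    rw [Real.rpow_neg (by positivity), ← Real.rpow_natCast]
    exact inv_anti₀ (Real.rpow_pos_of_pos (by positivity) _)
      (Real.rpow_le_rpow_of_exponent_le (by exact_mod_cast (by omega : 1 ≤ A.card))
        (Nat.le_ceil c))
  have hbad := ((measureReal_union_le _ _).trans herr').trans hpow
  refine ofReal_one_sub_le (Set.toFinite _).measurableSet hbad fun tape htape => ?_
  intro sched
  simp only [Set.mem_compl_iff, Set.mem_union, not_or, Set.mem_ofPred_eq, Set.mem_iUnion,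
    not_forall, not_exists, not_and, not_not, Finset.mem_product, mem_boundary] at htape
  -- Outside the two bad events, some window `w` begins with a head followed by `m - 1` other
  -- agents, and disjoint windows have different digits.
  obtain ⟨⟨w, hw, hwin⟩, hagree⟩ := htape
  have hmpos : 0 < m := by omega
  obtain ⟨M, hM, hgreat⟩ := exists_isGreatest (tape := tape) (m := m) (a := a)
    (x₀ := succ^[w * m] a) ⟨_, rfl⟩ (by simpa [IsHead] using hwin ⟨0, hmpos⟩)
    (segLength_ge (by simpa [IsHead] using hwin ⟨0, hmpos⟩) fun k hk h0 => by
      have := hwin ⟨k, hk⟩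
      rw [add_comm, Function.iterate_add_apply] at this
      simp [IsHead, this, h0.ne'])
    fun x y hx hy hxy => by
      obtain ⟨k, hk⟩ := hagree (x, y) ⟨hx, hy⟩ hxy
      exact ⟨k, k.2, hk⟩
  refine electsLeader (fun p => exists_adjacent (linked_of_connected hA) h2 p.2) hgreat ?_
    (fun x hx => ?_) lab sched
  -- Modulo 5, the total turns 6 and -6 are 1 and 4.
  · rw [totalTurn_eq hM, hturn]; decide
  · rw [hother x fun h => hx (hM.symm.trans h)]; decide
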